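/- Let $p$ be a prime, $\mathbb K=\mathbb Z/p^2\mathbb Z$, and let $A$ be an associative unital $\mathbb F_p$-algebra. For a $\mathbb K$-algebra $R$, $\mathrm{Shukla}^*(R/\mathbb K,R)$ denotes the Hochschild cohomology $H^*(R^c_*,R)$ (over $\mathbb K$, with cup product) of a quasi-free chain algebra $R^c_*$ over $\mathbb K$ with a weak equivalence $R^c_*\to R$; such resolutions exist, and the isomorphisms below hold for every choice of them. A lifting of $A$ to $\mathbb K$ is a $\mathbb K$-algebra $A_0$, free as a $\mathbb K$-module, with a ring isomorphism $A_0/pA_0\cong A$. If $A$ has a lifting to $\mathbb K$, then there is an isomorphism of graded $\mathbb F_p$-algebras $$\mathrm{Shukla}^*(A/\mathbb K,A)\cong H^*(A/\mathbb F_p,A)\otimes_{\mathbb F_p}\mathrm{Shukla}^*(\mathbb F_p/\mathbb K,\mathbb F_p),$$ where $H^*(A/\mathbb F_p,A)$ is Hochschild cohomology and the product on the tensor product follows the Koszul sign rule. Moreover, as graded $\mathbb F_p$-algebras: if $p=2$, $$\mathrm{Shukla}^*(\mathbb F_2/\mathbb K,\mathbb F_2)\cong\mathbb F_2[\sigma x,\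 \sigma y^{[2^n]}\ (n\ge 0)],$$ and if $p$ is odd, $$\mathrm{Shukla}^*(\mathbb F_p/\mathbb K,\mathbb F_p)\cong\Lambda^*(\sigma y^{[p^n]}\ (n\ge0))\otimes\mathbb F_p[\sigma x,\ \sigma^2y^{[p^n]}\ (n\ge 0)],$$ where the symbols denote free generators of degrees $|\sigma x|=2$, $|\sigma y^{[p^n]}|=2p^n+1$ and $|\sigma^2y^{[p^n]}|=2p^{n+1}+2$. -/

import Mathlib

open scoped TensorProduct DirectSum

universe u v w

set_option linter.unusedSectionVars false

/-! ### Chain algebras -/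

/-- A chain algebra over `K`: a graded algebra `⨁_{n ≥ 0} gr n` with a differential of degree `-1`
satisfying the graded Leibniz rule. -/
structure ChainAlgebra (K : Type u) [CommRing K] where
  carrier : Type v
  [ring : Ring carrier]
  [algebra : Algebra K carrier]
  gr : ℕ → Submodule K carrier
  [graded : GradedAlgebra gr]
  d : carrier →ₗ[K] carrier
  d_gr_zero : ∀ x ∈ gr 0, d x = 0
  d_gr_succ : ∀ n, ∀ x ∈ gr (n + 1), d x ∈ gr n
  d_d : ∀ x, d (d x) = 0
  leibniz : ∀ n, ∀ x ∈ gr n, ∀ y, d (x * y) = d x * y + (-1 : K) ^ n • (x * d y)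

namespace ChainAlgebra

attribute [instance] ChainAlgebra.ring ChainAlgebra.algebra ChainAlgebra.graded

instance (K : Type u) [CommRing K] : CoeSort (ChainAlgebra.{u, v} K) (Type v) :=
  ⟨ChainAlgebra.carrier⟩

/-- Morphisms of chain algebras. -/
structure Hom {K : Type u} [CommRing K] (P : ChainAlgebra.{u, v} K) (Q : ChainAlgebra.{u, w} K)
    where
  toAlgHom : P →ₐ[K] Q
  map_gr : ∀ n, ∀ x ∈ P.gr n, toAlgHom x ∈ Q.gr n
  map_d : ∀ x, toAlgHom (P.d x) = Q.d (toAlgHom x)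

/-- A weak equivalence: the induced maps `H_n(P) → H_n(Q)` are injective and surjective for all
`n`. -/
def Hom.IsWeakEquivalence {K : Type u} [CommRing K] {P : ChainAlgebra.{u, v} K}
    {Q : ChainAlgebra.{u, w} K} (f : Hom P Q) : Prop :=
  ∀ n,
    (∀ x ∈ P.gr n, P.d x = 0 → (∃ y ∈ Q.gr (n + 1), Q.d y = f.toAlgHom x) →
      ∃ z ∈ P.gr (n + 1), P.d z = x) ∧
    (∀ y ∈ Q.gr n, Q.d y = 0 →
      ∃ x ∈ P.gr n, P.d x = 0 ∧ ∃ z ∈ Q.gr (n + 1), Q.d z = f.toAlgHom x - y)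

/-- A chain algebra is quasi-free if its underlying graded algebra is free, that is, freely
generated as an algebra by a family of homogeneous elements. -/
def IsQuasiFree {K : Type u} [CommRing K] (P : ChainAlgebra.{u, v} K) : Prop :=
  ∃ (X : Type v) (deg : X → ℕ) (g : X → P),
    (∀ x, g x ∈ P.gr (deg x)) ∧ Function.Bijective (FreeAlgebra.lift K g)

/-- The grading of an algebra concentrated in degree zero. -/
def concGr (K : Type u) [CommRing K] (A : Type v) [Ring A] [Algebra K A] :
    ℕ → Submodule K A
  | 0 => ⊤
  | _ + 1 => ⊥

instance concGr_graded (K : Type u) [CommRing K] (A : Type v) [Ring A] [Algebra K A] :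
    GradedAlgebra (concGr K A) where
  one_mem := Submodule.mem_top
  mul_mem := by
    rintro (_ | i) (_ | j) x y hx hy
    · exact Submodule.mem_top
    · have hy0 : y = 0 := hy
      subst hy0
      rw [mul_zero]; exact Submodule.zero_mem _
    · have hx0 : x = 0 := hx
      subst hx0
      rw [zero_mul]; exact Submodule.zero_mem _
    · have hx0 : x = 0 := hx
      subst hx0
      rw [zero_mul]; exact Submodule.zero_mem _
  decompose' x := DirectSum.of (fun n => concGr K A n) 0 ⟨x, Submodule.mem_top⟩
  left_inv x := by simp
  right_inv x := by
    induction x using DirectSum.induction_on with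
    | zero =>
      have h : (⟨0, Submodule.mem_top⟩ : concGr K A 0) = 0 := rfl
      simp only [map_zero]
      rw [h, map_zero]
    | of i x =>
      rcases i with _ | i
      · simp
      · obtain ⟨x, hx⟩ := x
        have hx0 : x = 0 := hx
        subst hx0
        have h : (⟨0, hx⟩ : concGr K A (i + 1)) = 0 := rfl
        have h' : (⟨0, Submodule.mem_top⟩ : concGr K A 0) = 0 := rfl
        rw [h]
        simp only [map_zero]
        rw [h', map_zero]
    | add x y hx hy =>
      conv_rhs => rw [← hx, ← hy]
      rw [← map_add]
      refine congrArg _ (Subtype.ext ?_)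
      exact map_add (DirectSum.coeAddMonoidHom (concGr K A)) x y

/-- An algebra, viewed as a chain algebra concentrated in degree zero. -/
@[reducible]
def ofAlgebra (K : Type u) [CommRing K] (A : Type v) [Ring A] [Algebra K A] :
    ChainAlgebra.{u, v} K where
  carrier := A
  gr := concGr K A
  d := 0
  d_gr_zero _ _ := rfl
  d_gr_succ _ _ _ := Submodule.zero_mem _
  d_d _ := rfl
  leibniz _ _ _ _ := by simp

/-- The identity morphism. -/
def Hom.id {K : Type u} [CommRing K] (P : ChainAlgebra.{u, v} K) : Hom P P :=
  ⟨AlgHom.id K P, fun _ _ h => h, fun _ => rfl⟩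

/-- The linear involution `x ↦ (-1)^(|x|+1) x` of a chain algebra. -/
noncomputable def sgn {K : Type u} [CommRing K] (P : ChainAlgebra.{u, v} K) : P →ₗ[K] P :=
  (DirectSum.toModule K ℕ P fun n => (-1 : K) ^ (n + 1) • (P.gr n).subtype) ∘ₗ
    (DirectSum.decomposeLinearEquiv P.gr).toLinearMap

section sgn

variable {K : Type u} [CommRing K] (P : ChainAlgebra.{u, v} K)

theorem sgn_of_mem {n : ℕ} {x : P} (hx : x ∈ P.gr n) : P.sgn x = (-1 : K) ^ (n + 1) • x := by
  rw [sgn, LinearMap.comp_apply, LinearEquiv.coe_coe, DirectSum.decomposeLinearEquiv_apply,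
    DirectSum.decompose_of_mem _ hx, ← DirectSum.lof_eq_of K, DirectSum.toModule_lof]
  rfl

theorem sgn_mem {n : ℕ} {x : P} (hx : x ∈ P.gr n) : P.sgn x ∈ P.gr n := by
  rw [P.sgn_of_mem hx]; exact Submodule.smul_mem _ _ hx

theorem gr_induction {p : P → Prop} (h0 : p 0) (hom : ∀ n, ∀ x ∈ P.gr n, p x)
    (add : ∀ x y, p x → p y → p (x + y)) (x : P) : p x :=
  DirectSum.Decomposition.inductionOn P.gr h0 (fun {i} m => hom i m m.2)
    (fun m m' h h' => add m m' h h') x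

theorem sgn_sgn (x : P) : P.sgn (P.sgn x) = x := by
  induction x using P.gr_induction with
  | h0 => simp
  | hom n x hx =>
    rw [P.sgn_of_mem hx, map_smul, P.sgn_of_mem hx, smul_smul, ← mul_pow]
    simp
  | add x y hx hy => simp [hx, hy]

theorem sgn_d (x : P) : P.sgn (P.d x) = - P.d (P.sgn x) := by
  induction x using P.gr_induction with
  | h0 => simp
  | hom n x hx =>
    rcases n with _ | n
    · rw [P.sgn_of_mem hx, map_smul, P.d_gr_zero x hx]; simp
    · rw [P.sgn_of_mem hx, map_smul, P.sgn_of_mem (P.d_gr_succ n x hx), pow_succ _ (n + 1)]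
      simp
  | add x y hx hy => simp only [map_add, hx, hy]; abel

theorem sgn_mul (x y : P) : P.sgn (x * y) = - (P.sgn x * P.sgn y) := by
  induction x using P.gr_induction with
  | h0 => simp
  | hom n x hx =>
    induction y using P.gr_induction with
    | h0 => simp
    | hom m y hy =>
      rw [P.sgn_of_mem hx, P.sgn_of_mem hy, P.sgn_of_mem (SetLike.mul_mem_graded hx hy)]
      simp only [smul_mul_assoc, mul_smul_comm, smul_smul, ← neg_smul]
      congr 1
      ring
    | add x y hx hy => simp only [mul_add, map_add, hx, hy]; abel
  | add x y hx hy => simp only [add_mul, map_add, hx, hy]; abel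

theorem d_mul (x y : P) : P.d (x * y) = P.d x * y - P.sgn x * P.d y := by
  induction x using P.gr_induction with
  | h0 => simp
  | hom n x hx => rw [P.leibniz n x hx, P.sgn_of_mem hx, pow_succ]; simp
  | add x z hx hz => simp only [add_mul, map_add, hx, hz]; abel

end sgn

/-- The underlying algebra map `P → B` of an augmentation. -/
def Hom.aug {K : Type u} [CommRing K] {P : ChainAlgebra.{u, v} K} {B : Type w} [Ring B]
    [Algebra K B] (ε : Hom P (ofAlgebra K B)) : P →ₐ[K] B := ε.toAlgHom

section aug

variable {K : Type u} [CommRing K] {P : ChainAlgebra.{u, v} K} {B : Type w} [Ring B]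
  [Algebra K B] (ε : Hom P (ofAlgebra K B))

theorem Hom.aug_d (x : P) : ε.aug (P.d x) = 0 := ε.map_d x

theorem Hom.aug_gr_succ {n : ℕ} {x : P} (hx : x ∈ P.gr (n + 1)) : ε.aug x = 0 :=
  ε.map_gr (n + 1) x hx

theorem Hom.aug_sgn (x : P) : ε.aug (P.sgn x) = - ε.aug x := by
  induction x using P.gr_induction with
  | h0 => simp
  | hom n x hx =>
    rw [P.sgn_of_mem hx]
    rcases n with _ | n
    · simp
    · rw [map_smul, ε.aug_gr_succ hx]; simp
  | add x y hx hy => simp only [map_add, hx, hy]; abel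

end aug

end ChainAlgebra

/-! ### The Hochschild cochain complex of a chain algebra

A family `(f_n)` of functions `f_n : Pⁿ → B` is encoded as one function `f : List P → B`.
Coefficients are in an algebra `B` (in degree zero) over which `P` is augmented by
`ε : P → B`; so `B` is a bimodule over `H_0(P)`, and positive degree elements of `P` act as zero. -/

namespace HochschildCochain

open ChainAlgebra

/-- The cup product
`(f ∪ g)(r_1, …, r_n) = ∑_{i = 0}^n f(r_1, …, r_i) g(r_{i+1}, …, r_n)`. -/
def cup {X : Type v} {B : Type w} [Ring B] : (List X → B) → (List X → B) → List X → B
  | f, g, [] => f [] * g []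
  | f, g, x :: L => f [] * g (x :: L) + cup (fun L' => f (x :: L')) g L

/-- The unit of the cup product. -/
def unit {X : Type v} {B : Type w} [Ring B] : List X → B
  | [] => 1
  | _ :: _ => 0

/-- `f ↦ ± f`, with the sign `(-1)^(∑ (|r_i| + 1))` at `(r_1, …, r_n)`. -/
noncomputable def inv {K : Type u} [CommRing K] {P : ChainAlgebra.{u, v} K} {B : Type w}
    (f : List P → B) : List P → B := fun L => f (L.map P.sgn)

/-- `f((a * r_1), r_2, …, r_n)`, or `0` if `n = 0`. -/
def mulHead {X : Type v} [Mul X] {B : Type w} [Zero B] (f : List X → B) (a : X) : List X → B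
  | [] => 0
  | y :: L => f ((a * y) :: L)

/-- The sum of the internal part and of the inner terms of the Hochschild coboundary:
`∑_i ± f(r_1, …, d r_i, …, r_n) + ∑_{i < n} ± f(r_1, …, r_i r_{i+1}, …, r_n)`,
where the signs are `(-1)^(∑_{j < i} (|r_j| + 1))` and `(-1)^(∑_{j ≤ i} (|r_j| + 1))`. -/
noncomputable def bar {K : Type u} [CommRing K] {P : ChainAlgebra.{u, v} K} {B : Type w} [Ring B] :
    (List P → B) → List P → B
  | _, [] => 0
  | f, x :: L => f (P.d x :: L) + mulHead f (P.sgn x) L + bar (fun L' => f (P.sgn x :: L')) L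

/-- The augmentation as a cochain supported on lists of length one. -/
def tw {K : Type u} [CommRing K] {P : ChainAlgebra.{u, v} K} {B : Type w} [Ring B] [Algebra K B]
    (ε : Hom P (ofAlgebra K B)) : List P → B
  | [x] => ε.aug x
  | _ => 0

/-- The Hochschild coboundary (total differential)
`(D f)(r_1, …, r_n) = ε(r_1) f(r_2, …, r_n) + ∑_i ± f(r_1, …, d r_i, …, r_n)
  + ∑_{i < n} ± f(r_1, …, r_i r_{i+1}, …, r_n) ± f(r_1, …, r_{n-1}) ε(r_n)`,
with the signs `(-1)^(∑_{j < i} (|r_j| + 1))`, `(-1)^(∑_{j ≤ i} (|r_j| + 1))` and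
`-(-1)^(∑_{j < n} (|r_j| + 1))`. On an algebra in degree zero these are `(-1)^i` for
`r_i r_{i+1}`, and `(-1)^n` for the last term. -/
noncomputable def D {K : Type u} [CommRing K] {P : ChainAlgebra.{u, v} K} {B : Type w} [Ring B]
    [Algebra K B] (ε : Hom P (ofAlgebra K B)) (f : List P → B) : List P → B :=
  cup (tw ε) f + bar f - cup (inv f) (tw ε)

section cup

variable {X : Type v} {B : Type w} [Ring B]

@[simp] theorem cup_nil (f g : List X → B) : cup f g [] = f [] * g [] := rfl

@[simp] theorem cup_cons (f g : List X → B) (x : X) (L : List X) :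
    cup f g (x :: L) = f [] * g (x :: L) + cup (fun L' => f (x :: L')) g L := rfl

theorem cup_add (f g h : List X → B) : cup f (g + h) = cup f g + cup f h := by
  funext L
  induction L generalizing f with
  | nil => simp [mul_add]
  | cons x L ih =>
    have := ih (fun L' => f (x :: L'))
    simp only [Pi.add_apply] at this ⊢
    simp only [cup_cons, this, Pi.add_apply, mul_add]; abel

theorem add_cup (f g h : List X → B) : cup (f + g) h = cup f h + cup g h := by
  funext L
  induction L generalizing f g with
  | nil => simp [add_mul]
  | cons x L ih =>
    have := ih (fun L' => f (x :: L')) (fun L' => g (x :: L'))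
    have e : (fun L' => (f + g) (x :: L')) =
      (fun L' => f (x :: L')) + (fun L' => g (x :: L')) := rfl
    rw [cup_cons, e, this]
    simp only [cup_cons, Pi.add_apply, add_mul]; abel

theorem zero_cup (g : List X → B) : cup 0 g = 0 := by
  have := add_cup 0 0 g
  rw [add_zero] at this
  exact left_eq_add.mp this

theorem cup_zero (g : List X → B) : cup g 0 = 0 := by
  have := cup_add g 0 0
  rw [add_zero] at this
  exact left_eq_add.mp this

theorem neg_cup (f g : List X → B) : cup (-f) g = - cup f g := by
  rw [eq_neg_iff_add_eq_zero, ← add_cup, neg_add_cancel, zero_cup]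

theorem cup_neg (f g : List X → B) : cup f (-g) = - cup f g := by
  rw [eq_neg_iff_add_eq_zero, ← cup_add, neg_add_cancel, cup_zero]

theorem smul_cup {k : Type*} [CommRing k] [Algebra k B] (a : k) (f g : List X → B) :
    cup (a • f) g = a • cup f g := by
  funext L
  induction L generalizing f with
  | nil => simp
  | cons x L ih =>
    have := ih (fun L' => f (x :: L'))
    have e : (fun L' => (a • f) (x :: L')) = a • (fun L' => f (x :: L')) := rfl
    rw [cup_cons, e, this]
    simp only [cup_cons, Pi.smul_apply, smul_mul_assoc, smul_add]

theorem mul_left_cup (b : B) (f g : List X → B) (L : List X) :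
    cup (fun L' => b * f L') g L = b * cup f g L := by
  induction L generalizing f with
  | nil => simp [mul_assoc]
  | cons x L ih => simp only [cup_cons, ih (fun L' => f (x :: L')), mul_add, mul_assoc]

theorem cup_smul {k : Type*} [CommRing k] [Algebra k B] (a : k) (f g : List X → B) :
    cup f (a • g) = a • cup f g := by
  funext L
  induction L generalizing f with
  | nil => simp
  | cons x L ih =>
    simp only [cup_cons, ih (fun L' => f (x :: L')), Pi.smul_apply, mul_smul_comm, smul_add]

theorem cup_assoc (f g h : List X → B) : cup (cup f g) h = cup f (cup g h) := by
  funext L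
  induction L generalizing f with
  | nil => simp [mul_assoc]
  | cons x L ih =>
    have e : (fun L' => cup f g (x :: L')) =
      (fun L' => f [] * g (x :: L')) + cup (fun L' => f (x :: L')) g := rfl
    rw [cup_cons, e, add_cup, Pi.add_apply, ih (fun L' => f (x :: L')), mul_left_cup]
    simp only [cup_cons, cup_nil, mul_add, mul_assoc]
    abel

theorem unit_cup (f : List X → B) : cup unit f = f := by
  funext L
  cases L with
  | nil => simp [unit]
  | cons x L =>
    have e : (fun L' => (unit (x :: L') : B)) = 0 := rfl
    rw [cup_cons, e, zero_cup]
    simp [unit]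

theorem cup_unit (f : List X → B) : cup f unit = f := by
  funext L
  induction L generalizing f with
  | nil => simp [unit]
  | cons x L ih => simp [ih (fun L' => f (x :: L')), unit]

theorem cup_eq_zero (f g : List X → B) (L : List X)
    (h : ∀ L₁ L₂, L₁ ++ L₂ = L → f L₁ * g L₂ = 0) : cup f g L = 0 := by
  induction L generalizing f with
  | nil => exact h [] [] rfl
  | cons x L ih =>
    rw [cup_cons, h [] (x :: L) rfl, zero_add]
    exact ih _ fun L₁ L₂ e => h (x :: L₁) L₂ (by simp [e])

end cup

section diff

variable {K : Type u} [CommRing K] {P : ChainAlgebra.{u, v} K} {B : Type w} [Ring B]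

@[simp] theorem bar_nil (f : List P → B) : bar f [] = 0 := rfl

@[simp] theorem bar_cons (f : List P → B) (x : P) (L : List P) :
    bar f (x :: L) =
      f (P.d x :: L) + mulHead f (P.sgn x) L + bar (fun L' => f (P.sgn x :: L')) L := rfl

theorem mulHead_add (f g : List P → B) (a : P) (L : List P) :
    mulHead (f + g) a L = mulHead f a L + mulHead g a L := by
  cases L <;> simp [mulHead]

theorem bar_add (f g : List P → B) : bar (f + g) = bar f + bar g := by
  funext L
  induction L generalizing f g with
  | nil => simp
  | cons x L ih =>
    have e : (fun L' => (f + g) (P.sgn x :: L')) =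
      (fun L' => f (P.sgn x :: L')) + (fun L' => g (P.sgn x :: L')) := rfl
    rw [bar_cons, e, ih]
    simp only [bar_cons, Pi.add_apply, mulHead_add]; abel

theorem bar_smul {k : Type*} [CommRing k] [Algebra k B] (a : k) (f : List P → B) :
    bar (a • f) = a • bar f := by
  funext L
  induction L generalizing f with
  | nil => simp
  | cons x L ih =>
    have e : (fun L' => (a • f) (P.sgn x :: L')) = a • (fun L' => f (P.sgn x :: L')) := rfl
    have e' : mulHead (a • f) (P.sgn x) L = a • mulHead f (P.sgn x) L := by
      cases L <;> simp [mulHead]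
    rw [bar_cons, e, e', ih]
    simp only [bar_cons, Pi.smul_apply, smul_add]

theorem bar_neg (f : List P → B) : bar (-f) = - bar f := by
  have := bar_smul (-1 : ℤ) f
  simpa using this

theorem inv_inv (f : List P → B) : inv (inv f) = f := by
  funext L
  simp only [inv, List.map_map]
  congr 1
  conv_rhs => rw [← List.map_id L]
  congr 1
  funext x
  exact P.sgn_sgn x

theorem inv_cup (f g : List P → B) : inv (cup f g) = cup (inv f) (inv g) := by
  funext L
  induction L generalizing f with
  | nil => rfl
  | cons x L ih =>
    have := ih (fun L' => f (P.sgn x :: L'))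
    have e : inv (cup f g) (x :: L) = f [] * g (P.sgn x :: L.map P.sgn) +
      inv (cup (fun L' => f (P.sgn x :: L')) g) L := rfl
    rw [e, this]
    rfl

variable [Algebra K B]

/-- Multilinearity over `K` in all the entries. -/
def IsMultilinear (f : List P → B) : Prop :=
  (∀ L₁ L₂ x y, f (L₁ ++ (x + y) :: L₂) = f (L₁ ++ x :: L₂) + f (L₁ ++ y :: L₂)) ∧
  (∀ L₁ L₂ (c : K) x, f (L₁ ++ (c • x) :: L₂) = c • f (L₁ ++ x :: L₂))

theorem IsMultilinear.cons_add {f : List P → B} (hf : IsMultilinear f) (x y : P) (L : List P) :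
    f ((x + y) :: L) = f (x :: L) + f (y :: L) := hf.1 [] L x y

theorem IsMultilinear.cons_smul {f : List P → B} (hf : IsMultilinear f) (c : K) (x : P)
    (L : List P) : f ((c • x) :: L) = c • f (x :: L) := hf.2 [] L c x

theorem IsMultilinear.cons_neg {f : List P → B} (hf : IsMultilinear f) (x : P)
    (L : List P) : f ((-x) :: L) = - f (x :: L) := by
  have := hf.cons_smul (-1) x L
  simpa using this

theorem IsMultilinear.tail {f : List P → B} (hf : IsMultilinear f) (x : P) :
    IsMultilinear fun L => f (x :: L) :=
  ⟨fun L₁ L₂ => hf.1 (x :: L₁) L₂, fun L₁ L₂ => hf.2 (x :: L₁) L₂⟩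

theorem IsMultilinear.add {f g : List P → B} (hf : IsMultilinear f) (hg : IsMultilinear g) :
    IsMultilinear (f + g) := by
  refine ⟨fun L₁ L₂ x y => ?_, fun L₁ L₂ c x => ?_⟩
  · simp only [Pi.add_apply, hf.1, hg.1]; abel
  · simp only [Pi.add_apply, hf.2, hg.2, smul_add]

theorem IsMultilinear.smul {k : Type*} [CommRing k] [Algebra k B] (a : k) {f : List P → B}
    (hf : IsMultilinear f) : IsMultilinear (a • f) := by
  refine ⟨fun L₁ L₂ x y => ?_, fun L₁ L₂ c x => ?_⟩
  · simp only [Pi.smul_apply, hf.1, smul_add]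
  · simp only [Pi.smul_apply, hf.2]
    simp only [Algebra.smul_def, ← mul_assoc, Algebra.commutes a (algebraMap K B c)]

theorem isMultilinear_zero : IsMultilinear (0 : List P → B) := by
  refine ⟨fun L₁ L₂ x y => ?_, fun L₁ L₂ c x => ?_⟩ <;> simp

theorem IsMultilinear.sub {f g : List P → B} (hf : IsMultilinear f) (hg : IsMultilinear g) :
    IsMultilinear (f - g) := by
  have := hf.add (hg.smul (-1 : ℤ))
  simpa [sub_eq_add_neg] using this

theorem IsMultilinear.inv {f : List P → B} (hf : IsMultilinear f) : IsMultilinear (inv f) := by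
  refine ⟨fun L₁ L₂ x y => ?_, fun L₁ L₂ c x => ?_⟩
  · simp only [HochschildCochain.inv, List.map_append, List.map_cons, map_add, hf.1]
  · simp only [HochschildCochain.inv, List.map_append, List.map_cons, map_smul, hf.2]

theorem isMultilinear_unit : IsMultilinear (unit : List P → B) := by
  refine ⟨fun L₁ L₂ x y => ?_, fun L₁ L₂ c x => ?_⟩ <;> cases L₁ <;> simp [unit]

theorem isMultilinear_tw (ε : Hom P (ofAlgebra K B)) : IsMultilinear (tw ε) := by
  refine ⟨fun L₁ L₂ x y => ?_, fun L₁ L₂ c x => ?_⟩ <;>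
    rcases L₁ with _ | ⟨a, _ | ⟨b, L₁⟩⟩ <;> rcases L₂ with _ | ⟨c, L₂⟩ <;> simp [tw]

theorem IsMultilinear.cup {f g : List P → B} (hf : IsMultilinear f) (hg : IsMultilinear g) :
    IsMultilinear (cup f g) := by
  refine ⟨fun L₁ L₂ x y => ?_, fun L₁ L₂ c x => ?_⟩
  · induction L₁ generalizing f with
    | nil =>
      have e : (fun L' => f ((x + y) :: L')) =
        (fun L' => f (x :: L')) + (fun L' => f (y :: L')) := by
        funext L'; exact hf.cons_add x y L'
      rw [List.nil_append, cup_cons, e, add_cup]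
      simp only [List.nil_append, cup_cons, hg.cons_add, Pi.add_apply, mul_add]
      abel
    | cons a L₁ ih =>
      have h1 := ih (hf.tail a)
      have h2 := hg.1 (a :: L₁) L₂ x y
      simp only [List.cons_append] at h2
      simp only [List.cons_append, cup_cons, h1, h2, mul_add]
      abel
  · induction L₁ generalizing f with
    | nil =>
      have e : (fun L' => f ((c • x) :: L')) = c • (fun L' => f (x :: L')) := by
        funext L'; exact hf.cons_smul c x L'
      rw [List.nil_append, cup_cons, e, smul_cup]
      simp only [List.nil_append, cup_cons, hg.cons_smul, Pi.smul_apply, smul_add,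
        mul_smul_comm]
    | cons a L₁ ih =>
      have h1 := ih (hf.tail a)
      have h2 := hg.2 (a :: L₁) L₂ c x
      simp only [List.cons_append] at h2
      simp only [List.cons_append, cup_cons, h1, h2, smul_add, mul_smul_comm]

theorem IsMultilinear.mulHead {f : List P → B} (hf : IsMultilinear f) (a : P) :
    IsMultilinear (mulHead f a) := by
  refine ⟨fun L₁ L₂ x y => ?_, fun L₁ L₂ c x => ?_⟩ <;> rcases L₁ with _ | ⟨b, L₁⟩
  · simp only [List.nil_append, HochschildCochain.mulHead, mul_add, hf.cons_add]
  · exact hf.1 ((a * b) :: L₁) L₂ x y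
  · simp only [List.nil_append, HochschildCochain.mulHead, mul_smul_comm, hf.cons_smul]
  · exact hf.2 ((a * b) :: L₁) L₂ c x

theorem IsMultilinear.bar {f : List P → B} (hf : IsMultilinear f) : IsMultilinear (bar f) := by
  refine ⟨fun L₁ L₂ x y => ?_, fun L₁ L₂ c x => ?_⟩
  · induction L₁ generalizing f with
    | nil =>
      have e : (fun L' => f (P.sgn (x + y) :: L')) =
        (fun L' => f (P.sgn x :: L')) + (fun L' => f (P.sgn y :: L')) := by
        funext L'; rw [map_add]; exact hf.cons_add _ _ L'
      have e' : HochschildCochain.mulHead f (P.sgn (x + y)) L₂ =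
          HochschildCochain.mulHead f (P.sgn x) L₂ +
            HochschildCochain.mulHead f (P.sgn y) L₂ := by
        cases L₂ <;> simp [HochschildCochain.mulHead, add_mul, hf.cons_add]
      rw [List.nil_append, bar_cons, e, e', bar_add]
      simp only [List.nil_append, bar_cons, map_add, hf.cons_add, Pi.add_apply]
      abel
    | cons a L₁ ih =>
      have h1 := ih (hf.tail (P.sgn a))
      have h2 := hf.1 (P.d a :: L₁) L₂ x y
      have h3 := (hf.mulHead (P.sgn a)).1 L₁ L₂ x y
      simp only [List.cons_append] at h2
      simp only [List.cons_append, bar_cons, h1, h2, h3]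
      abel
  · induction L₁ generalizing f with
    | nil =>
      have e : (fun L' => f (P.sgn (c • x) :: L')) = c • (fun L' => f (P.sgn x :: L')) := by
        funext L'; rw [map_smul]; exact hf.cons_smul _ _ L'
      have e' : HochschildCochain.mulHead f (P.sgn (c • x)) L₂ =
          c • HochschildCochain.mulHead f (P.sgn x) L₂ := by
        cases L₂ <;> simp [HochschildCochain.mulHead, hf.cons_smul]
      rw [List.nil_append, bar_cons, e, e', bar_smul]
      simp only [List.nil_append, bar_cons, map_smul, hf.cons_smul, Pi.smul_apply, smul_add]
    | cons a L₁ ih =>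
      have h1 := ih (hf.tail (P.sgn a))
      have h2 := hf.2 (P.d a :: L₁) L₂ c x
      have h3 := (hf.mulHead (P.sgn a)).2 L₁ L₂ c x
      simp only [List.cons_append] at h2
      simp only [List.cons_append, bar_cons, h1, h2, h3, smul_add]

theorem IsMultilinear.D {f : List P → B} (hf : IsMultilinear f) (ε : Hom P (ofAlgebra K B)) :
    IsMultilinear (D ε f) :=
  (((isMultilinear_tw ε).cup hf).add hf.bar).sub (hf.inv.cup (isMultilinear_tw ε))

/-- `f` has total degree `n`: it vanishes at homogeneous `(r_1, …, r_l)` unless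
`l + |r_1| + ⋯ + |r_l| = n`. -/
def HasDegree (f : List P → B) (n : ℕ) : Prop :=
  ∀ (L : List P) (e : List ℕ), List.Forall₂ (fun x i => x ∈ P.gr i) L e →
    L.length + e.sum ≠ n → f L = 0

theorem HasDegree.cup {f g : List P → B} {m n : ℕ} (hf : HasDegree f m) (hg : HasDegree g n) :
    HasDegree (cup f g) (m + n) := by
  intro L e he hne
  refine cup_eq_zero _ _ _ fun L₁ L₂ h => ?_
  subst h
  obtain ⟨e₁, e₂, h₁, h₂, rfl⟩ : ∃ e₁ e₂, List.Forall₂ (fun x i => x ∈ P.gr i) L₁ e₁ ∧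
      List.Forall₂ (fun x i => x ∈ P.gr i) L₂ e₂ ∧ e = e₁ ++ e₂ := by
    refine ⟨e.take L₁.length, e.drop L₁.length, ?_, ?_, by simp⟩
    · simpa using List.forall₂_take L₁.length he
    · simpa using List.forall₂_drop L₁.length he
  by_cases h : L₁.length + e₁.sum = m
  · rw [hg L₂ e₂ h₂ ?_, mul_zero]
    intro h'
    apply hne
    simp only [List.length_append, List.sum_append]
    omega
  · rw [hf L₁ e₁ h₁ h, zero_mul]

theorem HasDegree.inv {f : List P → B} {n : ℕ} (hf : HasDegree f n) : HasDegree (inv f) n := by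
  intro L e he hne
  refine hf (L.map P.sgn) e ?_ (by simpa using hne)
  rw [List.forall₂_map_left_iff]
  exact he.imp fun _ _ h => P.sgn_mem h

theorem hasDegree_tw (ε : Hom P (ofAlgebra K B)) : HasDegree (tw ε) 1 := by
  intro L e he hne
  rcases he with _ | ⟨hx, _ | ⟨hy, he⟩⟩
  · rfl
  · rename_i x i
    rcases i with _ | i
    · simp at hne
    · exact ε.aug_gr_succ hx
  · rfl

theorem hasDegree_unit : HasDegree (unit : List P → B) 0 := by
  intro L e he hne
  rcases he with _ | ⟨hx, he⟩
  · simp at hne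
  · rfl

theorem HasDegree.bar {f : List P → B} {n : ℕ} (hf : HasDegree f n) :
    HasDegree (bar f) (n + 1) := by
  suffices H : ∀ (L : List P) (N : ℕ) (f : List P → B)
      (_ : ∀ (L : List P) (e : List ℕ), List.Forall₂ (fun x i => x ∈ P.gr i) L e →
        L.length + e.sum + N ≠ n → f L = 0) (e : List ℕ)
      (_ : List.Forall₂ (fun x i => x ∈ P.gr i) L e), L.length + e.sum + N ≠ n + 1 →
      HochschildCochain.bar f L = 0 from
    fun L e he hne => H L 0 f (fun L e he hne => hf L e he hne) e he hne
  intro L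
  induction L with
  | nil => intros; rfl
  | cons x L ih =>
    intro N f hf e he hne
    rcases he with _ | ⟨hx, he⟩
    rename_i i e
    simp only [List.length_cons, List.sum_cons] at hne
    have h1 : f (P.d x :: L) = 0 := by
      rcases i with _ | i
      · rw [P.d_gr_zero x hx]
        refine hf _ ((n + 1) :: e) (.cons (Submodule.zero_mem _) he) ?_
        simp only [List.length_cons, List.sum_cons]
        omega
      · refine hf _ (i :: e) (.cons (P.d_gr_succ i x hx) he) ?_
        simp only [List.length_cons, List.sum_cons]
        omega
    have h2 : HochschildCochain.mulHead f (P.sgn x) L = 0 := by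
      rcases he with _ | ⟨hy, he⟩
      · rfl
      · rename_i y j L e
        refine hf _ ((i + j) :: e) (.cons (SetLike.mul_mem_graded (P.sgn_mem hx) hy) he) ?_
        simp only [List.length_cons, List.sum_cons] at hne ⊢
        omega
    have h3 := ih (N + 1 + i) (fun L' => f (P.sgn x :: L')) (fun L' e' he' hne' =>
      hf _ (i :: e') (.cons (P.sgn_mem hx) he') (by
        simp only [List.length_cons, List.sum_cons]
        omega)) e he (by omega)
    rw [bar_cons, h1, h2, h3]
    simp

theorem HasDegree.D {f : List P → B} {n : ℕ} (hf : HasDegree f n) (ε : Hom P (ofAlgebra K B)) :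
    HasDegree (D ε f) (n + 1) := by
  intro L e he hne
  have h1 := (hasDegree_tw ε).cup hf L e he (by rw [Nat.add_comm 1 n]; exact hne)
  have h2 := hf.bar L e he hne
  have h3 := hf.inv.cup (hasDegree_tw ε) L e he hne
  simp only [HochschildCochain.D, Pi.add_apply, Pi.sub_apply, h1, h2, h3]
  simp

/-- `bar` is a graded derivation of the cup product. -/
theorem bar_cup {f : List P → B} (g : List P → B) :
    bar (cup f g) = cup (bar f) g + cup (inv f) (bar g) := by
  funext L
  induction L generalizing f with
  | nil => simp
  | cons x L ih =>
    have e1 : (fun L' => cup f g (P.sgn x :: L')) =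
        (fun L' => f [] * g (P.sgn x :: L')) + cup (fun L' => f (P.sgn x :: L')) g := rfl
    have e2 : (fun L' => bar f (x :: L')) =
        (fun L' => f (P.d x :: L')) + mulHead f (P.sgn x) + bar (fun L' => f (P.sgn x :: L')) :=
      rfl
    have e3 : (fun L' => inv f (x :: L')) = inv (fun L' => f (P.sgn x :: L')) := rfl
    have e4 : ∀ (b : B) (h : List P → B) (L : List P), bar (fun L' => b * h L') L = b * bar h L := by
      intro b h L
      induction L generalizing h with
      | nil => simp
      | cons y L ih =>
        have : mulHead (fun L' => b * h L') (P.sgn y) L = b * mulHead h (P.sgn y) L := by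
          cases L <;> simp [mulHead]
        simp only [bar_cons, ih (fun L' => h (P.sgn y :: L')), this, mul_add]
    have e5 : mulHead (cup f g) (P.sgn x) L =
        f [] * mulHead g (P.sgn x) L + cup (mulHead f (P.sgn x)) g L := by
      cases L with
      | nil => simp [mulHead]
      | cons y L => simp [mulHead]
    have e6 : inv f [] = f [] := rfl
    rw [bar_cons, e1, bar_add, Pi.add_apply, e4, ih, e5, Pi.add_apply, Pi.add_apply, cup_cons,
      cup_cons, cup_cons, e2, e3, e6, add_cup, add_cup, bar_nil, bar_cons]
    simp only [Pi.add_apply, mul_add, zero_mul, zero_add]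
    abel

theorem inv_tw (ε : Hom P (ofAlgebra K B)) : inv (tw ε) = - tw ε := by
  funext L
  rcases L with _ | ⟨x, _ | ⟨y, L⟩⟩
  · simp [inv, tw]
  · simpa [inv, tw] using ε.aug_sgn x
  · simp [inv, tw]

theorem inv_add (f g : List P → B) : inv (f + g) = inv f + inv g := rfl

theorem inv_neg (f : List P → B) : inv (-f) = - inv f := rfl

theorem inv_bar {f : List P → B} (hf : IsMultilinear f) : inv (bar f) = - bar (inv f) := by
  funext L
  induction L generalizing f with
  | nil => simp [inv]
  | cons x L ih =>
    have h1 := ih (hf.tail (P.sgn (P.sgn x)))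
    have e1 : (fun L' => inv f (P.sgn x :: L')) = inv (fun L' => f (P.sgn (P.sgn x) :: L')) := rfl
    have e2 : mulHead f (P.sgn (P.sgn x)) (L.map P.sgn) = - mulHead (inv f) (P.sgn x) L := by
      cases L with
      | nil => simp [mulHead]
      | cons y L =>
        simp only [mulHead, inv, List.map_cons, P.sgn_mul, hf.cons_neg, neg_neg]
    simp only [Pi.neg_apply] at h1 ⊢
    have e3 : inv f (P.d x :: L) = - f (P.d (P.sgn x) :: L.map P.sgn) := by
      simp only [inv, List.map_cons, P.sgn_d, hf.cons_neg]
    rw [bar_cons, e1, e3]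
    have e4 : inv (bar f) (x :: L) = f (P.d (P.sgn x) :: L.map P.sgn) +
      mulHead f (P.sgn (P.sgn x)) (L.map P.sgn) +
        inv (bar (fun L' => f (P.sgn (P.sgn x) :: L'))) L := rfl
    rw [e4, e2, h1]
    abel

theorem bar_tw (ε : Hom P (ofAlgebra K B)) : bar (tw ε) = - cup (tw ε) (tw ε) := by
  funext L
  rcases L with _ | ⟨x, _ | ⟨y, L⟩⟩
  · simp [tw]
  · simp [tw, mulHead, ε.aug_d]
  · cases L with
    | nil => simp [tw, mulHead, ε.aug_sgn]
    | cons z L =>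
      have e : ∀ (L : List P) (f : List P → B), (∀ L', f L' = 0) → bar f L = 0 := by
        intro L
        induction L with
        | nil => intros; rfl
        | cons x L ih =>
          intro f hf
          rw [bar_cons, hf, ih _ fun L' => hf _]
          cases L <;> simp [mulHead, hf]
      have e' : ∀ (L : List P) (f g : List P → B), (∀ L', f L' = 0) → cup f g L = 0 := by
        intro L f g hf
        exact cup_eq_zero _ _ _ fun L₁ L₂ _ => by rw [hf, zero_mul]
      simp only [bar_cons, cup_cons, Pi.neg_apply, tw, mulHead]
      rw [e _ _ fun L' => rfl, e' _ _ _ fun L' => rfl]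
      cases L <;> simp

/-- `D` is a graded derivation of the cup product. -/
theorem D_cup (ε : Hom P (ofAlgebra K B)) (f g : List P → B) :
    D ε (cup f g) = cup (D ε f) g + cup (inv f) (D ε g) := by
  simp only [D, bar_cup, inv_cup, sub_eq_add_neg, add_cup, cup_add, neg_cup, cup_neg, cup_assoc]
  abel

theorem D_inv (ε : Hom P (ofAlgebra K B)) {f : List P → B} (hf : IsMultilinear f) :
    D ε (inv f) = - inv (D ε f) := by
  simp only [D, sub_eq_add_neg, inv_add, inv_neg, inv_bar hf, inv_cup, inv_tw, neg_cup, cup_neg]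
  abel

theorem bar_bar {f : List P → B} (hf : IsMultilinear f) : bar (bar f) = 0 := by
  funext L
  induction L generalizing f with
  | nil => rfl
  | cons x L ih =>
    have h1 := ih (hf.tail (P.sgn (P.sgn x)))
    have e1 : (fun L' => bar f (P.sgn x :: L')) = (fun L' => f (P.d (P.sgn x) :: L')) +
      mulHead f (P.sgn (P.sgn x)) + bar (fun L' => f (P.sgn (P.sgn x) :: L')) := rfl
    rw [bar_cons, e1, bar_add, bar_add, Pi.add_apply, Pi.add_apply, h1, bar_cons, P.d_d]
    have z : f (0 :: L) = 0 := by simpa using hf.cons_smul 0 0 L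
    have e2 : (fun L' => f (P.sgn (P.d x) :: L')) = - fun L' => f (P.d (P.sgn x) :: L') := by
      funext L'
      rw [P.sgn_d, hf.cons_neg]; rfl
    have e3 : mulHead f (P.sgn (P.d x)) L = - mulHead f (P.d (P.sgn x)) L := by
      cases L with
      | nil => simp [mulHead]
      | cons y L => simp only [mulHead, P.sgn_d, neg_mul, hf.cons_neg]
    rw [z, e2, e3, bar_neg, P.sgn_sgn]
    cases L with
    | nil => simp [mulHead]
    | cons y L =>
      have e4 : mulHead (bar f) (P.sgn x) (y :: L) = f (P.d (P.sgn x * y) :: L) +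
        mulHead f (P.sgn (P.sgn x * y)) L + bar (fun L' => f (P.sgn (P.sgn x * y) :: L')) L := rfl
      have e5 : (fun L' => f (P.sgn (P.sgn x * y) :: L')) = - fun L' => f ((x * P.sgn y) :: L') := by
        funext L'
        rw [P.sgn_mul, P.sgn_sgn, hf.cons_neg]; rfl
      have e6 : mulHead f (P.sgn (P.sgn x * y)) L = - mulHead f (x * P.sgn y) L := by
        cases L with
        | nil => simp [mulHead]
        | cons y L => simp only [mulHead, P.sgn_mul, P.sgn_sgn, neg_mul, hf.cons_neg]
      have e7 : mulHead (mulHead f x) (P.sgn y) L = mulHead f (x * P.sgn y) L := by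
        cases L with
        | nil => simp [mulHead]
        | cons y L => simp only [mulHead, mul_assoc]
      have e8 : f (P.d (P.sgn x * y) :: L) =
          f ((P.d (P.sgn x) * y) :: L) - f ((x * P.d y) :: L) := by
        rw [P.d_mul, P.sgn_sgn, sub_eq_add_neg, hf.cons_add, hf.cons_neg, ← sub_eq_add_neg]
      rw [e4, e5, e6, e8, bar_neg]
      simp only [bar_cons, e7, Pi.neg_apply, Pi.zero_apply]
      simp only [mulHead]
      abel

theorem D_add (ε : Hom P (ofAlgebra K B)) (f g : List P → B) : D ε (f + g) = D ε f + D ε g := by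
  simp only [D, cup_add, bar_add, inv_add, add_cup]
  abel

theorem D_smul {k : Type*} [CommRing k] [Algebra k B] (ε : Hom P (ofAlgebra K B)) (a : k)
    (f : List P → B) : D ε (a • f) = a • D ε f := by
  have e : inv (a • f) = a • inv f := rfl
  simp only [D, cup_smul, bar_smul, e, smul_cup, smul_add, smul_sub]

theorem D_unit (ε : Hom P (ofAlgebra K B)) : D ε unit = 0 := by
  have e1 : (inv unit : List P → B) = unit := by
    funext L; cases L <;> rfl
  have e2 : (bar unit : List P → B) = 0 := by
    have e : ∀ (L : List P) (f : List P → B), (∀ L', f L' = 0) → bar f L = 0 := by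
      intro L
      induction L with
      | nil => intros; rfl
      | cons x L ih =>
        intro f hf
        rw [bar_cons, hf, ih _ fun L' => hf _]
        cases L <;> simp [mulHead, hf]
    funext L
    cases L with
    | nil => rfl
    | cons x L =>
      rw [bar_cons, e L (fun L' => unit (P.sgn x :: L')) fun L' => rfl]
      cases L <;> simp [mulHead, unit]
  simp [D, e1, e2, cup_unit, unit_cup]

/-- `D` is a differential. -/
theorem D_D (ε : Hom P (ofAlgebra K B)) {f : List P → B} (hf : IsMultilinear f) :
    D ε (D ε f) = 0 := by
  have h : D ε (D ε f) = cup (tw ε) (D ε f) + bar (D ε f) - cup (inv (D ε f)) (tw ε) := rfl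
  have h' : inv (D ε f) = - D ε (inv f) := by rw [D_inv ε hf, neg_neg]
  rw [h, h']
  have hbar : bar (D ε f) = bar (cup (tw ε) f) + bar (bar f) - bar (cup (inv f) (tw ε)) := by
    simp only [D, sub_eq_add_neg, bar_add, bar_neg]
  rw [hbar, bar_bar hf, bar_cup, bar_cup, bar_tw, inv_tw, inv_inv]
  simp only [D, inv_inv, sub_eq_add_neg, add_cup, cup_add, neg_cup, cup_neg, cup_assoc]
  abel

end diff

end HochschildCochain

/-! ### Hochschild cohomology of chain algebras -/

open ChainAlgebra HochschildCochain

section HH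

variable (k : Type*) [CommRing k] {K : Type u} [CommRing K] {P : ChainAlgebra.{u, v} K}
  {B : Type w} [Ring B] [Algebra K B] [Algebra k B]

/-- The `k`-module `Cⁿ(P, B)` of Hochschild cochains of total degree `n`: the product over
`l + q = n` of the modules of `K`-linear maps `(P^{⊗ l})_q → B`. -/
def hochschildCochains (P : ChainAlgebra.{u, v} K) (B : Type w) [Ring B] [Algebra K B]
    [Algebra k B] (n : ℕ) : Submodule k (List P → B) where
  carrier := {f | IsMultilinear f ∧ HasDegree f n}
  zero_mem' := ⟨isMultilinear_zero, fun _ _ _ _ => rfl⟩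
  add_mem' := fun ha hb => ⟨ha.1.add hb.1, fun L e he hne => by
    rw [Pi.add_apply, ha.2 L e he hne, hb.2 L e he hne, add_zero]⟩
  smul_mem' := fun c _ ha => ⟨ha.1.smul c, fun L e he hne => by
    rw [Pi.smul_apply, ha.2 L e he hne, smul_zero]⟩

/-- The Hochschild coboundary as a linear map. -/
noncomputable def hochschildD (ε : Hom P (ofAlgebra K B)) : (List P → B) →ₗ[k] (List P → B) where
  toFun := D ε
  map_add' := D_add ε
  map_smul' := D_smul ε

/-- Cocycles of degree `n`. -/
noncomputable def hochschildCocycles (ε : Hom P (ofAlgebra K B)) (n : ℕ) :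
    Submodule k (List P → B) :=
  hochschildCochains k P B n ⊓ LinearMap.ker (hochschildD k ε)

/-- Coboundaries of degree `n`. -/
noncomputable def hochschildCoboundaries (ε : Hom P (ofAlgebra K B)) :
    ℕ → Submodule k (List P → B)
  | 0 => ⊥
  | n + 1 => (hochschildCochains k P B n).map (hochschildD k ε)

theorem hochschildCoboundaries_le (ε : Hom P (ofAlgebra K B)) (n : ℕ) :
    hochschildCoboundaries k ε n ≤ hochschildCocycles k ε n := by
  rcases n with _ | n
  · exact bot_le
  · rintro _ ⟨f, hf, rfl⟩
    exact ⟨⟨hf.1.D ε, hf.2.D ε⟩, D_D ε hf.1⟩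

/-- The Hochschild cohomology `Hⁿ(P/K, B)` of a chain algebra `P` over `K`, with coefficients in an
algebra `B` over which `P` is augmented; a module over any ring `k` over which `B` is an algebra. -/
def HochschildH (ε : Hom P (ofAlgebra K B)) (n : ℕ) : Type (max v w) :=
  hochschildCocycles k ε n ⧸
    (hochschildCoboundaries k ε n).submoduleOf (hochschildCocycles k ε n)

noncomputable instance HochschildH.addCommGroup (ε : Hom P (ofAlgebra K B)) (n : ℕ) :
    AddCommGroup (HochschildH k ε n) :=
  inferInstanceAs (AddCommGroup (hochschildCocycles k ε n ⧸
    (hochschildCoboundaries k ε n).submoduleOf (hochschildCocycles k ε n)))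

noncomputable instance HochschildH.module (ε : Hom P (ofAlgebra K B)) (n : ℕ) :
    Module k (HochschildH k ε n) :=
  inferInstanceAs (Module k (hochschildCocycles k ε n ⧸
    (hochschildCoboundaries k ε n).submoduleOf (hochschildCocycles k ε n)))

/-- The class of a cocycle. -/
noncomputable def HochschildH.mk (ε : Hom P (ofAlgebra K B)) (n : ℕ) :
    hochschildCocycles k ε n →ₗ[k] HochschildH k ε n :=
  Submodule.mkQ _

theorem HochschildH.mk_surjective (ε : Hom P (ofAlgebra K B)) (n : ℕ) :
    Function.Surjective (HochschildH.mk k ε n) :=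
  Submodule.mkQ_surjective _

theorem HochschildH.mk_eq_zero (ε : Hom P (ofAlgebra K B)) {n : ℕ}
    {f : hochschildCocycles k ε n} (hf : f.1 ∈ hochschildCoboundaries k ε n) :
    HochschildH.mk k ε n f = 0 :=
  (Submodule.Quotient.mk_eq_zero _).2 hf

/-- The cup product of cocycles. -/
noncomputable def cupCocycles (ε : Hom P (ofAlgebra K B)) (i j : ℕ) :
    hochschildCocycles k ε i →ₗ[k] hochschildCocycles k ε j →ₗ[k]
      hochschildCocycles k ε (i + j) :=
  LinearMap.mk₂ k (fun f g => ⟨cup f.1 g.1,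
      ⟨f.2.1.1.cup g.2.1.1, f.2.1.2.cup g.2.1.2⟩, by
        have hf : D ε f.1 = 0 := f.2.2
        have hg : D ε g.1 = 0 := g.2.2
        change D ε (cup f.1 g.1) = 0
        rw [D_cup, hf, hg, zero_cup, cup_zero, add_zero]⟩)
    (fun _ _ _ => Subtype.ext (add_cup _ _ _)) (fun _ _ _ => Subtype.ext (smul_cup _ _ _))
    (fun _ _ _ => Subtype.ext (cup_add _ _ _)) (fun _ _ _ => Subtype.ext (cup_smul _ _ _))

theorem cup_coboundary (ε : Hom P (ofAlgebra K B)) {i j : ℕ} (f : hochschildCocycles k ε i)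
    (g : hochschildCocycles k ε j) (hg : g.1 ∈ hochschildCoboundaries k ε j) :
    cup f.1 g.1 ∈ hochschildCoboundaries k ε (i + j) := by
  rcases j with _ | j
  · have h : g.1 = 0 := hg
    rw [h, cup_zero]; exact Submodule.zero_mem _
  · obtain ⟨h, hh, e⟩ := hg
    have e : D ε h = g.1 := e
    have hf : D ε f.1 = 0 := f.2.2
    refine ⟨cup (inv f.1) h, ⟨f.2.1.1.inv.cup hh.1, f.2.1.2.inv.cup hh.2⟩, ?_⟩
    change D ε (cup (inv f.1) h) = _
    rw [D_cup, D_inv ε f.2.1.1, hf, HochschildCochain.inv_inv, e]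
    have : (inv (0 : List P → B)) = 0 := rfl
    rw [this, neg_zero, zero_cup, zero_add]

theorem coboundary_cup (ε : Hom P (ofAlgebra K B)) {i j : ℕ} (f : hochschildCocycles k ε i)
    (g : hochschildCocycles k ε j) (hf : f.1 ∈ hochschildCoboundaries k ε i) :
    cup f.1 g.1 ∈ hochschildCoboundaries k ε (i + j) := by
  rcases i with _ | i
  · have h : f.1 = 0 := hf
    rw [h, zero_cup]; exact Submodule.zero_mem _
  · obtain ⟨h, hh, e⟩ := hf
    have e : D ε h = f.1 := e
    have hg : D ε g.1 = 0 := g.2.2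
    rw [Nat.add_right_comm]
    refine ⟨cup h g.1, ⟨hh.1.cup g.2.1.1, hh.2.cup g.2.1.2⟩, ?_⟩
    change D ε (cup h g.1) = _
    rw [D_cup, hg, e, cup_zero, add_zero]

/-- The cup product `Hⁱ(P, B) × Hʲ(P, B) → Hⁱ⁺ʲ(P, B)`. -/
noncomputable def HochschildH.mul (ε : Hom P (ofAlgebra K B)) (i j : ℕ) :
    HochschildH k ε i →ₗ[k] HochschildH k ε j →ₗ[k] HochschildH k ε (i + j) :=
  Submodule.liftQ _
    (LinearMap.flip (Submodule.liftQ _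
      (LinearMap.flip ((cupCocycles k ε i j).compr₂ (HochschildH.mk k ε (i + j))))
      (fun g hg => by
        rw [LinearMap.mem_ker]
        ext f
        exact HochschildH.mk_eq_zero k ε (cup_coboundary k ε f g hg))))
    (fun f hf => by
      rw [LinearMap.mem_ker]
      refine LinearMap.ext fun b => ?_
      obtain ⟨g, rfl⟩ := HochschildH.mk_surjective k ε _ b
      exact HochschildH.mk_eq_zero k ε (f := cupCocycles k ε i j f g)
        (coboundary_cup k ε f g hf))

/-- The unit cochain as a cocycle. -/
noncomputable def unitCocycle (ε : Hom P (ofAlgebra K B)) : hochschildCocycles k ε 0 :=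
  ⟨unit, ⟨isMultilinear_unit, hasDegree_unit⟩, D_unit ε⟩

/-- The class of the unit cochain. -/
noncomputable def HochschildH.one (ε : Hom P (ofAlgebra K B)) : HochschildH k ε 0 :=
  HochschildH.mk k ε 0 (unitCocycle k ε)

theorem HochschildH.mul_mk (ε : Hom P (ofAlgebra K B)) (i j : ℕ)
    (f : hochschildCocycles k ε i) (g : hochschildCocycles k ε j) :
    HochschildH.mul k ε i j (HochschildH.mk k ε i f) (HochschildH.mk k ε j g) =
      HochschildH.mk k ε (i + j) (cupCocycles k ε i j f g) := rfl

theorem HochschildH.sigma_ext (ε : Hom P (ofAlgebra K B)) {i j : ℕ}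
    (f : hochschildCocycles k ε i) (g : hochschildCocycles k ε j) (h : i = j) (e : f.1 = g.1) :
    GradedMonoid.mk (A := HochschildH k ε) i (HochschildH.mk k ε i f) =
      GradedMonoid.mk j (HochschildH.mk k ε j g) := by
  subst h
  have : f = g := Subtype.ext e
  rw [this]

noncomputable instance HochschildH.gmul (ε : Hom P (ofAlgebra K B)) :
    GradedMonoid.GMul (HochschildH k ε) where
  mul {i j} a b := HochschildH.mul k ε i j a b

noncomputable instance HochschildH.gone (ε : Hom P (ofAlgebra K B)) :
    GradedMonoid.GOne (HochschildH k ε) where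
  one := HochschildH.one k ε

noncomputable instance HochschildH.gmonoid (ε : Hom P (ofAlgebra K B)) :
    GradedMonoid.GMonoid (HochschildH k ε) where
  one_mul := by
    rintro ⟨i, a⟩
    obtain ⟨f, rfl⟩ := HochschildH.mk_surjective k ε _ a
    exact HochschildH.sigma_ext k ε _ _ (zero_add i) (unit_cup f.1)
  mul_one := by
    rintro ⟨i, a⟩
    obtain ⟨f, rfl⟩ := HochschildH.mk_surjective k ε _ a
    exact HochschildH.sigma_ext k ε _ _ (add_zero i) (cup_unit f.1)
  mul_assoc := by
    rintro ⟨i, a⟩ ⟨j, b⟩ ⟨l, c⟩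
    obtain ⟨f, rfl⟩ := HochschildH.mk_surjective k ε _ a
    obtain ⟨g, rfl⟩ := HochschildH.mk_surjective k ε _ b
    obtain ⟨h, rfl⟩ := HochschildH.mk_surjective k ε _ c
    exact HochschildH.sigma_ext k ε _ _ (add_assoc i j l) (cup_assoc f.1 g.1 h.1)

/-- Hochschild cohomology is a graded ring under the cup product. -/
noncomputable instance HochschildH.gring (ε : Hom P (ofAlgebra K B)) :
    DirectSum.GRing (HochschildH k ε) where
  __ := HochschildH.gmonoid k ε
  mul_zero a := map_zero _
  zero_mul b := by
    change HochschildH.mul k ε _ _ 0 b = 0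
    rw [map_zero]; rfl
  mul_add a b c := map_add _ b c
  add_mul a b c := by
    change HochschildH.mul k ε _ _ (a + b) c = _
    rw [map_add]; rfl
  natCast n := (n : ℤ) • HochschildH.one k ε
  natCast_zero := by simp
  natCast_succ n := by
    change ((n + 1 : ℕ) : ℤ) • HochschildH.one k ε =
      (n : ℤ) • HochschildH.one k ε + HochschildH.one k ε
    rw [Nat.cast_succ, add_smul, one_smul]
  intCast n := n • HochschildH.one k ε
  intCast_ofNat n := rfl
  intCast_negSucc_ofNat n := by
    change Int.negSucc n • HochschildH.one k ε = -(((n + 1 : ℕ) : ℤ) • HochschildH.one k ε)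
    rw [← neg_smul]; rfl

noncomputable instance HochschildH.galgebra (ε : Hom P (ofAlgebra K B)) :
    DirectSum.GAlgebra k (HochschildH k ε) where
  toFun := ((LinearMap.toSpanSingleton k _ (HochschildH.one k ε)).toAddMonoidHom :
    k →+ HochschildH k ε 0)
  map_one := one_smul k (HochschildH.one k ε)
  map_mul r s := by
    refine HochschildH.sigma_ext k ε ((r * s) • unitCocycle k ε)
      (cupCocycles k ε 0 0 (r • unitCocycle k ε)
        (s • unitCocycle k ε)) rfl ?_
    change (r * s) • unit = cup (r • unit) (s • unit)
    rw [smul_cup, cup_smul, unit_cup, smul_smul]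
  commutes := by
    rintro r ⟨i, a⟩
    obtain ⟨f, rfl⟩ := HochschildH.mk_surjective k ε _ a
    refine HochschildH.sigma_ext k ε
      (cupCocycles k ε 0 i (r • unitCocycle k ε) f)
      (cupCocycles k ε i 0 f (r • unitCocycle k ε))
      (Nat.add_comm 0 i) ?_
    change cup (r • unit) f.1 = cup f.1 (r • unit)
    rw [smul_cup, cup_smul, unit_cup, cup_unit]
  smul_def := by
    rintro r ⟨i, a⟩
    obtain ⟨f, rfl⟩ := HochschildH.mk_surjective k ε _ a
    refine HochschildH.sigma_ext k ε (r • f)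
      (cupCocycles k ε 0 i (r • unitCocycle k ε) f)
      (Nat.zero_add i).symm ?_
    change r • f.1 = cup (r • unit) f.1
    rw [smul_cup, unit_cup]

end HH

/-! ### Shukla cohomology -/

/-- A quasi-free chain algebra with a weak equivalence to the algebra `R`. -/
structure QuasiFreeResolution (K : Type u) [CommRing K] (R : Type v) [Ring R] [Algebra K R] where
  complex : ChainAlgebra.{u, v} K
  quasiFree : complex.IsQuasiFree
  aug : Hom complex (ofAlgebra K R)
  weakEquivalence : aug.IsWeakEquivalence

/-- The Hochschild cohomology `Hⁿ(A/k, A)`, `n ≥ 0`, of a `k`-algebra `A`. -/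
abbrev HochschildAlg (k : Type u) [CommRing k] (A : Type v) [Ring A] [Algebra k A] :
    ℕ → Type v :=
  HochschildH k (Hom.id (ofAlgebra k A))

/-- The Shukla cohomology `Shuklaⁿ(A/K, A)`, `n ≥ 0`, computed by a quasi-free resolution of `A` over `K`:
the Hochschild cohomology of the resolution with coefficients in `A`. It is a module over any
commutative ring `k` over which `A` is an algebra. -/
abbrev Shukla (k : Type w) [CommRing k] {K : Type u} [CommRing K] {A : Type v} [Ring A]
    [Algebra K A] [Algebra k A] (R : QuasiFreeResolution K A) : ℕ → Type v :=
  HochschildH k R.aug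

/-- `A` has a lifting to `ℤ/p²`: an algebra `A₀` over `ℤ/p²`, free as a module, with a ring
isomorphism `A₀ / p A₀ ≅ A`. -/
def HasLifting (p : ℕ) (A : Type u) [Ring A] : Prop :=
  ∃ (A₀ : Type u) (_ : Ring A₀) (_ : Algebra (ZMod (p ^ 2)) A₀),
    Module.Free (ZMod (p ^ 2)) A₀ ∧
      ∃ π : A₀ →+* A, Function.Surjective π ∧ ∀ x, π x = 0 ↔ ∃ y, x = (p : A₀) * y

/-! Let A₀ be a lifting of A to ℤ/p². Over ℤ/p² the algebra A = A₀/p has a small multiplicative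
resolution: A₀ ⊗ Λ[x] ⊗ Γ[y] with |x| = 1, |y| = 2, dx = p and dy^[i] = p x y^[i-1] (`koszul`,
`koszul_isAcyclic`). It is not quasi-free, but every quasi-free resolution R of A maps to it over A
(`IsQuasiFree.exists_hom`). On both sides the p-torsion consists of multiples of p, so the mapping
cone stays acyclic modulo p (`exact_mod`) and the map is still an equivalence modulo p. The
differential of the Koszul algebra is divisible by p, hence its reduction is W = A ⊗ Λ[x] ⊗ Γ[y]
over 𝔽_p with zero differential. Cochains with values in A do not see multiples of p. A contraction
of R/p onto W, used one argument at a time along the filtration by the number of arguments,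
therefore identifies the Shukla cohomology of A with the Hochschild cohomology of W with
coefficients in A (`AugMor.Contraction.exists_decomp`, `QuasiFreeResolution.exists_bijective`).

It remains to compute the cohomology of W. By Lucas' congruence Γ[y] over 𝔽_p retracts onto a copy
of itself, spanned by the y^[pi], with complementary factor 𝔽_p[t]/t^p. Explicit homotopies on the
cochains show what one factor contributes. The exterior generator x gives a class ξ of degree 2
(`OddSplitting.D_h`). A truncated generator t gives, as its two-periodic resolution predicts, a
class λ of degree |t| + 1 and a class β of degree p|t| + 2 (`EvenSplitting.D_homotopy`): every class
is a class pulled back from the retract plus yλ plus βz, and the coefficients are recovered by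
operators on cohomology. Further homotopies show that ξ and β commute and λ commutes up to sign with
the classes from the retract. Moreover λ² = β for p = 2 and λ² = 0 for p odd, which is the only
source of the two shapes of the answer.

Peeling off one truncated factor after another gives a tower whose n-th stage has its divided power
generator in degree 2pⁿ. Up to that degree a cochain sees only A, so in each fixed degree the
process stops with the Hochschild cohomology of A. Hence the cohomology of W is H*(A/𝔽_p, A) ⊗ E,
where E is the polynomial algebra on ξ and the λ_n (p = 2), or the exterior algebra on the λ_n
tensored with the polynomial algebra on ξ and the β_n (p odd); this is `CohTower.Ψ_bijective`. For A
= 𝔽_p the first factor is 𝔽_p, so E is the Shukla cohomology of 𝔽_p (`bijective_of_ground`).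
Comparing the two computations through E gives the tensor product decomposition, and the Koszul sign
is the sign with which the λ_n pass classes of A (`exists_iso`). Resolutions exist by attaching a
generator for every cycle (`nonempty_quasiFreeResolution`). -/

section

open ChainAlgebra HochschildCochain

open ChainAlgebra

namespace HochschildCochain

/-! ### Operators on cochains -/

section Operators

variable {X : Type v} {B : Type w} [Ring B]

/-- The cochain `f(x, -)`. -/
def der (x : X) : (List X → B) →ₗ[B] (List X → B) where
  toFun f L := f (x :: L)
  map_add' _ _ := rfl
  map_smul' _ _ := rfl

@[simp] theorem der_apply (x : X) (f : List X → B) (L : List X) : der x f L = f (x :: L) := rfl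

/-- Auxiliary definition for `pre`. -/
def preAux (φ : X → X) (Y : (List X → B) → List X → B) : (List X → B) → List X → B
  | f, [] => Y f []
  | f, x :: L => Y f (x :: L) + preAux φ Y (fun L' => f (φ x :: L')) L

/-- The operator `f ↦ ∑_{L = L₁ ++ L₂} Y(f(φ L₁, -))(L₂)`. -/
def pre (φ : X → X) (Y : (List X → B) →ₗ[B] (List X → B)) :
    (List X → B) →ₗ[B] (List X → B) where
  toFun := preAux φ Y
  map_add' f g := by
    funext L
    induction L generalizing f g with
    | nil => simp [preAux]
    | cons x L ih =>
      have := ih (fun L' => f (φ x :: L')) (fun L' => g (φ x :: L'))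
      have e : (fun L' => (f + g) (φ x :: L')) =
        (fun L' => f (φ x :: L')) + (fun L' => g (φ x :: L')) := rfl
      rw [preAux, e, this]
      simp only [preAux, map_add, Pi.add_apply]
      abel
  map_smul' c f := by
    funext L
    induction L generalizing f with
    | nil => simp [preAux]
    | cons x L ih =>
      have := ih (fun L' => f (φ x :: L'))
      have e : (fun L' => (c • f) (φ x :: L')) = c • (fun L' => f (φ x :: L')) := rfl
      rw [preAux, e, this]
      simp only [preAux, map_smul, Pi.smul_apply, smul_add, RingHom.id_apply]

@[simp] theorem pre_nil (φ : X → X) (Y : (List X → B) →ₗ[B] (List X → B)) (f : List X → B) :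
    pre φ Y f [] = Y f [] := rfl

@[simp] theorem pre_cons (φ : X → X) (Y : (List X → B) →ₗ[B] (List X → B)) (f : List X → B)
    (x : X) (L : List X) : pre φ Y f (x :: L) = Y f (x :: L) + pre φ Y (der (φ x) f) L := rfl

theorem der_pre (φ : X → X) (Y : (List X → B) →ₗ[B] (List X → B)) (f : List X → B) (x : X) :
    der x (pre φ Y f) = der x (Y f) + pre φ Y (der (φ x) f) := rfl

theorem pre_add (φ : X → X) (Y Z : (List X → B) →ₗ[B] (List X → B)) (f : List X → B) :
    pre φ (Y + Z) f = pre φ Y f + pre φ Z f := by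
  funext L
  induction L generalizing f with
  | nil => rfl
  | cons x L ih =>
    simp only [pre_cons, ih, LinearMap.add_apply, Pi.add_apply]; abel

theorem pre_zero (φ : X → X) (f : List X → B) :
    pre φ (0 : (List X → B) →ₗ[B] (List X → B)) f = 0 := by
  funext L
  induction L generalizing f with
  | nil => rfl
  | cons x L ih =>
    simp only [pre_cons, ih, LinearMap.zero_apply, Pi.zero_apply]; abel

/-- The cup product with a fixed cochain on the right. -/
def cupR (g : List X → B) : (List X → B) →ₗ[B] (List X → B) where
  toFun f := cup f g
  map_add' f f' := add_cup f f' g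
  map_smul' b f := by
    funext L
    exact mul_left_cup b f g L

@[simp] theorem cupR_apply (g f : List X → B) : cupR g f = cup f g := rfl

theorem cup_cons' (f g : List X → B) (x : X) (L : List X) :
    cup f g (x :: L) = f [] * g (x :: L) + cup (der x f) g L := rfl

theorem der_cup (f g : List X → B) (x : X) :
    der x (cup f g) = (fun L => f [] * der x g L) + cup (der x f) g := rfl

/-- A cup product on the right cuts off a final segment, while `pre` works on an initial one; the
two sums over cuts can be exchanged. -/
theorem pre_cupR (φ : X → X) (Y : (List X → B) →ₗ[B] (List X → B)) (g f : List X → B) :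
    pre φ (cupR g ∘ₗ Y) f = cup (pre φ Y f) g := by
  funext L
  induction L generalizing f with
  | nil => rfl
  | cons x L ih =>
    rw [pre_cons, ih, cup_cons', der_pre, add_cup]
    simp only [LinearMap.comp_apply, cupR_apply, cup_cons', pre_nil, Pi.add_apply]
    abel

/-- Precomposition of a cochain with a map in all the entries. -/
def pull {X' : Type*} (φ : X → X') : (List X' → B) →ₗ[B] (List X → B) where
  toFun f L := f (L.map φ)
  map_add' _ _ := rfl
  map_smul' _ _ := rfl

@[simp] theorem pull_apply {X' : Type*} (φ : X → X') (f : List X' → B) (L : List X) :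
    pull φ f L = f (L.map φ) := rfl

theorem der_pull {X' : Type*} (φ : X → X') (f : List X' → B) (x : X) :
    der x (pull φ f) = pull φ (der (φ x) f) := rfl

theorem pull_cup {X' : Type*} (φ : X → X') (f g : List X' → B) :
    pull φ (cup f g) = cup (pull φ f) (pull φ g) := by
  funext L
  induction L generalizing f with
  | nil => rfl
  | cons x L ih =>
    have := ih (der (φ x) f)
    simp only [pull_apply, List.map_cons, cup_cons'] at this ⊢
    rw [this]
    rfl

theorem pull_unit {X' : Type*} (φ : X → X') : pull φ (unit : List X' → B) = unit := by
  funext L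
  cases L <;> rfl

theorem pull_pull {X' X'' : Type*} (φ : X → X') (ψ : X' → X'') (f : List X'' → B) :
    pull φ (pull ψ f) = pull (ψ ∘ φ) f := by
  funext L
  simp

end Operators

/-! ### Coboundaries by recursion on the first entry, commutators with `pre`, and degrees -/

section Calculus

variable {K : Type u} [CommRing K] {P : ChainAlgebra.{u, v} K} {B : Type w} [Ring B]
  [Algebra K B]

theorem IsMultilinear.der {f : List P → B} (hf : IsMultilinear f) (x : P) :
    IsMultilinear (der x f) := hf.tail x

theorem IsMultilinear.der_add {f : List P → B} (hf : IsMultilinear f) (x y : P) :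
    HochschildCochain.der (x + y) f = HochschildCochain.der x f + HochschildCochain.der y f := by
  funext L
  exact hf.cons_add x y L

theorem IsMultilinear.der_smul {f : List P → B} (hf : IsMultilinear f) (c : K) (x : P) :
    HochschildCochain.der (c • x) f = c • HochschildCochain.der x f := by
  funext L
  exact hf.cons_smul c x L

theorem IsMultilinear.der_neg {f : List P → B} (hf : IsMultilinear f) (x : P) :
    HochschildCochain.der (-x) f = - HochschildCochain.der x f := by
  funext L
  exact hf.cons_neg x L

theorem IsMultilinear.der_sub {f : List P → B} (hf : IsMultilinear f) (x y : P) :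
    HochschildCochain.der (x - y) f = HochschildCochain.der x f - HochschildCochain.der y f := by
  rw [sub_eq_add_neg, hf.der_add, hf.der_neg, ← sub_eq_add_neg]

theorem IsMultilinear.der_zero {f : List P → B} (hf : IsMultilinear f) :
    HochschildCochain.der 0 f = 0 := by
  have := hf.der_smul 0 0
  simpa using this

theorem IsMultilinear.der_zsmul {f : List P → B} (hf : IsMultilinear f) (n : ℤ) (x : P) :
    HochschildCochain.der (n • x) f = n • HochschildCochain.der x f := by
  have := hf.der_smul (n : K) x
  rw [Int.cast_smul_eq_zsmul] at this
  rw [this]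
  exact Int.cast_smul_eq_zsmul K n _

theorem IsMultilinear.cons_sub {f : List P → B} (hf : IsMultilinear f) (x y : P) (L : List P) :
    f ((x - y) :: L) = f (x :: L) - f (y :: L) := congrFun (hf.der_sub x y) L

theorem IsMultilinear.cons_zero {f : List P → B} (hf : IsMultilinear f) (L : List P) :
    f (0 :: L) = 0 := congrFun hf.der_zero L

theorem IsMultilinear.neg {f : List P → B} (hf : IsMultilinear f) : IsMultilinear (-f) := by
  simpa using hf.smul (-1 : ℤ)

theorem IsMultilinear.zsmul {f : List P → B} (hf : IsMultilinear f) (n : ℤ) :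
    IsMultilinear (n • f) := hf.smul n

variable (ε : Hom P (ofAlgebra K B))

/-- Multiplication by `a` on the first entry, or through the augmentation on the right. -/
def actR (a : P) : (List P → B) →ₗ[B] (List P → B) where
  toFun f L := match L with
    | [] => f [] * ε.aug a
    | y :: L => f ((a * y) :: L)
  map_add' f g := by
    funext L
    cases L <;> simp [add_mul]
  map_smul' c f := by
    funext L
    cases L <;> simp [mul_assoc]

@[simp] theorem actR_nil (a : P) (f : List P → B) : actR ε a f [] = f [] * ε.aug a := rfl

@[simp] theorem actR_cons (a : P) (f : List P → B) (y : P) (L : List P) :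
    actR ε a f (y :: L) = f ((a * y) :: L) := rfl

theorem der_actR (a y : P) (f : List P → B) : der y (actR ε a f) = der (a * y) f := rfl

theorem actR_neg {f : List P → B} (hf : IsMultilinear f) (a : P) :
    actR ε (-a) f = - actR ε a f := by
  funext L
  cases L <;> simp [hf.cons_neg]

/-- Multiplying into the next entry and acting on the coefficient after the last entry are one
operation, `actR`. With the last term of the coboundary absorbed in this way, `barR` satisfies a
single recursion, and every commutator below is computed by unfolding it once. -/
theorem mulHead_sub_tw_cons (f : List P → B) (a : P) (L : List P) :
    mulHead f (P.sgn a) L - f [] * tw ε (a :: L) = actR ε (P.sgn a) f L := by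
  cases L <;> simp [mulHead, tw, ε.aug_sgn]

/-- The Hochschild coboundary without its first term. -/
noncomputable def barR : (List P → B) →ₗ[B] (List P → B) where
  toFun f := bar f - cup (inv f) (tw ε)
  map_add' f g := by
    simp only [bar_add, inv_add, add_cup]; abel
  map_smul' b f := by
    funext L
    have h : ∀ (L : List P) (f : List P → B), bar (b • f) L = b * bar f L := by
      intro L
      induction L with
      | nil => simp
      | cons x L ih =>
        intro f
        have e : (fun L' => (b • f) (P.sgn x :: L')) = b • (fun L' => f (P.sgn x :: L')) := rfl
        have e' : mulHead (b • f) (P.sgn x) L = b * mulHead f (P.sgn x) L := by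
          cases L <;> simp [mulHead]
        rw [bar_cons, e, ih, e']
        simp [mul_add]
    have h' : cup (inv (b • f)) (tw ε) L = b * cup (inv f) (tw ε) L := mul_left_cup b _ _ L
    simp only [Pi.sub_apply, h, h', RingHom.id_apply, Pi.smul_apply, smul_eq_mul, mul_sub]

theorem D_eq_barR (f : List P → B) : D ε f = cup (tw ε) f + barR ε f := by
  simp only [D, barR, LinearMap.coe_mk, AddHom.coe_mk]; abel

@[simp] theorem barR_nil (f : List P → B) : barR ε f [] = 0 := by
  simp [barR, tw]

theorem barR_cons (f : List P → B) (x : P) (L : List P) :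
    barR ε f (x :: L) =
      f (P.d x :: L) + actR ε (P.sgn x) f L + barR ε (der (P.sgn x) f) L := by
  have h : barR ε f (x :: L) = bar f (x :: L) - cup (inv f) (tw ε) (x :: L) := rfl
  have h' : barR ε (der (P.sgn x) f) L =
    bar (der (P.sgn x) f) L - cup (inv (der (P.sgn x) f)) (tw ε) L := rfl
  have h'' : (fun L' => inv f (x :: L')) = inv (der (P.sgn x) f) := rfl
  have h3 : (fun L' => f (P.sgn x :: L')) = der (P.sgn x) f := rfl
  have h4 : inv f [] = f [] := rfl
  rw [h, h', bar_cons, cup_cons, h'', h3, h4, ← mulHead_sub_tw_cons ε f x L]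
  abel

theorem tw_nil : tw ε [] = 0 := rfl

theorem cup_tw_cons (f : List P → B) (x : P) (L : List P) :
    cup (tw ε) f (x :: L) = ε.aug x * f L := by
  rw [cup_cons, tw_nil, zero_mul, zero_add]
  cases L with
  | nil => rfl
  | cons y L =>
    rw [cup_cons]
    have : (fun L' => tw ε (x :: y :: L')) = 0 := rfl
    rw [this, zero_cup]
    simp [tw]

theorem cup_tw_nil (f : List P → B) : cup (tw ε) f [] = 0 := by simp [tw]

theorem der_cup_tw (f : List P → B) (x : P) : der x (cup (tw ε) f) = ε.aug x • f := by
  funext L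
  exact cup_tw_cons ε f x L

theorem der_barR (hd : ∀ x, P.d x = 0) {f : List P → B} (hf : IsMultilinear f) (x : P) :
    der x (barR ε f) = actR ε (P.sgn x) f + barR ε (der (P.sgn x) f) := by
  funext L
  rw [der_apply, barR_cons, hd, hf.cons_zero, zero_add]
  rfl

theorem IsMultilinear.pre {φ : P →ₗ[K] P} {Y : (List P → B) →ₗ[B] (List P → B)}
    (hY : ∀ f, IsMultilinear f → IsMultilinear (Y f)) {f : List P → B} (hf : IsMultilinear f) :
    IsMultilinear (pre φ Y f) := by
  refine ⟨fun L₁ L₂ x y => ?_, fun L₁ L₂ c x => ?_⟩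
  · induction L₁ generalizing f with
    | nil =>
      simp only [List.nil_append, pre_cons, (hY f hf).cons_add, map_add, hf.der_add, Pi.add_apply]
      abel
    | cons a L₁ ih =>
      have h1 := ih (hf.der (φ a))
      have h2 := (hY f hf).1 (a :: L₁) L₂ x y
      simp only [List.cons_append] at h2
      simp only [List.cons_append, pre_cons, h1, h2]
      abel
  · induction L₁ generalizing f with
    | nil =>
      have : ∀ (c : K) (g : List P → B), HochschildCochain.pre φ Y (c • g) =
          c • HochschildCochain.pre φ Y g := by
        intro c g
        have e : c • g = algebraMap K B c • g := by
          funext L; simp [Algebra.smul_def]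
        rw [e, map_smul]
        funext L; simp [Algebra.smul_def]
      simp only [List.nil_append, pre_cons, (hY f hf).cons_smul, map_smul φ, hf.der_smul, this,
        Pi.smul_apply, smul_add]
    | cons a L₁ ih =>
      have h1 := ih (hf.der (φ a))
      have h2 := (hY f hf).2 (a :: L₁) L₂ c x
      simp only [List.cons_append] at h2
      simp only [List.cons_append, pre_cons, h1, h2, smul_add]

/-- The commutator of `barR` with an operator `pre φ Y`, for a zero differential. -/
theorem barR_pre (hd : ∀ x, P.d x = 0) (φ : P →ₗ[K] P) (η : ℤ)
    (hφm : ∀ x y, φ (P.sgn x * y) = η • (P.sgn (φ x) * φ y))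
    (hφs : ∀ x, φ (P.sgn x) = P.sgn (φ x))
    (Y Z : (List P → B) →ₗ[B] (List P → B))
    (hY : ∀ f, IsMultilinear f → IsMultilinear (Y f))
    (hZ0 : ∀ f, IsMultilinear f → Z f [] = - (η • Y (barR ε f) []))
    (hZ1 : ∀ f, IsMultilinear f → ∀ x L, Z f (x :: L) = barR ε (Y f) (x :: L) -
      η • Y (barR ε f) (x :: L) - η • Y (actR ε (P.sgn (φ x)) f) L)
    {f : List P → B} (hf : IsMultilinear f) :
    barR ε (pre φ Y f) = η • pre φ Y (barR ε f) + pre (φ ∘ₗ P.sgn) Z f := by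
  funext L
  -- The sign `η` records how `φ` multiplies: it is 1 for a projection π and -1 for -π, which
  -- accompanies operators of odd degree. `Z` is the commutator at the place where `Y` acts; the
  -- induction shows that nothing else survives.
  induction L generalizing f with
  | nil => simp [hZ0 f hf]
  | cons x L ih =>
    have e1 : pre φ Y (barR ε f) (x :: L) = Y (barR ε f) (x :: L) +
        (pre φ Y (actR ε (P.sgn (φ x)) f) L + pre φ Y (barR ε (der (P.sgn (φ x)) f)) L) := by
      rw [pre_cons, der_barR ε hd hf, map_add, Pi.add_apply]
    have e2 : barR ε (pre φ Y f) (x :: L) = actR ε (P.sgn x) (pre φ Y f) L +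
        (barR ε (der (P.sgn x) (Y f)) L + barR ε (pre φ Y (der (φ (P.sgn x)) f)) L) := by
      rw [barR_cons, hd, (hf.pre hY).cons_zero, der_pre, map_add, Pi.add_apply, zero_add]
    have e3 : barR ε (Y f) (x :: L) = actR ε (P.sgn x) (Y f) L +
        barR ε (der (P.sgn x) (Y f)) L := by
      rw [barR_cons, hd, (hY f hf).cons_zero, zero_add]
    -- Products of two entries of the prefix cancel because `φ` is multiplicative up to `η`. Only
    -- the products at the border between the prefix and the place where `Y` acts remain, and `Z`
    -- accounts for these.
    have e4 : actR ε (P.sgn x) (pre φ Y f) L - η • pre φ Y (actR ε (P.sgn (φ x)) f) L =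
        actR ε (P.sgn x) (Y f) L - η • Y (actR ε (P.sgn (φ x)) f) L := by
      cases L with
      | nil => simp
      | cons y L =>
        rw [actR_cons, pre_cons, hφm, hf.der_zsmul, map_zsmul, pre_cons, der_actR, actR_cons]
        simp only [Pi.smul_apply, smul_add]
        abel
    have e5 := ih (hf.der (φ (P.sgn x)))
    have e6 : pre (φ ∘ₗ P.sgn) Z f (x :: L) =
      Z f (x :: L) + pre (φ ∘ₗ P.sgn) Z (der (φ (P.sgn x)) f) L := rfl
    rw [Pi.add_apply, Pi.smul_apply] at e5 ⊢
    rw [e2, e5, e1, e6, hZ1 f hf x L, e3, hφs, sub_eq_iff_eq_add.mp e4]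
    simp only [smul_add]
    abel

/-- If the prefix is nonempty, its first entry is consumed by the augmentation, which `φ` preserves
up to `η`. The extra term is the contribution of the empty prefix. -/
theorem pre_cup_tw (φ : P →ₗ[K] P) (η : ℤ)
    (hφε : ∀ x, ε.aug (φ x) = η • ε.aug x) (Y : (List P → B) →ₗ[B] (List P → B))
    (f : List P → B) :
    pre φ Y (cup (tw ε) f) = η • cup (tw ε) (pre φ Y f) + Y (cup (tw ε) f) := by
  funext L
  cases L with
  | nil => simp [tw]
  | cons x L =>
    rw [pre_cons, der_cup_tw, map_smul, hφε, Pi.add_apply, Pi.smul_apply, Pi.smul_apply,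
      cup_tw_cons, smul_eq_mul, smul_mul_assoc]
    abel

/-- The commutator of the coboundary with an operator `pre φ Y`, for a zero differential. -/
theorem D_pre (hd : ∀ x, P.d x = 0) (φ : P →ₗ[K] P) (η : ℤ) (hη : η * η = 1)
    (hφm : ∀ x y, φ (P.sgn x * y) = η • (P.sgn (φ x) * φ y))
    (hφs : ∀ x, φ (P.sgn x) = P.sgn (φ x)) (hφε : ∀ x, ε.aug (φ x) = η • ε.aug x)
    (Y Z : (List P → B) →ₗ[B] (List P → B))
    (hY : ∀ f, IsMultilinear f → IsMultilinear (Y f))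
    (hZ0 : ∀ f, IsMultilinear f → Z f [] = - (η • Y (barR ε f) []))
    (hZ1 : ∀ f, IsMultilinear f → ∀ x L, Z f (x :: L) = barR ε (Y f) (x :: L) -
      η • Y (barR ε f) (x :: L) - η • Y (actR ε (P.sgn (φ x)) f) L)
    {f : List P → B} (hf : IsMultilinear f) :
    D ε (pre φ Y f) =
      η • pre φ Y (D ε f) + pre (φ ∘ₗ P.sgn) Z f - η • Y (cup (tw ε) f) := by
  rw [D_eq_barR, D_eq_barR, barR_pre ε hd φ η hφm hφs Y Z hY hZ0 hZ1 hf, map_add,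
    pre_cup_tw ε φ η hφε, smul_add, smul_add, smul_smul, hη, one_smul]
  abel

/-! ### Degrees in `ℤ` -/

/-- `f` has total degree `n`, with `n` an integer. -/
def HasDeg (f : List P → B) (n : ℤ) : Prop :=
  ∀ (L : List P) (e : List ℕ), List.Forall₂ (fun x i => x ∈ P.gr i) L e →
    ((L.length + e.sum : ℕ) : ℤ) ≠ n → f L = 0

theorem hasDeg_iff {f : List P → B} {n : ℕ} : HasDeg f n ↔ HasDegree f n := by
  refine ⟨fun h L e he hne => h L e he (by exact_mod_cast hne),
    fun h L e he hne => h L e he (by exact_mod_cast hne)⟩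

theorem HasDeg.der {f : List P → B} {n : ℤ} (hf : HasDeg f n) {i : ℕ} {x : P} (hx : x ∈ P.gr i) :
    HasDeg (der x f) (n - 1 - i) := by
  intro L e he hne
  refine hf (x :: L) (i :: e) (.cons hx he) ?_
  simp only [List.length_cons, List.sum_cons]
  omega

/-- Each entry is a sum of homogeneous elements, so multilinearity reduces to homogeneous lists one
entry at a time. -/
theorem IsMultilinear.ext_homogeneous {f : List P → B} (hf : IsMultilinear f)
    (h : ∀ (L : List P) (e : List ℕ), List.Forall₂ (fun x i => x ∈ P.gr i) L e → f L = 0) :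
    f = 0 := by
  funext L
  induction L generalizing f with
  | nil => exact h [] [] .nil
  | cons x L ih =>
    induction x using P.gr_induction with
    | h0 => exact hf.cons_zero L
    | hom n x hx => exact ih (hf.der x) fun L e he => h (x :: L) (n :: e) (.cons hx he)
    | add x y hx hy => rw [hf.cons_add, hx, hy]; simp

/-- Degrees are taken in ℤ so that operators may lower them freely. This vanishing is what later
makes truncated subtraction of degrees harmless. -/
theorem HasDeg.eq_zero {f : List P → B} {n : ℤ} (hf : IsMultilinear f) (h : HasDeg f n)
    (hn : n < 0) : f = 0 :=
  hf.ext_homogeneous fun L e he => h L e he (by omega)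

theorem HasDeg.add {f g : List P → B} {n : ℤ} (hf : HasDeg f n) (hg : HasDeg g n) :
    HasDeg (f + g) n := fun L e he hne => by
  rw [Pi.add_apply, hf L e he hne, hg L e he hne, add_zero]

theorem HasDeg.zsmul {f : List P → B} {n : ℤ} (hf : HasDeg f n) (c : ℤ) :
    HasDeg (c • f) n := fun L e he hne => by
  rw [Pi.smul_apply, hf L e he hne, smul_zero]

theorem HasDeg.neg {f : List P → B} {n : ℤ} (hf : HasDeg f n) : HasDeg (-f) n :=
  fun L e he hne => by rw [Pi.neg_apply, hf L e he hne, neg_zero]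

theorem HasDeg.D {f : List P → B} {n : ℤ} (hm : IsMultilinear f) (hf : HasDeg f n) :
    HasDeg (D ε f) (n + 1) := by
  by_cases hn : 0 ≤ n
  · lift n to ℕ using hn
    exact_mod_cast hasDeg_iff.2 (HasDegree.D (hasDeg_iff.1 hf) ε)
  · rw [hf.eq_zero hm (by omega)]
    intro L e he hne
    simpa using congrFun (D_smul ε (0 : ℤ) (0 : List P → B)) L

/-- The value of `inv` on a cochain of degree `n`. -/
theorem HasDeg.inv_eq {f : List P → B} (hm : IsMultilinear f) {n : ℤ} (hf : HasDeg f n) :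
    inv f = (n.negOnePow : ℤ) • f := by
  have key : ∀ (L : List P) (e : List ℕ), List.Forall₂ (fun x i => x ∈ P.gr i) L e →
      ∀ f : List P → B, IsMultilinear f →
        f (L.map P.sgn) = ((-1 : ℤ) ^ (L.length + e.sum)) • f L := by
    intro L e he
    induction he with
    | nil => intro f _; simp
    | @cons x i L e hx he ih =>
      intro f hm
      have h1 := ih (HochschildCochain.der (P.sgn x) f) (hm.der _)
      rw [List.map_cons]
      rw [der_apply] at h1
      rw [h1, P.sgn_of_mem hx]
      have h2 : ((-1 : K) ^ (i + 1)) • x = ((-1 : ℤ) ^ (i + 1)) • x := by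
        rw [← Int.cast_smul_eq_zsmul K]; simp
      rw [h2, hm.der_zsmul, Pi.smul_apply, smul_smul, der_apply, List.length_cons, List.sum_cons]
      congr 1
      ring
  have h0 : IsMultilinear (inv f - (n.negOnePow : ℤ) • f) := hm.inv.sub (hm.smul _)
  rw [← sub_eq_zero]
  refine h0.ext_homogeneous fun L e he => ?_
  have h1 : inv f L = ((-1 : ℤ) ^ (L.length + e.sum)) • f L := key L e he f hm
  rw [Pi.sub_apply, h1, Pi.smul_apply]
  by_cases h : ((L.length + e.sum : ℕ) : ℤ) = n
  · have e : ((Int.negOnePow ((L.length + e.sum : ℕ) : ℤ) : ℤˣ) : ℤ) =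
        (-1) ^ (L.length + e.sum) := by
      rw [Int.negOnePow_def, zpow_natCast]; simp
    rw [← h, e, sub_self]
  · rw [hf L e he h]; simp

/-- `Y` preserves multilinearity and shifts degrees by `m`. -/
def IsOp (Y : (List P → B) →ₗ[B] (List P → B)) (m : ℤ) : Prop :=
  ∀ f, IsMultilinear f → IsMultilinear (Y f) ∧ ∀ n, HasDeg f n → HasDeg (Y f) (n + m)

theorem IsOp.ml {Y : (List P → B) →ₗ[B] (List P → B)} {m : ℤ} (hY : IsOp Y m) (f : List P → B)
    (hf : IsMultilinear f) : IsMultilinear (Y f) := (hY f hf).1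

theorem IsOp.comp {Y Z : (List P → B) →ₗ[B] (List P → B)} {m n : ℤ} (hY : IsOp Y m)
    (hZ : IsOp Z n) : IsOp (Y ∘ₗ Z) (n + m) := fun f hf =>
  ⟨hY.ml _ (hZ.ml f hf), fun k hk => by
    rw [← add_assoc]; exact (hY _ (hZ.ml f hf)).2 _ ((hZ f hf).2 k hk)⟩

theorem IsOp.add {Y Z : (List P → B) →ₗ[B] (List P → B)} {m : ℤ} (hY : IsOp Y m)
    (hZ : IsOp Z m) : IsOp (Y + Z) m := fun f hf =>
  ⟨(hY.ml _ hf).add (hZ.ml f hf), fun k hk => ((hY f hf).2 k hk).add ((hZ f hf).2 k hk)⟩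

theorem IsOp.neg {Y : (List P → B) →ₗ[B] (List P → B)} {m : ℤ} (hY : IsOp Y m) :
    IsOp (-Y) m := fun f hf =>
  ⟨(hY.ml _ hf).neg, fun k hk => ((hY f hf).2 k hk).neg⟩

theorem isOp_der {i : ℕ} {x : P} (hx : x ∈ P.gr i) : IsOp (der x : (List P → B) →ₗ[B] _) (-1 - i) :=
  fun f hf => ⟨hf.der x, fun n hn => by
    have := hn.der hx
    rwa [show n + (-1 - (i : ℤ)) = n - 1 - i by ring]⟩

theorem IsOp.pre {φ : P →ₗ[K] P} (hφ : ∀ n, ∀ x ∈ P.gr n, φ x ∈ P.gr n)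
    {Y : (List P → B) →ₗ[B] (List P → B)} {m : ℤ} (hY : IsOp Y m) : IsOp (pre φ Y) m :=
  fun f hf => ⟨hf.pre hY.ml, fun n hn L e he hne => by
    induction he generalizing f n with
    | nil => exact (hY f hf).2 n hn [] [] .nil hne
    | @cons x i L e hx he ih =>
      rw [pre_cons, (hY f hf).2 n hn _ _ (.cons hx he) hne, zero_add]
      refine ih _ (hf.der (φ x)) _ (hn.der (hφ _ _ hx)) ?_
      simp only [List.length_cons, List.sum_cons] at hne
      omega⟩

theorem IsMultilinear.pull {φ : P →ₗ[K] P} {f : List P → B} (hf : IsMultilinear f) :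
    IsMultilinear (pull φ f) := by
  refine ⟨fun L₁ L₂ x y => ?_, fun L₁ L₂ c x => ?_⟩
  · simp only [pull_apply, List.map_append, List.map_cons, map_add, hf.1]
  · simp only [pull_apply, List.map_append, List.map_cons, map_smul, hf.2]

theorem isOp_pull {φ : P →ₗ[K] P} (hφ : ∀ n, ∀ x ∈ P.gr n, φ x ∈ P.gr n) :
    IsOp (pull φ : (List P → B) →ₗ[B] _) 0 := fun f hf =>
  ⟨hf.pull, fun n hn L e he hne => by
    refine hn (L.map φ) e ?_ (by simpa using hne)
    rw [List.forall₂_map_left_iff]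
    exact he.imp fun _ _ h => hφ _ _ h⟩

theorem inv_eq_pull (f : List P → B) : inv f = pull P.sgn f := rfl

end Calculus

end HochschildCochain

end

/-! ### Operators that act on one or two entries, and cochains of length one and two -/

section

open ChainAlgebra HochschildCochain

open ChainAlgebra

namespace HochschildCochain

section Ops

variable {X : Type v} {B : Type w} [Ring B]

/-- The operator `f ↦ T(f(g(x), -))(L)` at `x :: L`. -/
def op1 (g : X → X) (T : (List X → B) →ₗ[B] (List X → B)) :
    (List X → B) →ₗ[B] (List X → B) where
  toFun f L := match L with
    | [] => 0
    | x :: L => T (der (g x) f) L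
  map_add' f h := by funext L; cases L <;> simp
  map_smul' c f := by funext L; cases L <;> simp

@[simp] theorem op1_nil (g : X → X) (T : (List X → B) →ₗ[B] (List X → B)) (f : List X → B) :
    op1 g T f [] = 0 := rfl

@[simp] theorem op1_cons (g : X → X) (T : (List X → B) →ₗ[B] (List X → B)) (f : List X → B)
    (x : X) (L : List X) : op1 g T f (x :: L) = T (der (g x) f) L := rfl

theorem der_op1 (g : X → X) (T : (List X → B) →ₗ[B] (List X → B)) (f : List X → B) (x : X) :
    der x (op1 g T f) = T (der (g x) f) := rfl

/-- The operator `f ↦ T(f(θ(x, y), -))(L)` at `x :: y :: L`. -/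
def op2 (θ : X → X → X) (T : (List X → B) →ₗ[B] (List X → B)) :
    (List X → B) →ₗ[B] (List X → B) where
  toFun f L := match L with
    | x :: y :: L => T (der (θ x y) f) L
    | _ => 0
  map_add' f h := by funext L; rcases L with _ | ⟨_, _ | ⟨_, _⟩⟩ <;> simp
  map_smul' c f := by funext L; rcases L with _ | ⟨_, _ | ⟨_, _⟩⟩ <;> simp

@[simp] theorem op2_nil (θ : X → X → X) (T : (List X → B) →ₗ[B] (List X → B)) (f : List X → B) :
    op2 θ T f [] = 0 := rfl

@[simp] theorem op2_single (θ : X → X → X) (T : (List X → B) →ₗ[B] (List X → B))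
    (f : List X → B) (x : X) : op2 θ T f [x] = 0 := rfl

@[simp] theorem op2_cons (θ : X → X → X) (T : (List X → B) →ₗ[B] (List X → B)) (f : List X → B)
    (x y : X) (L : List X) : op2 θ T f (x :: y :: L) = T (der (θ x y) f) L := rfl

theorem der_der_op2 (θ : X → X → X) (T : (List X → B) →ₗ[B] (List X → B)) (f : List X → B)
    (x y : X) : der y (der x (op2 θ T f)) = T (der (θ x y) f) := rfl

/-- A function as a cochain supported on lists of length one. -/
def lin (δ : X → B) : List X → B
  | [x] => δ x
  | _ => 0

@[simp] theorem lin_nil (δ : X → B) : lin δ [] = 0 := rfl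
@[simp] theorem lin_single (δ : X → B) (x : X) : lin δ [x] = δ x := rfl
@[simp] theorem lin_cons_cons (δ : X → B) (x y : X) (L : List X) : lin δ (x :: y :: L) = 0 := rfl

theorem cup_lin_cons (δ : X → B) (f : List X → B) (x : X) (L : List X) :
    cup (lin δ) f (x :: L) = δ x * f L := by
  rw [cup_cons, lin_nil, zero_mul, zero_add]
  cases L with
  | nil => rfl
  | cons y L =>
    rw [cup_cons]
    have : (fun L' => lin δ (x :: y :: L')) = 0 := rfl
    rw [this, zero_cup]
    simp

/-- A function of two variables as a cochain supported on lists of length two. -/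
def lin2 (β : X → X → B) : List X → B
  | [x, y] => β x y
  | _ => 0

@[simp] theorem lin2_nil (β : X → X → B) : lin2 β [] = 0 := rfl
@[simp] theorem lin2_single (β : X → X → B) (x : X) : lin2 β [x] = 0 := rfl
@[simp] theorem lin2_pair (β : X → X → B) (x y : X) : lin2 β [x, y] = β x y := rfl
@[simp] theorem lin2_cons_cons_cons (β : X → X → B) (x y z : X) (L : List X) :
    lin2 β (x :: y :: z :: L) = 0 := rfl

theorem der_lin2 (β : X → X → B) (x : X) : der x (lin2 β) = lin (β x) := by
  funext L
  rcases L with _ | ⟨y, _ | ⟨z, L⟩⟩ <;> rfl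

theorem cup_lin2_cons_cons (β : X → X → B) (f : List X → B) (x y : X) (L : List X) :
    cup (lin2 β) f (x :: y :: L) = β x y * f L := by
  rw [cup_cons', der_lin2, cup_lin_cons, lin2_nil, zero_mul, zero_add]

@[simp] theorem cup_lin2_single (β : X → X → B) (f : List X → B) (x : X) :
    cup (lin2 β) f [x] = 0 := by
  rw [cup_cons', der_lin2]
  simp

end Ops

section Central

variable {K : Type u} [CommRing K] {P : ChainAlgebra.{u, v} K} {B : Type w} [Ring B]
  [Algebra K B] (ε : Hom P (ofAlgebra K B))

theorem map_smul_K (T : (List P → B) →ₗ[B] (List P → B)) (c : K) (f : List P → B) :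
    T (c • f) = c • T f := by
  have e : ∀ g : List P → B, c • g = algebraMap K B c • g := by
    intro g; funext L; simp [Algebra.smul_def]
  rw [e, map_smul, ← e]

theorem isOp_id : IsOp (LinearMap.id : (List P → B) →ₗ[B] (List P → B)) 0 := fun f hf =>
  ⟨hf, fun n hn => by simpa using hn⟩

/-- The grading is by natural numbers, so a map that lowers degrees by `a` has no room on degrees
below `a`; this is the reason for the alternative `g x = 0`. -/
theorem isOp_op1 {g : P →ₗ[K] P} {a : ℕ}
    (hg : ∀ i, ∀ x ∈ P.gr i, g x = 0 ∨ ∃ j, i = j + a ∧ g x ∈ P.gr j)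
    {T : (List P → B) →ₗ[B] (List P → B)} {m : ℤ} (hT : IsOp T m) :
    IsOp (op1 g T) (m + a) := fun f hf => by
  refine ⟨⟨fun L₁ L₂ x y => ?_, fun L₁ L₂ c x => ?_⟩, fun n hn L e he hne => ?_⟩
  · rcases L₁ with _ | ⟨b, L₁⟩
    · simp only [List.nil_append, op1_cons, map_add, hf.der_add, Pi.add_apply]
    · exact (hT.ml _ (hf.der (g b))).1 L₁ L₂ x y
  · rcases L₁ with _ | ⟨b, L₁⟩
    · simp only [List.nil_append, op1_cons, map_smul g, hf.der_smul, map_smul_K, Pi.smul_apply]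
    · exact (hT.ml _ (hf.der (g b))).2 L₁ L₂ c x
  · rcases he with _ | ⟨hx, he⟩
    · rfl
    · rename_i x i L e
      rw [op1_cons]
      rcases hg i x hx with h | ⟨j, rfl, h⟩
      · rw [h, hf.der_zero, map_zero]; rfl
      · refine (hT _ (hf.der _)).2 _ (hn.der h) _ _ he ?_
        simp only [List.length_cons, List.sum_cons] at hne
        omega

theorem isOp_op2 {θ : P →ₗ[K] P →ₗ[K] P} {a : ℕ}
    (hθ : ∀ i j, ∀ x ∈ P.gr i, ∀ y ∈ P.gr j, θ x y = 0 ∨ ∃ k, i + j = k + a ∧ θ x y ∈ P.gr k)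
    {T : (List P → B) →ₗ[B] (List P → B)} {m : ℤ} (hT : IsOp T m) :
    IsOp (op2 (fun x y => θ x y) T) (m + a + 1) := fun f hf => by
  refine ⟨⟨fun L₁ L₂ x y => ?_, fun L₁ L₂ c x => ?_⟩, fun n hn L e he hne => ?_⟩
  · rcases L₁ with _ | ⟨b, _ | ⟨b', L₁⟩⟩
    · rcases L₂ with _ | ⟨z, L₂⟩
      · simp
      · simp only [List.nil_append, op2_cons, map_add, LinearMap.add_apply, hf.der_add,
          Pi.add_apply]
    · simp only [List.cons_append, List.nil_append, op2_cons, map_add, hf.der_add, Pi.add_apply]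
    · exact (hT.ml _ (hf.der (θ b b'))).1 L₁ L₂ x y
  · rcases L₁ with _ | ⟨b, _ | ⟨b', L₁⟩⟩
    · rcases L₂ with _ | ⟨z, L₂⟩
      · simp
      · simp only [List.nil_append, op2_cons, map_smul θ, LinearMap.smul_apply, hf.der_smul,
          map_smul_K, Pi.smul_apply]
    · simp only [List.cons_append, List.nil_append, op2_cons, map_smul (θ _), hf.der_smul,
        map_smul_K, Pi.smul_apply]
    · exact (hT.ml _ (hf.der (θ b b'))).2 L₁ L₂ c x
  · rcases he with _ | ⟨hx, _ | ⟨hy, he⟩⟩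
    · rfl
    · rfl
    · rename_i x i y j L e
      rw [op2_cons]
      rcases hθ i j x hx y hy with h | ⟨k, hk, h⟩
      · rw [h, hf.der_zero, map_zero]; rfl
      · refine (hT _ (hf.der _)).2 _ (hn.der h) _ _ he ?_
        simp only [List.length_cons, List.sum_cons] at hne
        omega

variable (hd : ∀ x, P.d x = 0)
include hd

theorem barR_cons' {f : List P → B} (hf : IsMultilinear f) (x : P) (L : List P) :
    barR ε f (x :: L) = actR ε (P.sgn x) f L + barR ε (der (P.sgn x) f) L := by
  rw [barR_cons, hd, hf.cons_zero, zero_add]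

/-- The value at `[]` or at `v :: L'` of a function of `v` and `L'` that is `0` at `[]`. -/
theorem barR_op1 {g : P → P} {T : (List P → B) →ₗ[B] (List P → B)} {f : List P → B}
    (hf : IsMultilinear (op1 g T f)) (x : P) (L : List P) :
    barR ε (op1 g T f) (x :: L) =
      op1 (fun y => g (P.sgn x * y)) T f L + barR ε (T (der (g (P.sgn x)) f)) L := by
  rw [barR_cons' ε hd hf, der_op1]
  cases L <;> simp

theorem op1_barR {g : P → P} {T : (List P → B) →ₗ[B] (List P → B)} {f : List P → B}
    (hf : IsMultilinear f) (x : P) (L : List P) :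
    op1 g T (barR ε f) (x :: L) =
      T (actR ε (P.sgn (g x)) f) L + T (barR ε (der (P.sgn (g x)) f)) L := by
  rw [op1_cons, der_barR ε hd hf, map_add]
  rfl

theorem barR_op2_single {θ : P → P → P} {T : (List P → B) →ₗ[B] (List P → B)} {f : List P → B}
    (hf : IsMultilinear (op2 θ T f)) (x : P) : barR ε (op2 θ T f) [x] = 0 := by
  simp [barR_cons' ε hd hf]

theorem barR_op2 {θ : P → P → P} {T : (List P → B) →ₗ[B] (List P → B)} {f : List P → B}
    (hf : IsMultilinear (op2 θ T f)) (x y : P) (L : List P) :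
    barR ε (op2 θ T f) (x :: y :: L) =
      op1 (θ (P.sgn x * y)) T f L + op1 (fun z => θ (P.sgn x) (P.sgn y * z)) T f L +
        barR ε (T (der (θ (P.sgn x) (P.sgn y)) f)) L := by
  rw [barR_cons' ε hd hf, barR_cons' ε hd (hf.der _), der_der_op2]
  cases L <;> simp [add_assoc]

omit hd in
/-- The operator `f ↦ f([]) g`. -/
def endOp (g : List P → B) : (List P → B) →ₗ[B] (List P → B) where
  toFun f L := f [] * g L
  map_add' f h := by funext L; simp [add_mul]
  map_smul' c f := by funext L; simp [mul_assoc]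

omit hd in
@[simp] theorem endOp_apply (g f : List P → B) (L : List P) : endOp g f L = f [] * g L := rfl

omit hd in
-- An operator that only looks at the value on the empty list turns the sum over prefixes into the
-- sum defining a cup product. Cup products enter the homotopy formulas in this way.
theorem pre_endOp (φ : P → P) (g : List P → B) (f : List P → B) :
    pre φ (endOp g) f = cup (pull φ f) g := by
  funext L
  induction L generalizing f with
  | nil => simp
  | cons x L ih =>
    rw [pre_cons, ih, cup_cons', endOp_apply]
    rfl

end Central

end HochschildCochain

end

/-! ### Splitting off an exterior generator of degree one -/

section

open ChainAlgebra HochschildCochain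

open ChainAlgebra

namespace HochschildCochain

section Splitting

variable {K : Type u} [CommRing K] {P : ChainAlgebra.{u, v} K} {B : Type w} [Ring B]
  [Algebra K B]

/-- The summand of each prefix is the difference between projecting one more entry and not doing so.
This is how a local correction becomes the global term `pull φ f - f` in the homotopies. -/
theorem pre_telescope (φ : P → P) (T : (List P → B) →ₗ[B] (List P → B))
    (hT0 : ∀ f, T f [] = 0) (hT1 : ∀ f x L, T f (x :: L) = f (φ x :: L) - f (x :: L))
    (f : List P → B) : pre φ T f = pull φ f - f := by
  funext L
  induction L generalizing f with
  | nil => simp [hT0]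
  | cons x L ih =>
    rw [pre_cons, ih, hT1]
    simp

theorem pre_congr (φ : P → P) {Y Z : (List P → B) →ₗ[B] (List P → B)} {S : Set (List P → B)}
    (hS : ∀ x, ∀ f ∈ S, der (φ x) f ∈ S)
    (h : ∀ f ∈ S, Y f = Z f) {f : List P → B} (hf : f ∈ S) : pre φ Y f = pre φ Z f := by
  funext L
  induction L generalizing f with
  | nil => simp [h f hf]
  | cons x L ih => rw [pre_cons, pre_cons, h f hf, ih (hS x f hf)]

/-- `f ↦ f(φ x, -) - f(x, -)`. -/
def subPull (φ : P → P) : (List P → B) →ₗ[B] (List P → B) where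
  toFun f L := match L with
    | [] => 0
    | x :: L => f (φ x :: L) - f (x :: L)
  map_add' f h := by
    funext L
    cases L
    · simp
    · simp only [Pi.add_apply]; abel
  map_smul' c f := by funext L; cases L <;> simp [mul_sub]

@[simp] theorem subPull_nil (φ : P → P) (f : List P → B) : subPull φ f [] = 0 := rfl
@[simp] theorem subPull_cons (φ : P → P) (f : List P → B) (x : P) (L : List P) :
    subPull φ f (x :: L) = f (φ x :: L) - f (x :: L) := rfl

theorem pre_subPull (φ : P → P) (f : List P → B) : pre φ (subPull φ) f = pull φ f - f :=
  pre_telescope φ _ (fun _ => rfl) (fun _ _ _ => rfl) f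

theorem isMultilinear_lin (δ : P →ₗ[K] B) : IsMultilinear (lin δ : List P → B) := by
  refine ⟨fun L₁ L₂ x y => ?_, fun L₁ L₂ c x => ?_⟩ <;>
    rcases L₁ with _ | ⟨a, _ | ⟨b, L₁⟩⟩ <;> rcases L₂ with _ | ⟨c, L₂⟩ <;> simp

theorem isMultilinear_lin2 (β : P →ₗ[K] P →ₗ[K] B) :
    IsMultilinear (lin2 (fun x y => β x y) : List P → B) := by
  refine ⟨fun L₁ L₂ x y => ?_, fun L₁ L₂ c x => ?_⟩ <;>
    rcases L₁ with _ | ⟨a, _ | ⟨b, _ | ⟨c, L₁⟩⟩⟩ <;> rcases L₂ with _ | ⟨c', _ | ⟨d, L₂⟩⟩ <;> simp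

theorem hasDegree_lin {δ : P → B} {a : ℕ} (h : ∀ i, ∀ x ∈ P.gr i, i ≠ a → δ x = 0) :
    HasDegree (lin δ) (a + 1) := by
  intro L e he hne
  rcases he with _ | ⟨hx, _ | ⟨hy, he⟩⟩
  · rfl
  · refine h _ _ hx ?_
    rintro rfl
    simp [Nat.add_comm] at hne
  · rfl

theorem hasDegree_lin2 {β : P → P → B} {a : ℕ}
    (h : ∀ i j, ∀ x ∈ P.gr i, ∀ y ∈ P.gr j, i + j ≠ a → β x y = 0) :
    HasDegree (lin2 β) (a + 2) := by
  intro L e he hne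
  rcases he with _ | ⟨hx, _ | ⟨hy, _ | ⟨hz, he⟩⟩⟩
  · rfl
  · rfl
  · refine h _ _ _ hx _ hy ?_
    rintro rfl
    simp [Nat.add_comm] at hne
  · rfl

variable (ε : Hom P (ofAlgebra K B)) in
-- The internal differential vanishes, so the coboundary lives on lists of length two, where it is
-- the defect of δ from being a derivation.
theorem D_lin (hd : ∀ w, P.d w = 0) {δ : P →ₗ[K] B}
    (h : ∀ w v, δ (P.sgn w * v) = δ (P.sgn w) * ε.aug v - ε.aug w * δ v) :
    D ε (lin δ) = 0 := by
  have hm := isMultilinear_lin δ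
  have h0 : ∀ w v, der v (der w (lin δ)) = 0 := fun w v => rfl
  rw [D_eq_barR]
  funext L
  rcases L with _ | ⟨w, _ | ⟨v, _ | ⟨z, L⟩⟩⟩
  · simp [-cup_cons]
  · simp [-cup_cons, cup_tw_cons, barR_cons' ε hd hm]
  · simp [-cup_cons, cup_tw_cons, barR_cons' ε hd hm, barR_cons' ε hd (hm.der _), h, ε.aug_sgn]
    abel
  · simp [-cup_cons, cup_tw_cons, barR_cons' ε hd hm, barR_cons' ε hd (hm.der _), h0]

variable (ε : Hom P (ofAlgebra K B)) in
theorem D_lin2 (hd : ∀ w, P.d w = 0) {β : P →ₗ[K] P →ₗ[K] B}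
    (h : ∀ w v z, ε.aug w * β v z + β (P.sgn w * v) z + β (P.sgn w) (P.sgn v * z) =
      β (P.sgn w) (P.sgn v) * ε.aug z) :
    D ε (lin2 fun x y => β x y) = 0 := by
  have hm := isMultilinear_lin2 β
  have h0 : ∀ w v z, der z (der v (der w (lin2 fun x y => β x y))) = 0 := fun w v z => rfl
  rw [D_eq_barR]
  funext L
  rcases L with _ | ⟨w, _ | ⟨v, _ | ⟨z, _ | ⟨y, L⟩⟩⟩⟩
  · simp [-cup_cons]
  · simp [-cup_cons, cup_tw_cons, barR_cons' ε hd hm]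
  · simp [-cup_cons, cup_tw_cons, barR_cons' ε hd hm, barR_cons' ε hd (hm.der _)]
  · have h1 := h w v z
    rw [← sub_eq_zero] at h1
    simp only [Pi.add_apply, cup_tw_cons, barR_cons' ε hd hm, barR_cons' ε hd (hm.der _),
      barR_cons' ε hd ((hm.der _).der _), h0, map_zero, Pi.zero_apply, actR_cons, actR_nil,
      der_apply, lin2_pair, ε.aug_sgn]
    refine Eq.trans ?_ h1
    simp only [add_zero, mul_neg, sub_eq_add_neg]
    abel
  · simp [-cup_cons, cup_tw_cons, barR_cons' ε hd hm, barR_cons' ε hd (hm.der _),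
      barR_cons' ε hd ((hm.der _).der _), h0]

/-- A chain algebra with zero differential, presented over the image of an idempotent `π` as
`im π ⊕ (im π) x` for a central element `x` of degree one and square zero. -/
structure OddSplitting (ε : Hom P (ofAlgebra K B)) where
  hd : ∀ w, P.d w = 0
  π : P →ₐ[K] P
  ρ : P →ₗ[K] P
  x : P
  π_gr : ∀ n, ∀ w ∈ P.gr n, π w ∈ P.gr n
  π_sgn : ∀ w, π (P.sgn w) = - π w
  sgn_π : ∀ w, P.sgn (π w) = - π w
  aug_π : ∀ w, ε.aug (π w) = ε.aug w
  x_mem : x ∈ P.gr 1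
  π_x : π x = 0
  π_π : ∀ w, π (π w) = π w
  ρ_x : ρ x = 1
  ρ_π : ∀ w, ρ (π w) = 0
  x_mul : ∀ w, x * w = π w * x
  add_eq : ∀ w, w = π w + ρ w * x
  ρ_mul : ∀ u v, ρ (u * v) = π u * ρ v + ρ u * π v
  ρ_sgn : ∀ w, ρ (P.sgn w) = ρ w
  sgn_ρ : ∀ w, P.sgn (ρ w) = - ρ w
  ρ_gr : ∀ i, ∀ w ∈ P.gr i, ρ w = 0 ∨ ∃ j, i = j + 1 ∧ ρ w ∈ P.gr j

namespace OddSplitting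

variable {ε : Hom P (ofAlgebra K B)} (X : OddSplitting ε)

/-- The linear map underlying `π`. -/
abbrev p : P →ₗ[K] P := X.π.toLinearMap

/-- The coefficient of the dual of `x`. -/
def S : (List P → B) →ₗ[B] (List P → B) := pre X.p (der X.x)

/-- The contracting homotopy. -/
def h : (List P → B) →ₗ[B] (List P → B) := pre (-X.p : P →ₗ[K] P) (op1 X.ρ X.S)

/-- The one-cocycle dual to `x`. -/
def cocycle : List P → B := lin fun w => ε.aug (X.ρ w)

theorem aug_x : ε.aug X.x = 0 := ε.aug_gr_succ X.x_mem

theorem isOp_S : IsOp X.S (-2) := by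
  have := (isOp_der (B := B) X.x_mem).pre (φ := X.p) X.π_gr
  exact this

theorem isOp_h : IsOp X.h (-1) := by
  have := (isOp_op1 X.ρ_gr X.isOp_S).pre (φ := -X.p)
    (fun n w hw => Submodule.neg_mem _ (X.π_gr n w hw))
  exact this

theorem sgn_x : P.sgn X.x = X.x := by rw [P.sgn_of_mem X.x_mem]; simp

theorem S_cup_tw (f : List P → B) : X.S (cup (tw ε) f) = cup (tw ε) (X.S f) := by
  have h := pre_cup_tw ε X.p 1 (fun w => by simpa using X.aug_π w) (der X.x) f
  rw [der_cup_tw, aug_x, zero_smul, add_zero, one_smul] at h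
  exact h

/-- The inserted `x` multiplied into the following entry w gives x·w, and in the next summand the
projected entry multiplied into `x` gives π(w)·x. These are equal, so neighbouring insertions cancel
in the commutator; the end terms vanish because `x` has augmentation zero. -/
theorem D_S {f : List P → B} (hf : IsMultilinear f) : D ε (X.S f) = X.S (D ε f) := by
  have h := D_pre ε X.hd X.p 1 rfl
    (fun u v => by
      change X.π (P.sgn u * v) = _
      rw [map_mul, X.π_sgn]
      change _ = (1 : ℤ) • (P.sgn (X.π u) * X.π v)
      rw [X.sgn_π, one_smul])
    (fun u => by
      change X.π (P.sgn u) = P.sgn (X.π u)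
      rw [X.π_sgn, X.sgn_π])
    (fun w => by simpa using X.aug_π w) (der X.x) 0 (fun f hf => hf.der _)
    (fun f hf => by simp [barR_cons' ε X.hd hf, X.sgn_x, X.aug_x])
    (fun f hf w L => by
      rw [der_apply X.x (barR ε f), barR_cons' ε X.hd hf X.x, X.sgn_x, actR_cons, X.x_mul]
      change 0 = barR ε (der X.x f) (w :: L) - (1 : ℤ) • _ -
        (1 : ℤ) • actR ε (P.sgn (X.π w)) f (X.x :: L)
      rw [X.sgn_π, actR_cons, neg_mul, hf.cons_neg]
      simp)
    hf
  rw [der_cup_tw, aug_x, zero_smul, pre_zero] at h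
  change D ε (X.S f) = (1 : ℤ) • X.S (D ε f) + 0 - (1 : ℤ) • 0 at h
  simpa using h

theorem barR_S {f : List P → B} (hf : IsMultilinear f) : barR ε (X.S f) = X.S (barR ε f) := by
  have h := X.D_S hf
  rw [D_eq_barR, D_eq_barR, map_add, S_cup_tw] at h
  exact add_left_cancel h

/-- `h` strips `x` off one entry with ρ and reinserts it at a later place. Multiplying the stripped
entry by an immediately following `x` gives ρ(w)x = w - π(w), and these differences telescope to
`pull π f - f`. The augmentation term, where ρ is applied to the first entry, produces the cup
product with the cocycle. -/
theorem D_h {f : List P → B} (hf : IsMultilinear f) :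
    D ε (X.h f) + X.h (D ε f) = - f + pull X.π f + cup X.cocycle (X.S f) := by
  have hop := isOp_op1 X.ρ_gr X.isOp_S
  have h := D_pre ε X.hd (-X.p) (-1) rfl
    (fun u v => by
      change -X.π (P.sgn u * v) = (-1 : ℤ) • (P.sgn (-X.π u) * -X.π v)
      rw [map_mul, X.π_sgn, map_neg, X.sgn_π]
      simp)
    (fun u => by
      change -X.π (P.sgn u) = P.sgn (-X.π u)
      rw [X.π_sgn, map_neg, X.sgn_π])
    (fun w => by
      change ε.aug (-X.π w) = _
      rw [map_neg, X.aug_π]; simp) (op1 X.ρ X.S) (subPull X.π) hop.ml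
    (fun f hf => by simp)
    (fun f hf w L => by
      have e1 : P.sgn ((-X.p : P →ₗ[K] P) w) = X.π w := by
        change P.sgn (-X.π w) = _
        rw [map_neg, X.sgn_π, neg_neg]
      have e2 : f (w :: L) = f (X.π w :: L) + f (X.ρ w * X.x :: L) := by
        conv_lhs => rw [X.add_eq w, hf.cons_add]
      rw [barR_op1 ε X.hd (hop.ml f hf), op1_barR ε X.hd hf, X.ρ_sgn, X.sgn_ρ, e1, hf.der_neg,
        map_neg, map_neg, ← X.barR_S (hf.der _), actR_neg ε hf, map_neg, subPull_cons, e2]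
      rcases L with _ | ⟨v, L⟩
      · simp [S]
      -- The derivation rule for ρ matches the products of two neighbouring entries; the sign comes
      -- from π(sgn w) = -π(w).
      · have e3 : X.S (der (X.ρ (P.sgn w * v)) f) L =
            - X.S (der (X.π w * X.ρ v) f) L + X.S (der (X.ρ w * X.π v) f) L := by
          rw [X.ρ_mul, X.π_sgn, X.ρ_sgn, neg_mul, hf.der_add, hf.der_neg, map_add, map_neg]
          rfl
        have e4 : X.S (actR ε (X.ρ w) f) (v :: L) =
            f (X.ρ w * X.x :: v :: L) + X.S (der (X.ρ w * X.π v) f) L := rfl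
        rw [op1_cons, op1_cons, der_actR, e3, Pi.neg_apply, e4]
        simp only [Int.reduceNeg, neg_smul, one_smul, neg_add, neg_neg, sub_eq_add_neg, Pi.neg_apply]
        abel)
    hf
  have e : ((-X.p : P →ₗ[K] P) ∘ₗ P.sgn : P →ₗ[K] P) = X.p := by
    ext w
    change -X.π (P.sgn w) = X.π w
    rw [X.π_sgn, neg_neg]
  have e5 : op1 X.ρ X.S (cup (tw ε) f) = cup X.cocycle (X.S f) := by
    funext L
    cases L with
    | nil => simp [cocycle]
    | cons w L =>
      rw [op1_cons, der_cup_tw, map_smul, cocycle, cup_lin_cons]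
      rfl
  rw [e, e5] at h
  have e6 := pre_subPull X.π f
  change D ε (X.h f) = (-1 : ℤ) • X.h (D ε f) + pre X.π (subPull X.π) f - _ at h
  rw [h, e6]
  simp only [neg_smul, one_smul]
  abel

/-- The cocycle applies ρ to the first entry, and ρ kills projected entries. So only the insertion
of `x` in front of everything contributes, with ρ(x) = 1. -/
theorem S_cup (g : List P → B) : X.S (cup X.cocycle g) = g := by
  have h0 : ∀ w, der (X.π w) (cup X.cocycle g) = 0 := by
    intro w
    funext L
    rw [der_apply, cocycle, cup_lin_cons, X.ρ_π]
    simp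
  funext L
  cases L with
  | nil =>
    change cup X.cocycle g [X.x] = _
    rw [cocycle, cup_lin_cons, X.ρ_x]
    simp
  | cons w L =>
    change cup X.cocycle g (X.x :: w :: L) + X.S (der (X.π w) (cup X.cocycle g)) L = _
    rw [h0, map_zero, cocycle, cup_lin_cons, X.ρ_x]
    simp

theorem S_pull {f : List P → B} (hf : IsMultilinear f) : X.S (pull X.π f) = 0 := by
  funext L
  induction L generalizing f with
  | nil =>
    change f [X.π X.x] = 0
    rw [X.π_x, hf.cons_zero]
  | cons w L ih =>
    change f (X.π X.x :: X.π w :: L.map X.π) + X.S (pull X.π (der (X.π (X.π w)) f)) L = 0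
    rw [X.π_x, hf.cons_zero, ih (hf.der _)]
    simp

theorem pull_cocycle : pull X.π X.cocycle = 0 := by
  funext L
  rcases L with _ | ⟨w, _ | ⟨v, L⟩⟩ <;> simp [cocycle, X.ρ_π]

theorem D_cocycle : D ε X.cocycle = 0 := by
  refine D_lin ε X.hd (δ := ε.aug.toLinearMap ∘ₗ X.ρ) fun w v => ?_
  simp only [LinearMap.comp_apply, AlgHom.toLinearMap_apply, X.ρ_mul, X.π_sgn, X.ρ_sgn, map_add,
    map_mul, map_neg, X.aug_π]
  rw [neg_mul, add_comm, sub_eq_add_neg]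

theorem isMultilinear_cocycle : IsMultilinear X.cocycle :=
  isMultilinear_lin (ε.aug.toLinearMap ∘ₗ X.ρ)

theorem hasDegree_cocycle : HasDegree X.cocycle 2 := by
  refine hasDegree_lin (a := 1) fun i w hw hi => ?_
  rcases X.ρ_gr i w hw with h | ⟨j, rfl, h⟩
  · rw [h, map_zero]
  -- Since ρ lowers degrees by one, off degree 1 the value ρ(w) has positive degree and augmentation
  -- zero.
  · obtain ⟨j, rfl⟩ : ∃ k, j = k + 1 := ⟨j - 1, by omega⟩
    exact ε.aug_gr_succ h

end OddSplitting

end Splitting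

end HochschildCochain

end

/-! ### Splitting off a truncated polynomial generator -/

section

open ChainAlgebra HochschildCochain

open ChainAlgebra

namespace HochschildCochain

section EvenSplitting

variable {K : Type u} [CommRing K] {P : ChainAlgebra.{u, v} K} {B : Type w} [Ring B]
  [Algebra K B]

/-- A chain algebra with zero differential in even degrees, presented over the image of an
idempotent `π` as `im π ⊗ K[t]/t^p`, up to a two-cocycle `bz` that corrects `t^p = 0`. -/
structure EvenSplitting (ε : Hom P (ofAlgebra K B)) where
  hd : ∀ w, P.d w = 0
  hs : ∀ w, P.sgn w = - w
  π : P →ₐ[K] P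
  ρ : P →ₗ[K] P
  bz : P →ₗ[K] P →ₗ[K] P
  t : P
  t' : P
  dt : ℕ
  dt' : ℕ
  dt_pos : 0 < dt
  dt'_pos : 0 < dt'
  π_gr : ∀ n, ∀ w ∈ P.gr n, π w ∈ P.gr n
  aug_π : ∀ w, ε.aug (π w) = ε.aug w
  t_mem : t ∈ P.gr dt
  t'_mem : t' ∈ P.gr dt'
  π_t : π t = 0
  π_t' : π t' = 0
  t_mul_t' : t * t' = 0
  π_π : ∀ w, π (π w) = π w
  ρ_t : ρ t = 1
  ρ_π : ∀ w, ρ (π w) = 0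
  t_mul : ∀ w, t * π w = π w * t
  t'_mul : ∀ w, t' * w = π w * t'
  add_eq : ∀ w, w = π w + t * ρ w
  π_bz : ∀ u v, π (bz u v) = bz u v
  ρ_mul : ∀ u v, ρ u * v + π u * ρ v - ρ (u * v) = t' * bz u v
  bz_cocycle : ∀ u v w, π u * bz v w - bz (u * v) w + bz u (v * w) - bz u v * π w = 0
  bz_t_t' : bz t t' = 1
  aug_bz_t' : ∀ w, ε.aug (bz t' w) = ε.aug (ρ w)
  bz_π : ∀ u w, bz u (π w) = 0
  π_bz' : ∀ u w, bz (π w) u = 0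
  ρ_gr : ∀ i, ∀ w ∈ P.gr i, ρ w = 0 ∨ ∃ j, i = j + dt ∧ ρ w ∈ P.gr j
  bz_gr : ∀ i j, ∀ u ∈ P.gr i, ∀ v ∈ P.gr j,
    bz u v = 0 ∨ ∃ k, i + j = k + (dt + dt') ∧ bz u v ∈ P.gr k

namespace EvenSplitting

variable {ε : Hom P (ofAlgebra K B)} (X : EvenSplitting ε)

/-- The linear map underlying `π`. -/
abbrev p : P →ₗ[K] P := X.π.toLinearMap

/-- The map `-π`. -/
abbrev m : P →ₗ[K] P := -X.p

theorem m_gr : ∀ n, ∀ w ∈ P.gr n, X.m w ∈ P.gr n :=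
  fun n w hw => Submodule.neg_mem _ (X.π_gr n w hw)

theorem m_sgn : (X.m ∘ₗ P.sgn : P →ₗ[K] P) = X.p := by
  ext w
  change -X.π (P.sgn w) = X.π w
  rw [X.hs, map_neg, neg_neg]

theorem p_sgn : (X.p ∘ₗ P.sgn : P →ₗ[K] P) = X.m := by
  ext w
  change X.π (P.sgn w) = -X.π w
  rw [X.hs, map_neg]

theorem aug_t : ε.aug X.t = 0 := by
  obtain ⟨n, hn⟩ := Nat.exists_eq_succ_of_ne_zero X.dt_pos.ne'
  exact ε.aug_gr_succ (hn ▸ X.t_mem)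

theorem aug_t' : ε.aug X.t' = 0 := by
  obtain ⟨n, hn⟩ := Nat.exists_eq_succ_of_ne_zero X.dt'_pos.ne'
  exact ε.aug_gr_succ (hn ▸ X.t'_mem)

include X in
theorem barR_eq {f : List P → B} (hf : IsMultilinear f) (w : P) (L : List P) :
    barR ε f (w :: L) = - actR ε w f L - barR ε (der w f) L := by
  rw [barR_cons' ε X.hd hf, X.hs, actR_neg ε hf, hf.der_neg, map_neg]
  simp [sub_eq_add_neg]

include X in
theorem der_barR_eq {f : List P → B} (hf : IsMultilinear f) (w : P) :
    der w (barR ε f) = - actR ε w f - barR ε (der w f) := by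
  funext L
  exact X.barR_eq hf w L

/-- The commutator of the coboundary with `pre π Y`. -/
theorem D_pre_p (Y Z : (List P → B) →ₗ[B] (List P → B))
    (hY : ∀ f, IsMultilinear f → IsMultilinear (Y f))
    (hZ0 : ∀ f, IsMultilinear f → Z f [] = - Y (barR ε f) [])
    (hZ1 : ∀ f, IsMultilinear f → ∀ w L, Z f (w :: L) = barR ε (Y f) (w :: L) -
      Y (barR ε f) (w :: L) + Y (actR ε (X.π w) f) L)
    {f : List P → B} (hf : IsMultilinear f) :
    D ε (pre X.p Y f) = pre X.p Y (D ε f) + pre X.m Z f - Y (cup (tw ε) f) := by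
  have h := D_pre ε X.hd X.p 1 rfl
    (fun u v => by
      change X.π (P.sgn u * v) = (1 : ℤ) • (P.sgn (X.π u) * X.π v)
      simp [X.hs])
    (fun u => by
      change X.π (P.sgn u) = P.sgn (X.π u)
      simp [X.hs])
    (fun w => by
      change ε.aug (X.π w) = _
      simp [X.aug_π]) Y Z hY
    (fun f hf => by simp [hZ0 f hf])
    (fun f hf w L => by
      have e : actR ε (P.sgn (X.p w)) f = - actR ε (X.π w) f := by
        rw [X.hs, actR_neg ε hf]
        rfl
      rw [hZ1 f hf, e, map_neg]
      simp) hf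
  rw [X.p_sgn] at h
  simpa using h

/-- The commutator of the coboundary with `pre (-π) Y`. -/
theorem D_pre_m (Y Z : (List P → B) →ₗ[B] (List P → B))
    (hY : ∀ f, IsMultilinear f → IsMultilinear (Y f))
    (hZ0 : ∀ f, IsMultilinear f → Z f [] = Y (barR ε f) [])
    (hZ1 : ∀ f, IsMultilinear f → ∀ w L, Z f (w :: L) = barR ε (Y f) (w :: L) +
      Y (barR ε f) (w :: L) + Y (actR ε (X.π w) f) L)
    {f : List P → B} (hf : IsMultilinear f) :
    D ε (pre X.m Y f) + pre X.m Y (D ε f) = pre X.p Z f + Y (cup (tw ε) f) := by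
  have h := D_pre ε X.hd X.m (-1) rfl
    (fun u v => by
      change -X.π (P.sgn u * v) = (-1 : ℤ) • (P.sgn (-X.π u) * -X.π v)
      simp [X.hs])
    (fun u => by
      change -X.π (P.sgn u) = P.sgn (-X.π u)
      simp [X.hs])
    (fun w => by
      change ε.aug (-X.π w) = _
      simp [X.aug_π]) Y Z hY
    (fun f hf => by simp [hZ0 f hf])
    (fun f hf w L => by
      have e : P.sgn (X.m w) = X.π w := by
        rw [X.hs]
        exact neg_neg _
      rw [hZ1 f hf, e]
      simp) hf
  rw [X.m_sgn] at h
  rw [h]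
  simp only [neg_smul, one_smul]
  abel

theorem pre_p_cup_tw (Y : (List P → B) →ₗ[B] (List P → B)) (f : List P → B) :
    pre X.p Y (cup (tw ε) f) = cup (tw ε) (pre X.p Y f) + Y (cup (tw ε) f) := by
  have h := pre_cup_tw ε X.p 1 (fun w => by simpa using X.aug_π w) Y f
  rwa [one_smul] at h

theorem pre_m_cup_tw (Y : (List P → B) →ₗ[B] (List P → B)) (f : List P → B) :
    pre X.m Y (cup (tw ε) f) = - cup (tw ε) (pre X.m Y f) + Y (cup (tw ε) f) := by
  have h := pre_cup_tw ε X.m (-1) (fun w => by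
    change ε.aug (-X.π w) = _
    simp [X.aug_π]) Y f
  rwa [neg_smul, one_smul] at h

/-- Insertion of `t'`. -/
def ins : (List P → B) →ₗ[B] (List P → B) := pre X.m (der X.t')

/-- The coefficient of the two-cocycle. -/
def S : (List P → B) →ₗ[B] (List P → B) := pre X.p (X.ins ∘ₗ der X.t)

/-- The operator `f ↦ f ∘ (-π)`. -/
def J : (List P → B) →ₗ[B] (List P → B) := pull X.m

/-- The coefficient of the one-cocycle. -/
def R : (List P → B) →ₗ[B] (List P → B) := pre X.p (X.J ∘ₗ der X.t)

/-- The one-cocycle dual to `t`. -/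
def cocycle₁ : List P → B := lin fun w => ε.aug (X.ρ w)

/-- The two-cocycle dual to `t^p`. -/
def cocycle₂ : List P → B := lin2 fun u v => ε.aug (X.bz u v)

theorem isOp_ins : IsOp X.ins (-1 - X.dt') := (isOp_der X.t'_mem).pre X.m_gr

theorem isOp_S : IsOp X.S (-2 - X.dt - X.dt') := by
  have := (X.isOp_ins.comp (isOp_der X.t_mem)).pre (φ := X.p) X.π_gr
  rwa [show (-1 - (X.dt : ℤ)) + (-1 - X.dt') = -2 - X.dt - X.dt' by ring] at this

theorem isOp_J : IsOp X.J 0 := isOp_pull X.m_gr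

theorem isOp_R : IsOp X.R (-1 - X.dt) := by
  have := (X.isOp_J.comp (isOp_der X.t_mem)).pre (φ := X.p) X.π_gr
  rwa [add_zero] at this

/-- The same cancellation of neighbouring insertions as for `x`, now for `t'`, which satisfies t'·w
= π(w)·t' and has augmentation zero. The sign -π in the prefix makes the operator anticommute. -/
theorem D_ins {f : List P → B} (hf : IsMultilinear f) :
    D ε (X.ins f) + X.ins (D ε f) = 0 := by
  have h := X.D_pre_m (der X.t') 0 (fun f hf => hf.der _)
    (fun f hf => by simp [X.barR_eq hf, X.aug_t'])
    (fun f hf w L => by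
      rw [X.der_barR_eq hf]
      simp [X.t'_mul]) hf
  rw [der_cup_tw, X.aug_t', zero_smul, pre_zero, add_zero] at h
  exact h

theorem barR_ins {f : List P → B} (hf : IsMultilinear f) :
    barR ε (X.ins f) = - X.ins (barR ε f) := by
  have h := X.D_ins hf
  have e := X.pre_m_cup_tw (der X.t') f
  rw [der_cup_tw, X.aug_t', zero_smul, add_zero] at e
  change X.ins _ = - cup _ (X.ins f) at e
  rw [D_eq_barR, D_eq_barR, map_add, e] at h
  rw [eq_neg_iff_add_eq_zero, ← h]
  abel

/-- The inserted `t` and `t'` may become neighbours and be multiplied; the product t·t' = t^p, up to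
a factor, is zero. This reflects the two-periodic resolution of K[t]/t^p, whose maps are alternately
t and t^(p-1). -/
theorem ins_actR_t {f : List P → B} (hf : IsMultilinear f) :
    X.ins (actR ε X.t f) [] = 0 := by
  change f [X.t * X.t'] = 0
  rw [X.t_mul_t', hf.cons_zero]

theorem ins_actR_t_cons {f : List P → B} (hf : IsMultilinear f) (w : P) (L : List P) :
    X.ins (actR ε X.t f) (w :: L) = - X.ins (der (X.t * X.π w) f) L := by
  change f (X.t * X.t' :: w :: L) + X.ins (der (X.t * -X.π w) f) L = _
  rw [X.t_mul_t', hf.cons_zero, zero_add, mul_neg, hf.der_neg, map_neg]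
  rfl

/-- `S` inserts `t` and, further to the right, `t'`. Each insertion is compatible with the
coboundary on its own, and the only new term, where both meet, vanishes by t·t' = 0. -/
theorem D_S {f : List P → B} (hf : IsMultilinear f) : D ε (X.S f) = X.S (D ε f) := by
  have h := X.D_pre_p (X.ins ∘ₗ der X.t) 0 (X.isOp_ins.comp (isOp_der X.t_mem)).ml
    (fun f hf => by
      have e := congrFun (X.barR_ins (hf.der X.t)) []
      rw [LinearMap.comp_apply, X.der_barR_eq hf, map_sub, map_neg]
      simp only [barR_nil, Pi.neg_apply, zero_eq_neg] at e
      simp [X.ins_actR_t hf, e])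
    (fun f hf w L => by
      simp only [LinearMap.comp_apply]
      rw [X.barR_ins (hf.der _), X.der_barR_eq hf, map_sub, map_neg, der_actR, ← X.t_mul w]
      simp only [Pi.sub_apply, Pi.neg_apply, X.ins_actR_t_cons hf, LinearMap.zero_apply, Pi.zero_apply]
      abel) hf
  rw [LinearMap.comp_apply, der_cup_tw, X.aug_t, zero_smul, map_zero, pre_zero, sub_zero,
    add_zero] at h
  exact h

theorem S_cup_tw (f : List P → B) : X.S (cup (tw ε) f) = cup (tw ε) (X.S f) := by
  have h := X.pre_p_cup_tw (X.ins ∘ₗ der X.t) f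
  rw [LinearMap.comp_apply, der_cup_tw, X.aug_t, zero_smul, map_zero, add_zero] at h
  exact h

theorem barR_S {f : List P → B} (hf : IsMultilinear f) : barR ε (X.S f) = X.S (barR ε f) := by
  have h := X.D_S hf
  rw [D_eq_barR, D_eq_barR, map_add, S_cup_tw] at h
  exact add_left_cancel h

theorem J_cons (f : List P → B) (w : P) (L : List P) :
    X.J f (w :: L) = X.J (der (-X.π w) f) L := rfl

/-- All degrees are even, so sgn is -1 and -π is π with the sign of every entry built in. Pulling
back along it therefore anticommutes with the coboundary. -/
theorem barR_J {f : List P → B} (hf : IsMultilinear f) :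
    barR ε (X.J f) = - X.J (barR ε f) := by
  funext L
  induction L generalizing f with
  | nil =>
    change _ = - barR ε f []
    simp
  | cons w L ih =>
    have e1 : X.J (barR ε f) (w :: L) = X.J (actR ε (X.π w) f) L +
        X.J (barR ε (der (X.π w) f)) L := by
      rw [J_cons, X.der_barR_eq hf, actR_neg ε hf, hf.der_neg, map_neg, map_sub, map_neg, map_neg,
        map_neg]
      simp [sub_eq_add_neg]
    have e2 : der w (X.J f) = - X.J (der (X.π w) f) := by
      rw [← map_neg, ← hf.der_neg]
      rfl
    have e3 := ih (hf.der (X.π w))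
    have e4 : actR ε w (X.J f) L = X.J (actR ε (X.π w) f) L := by
      rcases L with _ | ⟨v, L⟩
      · change f [] * ε.aug w = f [] * ε.aug (X.π w)
        rw [X.aug_π]
      · change f (-X.π (w * v) :: _) = f (X.π w * -X.π v :: _)
        rw [map_mul, mul_neg]
    rw [X.barR_eq (X.isOp_J.ml f hf), e2, map_neg, Pi.neg_apply, Pi.neg_apply, e1, e3, e4, Pi.neg_apply]
    abel

theorem J_actR_t_cons {f : List P → B} (hf : IsMultilinear f) (w : P) (L : List P) :
    X.J (actR ε X.t f) (w :: L) = - X.J (der (X.t * X.π w) f) L := by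
  rw [J_cons, der_actR, mul_neg, hf.der_neg, map_neg]
  rfl

theorem D_R {f : List P → B} (hf : IsMultilinear f) : D ε (X.R f) = X.R (D ε f) := by
  have h := X.D_pre_p (X.J ∘ₗ der X.t) 0 (X.isOp_J.comp (isOp_der X.t_mem)).ml
    (fun f hf => by
      change 0 = - barR ε f [X.t]
      simp [X.barR_eq hf, X.aug_t])
    (fun f hf w L => by
      simp only [LinearMap.comp_apply]
      rw [X.barR_J (hf.der _), X.der_barR_eq hf, map_sub, map_neg, der_actR, ← X.t_mul w]
      simp only [Pi.sub_apply, Pi.neg_apply, X.J_actR_t_cons hf, LinearMap.zero_apply, Pi.zero_apply]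
      abel) hf
  rw [LinearMap.comp_apply, der_cup_tw, X.aug_t, zero_smul, map_zero, pre_zero, sub_zero,
    add_zero] at h
  exact h

/-- Auxiliary operator. -/
def A : (List P → B) →ₗ[B] (List P → B) := pre X.p (op1 X.ρ LinearMap.id)

/-- Auxiliary operator. -/
def Q : (List P → B) →ₗ[B] (List P → B) :=
  pre X.m (op2 (fun u v => X.t' * X.bz u v) LinearMap.id)

theorem isOp_op1 : IsOp (op1 X.ρ LinearMap.id : (List P → B) →ₗ[B] _) X.dt := by
  have := HochschildCochain.isOp_op1 (B := B) X.ρ_gr isOp_id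
  rwa [zero_add] at this

theorem isOp_A : IsOp X.A X.dt := X.isOp_op1.pre X.π_gr

/-- Were ρ a derivation relative to π, applying it to one entry at a time would commute with `barR`
except at the end of the list, where the cup product with the one-cocycle appears. Its failure to be
one is t'·bz, and this is the term `Q`. -/
theorem barR_A {f : List P → B} (hf : IsMultilinear f) :
    barR ε (X.A f) = X.A (barR ε f) + cup (X.J f) X.cocycle₁ + X.Q f := by
  have h := X.D_pre_p (op1 X.ρ LinearMap.id)
    (endOp X.cocycle₁ + op2 (fun u v => X.t' * X.bz u v) LinearMap.id) X.isOp_op1.ml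
    (fun f hf => by simp [cocycle₁])
    (fun f hf w L => by
      rw [barR_op1 ε X.hd (X.isOp_op1.ml f hf), op1_barR ε X.hd hf]
      simp only [X.hs, map_neg, hf.der_neg, LinearMap.id_apply, actR_neg ε hf]
      rcases L with _ | ⟨v, L⟩
      · simp [cocycle₁]
      · have e : f (X.t' * X.bz w v :: L) = f (X.ρ w * v :: L) + f (X.π w * X.ρ v :: L) -
            f (X.ρ (w * v) :: L) := by
          rw [← X.ρ_mul, hf.cons_sub, hf.cons_add]
        simp [cocycle₁, e, hf.cons_neg]
        abel) hf
  have e := X.pre_p_cup_tw (op1 X.ρ LinearMap.id) f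
  rw [D_eq_barR, D_eq_barR, map_add, e, pre_add, pre_endOp] at h
  change cup (tw ε) (X.A f) + barR ε (X.A f) = cup (tw ε) (X.A f) + _ + X.A (barR ε f) +
    (cup (X.J f) X.cocycle₁ + X.Q f) - _ at h
  rw [← add_left_cancel_iff (a := cup (tw ε) (X.A f)), h]
  abel

/-- Part of the contracting homotopy. -/
def h : (List P → B) →ₗ[B] (List P → B) := pre X.m (X.A ∘ₗ der X.t)

/-- Auxiliary operator. -/
def E : (List P → B) →ₗ[B] (List P → B) := pre X.p (X.Q ∘ₗ der X.t)

theorem isOp_h : IsOp X.h (-1) := by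
  have := (X.isOp_A.comp (isOp_der X.t_mem)).pre X.m_gr
  rwa [sub_add_cancel] at this

theorem A_actR_t_cons (f : List P → B) (w : P) (L : List P) :
    X.A (actR ε X.t f) (w :: L) = f (X.t * X.ρ w :: L) + X.A (der (X.t * X.π w) f) L := rfl

/-- `h` inserts `t` and strips a `t` off some later entry. When the two are adjacent one obtains
t·ρ(w) = w - π(w), which telescopes. The right end of the list gives the λ-part, and the failure of
ρ to be a derivation leaves the error `E`, to be removed by `k`. -/
theorem D_h {f : List P → B} (hf : IsMultilinear f) :
    D ε (X.h f) + X.h (D ε f) = - f + pull X.π f + cup (X.R f) X.cocycle₁ + X.E f := by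
  have h := X.D_pre_m (X.A ∘ₗ der X.t)
    (cupR X.cocycle₁ ∘ₗ (X.J ∘ₗ der X.t) + X.Q ∘ₗ der X.t + subPull X.π)
    (X.isOp_A.comp (isOp_der X.t_mem)).ml
    (fun f hf => by simp [cocycle₁, A, Q])
    (fun f hf w L => by
      have e1 : f (w :: L) = f (X.π w :: L) + f (X.t * X.ρ w :: L) := by
        conv_lhs => rw [X.add_eq w, hf.cons_add]
      simp only [LinearMap.comp_apply, LinearMap.add_apply, Pi.add_apply, cupR_apply]
      rw [X.barR_A (hf.der _), X.der_barR_eq hf, map_sub, map_neg, der_actR, ← X.t_mul w,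
        subPull_cons, e1]
      simp only [Pi.add_apply, Pi.sub_apply, Pi.neg_apply, X.A_actR_t_cons f]
      abel) hf
  rw [LinearMap.comp_apply, der_cup_tw, X.aug_t, zero_smul, map_zero, add_zero, pre_add, pre_add,
    pre_cupR] at h
  have e := pre_subPull X.π f
  change D ε (X.h f) + X.h (D ε f) = cup (X.R f) X.cocycle₁ + X.E f + pre X.π (subPull X.π) f at h
  rw [h, e]
  abel

/-- Auxiliary operator. -/
def k₁ : (List P → B) →ₗ[B] (List P → B) := pre X.p (op2 (fun u v => X.bz u v) X.ins)

theorem isOp_op2_ins : IsOp (op2 (fun u v => X.bz u v) X.ins) X.dt := by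
  have := isOp_op2 X.bz_gr X.isOp_ins
  rwa [show (-1 - (X.dt' : ℤ)) + (X.dt + X.dt' : ℕ) + 1 = X.dt by push_cast; ring] at this

theorem isOp_op2_S : IsOp (op2 (fun u v => X.bz u v) X.S) (-1) := by
  have := isOp_op2 X.bz_gr X.isOp_S
  rwa [show (-2 - (X.dt : ℤ) - X.dt') + (X.dt + X.dt' : ℕ) + 1 = -1 by push_cast; ring] at this

theorem isOp_k₁ : IsOp X.k₁ X.dt := X.isOp_op2_ins.pre X.π_gr

theorem barR_op2_eq {T : (List P → B) →ₗ[B] (List P → B)} {f : List P → B}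
    (hf : IsMultilinear (op2 (fun u v => X.bz u v) T f)) (hf' : IsMultilinear f)
    (w v : P) (L : List P) :
    barR ε (op2 (fun u v => X.bz u v) T f) (w :: v :: L) =
      - op1 (X.bz (w * v)) T f L + op1 (fun z => X.bz w (v * z)) T f L +
        barR ε (T (der (X.bz w v) f)) L := by
  rw [barR_op2 ε X.hd hf]
  rcases L with _ | ⟨z, L⟩
  · simp [X.hs]
  · simp [X.hs, hf'.der_neg]

theorem op2_barR_eq {T : (List P → B) →ₗ[B] (List P → B)} {f : List P → B}
    (hf : IsMultilinear f) (w v : P) (L : List P) :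
    op2 (fun u v => X.bz u v) T (barR ε f) (w :: v :: L) =
      - T (actR ε (X.bz w v) f) L - T (barR ε (der (X.bz w v) f)) L := by
  rw [op2_cons, X.der_barR_eq hf, map_sub, map_neg]
  rfl

/-- The cocycle identity for `bz`, applied to a family of cochains. -/
theorem bz_der {T : (List P → B) →ₗ[B] (List P → B)} {f : List P → B} (hf : IsMultilinear f)
    (w v z : P) :
    T (der (X.π w * X.bz v z) f) - T (der (X.bz (w * v) z) f) + T (der (X.bz w (v * z)) f) -
      T (der (X.bz w v * X.π z) f) = 0 := by
  rw [← map_sub, ← map_add, ← map_sub, ← hf.der_sub, ← hf.der_add, ← hf.der_sub, X.bz_cocycle,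
    hf.der_zero, map_zero]

theorem ins_actR {f : List P → B} (hf : IsMultilinear f) (u z : P) (L : List P) :
    X.ins (actR ε u f) (z :: L) = f (u * X.t' :: z :: L) - X.ins (der (u * X.π z) f) L := by
  change f (u * X.t' :: z :: L) + X.ins (der (u * -X.π z) f) L = _
  rw [mul_neg, hf.der_neg, map_neg, sub_eq_add_neg]
  rfl

/-- Merge two entries by bz and insert `t'` at a later place. Insertion right after the merged entry
gives bz(u,v)·t' = t'·bz(u,v), which is `Q`; all other terms cancel by the cocycle identity of bz.
-/
theorem barR_k₁ {f : List P → B} (hf : IsMultilinear f) :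
    barR ε (X.k₁ f) = X.k₁ (barR ε f) + X.Q f := by
  have h := X.D_pre_p (op2 (fun u v => X.bz u v) X.ins)
    (op2 (fun u v => X.t' * X.bz u v) LinearMap.id) X.isOp_op2_ins.ml
    (fun f hf => by simp)
    (fun f hf w L => by
      rcases L with _ | ⟨v, L⟩
      · rw [barR_op2_single ε X.hd (X.isOp_op2_ins.ml f hf)]
        simp
      · rw [X.barR_op2_eq (X.isOp_op2_ins.ml f hf) hf, X.op2_barR_eq hf, X.barR_ins (hf.der _)]
        rcases L with _ | ⟨z, L⟩
        · have e : X.ins (actR ε (X.bz w v) f) [] = f [X.bz w v * X.t'] := rfl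
          simp [e, X.t'_mul, X.π_bz]
          abel
        · have e := congrFun (X.bz_der (T := X.ins) hf w v z) L
          simp only [Pi.add_apply, Pi.sub_apply, Pi.zero_apply] at e
          simp only [op1_cons, op2_cons, der_actR, X.ins_actR hf, X.t'_mul, X.π_bz,
            LinearMap.id_apply, der_apply, Pi.neg_apply]
          rw [← sub_eq_zero, ← neg_eq_zero, ← e]
          abel) hf
  have e := X.pre_p_cup_tw (op2 (fun u v => X.bz u v) X.ins) f
  rw [D_eq_barR, D_eq_barR, map_add, e] at h
  change cup (tw ε) (X.k₁ f) + barR ε (X.k₁ f) = cup (tw ε) (X.k₁ f) + _ + X.k₁ (barR ε f) +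
    X.Q f - _ at h
  rw [← add_left_cancel_iff (a := cup (tw ε) (X.k₁ f)), h]
  abel

/-- Part of the contracting homotopy. -/
def k : (List P → B) →ₗ[B] (List P → B) :=
  pre X.m (X.k₁ ∘ₗ der X.t + -op2 (fun u v => X.bz u v) X.S)

theorem isOp_k_aux : IsOp (X.k₁ ∘ₗ der X.t + -op2 (fun u v => X.bz u v) X.S) (-1) := by
  have := X.isOp_k₁.comp (isOp_der (B := B) X.t_mem)
  rw [sub_add_cancel] at this
  exact this.add X.isOp_op2_S.neg

theorem isOp_k : IsOp X.k (-1) := X.isOp_k_aux.pre X.m_gr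

theorem S_actR {f : List P → B} (u z : P) (L : List P) :
    X.S (actR ε u f) (z :: L) = X.ins (der (u * X.t) f) (z :: L) + X.S (der (u * X.π z) f) L := rfl

theorem k₁_actR_t {f : List P → B} (w : P) (L : List P) :
    X.k₁ (actR ε X.t f) (w :: L) = op2 (fun u v => X.bz u v) X.ins (actR ε X.t f) (w :: L) +
      X.k₁ (der (X.t * X.π w) f) L := rfl

/-- Since `k₁` bounds `Q`, inserting `t` in front of it bounds `E`, except for the product of `t`
with a merged entry. That product is cancelled by the summand with `S`, where a merged entry meets
an inserted `t`. The augmentation of the merged entry yields the cup product with the two-cocycle.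
-/
theorem D_k {f : List P → B} (hf : IsMultilinear f) :
    D ε (X.k f) + X.k (D ε f) = X.E f - cup X.cocycle₂ (X.S f) := by
  have h := X.D_pre_m (X.k₁ ∘ₗ der X.t + -op2 (fun u v => X.bz u v) X.S) (X.Q ∘ₗ der X.t)
    X.isOp_k_aux.ml
    (fun f hf => by simp [k₁, Q])
    (fun f hf w L => by
      simp only [LinearMap.comp_apply, LinearMap.add_apply, LinearMap.neg_apply, map_add, map_neg,
        Pi.add_apply, Pi.neg_apply]
      rw [X.barR_k₁ (hf.der _), X.der_barR_eq hf, map_sub, map_neg, der_actR, ← X.t_mul w]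
      simp only [Pi.add_apply, Pi.neg_apply, Pi.sub_apply, X.k₁_actR_t]
      rcases L with _ | ⟨v, L⟩
      · rw [barR_op2_single ε X.hd (X.isOp_op2_S.ml f hf)]
        simp
        abel
      · rw [X.barR_op2_eq (X.isOp_op2_S.ml f hf) hf, X.op2_barR_eq hf, X.barR_S (hf.der _),
          op2_cons, der_actR, ← X.π_bz w v, X.t_mul, X.π_bz]
        rcases L with _ | ⟨z, L⟩
        · have e : X.S (actR ε (X.bz w v) f) [] = X.ins (der (X.bz w v * X.t) f) [] := rfl
          simp [e]
          abel
        · have e := congrFun (X.bz_der (T := X.S) hf w v z) L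
          simp only [Pi.add_apply, Pi.sub_apply, Pi.zero_apply] at e
          simp only [op1_cons, op2_cons, der_actR, X.S_actR]
          rw [← sub_eq_zero, ← e]
          abel) hf
  have e : (X.k₁ ∘ₗ der X.t + -op2 (fun u v => X.bz u v) X.S) (cup (tw ε) f) =
      - cup X.cocycle₂ (X.S f) := by
    funext L
    rw [LinearMap.add_apply, LinearMap.comp_apply, der_cup_tw, X.aug_t, zero_smul, map_zero,
      zero_add, LinearMap.neg_apply]
    rcases L with _ | ⟨w, _ | ⟨v, L⟩⟩
    · simp [cocycle₂]
    · rw [Pi.neg_apply, Pi.neg_apply, op2_single, cocycle₂, cup_lin2_single]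
    · rw [Pi.neg_apply, Pi.neg_apply, op2_cons, der_cup_tw, map_smul, cocycle₂, cup_lin2_cons_cons]
      rfl
  rw [e] at h
  rw [sub_eq_add_neg]
  exact h

/-- The homotopy that splits a cochain into its restriction and its two coefficients. -/
theorem D_homotopy {f : List P → B} (hf : IsMultilinear f) :
    D ε ((X.h + -X.k) f) + (X.h + -X.k) (D ε f) =
      - f + pull X.π f + cup (X.R f) X.cocycle₁ + cup X.cocycle₂ (X.S f) := by
  have e1 := X.D_h hf
  have e2 := X.D_k hf
  have e3 : D ε (-X.k f) = - D ε (X.k f) := by simpa using D_smul ε (-1 : ℤ) (X.k f)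
  simp only [LinearMap.add_apply, LinearMap.neg_apply, D_add, e3]
  calc _ = (D ε (X.h f) + X.h (D ε f)) - (D ε (X.k f) + X.k (D ε f)) := by abel
    _ = _ := by rw [e1, e2]; abel

theorem isOp_homotopy : IsOp (X.h + -X.k) (-1) := X.isOp_h.add X.isOp_k.neg

/-- The defect t'·bz of the derivation rule has augmentation zero, so ρ followed by the augmentation
is an honest derivation. -/
theorem D_cocycle₁ : D ε X.cocycle₁ = 0 := by
  refine D_lin ε X.hd (δ := ε.aug.toLinearMap ∘ₗ X.ρ) fun w v => ?_
  have h := congrArg ε.aug (X.ρ_mul w v)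
  simp only [map_sub, map_add, map_mul, X.aug_π, X.aug_t', zero_mul] at h
  simp only [LinearMap.comp_apply, AlgHom.toLinearMap_apply, X.hs, neg_mul, map_neg]
  rw [← sub_eq_zero, ← h]
  abel

theorem D_cocycle₂ : D ε X.cocycle₂ = 0 := by
  refine D_lin2 ε X.hd (β := X.bz.compr₂ ε.aug.toLinearMap) fun w v z => ?_
  have h := congrArg ε.aug (X.bz_cocycle w v z)
  simp only [map_sub, map_add, map_mul, X.aug_π, map_zero] at h
  simp only [LinearMap.compr₂_apply, AlgHom.toLinearMap_apply, X.hs, neg_mul, map_neg,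
    LinearMap.neg_apply, neg_neg]
  rw [← sub_eq_zero, ← h]
  abel

theorem isMultilinear_cocycle₁ : IsMultilinear X.cocycle₁ :=
  isMultilinear_lin (ε.aug.toLinearMap ∘ₗ X.ρ)

theorem isMultilinear_cocycle₂ : IsMultilinear X.cocycle₂ :=
  isMultilinear_lin2 (X.bz.compr₂ ε.aug.toLinearMap)

theorem hasDegree_cocycle₁ : HasDegree X.cocycle₁ (X.dt + 1) := by
  refine hasDegree_lin fun i w hw hi => ?_
  rcases X.ρ_gr i w hw with h | ⟨j, rfl, h⟩
  · rw [h, map_zero]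
  · obtain ⟨j, rfl⟩ : ∃ k, j = k + 1 := ⟨j - 1, by omega⟩
    exact ε.aug_gr_succ h

theorem hasDegree_cocycle₂ : HasDegree X.cocycle₂ (X.dt + X.dt' + 2) := by
  refine hasDegree_lin2 fun i j u hu v hv hi => ?_
  rcases X.bz_gr i j u hu v hv with h | ⟨k, hk, h⟩
  · rw [h, map_zero]
  · obtain ⟨k, rfl⟩ : ∃ l, k = l + 1 := ⟨k - 1, by omega⟩
    exact ε.aug_gr_succ h

theorem der_π_cup₂ (g : List P → B) (w : P) : der (X.π w) (cup X.cocycle₂ g) = 0 := by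
  funext L
  rcases L with _ | ⟨v, L⟩
  · rw [der_apply, cocycle₂, cup_lin2_single]
    rfl
  · rw [der_apply, cocycle₂, cup_lin2_cons_cons, X.π_bz']
    simp

theorem der_t_cup₂ (g : List P → B) (w : P) :
    der (-X.π w) (der X.t (cup X.cocycle₂ g)) = 0 := by
  funext L
  rw [der_apply, der_apply, cocycle₂, cup_lin2_cons_cons, map_neg, X.bz_π]
  simp

/-- bz vanishes as soon as one of its arguments is projected. Hence `t` and `t'` must be inserted in
the first two places, where bz(t,t') = 1. -/
theorem S_cup₂ (g : List P → B) : X.S (cup X.cocycle₂ g) = g := by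
  funext L
  cases L with
  | nil =>
    change cup X.cocycle₂ g [X.t, X.t'] = _
    rw [cocycle₂, cup_lin2_cons_cons, X.bz_t_t']
    simp
  | cons w L =>
    change cup X.cocycle₂ g (X.t :: X.t' :: w :: L) +
      X.ins (der (-X.π w) (der X.t (cup X.cocycle₂ g))) L +
        X.S (der (X.π w) (cup X.cocycle₂ g)) L = _
    rw [der_t_cup₂, der_π_cup₂, map_zero, map_zero, cocycle₂, cup_lin2_cons_cons, X.bz_t_t']
    simp

theorem R_cup₂ (g : List P → B) : X.R (cup X.cocycle₂ g) = 0 := by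
  funext L
  cases L with
  | nil =>
    change cup X.cocycle₂ g [X.t] = _
    rw [cocycle₂, cup_lin2_single]
    rfl
  | cons w L =>
    change X.J (der (-X.π w) (der X.t (cup X.cocycle₂ g))) L +
        X.R (der (X.π w) (cup X.cocycle₂ g)) L = _
    rw [der_t_cup₂, der_π_cup₂, map_zero, map_zero]
    simp

theorem der_t_pull {f : List P → B} (hf : IsMultilinear f) : der X.t (pull X.π f) = 0 := by
  rw [der_pull, X.π_t, hf.der_zero, map_zero]

theorem R_pull {f : List P → B} (hf : IsMultilinear f) : X.R (pull X.π f) = 0 := by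
  funext L
  induction L generalizing f with
  | nil =>
    change X.J (der X.t (pull X.π f)) [] = 0
    rw [X.der_t_pull hf, map_zero]
    rfl
  | cons w L ih =>
    change X.J (der X.t (pull X.π f)) (w :: L) + X.R (pull X.π (der (X.π (X.π w)) f)) L = 0
    rw [X.der_t_pull hf, map_zero, ih (hf.der _)]
    simp

theorem S_pull {f : List P → B} (hf : IsMultilinear f) : X.S (pull X.π f) = 0 := by
  funext L
  induction L generalizing f with
  | nil =>
    change X.ins (der X.t (pull X.π f)) [] = 0
    rw [X.der_t_pull hf, map_zero]
    rfl
  | cons w L ih =>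
    change X.ins (der X.t (pull X.π f)) (w :: L) + X.S (pull X.π (der (X.π (X.π w)) f)) L = 0
    rw [X.der_t_pull hf, map_zero, ih (hf.der _)]
    simp

theorem der_t_pull_cup {f : List P → B} (hf : IsMultilinear f) :
    der X.t (cup (pull X.π f) X.cocycle₁) = f [] • (unit : List P → B) := by
  have e : (der X.t X.cocycle₁ : List P → B) = unit := by
    funext L
    cases L <;> simp [cocycle₁, X.ρ_t, unit]
  rw [der_cup, X.der_t_pull hf, zero_cup, add_zero, e]
  rfl

theorem der_π_pull_cup (f : List P → B) (w : P) :
    der (X.π w) (cup (pull X.π f) X.cocycle₁) = cup (pull X.π (der (X.π w) f)) X.cocycle₁ := by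
  have e : der (X.π w) X.cocycle₁ = 0 := by
    funext L
    cases L <;> simp [cocycle₁, X.ρ_π]
  rw [der_cup, der_pull, X.π_π, e]
  funext L
  simp

theorem J_unit : X.J (unit : List P → B) = unit := pull_unit _

theorem ins_unit : X.ins (unit : List P → B) = 0 := by
  funext L
  cases L with
  | nil => rfl
  | cons w L =>
    change (unit (X.t' :: w :: L) : B) + X.ins 0 L = 0
    rw [map_zero]
    simp [unit]

/-- A cochain pulled back along π vanishes on `t`, so the inserted `t` must be the last entry, fed
to the one-cocycle. `R` thus reads off a coefficient standing to the left of λ, whereas `S` reads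
one to the right of β. -/
theorem R_pull_cup {f : List P → B} (hf : IsMultilinear f) :
    X.R (cup (pull X.π f) X.cocycle₁) = pull X.π f := by
  funext L
  induction L generalizing f with
  | nil =>
    change X.J (der X.t (cup (pull X.π f) X.cocycle₁)) [] = _
    rw [X.der_t_pull_cup hf, map_smul, J_unit]
    simp [unit]
  | cons w L ih =>
    change X.J (der X.t (cup (pull X.π f) X.cocycle₁)) (w :: L) +
      X.R (der (X.π w) (cup (pull X.π f) X.cocycle₁)) L = _
    rw [X.der_t_pull_cup hf, map_smul, J_unit, der_π_pull_cup, ih (hf.der _)]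
    simp [unit]

theorem S_pull_cup {f : List P → B} (hf : IsMultilinear f) :
    X.S (cup (pull X.π f) X.cocycle₁) = 0 := by
  funext L
  induction L generalizing f with
  | nil =>
    change X.ins (der X.t (cup (pull X.π f) X.cocycle₁)) [] = _
    rw [X.der_t_pull_cup hf, map_smul, ins_unit]
    simp
  | cons w L ih =>
    change X.ins (der X.t (cup (pull X.π f) X.cocycle₁)) (w :: L) +
      X.S (der (X.π w) (cup (pull X.π f) X.cocycle₁)) L = _
    rw [X.der_t_pull_cup hf, map_smul, ins_unit, der_π_pull_cup, ih (hf.der _)]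
    simp

theorem pull_cocycle₁ : pull X.π X.cocycle₁ = 0 := by
  funext L
  rcases L with _ | ⟨w, _ | ⟨v, L⟩⟩ <;> simp [cocycle₁, X.ρ_π]

theorem pull_cocycle₂ : pull X.π X.cocycle₂ = 0 := by
  funext L
  rcases L with _ | ⟨w, _ | ⟨v, _ | ⟨z, L⟩⟩⟩ <;> simp [cocycle₂, X.bz_π]

end EvenSplitting

end EvenSplitting

end HochschildCochain

end

/-! ### Cohomology classes and operators on cohomology -/

section

open ChainAlgebra HochschildCochain

section Coh

variable {K : Type u} [CommRing K] {P : ChainAlgebra.{u, v} K} {B : Type w} [Ring B]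
  [Algebra K B]

/-- `f` is a cocycle of degree `n`. -/
def IsCocycle (ε : Hom P (ofAlgebra K B)) (n : ℕ) (f : List P → B) : Prop :=
  (IsMultilinear f ∧ HasDegree f n) ∧ D ε f = 0

namespace IsCocycle

variable {ε : Hom P (ofAlgebra K B)} {m n : ℕ} {f g : List P → B}

theorem ml (hf : IsCocycle ε n f) : IsMultilinear f := hf.1.1

theorem hasDeg (hf : IsCocycle ε n f) : HasDeg f n := hasDeg_iff.2 hf.1.2

theorem D_eq (hf : IsCocycle ε n f) : D ε f = 0 := hf.2

theorem zero : IsCocycle ε n 0 :=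
  ⟨⟨isMultilinear_zero, fun _ _ _ _ => rfl⟩, by simpa using D_smul ε (0 : ℤ) (0 : List P → B)⟩

theorem add (hf : IsCocycle ε n f) (hg : IsCocycle ε n g) : IsCocycle ε n (f + g) :=
  ⟨⟨hf.ml.add hg.ml, hasDeg_iff.1 (hf.hasDeg.add hg.hasDeg)⟩, by
    rw [D_add, hf.D_eq, hg.D_eq, add_zero]⟩

theorem zsmul (hf : IsCocycle ε n f) (c : ℤ) : IsCocycle ε n (c • f) :=
  ⟨⟨hf.ml.zsmul c, hasDeg_iff.1 (hf.hasDeg.zsmul c)⟩, by rw [D_smul, hf.D_eq, smul_zero]⟩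

theorem neg (hf : IsCocycle ε n f) : IsCocycle ε n (-f) := by simpa using hf.zsmul (-1)

theorem sub (hf : IsCocycle ε n f) (hg : IsCocycle ε n g) : IsCocycle ε n (f - g) := by
  rw [sub_eq_add_neg]; exact hf.add hg.neg

theorem cup (hf : IsCocycle ε m f) (hg : IsCocycle ε n g) :
    IsCocycle ε (m + n) (cup f g) :=
  ⟨⟨hf.ml.cup hg.ml, hf.1.2.cup hg.1.2⟩, by
    rw [D_cup, hf.D_eq, hg.D_eq, zero_cup, cup_zero, add_zero]⟩

theorem unit : IsCocycle ε 0 (unit : List P → B) :=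
  ⟨⟨isMultilinear_unit, hasDegree_unit⟩, D_unit ε⟩

/-- The image of a cocycle under an operator that commutes with the coboundary up to a factor. -/
theorem op {T : (List P → B) →ₗ[B] (List P → B)} {a : ℕ} (hT : IsOp T (-a)) {c : ℤ}
    (hD : ∀ f, IsMultilinear f → D ε (T f) = c • T (D ε f)) (hf : IsCocycle ε n f) :
    IsCocycle ε (n - a) (T f) := by
  refine ⟨⟨hT.ml f hf.ml, ?_⟩, by rw [hD f hf.ml, hf.D_eq, map_zero, smul_zero]⟩
  have h := (hT f hf.ml).2 _ hf.hasDeg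
  -- For `n < a` the target degree truncates to 0; the image then has negative degree and is zero,
  -- so the claim still holds.
  by_cases hn : a ≤ n
  · refine hasDeg_iff.1 ?_
    rw [Nat.cast_sub hn]
    exact h
  · rw [h.eq_zero (hT.ml f hf.ml) (by omega)]
    exact fun _ _ _ _ => rfl

end IsCocycle

variable (k : Type*) [CommRing k] [Algebra k B] (ε : Hom P (ofAlgebra K B))

/-- The total Hochschild cohomology ring. -/
abbrev Coh := DirectSum ℕ (HochschildH k ε)

/-- The class of a cocycle in the total cohomology ring. -/
noncomputable def cls (n : ℕ) (f : List P → B) (hf : IsCocycle ε n f) : Coh k ε :=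
  DirectSum.of (HochschildH k ε) n (HochschildH.mk k ε n ⟨f, hf⟩)

variable {ε}

theorem cls_add {n : ℕ} {f g : List P → B} (hf : IsCocycle ε n f) (hg : IsCocycle ε n g) :
    cls k ε n (f + g) (hf.add hg) = cls k ε n f hf + cls k ε n g hg := by
  rw [cls, cls, cls, ← map_add, ← map_add]
  rfl

theorem cls_zero {n : ℕ} : cls k ε n 0 .zero = 0 := by
  have := cls_add k (ε := ε) (n := n) .zero .zero
  simp only [add_zero] at this
  exact left_eq_add.mp this

theorem cls_congr {m n : ℕ} {f g : List P → B} (hf : IsCocycle ε m f) (hg : IsCocycle ε n g)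
    (h : m = n) (e : f = g) : cls k ε m f hf = cls k ε n g hg := by
  subst h; subst e; rfl

theorem cls_neg {n : ℕ} {f : List P → B} (hf : IsCocycle ε n f) :
    cls k ε n (-f) hf.neg = - cls k ε n f hf := by
  rw [eq_neg_iff_add_eq_zero, ← cls_add, ← cls_zero (ε := ε) (n := n) k]
  exact cls_congr k _ _ rfl (neg_add_cancel f)

theorem cls_sub {n : ℕ} {f g : List P → B} (hf : IsCocycle ε n f) (hg : IsCocycle ε n g) :
    cls k ε n (f - g) (hf.sub hg) = cls k ε n f hf - cls k ε n g hg := by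
  rw [sub_eq_add_neg (cls k ε n f hf), ← cls_neg, ← cls_add]
  exact cls_congr k _ _ rfl (sub_eq_add_neg f g)

theorem cls_zsmul {n : ℕ} {f : List P → B} (hf : IsCocycle ε n f) (c : ℤ) :
    cls k ε n (c • f) (hf.zsmul c) = c • cls k ε n f hf := by
  rw [cls, cls, ← map_zsmul, ← map_zsmul]
  rfl

theorem cls_mul {m n : ℕ} {f g : List P → B} (hf : IsCocycle ε m f) (hg : IsCocycle ε n g) :
    cls k ε m f hf * cls k ε n g hg = cls k ε (m + n) (cup f g) (hf.cup hg) := by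
  rw [cls, cls, DirectSum.of_mul_of]
  rfl

theorem cls_unit : cls k ε 0 unit .unit = 1 := rfl

/-- Allowing a bounding cochain of degree -1, which must vanish, makes degree zero uniform with the
others. -/
theorem cls_eq_zero_iff {n : ℕ} {f : List P → B} (hf : IsCocycle ε n f) :
    cls k ε n f hf = 0 ↔ ∃ h, IsMultilinear h ∧ HasDeg h (n - 1 : ℤ) ∧ D ε h = f := by
  have e : HochschildH.mk k ε n ⟨f, hf⟩ = 0 ↔ f ∈ hochschildCoboundaries k ε n :=
    Submodule.Quotient.mk_eq_zero _
  rw [cls, map_eq_zero_iff _ (DirectSum.of_injective n), e]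
  rcases n with _ | n
  · change f = 0 ↔ _
    constructor
    · rintro rfl
      exact ⟨0, isMultilinear_zero, fun _ _ _ _ => rfl, IsCocycle.zero (n := 0).2⟩
    · rintro ⟨h, h1, h2, rfl⟩
      rw [h2.eq_zero h1 (by simp)]
      exact IsCocycle.zero (n := 0).2
  · constructor
    · rintro ⟨h, ⟨h1, h2⟩, h3⟩
      exact ⟨h, h1, by simpa using hasDeg_iff.2 h2, h3⟩
    · rintro ⟨h, h1, h2, h3⟩
      exact ⟨h, ⟨h1, hasDeg_iff.1 (by simpa using h2)⟩, h3⟩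

theorem cls_eq_iff {n : ℕ} {f g : List P → B} (hf : IsCocycle ε n f) (hg : IsCocycle ε n g) :
    cls k ε n f hf = cls k ε n g hg ↔
      ∃ h, IsMultilinear h ∧ HasDeg h (n - 1 : ℤ) ∧ D ε h = f - g := by
  rw [← sub_eq_zero, ← cls_sub, cls_eq_zero_iff]

variable {k}

theorem Coh.induction {C : Coh k ε → Prop} (h0 : C 0) (h1 : ∀ n f hf, C (cls k ε n f hf))
    (h2 : ∀ x y, C x → C y → C (x + y)) (x : Coh k ε) : C x := by
  induction x using DirectSum.induction_on with
  | zero => exact h0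
  | of i x =>
    obtain ⟨⟨f, hf⟩, rfl⟩ := HochschildH.mk_surjective k ε _ x
    exact h1 i f hf
  | add x y hx hy => exact h2 x y hx hy

variable (k) in
theorem exists_cls {n : ℕ} (x : HochschildH k ε n) :
    ∃ f hf, DirectSum.of (HochschildH k ε) n x = cls k ε n f hf := by
  obtain ⟨⟨f, hf⟩, rfl⟩ := HochschildH.mk_surjective k ε _ x
  exact ⟨f, hf, rfl⟩

/-- A linear map out of the cohomology ring, from a family of linear maps on cocycles. -/
noncomputable def Coh.lift {M : Type*} [AddCommGroup M] [Module k M]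
    (F : ∀ n, hochschildCocycles k ε n →ₗ[k] M)
    (hF : ∀ n f, cls k ε n f.1 f.2 = 0 → F n f = 0) : Coh k ε →ₗ[k] M :=
  DirectSum.toModule k ℕ M fun n => Submodule.liftQ _ (F n) fun f hf => by
    have e : HochschildH.mk k ε n f = 0 := (Submodule.Quotient.mk_eq_zero _).2 hf
    refine hF n f ?_
    change DirectSum.of (HochschildH k ε) n (HochschildH.mk k ε n f) = 0
    rw [e, map_zero]

theorem Coh.lift_cls {M : Type*} [AddCommGroup M] [Module k M]
    (F : ∀ n, hochschildCocycles k ε n →ₗ[k] M)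
    (hF : ∀ n f, cls k ε n f.1 f.2 = 0 → F n f = 0) {n : ℕ} {f : List P → B}
    (hf : IsCocycle ε n f) : Coh.lift F hF (cls k ε n f hf) = F n ⟨f, hf⟩ := by
  rw [Coh.lift, cls]
  erw [DirectSum.toModule_lof]
  rfl

variable (k ε) in
/-- The class of a cocycle, as a linear map. -/
noncomputable def clsL (n : ℕ) : hochschildCocycles k ε n →ₗ[k] Coh k ε :=
  DirectSum.lof k ℕ (HochschildH k ε) n ∘ₗ HochschildH.mk k ε n

theorem map_smul_k (T : (List P → B) →ₗ[B] (List P → B)) (c : k) (f : List P → B) :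
    T (c • f) = c • T f := by
  have e : ∀ g : List P → B, c • g = algebraMap k B c • g := by
    intro g; funext L; simp [Algebra.smul_def]
  rw [e, map_smul, ← e]

/-- The map on cohomology induced by an operator that lowers degrees by `a` and commutes with the
coboundary. -/
noncomputable def Coh.op (T : (List P → B) →ₗ[B] (List P → B)) (a : ℕ) (hT : IsOp T (-a))
    (hD : ∀ f, IsMultilinear f → D ε (T f) = T (D ε f)) : Coh k ε →ₗ[k] Coh k ε :=
  have hD' : ∀ f, IsMultilinear f → D ε (T f) = (1 : ℤ) • T (D ε f) := by simpa using hD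
  Coh.lift (fun n => clsL k ε (n - a) ∘ₗ
      { toFun := fun f => ⟨T f.1, IsCocycle.op hT hD' f.2⟩
        map_add' := fun f g => Subtype.ext (map_add T f.1 g.1)
        map_smul' := fun c f => Subtype.ext (map_smul_k T c f.1) }) fun n f hf => by
    obtain ⟨h, h1, h2, h3⟩ := (cls_eq_zero_iff k f.2).1 hf
    change cls k ε _ (T f.1) (IsCocycle.op hT hD' f.2) = 0
    have h4 := (hT h h1).2 _ h2
    rw [cls_eq_zero_iff]
    by_cases hn : a ≤ n
    · refine ⟨T h, hT.ml h h1, ?_, by rw [hD h h1, h3]⟩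
      rw [Nat.cast_sub hn, sub_sub, add_comm, ← sub_sub]
      exact h4
    · refine ⟨0, isMultilinear_zero, fun _ _ _ _ => rfl, ?_⟩
      rw [← h3, ← hD h h1, h4.eq_zero (hT.ml h h1) (by omega)]

theorem Coh.op_cls {T : (List P → B) →ₗ[B] (List P → B)} {a : ℕ} (hT : IsOp T (-a))
    (hD : ∀ f, IsMultilinear f → D ε (T f) = T (D ε f)) {n : ℕ} {f : List P → B}
    (hf : IsCocycle ε n f) :
    Coh.op (k := k) T a hT hD (cls k ε n f hf) = cls k ε (n - a) (T f)
      (IsCocycle.op hT (c := 1) (by simpa using hD) hf) := by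
  rw [Coh.op, Coh.lift_cls]
  rfl

/-- Homogeneous elements of degree `n`. -/
def Coh.IsHomog (x : Coh k ε) (n : ℕ) : Prop := ∃ f hf, x = cls k ε n f hf

theorem Coh.isHomog_cls {n : ℕ} {f : List P → B} (hf : IsCocycle ε n f) :
    (cls k ε n f hf).IsHomog n := ⟨f, hf, rfl⟩

theorem Coh.IsHomog.exists_of {x : Coh k ε} {n : ℕ} (hx : x.IsHomog n) :
    ∃ c, x = DirectSum.of (HochschildH k ε) n c := by
  obtain ⟨f, hf, rfl⟩ := hx
  exact ⟨_, rfl⟩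

theorem Coh.isHomog_of {n : ℕ} (c : HochschildH k ε n) :
    Coh.IsHomog (k := k) (ε := ε) (DirectSum.of (HochschildH k ε) n c) n := exists_cls k c

theorem Coh.isHomog_one : (1 : Coh k ε).IsHomog 0 := ⟨unit, .unit, rfl⟩

theorem Coh.isHomog_zero {n : ℕ} : (0 : Coh k ε).IsHomog n := ⟨0, .zero, (cls_zero k).symm⟩

theorem Coh.IsHomog.add {x y : Coh k ε} {n : ℕ} (hx : x.IsHomog n) (hy : y.IsHomog n) :
    (x + y).IsHomog n := by
  obtain ⟨f, hf, rfl⟩ := hx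
  obtain ⟨g, hg, rfl⟩ := hy
  exact ⟨_, _, (cls_add k hf hg).symm⟩

theorem Coh.IsHomog.mul {x y : Coh k ε} {m n : ℕ} (hx : x.IsHomog m) (hy : y.IsHomog n) :
    (x * y).IsHomog (m + n) := by
  obtain ⟨f, hf, rfl⟩ := hx
  obtain ⟨g, hg, rfl⟩ := hy
  exact ⟨_, _, cls_mul k hf hg⟩

theorem Coh.IsHomog.smul {x : Coh k ε} {n : ℕ} (hx : x.IsHomog n) (c : k) :
    (c • x).IsHomog n := by
  obtain ⟨y, rfl⟩ := hx.exists_of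
  have : c • DirectSum.of (HochschildH k ε) n y = DirectSum.of (HochschildH k ε) n (c • y) :=
    (map_smul (DirectSum.lof k ℕ (HochschildH k ε) n) c y).symm
  rw [this]
  exact Coh.isHomog_of _

theorem Coh.IsHomog.congr {x y : Coh k ε} {m n : ℕ} (hx : x.IsHomog m) (h : m = n) (e : x = y) :
    y.IsHomog n := by
  subst h; subst e; exact hx

theorem Coh.IsHomog.component {x : Coh k ε} {m n : ℕ} (hx : x.IsHomog m) (h : m ≠ n) :
    x n = 0 := by
  obtain ⟨c, rfl⟩ := hx.exists_of
  exact DirectSum.of_eq_of_ne _ _ _ h.symm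

theorem Coh.IsHomog.op {T : (List P → B) →ₗ[B] (List P → B)} {a : ℕ} (hT : IsOp T (-a))
    (hD : ∀ f, IsMultilinear f → D ε (T f) = T (D ε f)) {n : ℕ} {x : Coh k ε}
    (hx : x.IsHomog n) : (Coh.op (k := k) T a hT hD x).IsHomog (n - a) := by
  obtain ⟨f, hf, rfl⟩ := hx
  rw [Coh.op_cls]
  exact Coh.isHomog_cls _

end Coh

end

/-! ### Functoriality for augmented morphisms -/

section

open ChainAlgebra HochschildCochain

section Mor

/-- Morphisms of augmented chain algebras, possibly over different base rings. -/
structure AugMor {K K' : Type*} [CommRing K] [CommRing K'] {P : ChainAlgebra.{_, v} K}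
    {Q : ChainAlgebra.{_, w} K'} {B : Type*} [Ring B] [Algebra K B] [Algebra K' B]
    (ε : Hom P (ofAlgebra K B)) (ε' : Hom Q (ofAlgebra K' B)) where
  φ : P →+* Q
  map_gr : ∀ n, ∀ x ∈ P.gr n, φ x ∈ Q.gr n
  map_d : ∀ x, φ (P.d x) = Q.d (φ x)
  map_aug : ∀ x, ε'.aug (φ x) = ε.aug x
  ml : ∀ f : List Q → B, IsMultilinear f → IsMultilinear (pull φ f)

variable {K K' : Type*} [CommRing K] [CommRing K'] {P : ChainAlgebra.{_, v} K}
  {Q : ChainAlgebra.{_, w} K'} {B : Type*} [Ring B] [Algebra K B] [Algebra K' B]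
  {ε : Hom P (ofAlgebra K B)} {ε' : Hom Q (ofAlgebra K' B)}

/-- A morphism of chain algebras over one base ring as an `AugMor`. -/
def ChainAlgebra.Hom.toAugMor {Q : ChainAlgebra.{_, w} K} {ε' : Hom Q (ofAlgebra K B)}
    (f : Hom P Q) (h : ∀ x, ε'.aug (f.toAlgHom x) = ε.aug x) : AugMor ε ε' where
  φ := f.toAlgHom
  map_gr := f.map_gr
  map_d := f.map_d
  map_aug := h
  ml g hg := by
    refine ⟨fun L₁ L₂ x y => ?_, fun L₁ L₂ c x => ?_⟩
    · simpa using hg.1 (L₁.map f.toAlgHom) (L₂.map f.toAlgHom) (f.toAlgHom x) (f.toAlgHom y)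
    · simpa using hg.2 (L₁.map f.toAlgHom) (L₂.map f.toAlgHom) c (f.toAlgHom x)

/-- Integer signs make sense over every base ring, so they can be compared along a morphism that
changes the base. -/
theorem ChainAlgebra.sgn_of_mem_int {n : ℕ} {x : P} (hx : x ∈ P.gr n) :
    P.sgn x = (-1 : ℤ) ^ (n + 1) • x := by
  rw [P.sgn_of_mem hx, ← Int.cast_smul_eq_zsmul K]
  simp

namespace AugMor

variable (M : AugMor ε ε')

theorem map_sgn (x : P) : M.φ (P.sgn x) = Q.sgn (M.φ x) := by
  induction x using P.gr_induction with
  | h0 => simp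
  | hom n x hx => rw [P.sgn_of_mem_int hx, Q.sgn_of_mem_int (M.map_gr n x hx), map_zsmul]
  | add x y hx hy => simp only [map_add, hx, hy]

theorem pull_tw : pull M.φ (tw ε') = tw ε := by
  funext L
  rcases L with _ | ⟨x, _ | ⟨y, L⟩⟩ <;> simp [tw, M.map_aug]

theorem pull_inv (f : List Q → B) : pull M.φ (inv f) = inv (pull M.φ f) := by
  funext L
  change f _ = f _
  simp only [List.map_map]
  congr 2
  funext x
  exact (M.map_sgn x).symm

theorem pull_mulHead (f : List Q → B) (a : P) (L : List P) :
    mulHead f (M.φ a) (L.map M.φ) = mulHead (pull M.φ f) a L := by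
  cases L <;> simp [mulHead]

theorem pull_bar (f : List Q → B) : pull M.φ (bar f) = bar (pull M.φ f) := by
  funext L
  induction L generalizing f with
  | nil => rfl
  | cons x L ih =>
    have h := ih (der (M.φ (P.sgn x)) f)
    rw [pull_apply, List.map_cons, bar_cons, bar_cons, ← M.map_sgn, M.pull_mulHead, ← M.map_d]
    exact congrArg _ h

theorem pull_D (f : List Q → B) : pull M.φ (D ε' f) = D ε (pull M.φ f) := by
  rw [D, D, map_sub, map_add, pull_cup, pull_cup, M.pull_tw, M.pull_inv, M.pull_bar]

theorem hasDegree {f : List Q → B} {n : ℕ} (hf : HasDegree f n) : HasDegree (pull M.φ f) n := by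
  intro L e he hne
  refine hf (L.map M.φ) e ?_ (by simpa using hne)
  rw [List.forall₂_map_left_iff]
  exact he.imp fun _ _ h => M.map_gr _ _ h

theorem isCocycle {f : List Q → B} {n : ℕ} (hf : IsCocycle ε' n f) :
    IsCocycle ε n (pull M.φ f) :=
  ⟨⟨M.ml f hf.ml, M.hasDegree hf.1.2⟩, by rw [← M.pull_D, hf.D_eq, map_zero]⟩

variable (k : Type*) [CommRing k] [Algebra k B]

/-- The linear map on cohomology induced by a morphism. -/
noncomputable def pullL : Coh k ε' →ₗ[k] Coh k ε :=
  Coh.lift (fun n => clsL k ε n ∘ₗ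
      { toFun := fun f => ⟨pull M.φ f.1, M.isCocycle f.2⟩
        map_add' := fun f g => rfl
        map_smul' := fun c f => rfl }) fun n f hf => by
    obtain ⟨h, h1, h2, h3⟩ := (cls_eq_zero_iff k f.2).1 hf
    change cls k ε _ (pull M.φ f.1) (M.isCocycle f.2) = 0
    rw [cls_eq_zero_iff]
    refine ⟨pull M.φ h, M.ml h h1, ?_, by rw [← M.pull_D, h3]⟩
    intro L e he hne
    refine h2 (L.map M.φ) e ?_ (by simpa using hne)
    rw [List.forall₂_map_left_iff]
    exact he.imp fun _ _ h => M.map_gr _ _ h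

theorem pullL_cls {f : List Q → B} {n : ℕ} (hf : IsCocycle ε' n f) :
    M.pullL k (cls k ε' n f hf) = cls k ε n (pull M.φ f) (M.isCocycle hf) := by
  rw [pullL, Coh.lift_cls]
  rfl

/-- The ring homomorphism on cohomology induced by a morphism. -/
noncomputable def pullH : Coh k ε' →ₐ[k] Coh k ε :=
  AlgHom.ofLinearMap (M.pullL k)
    (by
      rw [← cls_unit, pullL_cls, ← cls_unit]
      exact cls_congr k _ _ rfl (pull_unit _))
    (fun x y => by
      induction x using Coh.induction with
      | h0 => simp
      | h2 x y hx hy => rw [add_mul, map_add, hx, hy, map_add, add_mul]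
      | h1 m f hf =>
        induction y using Coh.induction with
        | h0 => simp
        | h2 x y hx hy => rw [mul_add, map_add, hx, hy, map_add, mul_add]
        | h1 n g hg =>
          rw [cls_mul, pullL_cls, pullL_cls, pullL_cls, cls_mul]
          exact cls_congr k _ _ rfl (pull_cup _ _ _))

variable {k}

theorem pullH_cls {f : List Q → B} {n : ℕ} (hf : IsCocycle ε' n f) :
    M.pullH k (cls k ε' n f hf) = cls k ε n (pull M.φ f) (M.isCocycle hf) := M.pullL_cls k hf

theorem isHomog {x : Coh k ε'} {n : ℕ} (hx : x.IsHomog n) : (M.pullH k x).IsHomog n := by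
  obtain ⟨f, hf, rfl⟩ := hx
  rw [pullH_cls]
  exact Coh.isHomog_cls _

end AugMor

end Mor

/-! ### The decompositions in cohomology -/

section Split

variable {K : Type u} [CommRing K] {P : ChainAlgebra.{u, v} K} {Z : ChainAlgebra.{u, v} K}
  {B : Type w} [Ring B] [Algebra K B] {ε : Hom P (ofAlgebra K B)} {ε' : Hom Z (ofAlgebra K B)}
  {k : Type*} [CommRing k] [Algebra k B]

theorem pull_eq_pull_π {φ : P → Z} {ι : Z → P} {π : P → P} (h : ∀ w, ι (φ w) = π w)
    (h' : ∀ z, φ (ι z) = z) (f : List Z → B) : pull φ f = pull π (pull φ f) := by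
  funext L
  simp only [pull_apply, List.map_map]
  congr 2
  funext w
  simp [← h, h']

theorem pullH_pullH {M : AugMor ε ε'} {N : AugMor ε' ε} (h : ∀ z, M.φ (N.φ z) = z)
    (x : Coh k ε') : N.pullH k (M.pullH k x) = x := by
  induction x using Coh.induction with
  | h0 => simp
  | h1 n f hf =>
    rw [AugMor.pullH_cls, AugMor.pullH_cls]
    refine cls_congr k _ _ rfl ?_
    funext L
    simp only [pull_apply, List.map_map]
    congr 1
    conv_rhs => rw [← List.map_id L]
    congr 1
    funext z
    exact h z
  | h2 x y hx hy => simp only [map_add, hx, hy]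

namespace HochschildCochain.OddSplitting

variable (X : OddSplitting ε) (k)

theorem isCocycle : IsCocycle ε 2 X.cocycle :=
  ⟨⟨X.isMultilinear_cocycle, X.hasDegree_cocycle⟩, X.D_cocycle⟩

/-- The class dual to `x`. -/
noncomputable def ξ : Coh k ε := cls k ε 2 X.cocycle X.isCocycle

/-- The coefficient of `ξ`. -/
noncomputable def SH : Coh k ε →ₗ[k] Coh k ε := Coh.op X.S 2 X.isOp_S fun _ hf => X.D_S hf

variable {k}

/-- On a cocycle the homotopy formula has only one term on its left side, so it exhibits the
difference of the two sides as a coboundary. -/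
theorem decomp {M : AugMor ε ε'} {N : AugMor ε' ε} (h : ∀ w, N.φ (M.φ w) = X.π w) {n : ℕ}
    {f : List P → B} (hf : IsCocycle ε n f) :
    cls k ε n f hf = M.pullH k (N.pullH k (cls k ε n f hf)) +
      X.ξ k * X.SH k (cls k ε n f hf) := by
  have hS : IsCocycle ε (n - 2) (X.S f) :=
    IsCocycle.op X.isOp_S (c := 1) (by simpa using fun f hf => X.D_S hf) hf
  rw [AugMor.pullH_cls, AugMor.pullH_cls, SH, Coh.op_cls, ξ, cls_mul]
  have e : pull M.φ (pull N.φ f) = pull X.π f := by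
    have e0 : (N.φ ∘ M.φ) = X.π := funext h
    rw [pull_pull, e0]
  have hD := X.D_h hf.ml
  rw [hf.D_eq, map_zero, add_zero] at hD
  have hp : IsCocycle ε n (pull X.π f) := e ▸ M.isCocycle (N.isCocycle hf)
  -- Below degree 2 the coefficient has negative degree and vanishes, so the mismatch caused by `n -
  -- 2` in ℕ does not matter.
  by_cases hn : 2 ≤ n
  · have e2 : 2 + (n - 2) = n := by omega
    have hc : IsCocycle ε n (cup X.cocycle (X.S f)) := by
      have := X.isCocycle.cup hS
      rwa [e2] at this
    rw [cls_congr k _ hp rfl e, cls_congr k (X.isCocycle.cup hS) hc e2 rfl, ← cls_add, eq_comm,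
      cls_eq_iff]
    refine ⟨X.h f, X.isOp_h.ml f hf.ml, (X.isOp_h f hf.ml).2 _ hf.hasDeg, ?_⟩
    rw [hD]
    abel
  · have e3 : X.S f = 0 := ((X.isOp_S f hf.ml).2 _ hf.hasDeg).eq_zero (X.isOp_S.ml f hf.ml) (by omega)
    rw [cls_congr k (X.isCocycle.cup hS) IsCocycle.zero rfl (by rw [e3, cup_zero]), cls_zero,
      add_zero, cls_congr k _ hp rfl e, eq_comm, cls_eq_iff]
    refine ⟨X.h f, X.isOp_h.ml f hf.ml, (X.isOp_h f hf.ml).2 _ hf.hasDeg, ?_⟩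
    rw [hD, e3, cup_zero]
    abel

theorem SH_mul (y : Coh k ε) : X.SH k (X.ξ k * y) = y := by
  induction y using Coh.induction with
  | h0 => simp
  | h1 n f hf =>
    rw [ξ, cls_mul, SH, Coh.op_cls]
    exact cls_congr k _ _ (by omega) (X.S_cup f)
  | h2 x y hx hy => simp only [mul_add, map_add, hx, hy]

theorem SH_pull {M : AugMor ε ε'} {N : AugMor ε' ε} (h : ∀ w, N.φ (M.φ w) = X.π w)
    (h' : ∀ z, M.φ (N.φ z) = z) (y : Coh k ε') : X.SH k (M.pullH k y) = 0 := by
  induction y using Coh.induction with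
  | h0 => simp
  | h1 n f hf =>
    rw [AugMor.pullH_cls, SH, Coh.op_cls, ← cls_zero k (n := n - 2)]
    refine cls_congr k _ _ rfl ?_
    rw [pull_eq_pull_π h h', X.S_pull (M.isCocycle hf).ml]
  | h2 x y hx hy => simp only [map_add, hx, hy, add_zero]

theorem pull_ξ {M : AugMor ε ε'} {N : AugMor ε' ε} (h : ∀ w, N.φ (M.φ w) = X.π w)
    (h' : ∀ z, M.φ (N.φ z) = z) : N.pullH k (X.ξ k) = 0 := by
  rw [ξ, AugMor.pullH_cls, ← cls_zero k (n := 2)]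
  refine cls_congr k _ _ rfl ?_
  have e : pull N.φ X.cocycle = pull N.φ (pull X.π X.cocycle) := by
    funext L
    simp only [pull_apply, List.map_map]
    congr 2
    funext w
    simp [← h, h']
  rw [e, X.pull_cocycle, map_zero]

end HochschildCochain.OddSplitting

namespace HochschildCochain.EvenSplitting

variable (X : EvenSplitting ε) (k)

theorem isCocycle₁ : IsCocycle ε (X.dt + 1) X.cocycle₁ :=
  ⟨⟨X.isMultilinear_cocycle₁, X.hasDegree_cocycle₁⟩, X.D_cocycle₁⟩

theorem isCocycle₂ : IsCocycle ε (X.dt + X.dt' + 2) X.cocycle₂ :=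
  ⟨⟨X.isMultilinear_cocycle₂, X.hasDegree_cocycle₂⟩, X.D_cocycle₂⟩

theorem isOp_S' : IsOp X.S (-(X.dt + X.dt' + 2 : ℕ)) := by
  have h := X.isOp_S
  rwa [show (-2 - X.dt - X.dt' : ℤ) = -(X.dt + X.dt' + 2 : ℕ) by push_cast; ring] at h

theorem isOp_R' : IsOp X.R (-(X.dt + 1 : ℕ)) := by
  have h := X.isOp_R
  rwa [show (-1 - X.dt : ℤ) = -(X.dt + 1 : ℕ) by push_cast; ring] at h

/-- The class dual to `t`. -/
noncomputable def lam : Coh k ε := cls k ε _ X.cocycle₁ X.isCocycle₁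

/-- The class dual to `t^p`. -/
noncomputable def bet : Coh k ε := cls k ε _ X.cocycle₂ X.isCocycle₂

/-- The coefficient of `β`. -/
noncomputable def SH : Coh k ε →ₗ[k] Coh k ε := Coh.op X.S _ X.isOp_S' fun _ hf => X.D_S hf

/-- The coefficient of `λ`. -/
noncomputable def RH : Coh k ε →ₗ[k] Coh k ε := Coh.op X.R _ X.isOp_R' fun _ hf => X.D_R hf

variable {k}

theorem decomp {M : AugMor ε ε'} {N : AugMor ε' ε} (h : ∀ w, N.φ (M.φ w) = X.π w) {n : ℕ}
    {f : List P → B} (hf : IsCocycle ε n f) :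
    cls k ε n f hf = M.pullH k (N.pullH k (cls k ε n f hf)) +
      X.RH k (cls k ε n f hf) * X.lam k + X.bet k * X.SH k (cls k ε n f hf) := by
  have hS : IsCocycle ε (n - (X.dt + X.dt' + 2)) (X.S f) :=
    IsCocycle.op X.isOp_S' (c := 1) (by simpa using fun f hf => X.D_S hf) hf
  have hR : IsCocycle ε (n - (X.dt + 1)) (X.R f) :=
    IsCocycle.op X.isOp_R' (c := 1) (by simpa using fun f hf => X.D_R hf) hf
  rw [AugMor.pullH_cls, AugMor.pullH_cls, SH, RH, Coh.op_cls, Coh.op_cls, bet, lam, cls_mul,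
    cls_mul]
  have e : pull M.φ (pull N.φ f) = pull X.π f := by
    have e0 : (N.φ ∘ M.φ) = X.π := funext h
    rw [pull_pull, e0]
  have hD := X.D_homotopy hf.ml
  rw [hf.D_eq, map_zero, add_zero] at hD
  have hp : IsCocycle ε n (pull X.π f) := e ▸ M.isCocycle (N.isCocycle hf)
  -- The product lies in degree `n` only if the subtraction of degrees is honest; otherwise its
  -- coefficient vanishes and both sides are zero.
  have key₁ : ∃ hc : IsCocycle ε n (cup (X.R f) X.cocycle₁),
      cls k ε _ _ (hR.cup X.isCocycle₁) = cls k ε n _ hc := by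
    by_cases hn : X.dt + 1 ≤ n
    · have e2 : n - (X.dt + 1) + (X.dt + 1) = n := by omega
      have hc := hR.cup X.isCocycle₁
      rw [e2] at hc
      exact ⟨hc, cls_congr k _ _ e2 rfl⟩
    · have e3 : cup (X.R f) X.cocycle₁ = 0 := by
        rw [((X.isOp_R' f hf.ml).2 _ hf.hasDeg).eq_zero (X.isOp_R'.ml f hf.ml)
          (by push_cast; omega), zero_cup]
      have hc : IsCocycle ε n (cup (X.R f) X.cocycle₁) := by rw [e3]; exact .zero
      refine ⟨hc, ?_⟩
      rw [cls_congr k hc .zero rfl e3, cls_congr k (hR.cup X.isCocycle₁) .zero rfl e3, cls_zero,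
        cls_zero]
  have key₂ : ∃ hc : IsCocycle ε n (cup X.cocycle₂ (X.S f)),
      cls k ε _ _ (X.isCocycle₂.cup hS) = cls k ε n _ hc := by
    by_cases hn : X.dt + X.dt' + 2 ≤ n
    · have e2 : X.dt + X.dt' + 2 + (n - (X.dt + X.dt' + 2)) = n := by omega
      have hc := X.isCocycle₂.cup hS
      rw [e2] at hc
      exact ⟨hc, cls_congr k _ _ e2 rfl⟩
    · have e3 : cup X.cocycle₂ (X.S f) = 0 := by
        rw [((X.isOp_S' f hf.ml).2 _ hf.hasDeg).eq_zero (X.isOp_S'.ml f hf.ml)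
          (by push_cast; omega), cup_zero]
      have hc : IsCocycle ε n (cup X.cocycle₂ (X.S f)) := by rw [e3]; exact .zero
      refine ⟨hc, ?_⟩
      rw [cls_congr k hc .zero rfl e3, cls_congr k (X.isCocycle₂.cup hS) .zero rfl e3, cls_zero,
        cls_zero]
  obtain ⟨h1, h1'⟩ := key₁
  obtain ⟨h2, h2'⟩ := key₂
  rw [h1', h2', cls_congr k _ hp rfl e, ← cls_add, ← cls_add, eq_comm, cls_eq_iff]
  refine ⟨(X.h + -X.k) f, X.isOp_homotopy.ml f hf.ml, (X.isOp_homotopy f hf.ml).2 _ hf.hasDeg, ?_⟩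
  rw [hD]
  abel

theorem SH_mul (y : Coh k ε) : X.SH k (X.bet k * y) = y := by
  induction y using Coh.induction with
  | h0 => simp
  | h1 n f hf =>
    rw [bet, cls_mul, SH, Coh.op_cls]
    exact cls_congr k _ _ (by omega) (X.S_cup₂ f)
  | h2 x y hx hy => simp only [mul_add, map_add, hx, hy]

theorem RH_mul (y : Coh k ε) : X.RH k (X.bet k * y) = 0 := by
  induction y using Coh.induction with
  | h0 => simp
  | h1 n f hf =>
    rw [bet, cls_mul, RH, Coh.op_cls, ← cls_zero k]
    exact cls_congr k _ _ rfl (X.R_cup₂ f)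
  | h2 x y hx hy => simp only [mul_add, map_add, hx, hy, add_zero]

section

variable {M : AugMor ε ε'} {N : AugMor ε' ε} (h : ∀ w, N.φ (M.φ w) = X.π w)
  (h' : ∀ z, M.φ (N.φ z) = z)
include h h'

theorem SH_pull (y : Coh k ε') : X.SH k (M.pullH k y) = 0 := by
  induction y using Coh.induction with
  | h0 => simp
  | h1 n f hf =>
    rw [AugMor.pullH_cls, SH, Coh.op_cls, ← cls_zero k]
    refine cls_congr k _ _ rfl ?_
    rw [pull_eq_pull_π h h', X.S_pull (M.isCocycle hf).ml]
  | h2 x y hx hy => simp only [map_add, hx, hy, add_zero]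

theorem RH_pull (y : Coh k ε') : X.RH k (M.pullH k y) = 0 := by
  induction y using Coh.induction with
  | h0 => simp
  | h1 n f hf =>
    rw [AugMor.pullH_cls, RH, Coh.op_cls, ← cls_zero k]
    refine cls_congr k _ _ rfl ?_
    rw [pull_eq_pull_π h h', X.R_pull (M.isCocycle hf).ml]
  | h2 x y hx hy => simp only [map_add, hx, hy, add_zero]

theorem SH_pull_mul (y : Coh k ε') : X.SH k (M.pullH k y * X.lam k) = 0 := by
  induction y using Coh.induction with
  | h0 => simp
  | h1 n f hf =>
    rw [AugMor.pullH_cls, lam, cls_mul, SH, Coh.op_cls, ← cls_zero k]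
    refine cls_congr k _ _ rfl ?_
    rw [pull_eq_pull_π h h', X.S_pull_cup (M.isCocycle hf).ml]
  | h2 x y hx hy => simp only [add_mul, map_add, hx, hy, add_zero]

theorem RH_pull_mul (y : Coh k ε') : X.RH k (M.pullH k y * X.lam k) = M.pullH k y := by
  induction y using Coh.induction with
  | h0 => simp
  | h1 n f hf =>
    rw [AugMor.pullH_cls, lam, cls_mul, RH, Coh.op_cls]
    refine cls_congr k _ _ (by omega) ?_
    rw [pull_eq_pull_π h h', X.R_pull_cup (M.isCocycle hf).ml]
  | h2 x y hx hy => simp only [add_mul, map_add, hx, hy]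

theorem pull_lam : N.pullH k (X.lam k) = 0 := by
  rw [lam, AugMor.pullH_cls, ← cls_zero k]
  refine cls_congr k _ _ rfl ?_
  have e : pull N.φ X.cocycle₁ = pull N.φ (pull X.π X.cocycle₁) := by
    funext L
    simp only [pull_apply, List.map_map]
    congr 2
    funext w
    simp [← h, h']
  rw [e, X.pull_cocycle₁, map_zero]

theorem pull_bet : N.pullH k (X.bet k) = 0 := by
  rw [bet, AugMor.pullH_cls, ← cls_zero k]
  refine cls_congr k _ _ rfl ?_
  have e : pull N.φ X.cocycle₂ = pull N.φ (pull X.π X.cocycle₂) := by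
    funext L
    simp only [pull_apply, List.map_map]
    congr 2
    funext w
    simp [← h, h']
  rw [e, X.pull_cocycle₂, map_zero]

end

end HochschildCochain.EvenSplitting

end Split

end

/-! ### Commutation relations between the classes -/

section

open ChainAlgebra HochschildCochain

namespace HochschildCochain

section Commute

variable {K : Type u} [CommRing K] {P : ChainAlgebra.{u, v} K} {B : Type w} [Ring B]
  [Algebra K B] (ε : Hom P (ofAlgebra K B))

/-- The operator that describes the commutator of `barR` and `pre φ Y`. -/
noncomputable def commOp (φ : P → P) (η : ℤ) (Y : (List P → B) →ₗ[B] (List P → B)) :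
    (List P → B) →ₗ[B] (List P → B) where
  toFun f L := match L with
    | [] => - (η • Y (barR ε f) [])
    | x :: L => barR ε (Y f) (x :: L) - η • Y (barR ε f) (x :: L) -
        η • Y (actR ε (P.sgn (φ x)) f) L
  map_add' f g := by
    funext L
    cases L
    · simp only [map_add, Pi.add_apply, smul_add, neg_add]
    · simp only [map_add, Pi.add_apply, smul_add]; abel
  map_smul' c f := by
    funext L
    cases L
    · simp only [map_smul, Pi.smul_apply, RingHom.id_apply, smul_neg, smul_comm η c]
    · simp only [map_smul, Pi.smul_apply, RingHom.id_apply, smul_sub, smul_comm η c]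

/-- The cochains that factor through an idempotent. -/
def Factors (π : P → P) (f : List P → B) : Prop := IsMultilinear f ∧ pull π f = f

theorem Factors.cons {π : P → P} {f : List P → B} (hf : Factors π f)
    (hπ : ∀ w, π (π w) = π w) (x : P) (L : List P) : f (π x :: L) = f (x :: L) := by
  have h1 := congrFun hf.2 (x :: L)
  have h2 := congrFun hf.2 (π x :: L)
  simp only [pull_apply, List.map_cons, hπ] at h1 h2
  rw [← h1, ← h2]

theorem Factors.der {π : P → P} {f : List P → B} (hf : Factors π f)
    (hπ : ∀ w, π (π w) = π w) (x : P) : Factors π (der (π x) f) := by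
  refine ⟨hf.1.der _, ?_⟩
  funext L
  have h := congrFun hf.2 (x :: L)
  simp only [pull_apply, List.map_cons] at h ⊢
  rw [der_apply, der_apply, h, hf.cons hπ]

theorem Factors.der_neg {π : P → P} {f : List P → B} (hf : Factors π f)
    (hπ : ∀ w, π (π w) = π w) (x : P) : Factors π (HochschildCochain.der (-π x) f) := by
  have h := hf.der hπ x
  rw [hf.1.der_neg]
  exact ⟨h.1.neg, by rw [map_neg, h.2]⟩

/-- Cochains that factor through π keep doing so when their first entry is fixed to ±π(x). The
commutator operator therefore only has to be known on such cochains, where it is far simpler than in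
general. -/
theorem pre_eq_cup {φ π : P → P} {Z : (List P → B) →ₗ[B] (List P → B)} {g : List P → B}
    (hπ : ∀ w, π (π w) = π w) (hφ : ∀ x, φ x = π x ∨ φ x = - π x)
    (h : ∀ f, Factors π f → Z f = endOp g f) {f : List P → B} (hf : Factors π f) :
    pre φ Z f = cup (pull φ f) g := by
  rw [← pre_endOp]
  refine pre_congr (S := {f | Factors π f}) φ (fun x f hf => ?_) h hf
  rcases hφ x with e | e <;> rw [e]
  · exact hf.der hπ x
  · exact hf.der_neg hπ x

namespace OddSplitting

variable {ε} (X : OddSplitting ε)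

/-- The homotopy between the two products with the cocycle. -/
def hc : (List P → B) →ₗ[B] (List P → B) := pre (-X.p : P →ₗ[K] P) (op1 X.ρ LinearMap.id)

theorem isOp_op1 : IsOp (op1 X.ρ LinearMap.id : (List P → B) →ₗ[B] _) 1 := by
  have := HochschildCochain.isOp_op1 (B := B) X.ρ_gr isOp_id
  rwa [zero_add] at this

theorem isOp_hc : IsOp X.hc 1 :=
  X.isOp_op1.pre (φ := -X.p) (fun n w hw => Submodule.neg_mem _ (X.π_gr n w hw))

/-- `hc` applies ρ to one entry at a time. On cochains that factor through π the derivation rule for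
ρ makes all inner terms cancel, and the two ends of the list give the two cup products. -/
theorem D_hc {f : List P → B} (hf : Factors X.π f) :
    D ε (X.hc f) + X.hc (D ε f) = cup X.cocycle f - cup f X.cocycle := by
  have h := D_pre ε X.hd (-X.p) (-1) rfl
    (fun u v => by
      change -X.π (P.sgn u * v) = (-1 : ℤ) • (P.sgn (-X.π u) * -X.π v)
      rw [map_mul, X.π_sgn, map_neg, X.sgn_π]
      simp)
    (fun u => by
      change -X.π (P.sgn u) = P.sgn (-X.π u)
      rw [X.π_sgn, map_neg, X.sgn_π])
    (fun w => by
      change ε.aug (-X.π w) = _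
      rw [map_neg, X.aug_π]; simp) (op1 X.ρ LinearMap.id) (commOp ε (-X.p : P →ₗ[K] P) (-1) _)
    X.isOp_op1.ml (fun _ _ => rfl) (fun _ _ _ _ => rfl) hf.1
  have e : ((-X.p : P →ₗ[K] P) ∘ₗ P.sgn : P →ₗ[K] P) = X.p := by
    ext w
    change -X.π (P.sgn w) = X.π w
    rw [X.π_sgn, neg_neg]
  have e5 : op1 X.ρ LinearMap.id (cup (tw ε) f) = cup X.cocycle f := by
    funext L
    cases L with
    | nil => simp [cocycle]
    | cons w L =>
      rw [op1_cons, der_cup_tw, map_smul, cocycle, cup_lin_cons]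
      rfl
  rw [e, e5, pre_eq_cup (φ := X.p) (π := X.π) (g := -X.cocycle) X.π_π
    (fun x => Or.inl rfl) ?_ hf] at h
  · have e6 : pull X.p f = f := hf.2
    rw [e6, cup_neg] at h
    change D ε (X.hc f) = (-1 : ℤ) • X.hc (D ε f) + _ - _ at h
    rw [h]
    simp only [neg_smul, one_smul]
    abel
  · intro f hf
    funext L
    cases L with
    | nil => simp [commOp, cocycle]
    | cons w L =>
      have e1 : P.sgn ((-X.p : P →ₗ[K] P) w) = X.π w := by
        change P.sgn (-X.π w) = _
        rw [map_neg, X.sgn_π, neg_neg]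
      change barR ε (op1 X.ρ LinearMap.id f) (w :: L) -
        (-1 : ℤ) • op1 X.ρ LinearMap.id (barR ε f) (w :: L) -
        (-1 : ℤ) • op1 X.ρ LinearMap.id (actR ε (P.sgn ((-X.p : P →ₗ[K] P) w)) f) L = _
      rw [barR_op1 ε X.hd (X.isOp_op1.ml f hf.1), op1_barR ε X.hd hf.1, X.ρ_sgn, X.sgn_ρ, e1,
        hf.1.der_neg, map_neg, map_neg, actR_neg ε hf.1, map_neg]
      rcases L with _ | ⟨v, L⟩
      · simp [cocycle]
      · have e3 : f (X.ρ (P.sgn w * v) :: L) =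
            - f (X.π w * X.ρ v :: L) + f (X.ρ w * X.π v :: L) := by
          rw [X.ρ_mul, X.π_sgn, X.ρ_sgn, neg_mul, hf.1.cons_add, hf.1.cons_neg]
        have e4 : f (X.ρ w * X.π v :: L) = f (X.ρ w * v :: L) := by
          rw [← hf.cons X.π_π, map_mul, X.π_π, ← map_mul, hf.cons X.π_π]
        simp only [op1_cons, LinearMap.id_apply, der_apply, actR_cons, Pi.neg_apply, e3, e4,
          endOp_apply, cocycle, lin_cons_cons]
        simp

end OddSplitting

namespace EvenSplitting

variable {ε} (X : EvenSplitting ε)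

theorem J_eq {f : List P → B} (hf : Factors X.π f) : X.J f = inv f := by
  conv_rhs => rw [← hf.2, inv_eq_pull, pull_pull]
  have e : (X.m : P → P) = X.π ∘ P.sgn := by
    funext w
    change -X.π w = X.π (P.sgn w)
    rw [X.hs, map_neg]
  rw [J, e]

/-- The obstruction t'·bz lies in the kernel of π, so it is invisible to cochains that factor
through π. -/
theorem Q_eq {f : List P → B} (hf : Factors X.π f) : X.Q f = 0 := by
  have h : X.Q f = pre X.m 0 f :=
    pre_congr (S := {f | Factors X.π f}) _ (fun x f hf => hf.der_neg X.π_π x) (fun f hf => by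
      funext L
      rcases L with _ | ⟨u, _ | ⟨v, L⟩⟩
      · rfl
      · rfl
      · change f (X.t' * X.bz u v :: L) = 0
        rw [X.t'_mul, X.π_bz, ← hf.cons X.π_π, map_mul, X.π_t', mul_zero, hf.1.cons_zero]) hf
  rw [h, pre_zero]

theorem D_A {f : List P → B} (hf : Factors X.π f) :
    D ε (X.A f) = X.A (D ε f) + (cup (inv f) X.cocycle₁ - cup X.cocycle₁ f) := by
  have e := X.pre_p_cup_tw (op1 X.ρ LinearMap.id) f
  have e5 : op1 X.ρ LinearMap.id (cup (tw ε) f) = cup X.cocycle₁ f := by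
    funext L
    cases L with
    | nil => simp [cocycle₁]
    | cons w L =>
      rw [op1_cons, der_cup_tw, map_smul, cocycle₁, cup_lin_cons]
      rfl
  rw [e5] at e
  change X.A _ = cup _ (X.A f) + _ at e
  rw [D_eq_barR, D_eq_barR, map_add, e, X.barR_A hf.1, X.Q_eq hf, X.J_eq hf]
  abel

theorem isOp_op2 : IsOp (op2 (fun u v => X.bz u v) LinearMap.id : (List P → B) →ₗ[B] _)
    (X.dt + X.dt' + 1) := by
  have := HochschildCochain.isOp_op2 (B := B) X.bz_gr isOp_id
  rwa [zero_add, Nat.cast_add] at this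

/-- The homotopy between the two products with the two-cocycle. -/
def hc : (List P → B) →ₗ[B] (List P → B) := pre X.m (op2 (fun u v => X.bz u v) LinearMap.id)

theorem isOp_hc : IsOp X.hc (X.dt + X.dt' + 1) := X.isOp_op2.pre X.m_gr

/-- The same argument with bz applied to two neighbouring entries; the inner terms cancel by the
cocycle identity of bz. -/
theorem D_hc {f : List P → B} (hf : Factors X.π f) :
    D ε (X.hc f) + X.hc (D ε f) = cup X.cocycle₂ f - cup f X.cocycle₂ := by
  have h := X.D_pre_m (op2 (fun u v => X.bz u v) LinearMap.id)
    (commOp ε X.m (-1) (op2 (fun u v => X.bz u v) LinearMap.id)) X.isOp_op2.ml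
    (fun f hf => by simp [commOp])
    (fun f hf w L => by
      have e : P.sgn (X.m w) = X.π w := by
        rw [X.hs]
        exact neg_neg _
      change barR ε (op2 (fun u v => X.bz u v) LinearMap.id f) (w :: L) -
        (-1 : ℤ) • op2 (fun u v => X.bz u v) LinearMap.id (barR ε f) (w :: L) -
        (-1 : ℤ) • op2 (fun u v => X.bz u v) LinearMap.id (actR ε (P.sgn (X.m w)) f) L = _
      rw [e]
      simp) hf.1
  have e5 : op2 (fun u v => X.bz u v) LinearMap.id (cup (tw ε) f) = cup X.cocycle₂ f := by
    funext L
    rcases L with _ | ⟨w, _ | ⟨v, L⟩⟩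
    · simp [cocycle₂]
    · rw [op2_single, cocycle₂, cup_lin2_single]
    · rw [op2_cons, der_cup_tw, map_smul, cocycle₂, cup_lin2_cons_cons]
      rfl
  rw [e5, pre_eq_cup (φ := X.p) (π := X.π) (g := -X.cocycle₂) X.π_π
    (fun x => Or.inl rfl) ?_ hf] at h
  · have e6 : pull X.p f = f := hf.2
    rw [e6, cup_neg] at h
    change D ε (X.hc f) + X.hc (D ε f) = _ at h
    rw [h]
    abel
  · intro f hf
    funext L
    rcases L with _ | ⟨w, L⟩
    · simp [commOp, cocycle₂]
    · have e : P.sgn (X.m w) = X.π w := by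
        rw [X.hs]
        exact neg_neg _
      change barR ε (op2 (fun u v => X.bz u v) LinearMap.id f) (w :: L) -
        (-1 : ℤ) • op2 (fun u v => X.bz u v) LinearMap.id (barR ε f) (w :: L) -
        (-1 : ℤ) • op2 (fun u v => X.bz u v) LinearMap.id (actR ε (P.sgn (X.m w)) f) L = _
      rw [e]
      rcases L with _ | ⟨v, L⟩
      · rw [barR_op2_single ε X.hd (X.isOp_op2.ml f hf.1)]
        simp [cocycle₂]
      · rw [X.barR_op2_eq (X.isOp_op2.ml f hf.1) hf.1, X.op2_barR_eq hf.1]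
        rcases L with _ | ⟨z, L⟩
        · simp [cocycle₂]
        · have e := congrFun (X.bz_der (T := LinearMap.id) hf.1 w v z) L
          have e1 : f (X.bz w v * X.π z :: L) = f (X.bz w v * z :: L) := by
            rw [← hf.cons X.π_π, map_mul, X.π_π, ← map_mul, hf.cons X.π_π]
          simp only [LinearMap.id_apply, Pi.add_apply, Pi.sub_apply, Pi.zero_apply, der_apply,
            e1] at e
          simp only [op1_cons, op2_cons, actR_cons, der_apply, LinearMap.id_apply, endOp_apply,
            Pi.neg_apply, cocycle₂, lin2_cons_cons_cons, neg_zero, mul_zero]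
          rw [← e]
          simp only [neg_smul, one_smul]
          abel

/-- Only `t` inserted in front survives, and it is consumed by the one-cocycle. Then `t'` has to be
the first argument of bz, and the augmentation of bz(t',w) is that of ρ(w). -/
theorem S_cocycles : X.S (cup X.cocycle₁ X.cocycle₂) = X.cocycle₁ := by
  have h0 : ∀ w, der (X.π w) (cup X.cocycle₁ X.cocycle₂) = 0 := by
    intro w
    funext L
    rw [der_apply, cocycle₁, cup_lin_cons, X.ρ_π]
    simp
  have h1 : der X.t (cup X.cocycle₁ X.cocycle₂) = X.cocycle₂ := by
    funext L
    rw [der_apply, cocycle₁, cup_lin_cons, X.ρ_t]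
    simp
  have h2 : ∀ w, der (-X.π w) X.cocycle₂ = 0 := by
    intro w
    funext L
    rcases L with _ | ⟨v, _ | ⟨z, L⟩⟩ <;> simp [cocycle₂, X.π_bz']
  funext L
  cases L with
  | nil =>
    change der X.t (cup X.cocycle₁ X.cocycle₂) [X.t'] = _
    rw [h1]
    rfl
  | cons w L =>
    change X.ins (der X.t (cup X.cocycle₁ X.cocycle₂)) (w :: L) +
      X.S (der (X.π w) (cup X.cocycle₁ X.cocycle₂)) L = _
    have e : X.ins X.cocycle₂ (w :: L) =
      X.cocycle₂ (X.t' :: w :: L) + X.ins (der (-X.π w) X.cocycle₂) L := rfl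
    rw [h0, h1, e, h2, map_zero, map_zero]
    cases L <;> simp [cocycle₂, cocycle₁, X.aug_bz_t']

theorem R_cocycles : X.R (cup X.cocycle₁ X.cocycle₂) = 0 := by
  have h0 : ∀ w, der (X.π w) (cup X.cocycle₁ X.cocycle₂) = 0 := by
    intro w
    funext L
    rw [der_apply, cocycle₁, cup_lin_cons, X.ρ_π]
    simp
  have h1 : der X.t (cup X.cocycle₁ X.cocycle₂) = X.cocycle₂ := by
    funext L
    rw [der_apply, cocycle₁, cup_lin_cons, X.ρ_t]
    simp
  have h2 : X.J X.cocycle₂ = 0 := by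
    funext L
    rcases L with _ | ⟨w, _ | ⟨v, _ | ⟨z, L⟩⟩⟩ <;> simp [J, m, cocycle₂, X.bz_π]
  funext L
  cases L with
  | nil =>
    change X.J (der X.t (cup X.cocycle₁ X.cocycle₂)) [] = _
    rw [h1, h2]
  | cons w L =>
    change X.J (der X.t (cup X.cocycle₁ X.cocycle₂)) (w :: L) +
      X.R (der (X.π w) (cup X.cocycle₁ X.cocycle₂)) L = _
    rw [h0, h1, h2, map_zero]
    simp

end EvenSplitting

end Commute

section CommuteClass

variable {K : Type u} [CommRing K] {P : ChainAlgebra.{u, v} K} {Z : ChainAlgebra.{u, v} K}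
  {B : Type w} [Ring B] [Algebra K B] {ε : Hom P (ofAlgebra K B)} {ε' : Hom Z (ofAlgebra K B)}
  {k : Type*} [CommRing k] [Algebra k B]

theorem factors_pull {M : AugMor ε ε'} {N : AugMor ε' ε} {π : P → P}
    (h : ∀ w, N.φ (M.φ w) = π w) (h' : ∀ z, M.φ (N.φ z) = z) {f : List Z → B}
    (hf : IsMultilinear f) : Factors π (pull M.φ f) :=
  ⟨M.ml f hf, (pull_eq_pull_π h h' f).symm⟩

namespace OddSplitting

variable (X : OddSplitting ε)

theorem ξ_comm {M : AugMor ε ε'} {N : AugMor ε' ε} (h : ∀ w, N.φ (M.φ w) = X.π w)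
    (h' : ∀ z, M.φ (N.φ z) = z) (y : Coh k ε') :
    X.ξ k * M.pullH k y = M.pullH k y * X.ξ k := by
  induction y using Coh.induction with
  | h0 => simp
  | h1 n f hf =>
    have hF := factors_pull (π := X.π) h h' hf.ml
    have hc := M.isCocycle hf
    rw [AugMor.pullH_cls, ξ, cls_mul, cls_mul]
    have e : IsCocycle ε (n + 2) (cup X.cocycle (pull M.φ f)) := by
      rw [add_comm]; exact X.isCocycle.cup hc
    rw [cls_congr k (X.isCocycle.cup hc) e (add_comm _ _) rfl, cls_eq_iff]
    refine ⟨X.hc (pull M.φ f), X.isOp_hc.ml _ hc.ml, ?_, ?_⟩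
    · have := (X.isOp_hc _ hc.ml).2 _ hc.hasDeg
      rwa [show (n : ℤ) + 1 = ((n + 2 : ℕ) : ℤ) - 1 by push_cast; ring] at this
    · rw [← X.D_hc hF, hc.D_eq, map_zero, add_zero]
  | h2 x y hx hy => simp only [map_add, mul_add, add_mul, hx, hy]

end OddSplitting

namespace EvenSplitting

variable (X : EvenSplitting ε)

theorem bet_comm {M : AugMor ε ε'} {N : AugMor ε' ε} (h : ∀ w, N.φ (M.φ w) = X.π w)
    (h' : ∀ z, M.φ (N.φ z) = z) (y : Coh k ε') :
    X.bet k * M.pullH k y = M.pullH k y * X.bet k := by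
  induction y using Coh.induction with
  | h0 => simp
  | h1 n f hf =>
    have hF := factors_pull (π := X.π) h h' hf.ml
    have hc := M.isCocycle hf
    rw [AugMor.pullH_cls, bet, cls_mul, cls_mul]
    have e : IsCocycle ε (n + (X.dt + X.dt' + 2)) (cup X.cocycle₂ (pull M.φ f)) := by
      rw [add_comm]; exact X.isCocycle₂.cup hc
    rw [cls_congr k (X.isCocycle₂.cup hc) e (add_comm _ _) rfl, cls_eq_iff]
    refine ⟨X.hc (pull M.φ f), X.isOp_hc.ml _ hc.ml, ?_, ?_⟩
    · have := (X.isOp_hc _ hc.ml).2 _ hc.hasDeg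
      rwa [show (n : ℤ) + (X.dt + X.dt' + 1) = ((n + (X.dt + X.dt' + 2) : ℕ) : ℤ) - 1 by
        push_cast; ring] at this
    · rw [← X.D_hc hF, hc.D_eq, map_zero, add_zero]
  | h2 x y hx hy => simp only [map_add, mul_add, add_mul, hx, hy]

/-- The homotopy `A` compares `inv f ∪ λ` with `λ ∪ f`, and `inv` is the sign (-1)ⁿ on cochains of
degree n. -/
theorem lam_comm {M : AugMor ε ε'} {N : AugMor ε' ε} (h : ∀ w, N.φ (M.φ w) = X.π w)
    (h' : ∀ z, M.φ (N.φ z) = z) {n : ℕ} {y : Coh k ε'} (hy : y.IsHomog n) :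
    X.lam k * M.pullH k y = (-1 : ℤ) ^ n • (M.pullH k y * X.lam k) := by
  obtain ⟨f, hf, rfl⟩ := hy
  have hF := factors_pull (π := X.π) h h' hf.ml
  have hc := M.isCocycle hf
  have hi : inv (pull M.φ f) = (-1 : ℤ) ^ n • pull M.φ f := by
    rw [hc.hasDeg.inv_eq hc.ml]
    simp [Int.negOnePow_def]
  rw [AugMor.pullH_cls, lam, cls_mul, cls_mul, ← cls_zsmul]
  have e : IsCocycle ε (n + (X.dt + 1)) (cup X.cocycle₁ (pull M.φ f)) := by
    rw [add_comm]; exact X.isCocycle₁.cup hc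
  rw [cls_congr k (X.isCocycle₁.cup hc) e (add_comm _ _) rfl, eq_comm, cls_eq_iff]
  refine ⟨X.A (pull M.φ f), X.isOp_A.ml _ hc.ml, ?_, ?_⟩
  · have := (X.isOp_A _ hc.ml).2 _ hc.hasDeg
    rwa [show (n : ℤ) + X.dt = ((n + (X.dt + 1) : ℕ) : ℤ) - 1 by push_cast; ring] at this
  · rw [X.D_A hF, hc.D_eq, map_zero, zero_add, hi, smul_cup]

/-- The commuting homotopies need a factor that comes from the retract, and β does not. Instead λβ
is put through the decomposition: its restriction and λ-coefficient vanish, and its β-coefficient is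
λ. -/
theorem lam_mul_bet {M : AugMor ε ε'} {N : AugMor ε' ε} (h : ∀ w, N.φ (M.φ w) = X.π w)
    (h' : ∀ z, M.φ (N.φ z) = z) : X.lam k * X.bet k = X.bet k * X.lam k := by
  have hd := X.decomp (k := k) h (X.isCocycle₁.cup X.isCocycle₂)
  rw [← cls_mul] at hd
  have h1 : X.SH k (X.lam k * X.bet k) = X.lam k := by
    rw [lam, bet, cls_mul, SH, Coh.op_cls]
    exact cls_congr k _ _ (by omega) X.S_cocycles
  have h2 : X.RH k (X.lam k * X.bet k) = 0 := by
    rw [lam, bet, cls_mul, RH, Coh.op_cls, ← cls_zero k]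
    exact cls_congr k _ _ rfl X.R_cocycles
  change X.lam k * X.bet k = M.pullH k (N.pullH k (X.lam k * X.bet k)) +
    X.RH k (X.lam k * X.bet k) * X.lam k + X.bet k * X.SH k (X.lam k * X.bet k) at hd
  rw [h1, h2, map_mul, X.pull_lam h h', zero_mul, zero_mul, map_zero, zero_add, zero_add] at hd
  exact hd

/-- This is the case p = 2, in which t = t'. The relation holds already for cochains; equality of
`dt` and `dt'` makes the degrees agree. -/
theorem lam_sq_eq_bet (h : ∀ u v, ε.aug (X.bz u v) = ε.aug (X.ρ u) * ε.aug (X.ρ v))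
    (hdt : X.dt = X.dt') : X.lam k * X.lam k = X.bet k := by
  rw [lam, cls_mul, bet]
  refine cls_congr k _ _ (by omega) ?_
  funext L
  rcases L with _ | ⟨u, _ | ⟨v, L⟩⟩
  · simp [cocycle₁, cocycle₂]
  · rw [cocycle₁, cup_lin_cons]
    simp [cocycle₂]
  · rw [cocycle₁, cup_lin_cons]
    cases L <;> simp [cocycle₂, h]

/-- Think of μ as the coefficient of the divided square of t. The relation t² = 2t^[2] says that μ
fails to be a derivation by twice the product of the linear coefficients, so twice the square of the
cocycle is the coboundary of -μ. For p odd the 2 can be divided out. -/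
theorem lam_sq_eq_zero {μ : P →ₗ[K] B} (hμ : ∀ u v, μ (u * v) =
      ε.aug u * μ v + μ u * ε.aug v + 2 * (ε.aug (X.ρ u) * ε.aug (X.ρ v)))
    (hμg : ∀ i, ∀ x ∈ P.gr i, i ≠ 2 * X.dt → μ x = 0) :
    (2 : ℤ) • (X.lam k * X.lam k) = 0 := by
  rw [lam, cls_mul, ← cls_zsmul, cls_eq_zero_iff]
  have hm := isMultilinear_lin μ
  refine ⟨-lin μ, hm.neg, HasDeg.neg ?_, ?_⟩
  · have := hasDeg_iff.2 (hasDegree_lin hμg)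
    rwa [show ((2 * X.dt + 1 : ℕ) : ℤ) = ((X.dt + 1 + (X.dt + 1) : ℕ) : ℤ) - 1 by
      push_cast; ring] at this
  · have e3 : D ε (-lin μ) = - D ε (lin μ) := by simpa using D_smul ε (-1 : ℤ) (lin μ)
    rw [e3, D_eq_barR]
    have h0 : ∀ w v, der v (der w (lin μ)) = 0 := fun w v => rfl
    funext L
    rcases L with _ | ⟨w, _ | ⟨v, _ | ⟨z, L⟩⟩⟩
    · simp [tw, cocycle₁]
    · rw [Pi.smul_apply, cocycle₁, cup_lin_cons]
      simp [-cup_cons, cup_tw_cons, barR_cons' ε X.hd hm]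
    · rw [Pi.smul_apply, cocycle₁, cup_lin_cons]
      simp only [Pi.neg_apply, Pi.add_apply, cup_tw_cons, barR_cons' ε X.hd hm,
        barR_cons' ε X.hd (hm.der _), h0, map_zero, Pi.zero_apply, actR_cons, actR_nil, der_apply,
        lin_single, X.hs, neg_mul, map_neg, hμ]
      rw [two_mul, two_zsmul]
      simp only [mul_neg, neg_neg, add_zero]
      abel
    · rw [Pi.smul_apply, cocycle₁, cup_lin_cons]
      simp [-cup_cons, cup_tw_cons, barR_cons' ε X.hd hm, barR_cons' ε X.hd (hm.der _), h0]

end EvenSplitting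

end CommuteClass

end HochschildCochain

end

section

open ChainAlgebra HochschildCochain

/-! ### Twisted polynomial algebras -/

/-- Structure constants of a multiplication `e_i e_j = c(i, j) e_{i + j}`. -/
structure StructureConstants where
  c : ℕ → ℕ → ℕ
  zero_left : ∀ j, c 0 j = 1
  zero_right : ∀ i, c i 0 = 1
  assoc : ∀ i j k, c i j * c (i + j) k = c j k * c i (j + k)

/-- The summands of `TwistedPoly`. -/
@[nolint unusedArguments]
def TwistedPolyFam (_ : StructureConstants) (A : Type u) (_ : ℕ) : Type u := A

namespace TwistedPolyFam

variable (C : StructureConstants) (A : Type u) [Ring A]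

instance (i : ℕ) : AddCommGroup (TwistedPolyFam C A i) := inferInstanceAs (AddCommGroup A)

instance {K : Type*} [CommRing K] [Algebra K A] (i : ℕ) : Module K (TwistedPolyFam C A i) :=
  inferInstanceAs (Module K A)

theorem mk_ext {i j : ℕ} {a b : A} (h : i = j) (e : a = b) :
    GradedMonoid.mk (A := TwistedPolyFam C A) i a = GradedMonoid.mk j b := by
  subst h; subst e; rfl

/-- The product `e_i e_j`-component. -/
def mulFun (i j : ℕ) (a b : A) : A := C.c i j • (a * b)

instance : GradedMonoid.GOne (TwistedPolyFam C A) := ⟨(1 : A)⟩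

instance : GradedMonoid.GMul (TwistedPolyFam C A) := ⟨fun {i j} => mulFun C A i j⟩

instance : DirectSum.GRing (TwistedPolyFam C A) where
  one_mul := by
    rintro ⟨i, (a : A)⟩
    refine mk_ext C A (zero_add i) ?_
    change C.c 0 i • ((1 : A) * a) = a
    rw [C.zero_left, one_smul, one_mul]
  mul_one := by
    rintro ⟨i, (a : A)⟩
    refine mk_ext C A (add_zero i) ?_
    change C.c i 0 • (a * 1) = a
    rw [C.zero_right, one_smul, mul_one]
  mul_assoc := by
    rintro ⟨i, (a : A)⟩ ⟨j, (b : A)⟩ ⟨k, (c : A)⟩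
    refine mk_ext C A (add_assoc i j k) ?_
    change C.c (i + j) k • ((C.c i j • (a * b)) * c) =
      C.c i (j + k) • (a * (C.c j k • (b * c)))
    rw [smul_mul_assoc, mul_smul_comm, smul_smul, smul_smul, mul_assoc, mul_comm (C.c (i + j) k),
      C.assoc, mul_comm (C.c j k)]
  mul_zero {i j} (a : A) := by
    change C.c i j • (a * 0) = 0
    simp
  zero_mul {i j} (a : A) := by
    change C.c i j • (0 * a) = 0
    simp
  mul_add {i j} (a b c : A) := by
    change C.c i j • (a * (b + c)) = C.c i j • (a * b) + C.c i j • (a * c)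
    rw [mul_add, smul_add]
  add_mul {i j} (a b c : A) := by
    change C.c i j • ((a + b) * c) = C.c i j • (a * c) + C.c i j • (b * c)
    rw [add_mul, smul_add]
  natCast n := (n : A)
  natCast_zero := Nat.cast_zero (R := A)
  natCast_succ := Nat.cast_succ (R := A)
  intCast n := (n : A)
  intCast_ofNat := Int.cast_natCast (R := A)
  intCast_negSucc_ofNat := Int.cast_negSucc (R := A)

instance {K : Type*} [CommRing K] [Algebra K A] : DirectSum.GAlgebra K (TwistedPolyFam C A) where
  toFun := (algebraMap K A : K →+ A)
  map_one := map_one (algebraMap K A)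
  map_mul r s := by
    refine mk_ext C A rfl ?_
    change algebraMap K A (r * s) = C.c 0 0 • (algebraMap K A r * algebraMap K A s)
    rw [C.zero_left, one_smul, map_mul]
  commutes := by
    rintro r ⟨i, (a : A)⟩
    refine mk_ext C A (add_comm 0 i) ?_
    change C.c 0 i • (algebraMap K A r * a) = C.c i 0 • (a * algebraMap K A r)
    rw [C.zero_left, C.zero_right, Algebra.commutes r a]
  smul_def := by
    rintro r ⟨i, (a : A)⟩
    refine mk_ext C A (zero_add i).symm ?_
    change r • a = C.c 0 i • (algebraMap K A r * a)
    rw [C.zero_left, one_smul, Algebra.smul_def]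

end TwistedPolyFam

/-- The algebra `⨁ A e_i` with `e_i e_j = c(i, j) e_{i + j}` and the `e_i` central. -/
def TwistedPoly (C : StructureConstants) (A : Type u) [Ring A] : Type u :=
  DirectSum ℕ (TwistedPolyFam C A)

namespace TwistedPoly

variable (C : StructureConstants) (A : Type u) [Ring A]

noncomputable instance : Ring (TwistedPoly C A) :=
  inferInstanceAs (Ring (DirectSum ℕ (TwistedPolyFam C A)))

noncomputable instance {K : Type*} [CommRing K] [Algebra K A] : Algebra K (TwistedPoly C A) :=
  inferInstanceAs (Algebra K (DirectSum ℕ (TwistedPolyFam C A)))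

variable {A}

/-- The element `a e_i`. -/
noncomputable def mon (i : ℕ) : A →+ TwistedPoly C A :=
  DirectSum.of (TwistedPolyFam C A) i

theorem mon_mul (i j : ℕ) (a b : A) :
    mon C i a * mon C j b = mon C (i + j) (C.c i j • (a * b)) :=
  DirectSum.of_mul_of (A := TwistedPolyFam C A) _ _

theorem mon_one : mon C 0 (1 : A) = 1 := rfl

variable {C}

theorem induction {F : TwistedPoly C A → Prop} (h0 : F 0) (h1 : ∀ i a, F (mon C i a))
    (h2 : ∀ x y, F x → F y → F (x + y)) (x : TwistedPoly C A) : F x :=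
  DirectSum.induction_on (β := TwistedPolyFam C A) x h0 h1 h2

theorem addHom_ext {M : Type*} [AddCommMonoid M] {f g : TwistedPoly C A →+ M}
    (h : ∀ i a, f (mon C i a) = g (mon C i a)) : f = g :=
  DirectSum.addHom_ext (β := TwistedPolyFam C A) h

/-- The additive map with prescribed values on the `a e_i`. -/
noncomputable def liftA {M : Type*} [AddCommMonoid M] (f : ∀ _ : ℕ, A →+ M) :
    TwistedPoly C A →+ M :=
  DirectSum.toAddMonoid (β := TwistedPolyFam C A) f

@[simp] theorem liftA_mon {M : Type*} [AddCommMonoid M] (f : ∀ _ : ℕ, A →+ M) (i : ℕ) (a : A) :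
    liftA f (mon C i a) = f i a :=
  DirectSum.toAddMonoid_of (β := TwistedPolyFam C A) f i a

theorem map_mul_of_mon {S : Type*} [Ring S] {f : TwistedPoly C A →+ S}
    (h : ∀ i j a b, f (mon C i a * mon C j b) = f (mon C i a) * f (mon C j b))
    (x y : TwistedPoly C A) : f (x * y) = f x * f y := by
  induction x using induction with
  | h0 => simp
  | h1 i a =>
    induction y using induction with
    | h0 => simp
    | h1 j b => exact h i j a b
    | h2 y z hy hz => simp only [mul_add, map_add, hy, hz]
  | h2 x z hx hz => simp only [add_mul, map_add, hx, hz]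

/-- The coefficient of `e_i`. -/
noncomputable def coef (i : ℕ) : TwistedPoly C A →+ A :=
  liftA fun j => if j = i then AddMonoidHom.id A else 0

theorem coef_mon (i j : ℕ) (a : A) : coef i (mon C j a) = if j = i then a else 0 := by
  rw [coef, liftA_mon]
  split_ifs <;> rfl

theorem coef_mon_self (i : ℕ) (a : A) : coef i (mon C i a) = a := by rw [coef_mon, if_pos rfl]

theorem coef_eq (i : ℕ) (x : TwistedPoly C A) :
    coef i x = (show DirectSum ℕ (TwistedPolyFam C A) from x) i := by
  induction x using induction with
  | h0 => rw [map_zero]; rfl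
  | h1 j a =>
    rw [coef_mon]
    split_ifs with h
    · subst h
      exact (DirectSum.of_eq_same (β := TwistedPolyFam C A) j a).symm
    · exact (DirectSum.of_eq_of_ne (β := TwistedPolyFam C A) j i a (Ne.symm h)).symm
  | h2 x y hx hy => rw [map_add, hx, hy]; rfl

theorem ext {x y : TwistedPoly C A} (h : ∀ i, coef i x = coef i y) : x = y := by
  refine DFinsupp.ext (β := TwistedPolyFam C A) fun i => ?_
  have := h i
  rw [coef_eq, coef_eq] at this
  exact this

section Linear

variable {K : Type*} [CommRing K] [Algebra K A]

theorem smul_mon (r : K) (i : ℕ) (a : A) : r • mon C i a = mon C i (r • a) :=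
  (map_smul (DirectSum.lof K ℕ (TwistedPolyFam C A) i) r a).symm

theorem coef_smul (r : K) (i : ℕ) (x : TwistedPoly C A) : coef i (r • x) = r • coef i x := by
  induction x using induction with
  | h0 => simp
  | h1 j a =>
    rw [smul_mon, coef_mon, coef_mon]
    split_ifs <;> simp
  | h2 x y hx hy => simp only [smul_add, map_add, hx, hy]

/-- An additive map that is linear on the `a e_i` is linear. -/
noncomputable def toLin {M : Type*} [AddCommGroup M] [Module K M] (f : TwistedPoly C A →+ M)
    (h : ∀ (r : K) i a, f (mon C i (r • a)) = r • f (mon C i a)) : TwistedPoly C A →ₗ[K] M :=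
  { f with
    map_smul' := fun r x => by
      change f (r • x) = r • f x
      induction x using induction with
      | h0 => simp
      | h1 i a => rw [smul_mon, h]
      | h2 x y hx hy => rw [smul_add, map_add, map_add, hx, hy, smul_add] }

@[simp] theorem toLin_apply {M : Type*} [AddCommGroup M] [Module K M] (f : TwistedPoly C A →+ M)
    (h : ∀ (r : K) i a, f (mon C i (r • a)) = r • f (mon C i a)) (x : TwistedPoly C A) :
    toLin f h x = f x := rfl

/-- The bilinear map `e_i, e_j ↦ γ(i, j) e_{s(i, j)}`. -/
noncomputable def bilinear (γ : ℕ → ℕ → K) (s : ℕ → ℕ → ℕ) :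
    TwistedPoly C A →ₗ[K] TwistedPoly C A →ₗ[K] TwistedPoly C A :=
  LinearMap.mk₂ K
    (fun x y => liftA (fun i => AddMonoidHom.flip (liftA fun j =>
      AddMonoidHom.mk' (fun b => AddMonoidHom.mk' (fun a => mon C (s i j) (γ i j • (a * b)))
        (fun a a' => by rw [add_mul, smul_add, map_add]))
        (fun b b' => by ext a; simp [mul_add]))) x y)
    (fun x x' y => by rw [map_add, AddMonoidHom.add_apply])
    (fun r x y => by
      induction x using induction with
      | h0 => simp
      | h1 i a =>
        induction y using induction with
        | h0 => simp
        | h1 j b => simp [smul_mon, smul_comm r (γ i j)]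
        | h2 y z hy hz => simp only [map_add, hy, hz, smul_add]
      | h2 x z hx hz => simp only [smul_add, map_add, AddMonoidHom.add_apply, hx, hz])
    (fun x y y' => by rw [map_add])
    (fun r x y => by
      induction x using induction with
      | h0 => simp
      | h1 i a =>
        induction y using induction with
        | h0 => simp
        | h1 j b => simp [smul_mon, smul_comm r (γ i j)]
        | h2 y z hy hz => simp only [map_add, hy, hz, smul_add]
      | h2 x z hx hz => simp only [smul_add, map_add, AddMonoidHom.add_apply, hx, hz])

@[simp] theorem bilinear_mon (γ : ℕ → ℕ → K) (s : ℕ → ℕ → ℕ) (i j : ℕ) (a b : A) :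
    bilinear γ s (mon C i a) (mon C j b) = mon C (s i j) (γ i j • (a * b)) := by
  simp [bilinear]

/-- The grading with `e_i` in degree `D i`. -/
noncomputable def gr (C : StructureConstants) (A : Type u) [Ring A] [Algebra K A] (D n : ℕ) :
    Submodule K (TwistedPoly C A) where
  carrier := {x | ∀ i, D * i ≠ n → coef i x = 0}
  zero_mem' := fun _ _ => map_zero _
  add_mem' := fun hx hy i hi => by rw [map_add, hx i hi, hy i hi, add_zero]
  smul_mem' := fun r x hx i hi => by rw [coef_smul, hx i hi, smul_zero]

variable (K) in
theorem mon_mem (D i : ℕ) (a : A) : mon C i a ∈ gr (K := K) C A D (D * i) := by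
  intro j hj
  rw [coef_mon, if_neg]
  rintro rfl
  exact hj rfl

/-- With `D > 0` distinct indices have distinct degrees, so a homogeneous element is a single
monomial. All later checks on homogeneous elements go through this. -/
theorem gr_cases {D n : ℕ} (hD : 0 < D) {x : TwistedPoly C A} (hx : x ∈ gr (K := K) C A D n) :
    x = 0 ∨ ∃ i a, n = D * i ∧ x = mon C i a := by
  by_cases h : ∃ i, n = D * i
  · obtain ⟨i, rfl⟩ := h
    refine Or.inr ⟨i, coef i x, rfl, ext fun j => ?_⟩
    rw [coef_mon]
    split_ifs with h
    · rw [h]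
    · exact hx j fun h' => h (Nat.eq_of_mul_eq_mul_left hD h').symm
  · refine Or.inl (ext fun j => ?_)
    rw [map_zero]
    exact hx j fun h' => h ⟨j, h'.symm⟩

/-- `gr` is a grading. -/
@[reducible]
noncomputable def gradedAlgebra (D : ℕ) (hD : 0 < D) : GradedAlgebra (gr (K := K) C A D) where
  one_mem := mon_mem K D 0 1
  mul_mem := by
    intro m n x y hx hy
    rcases gr_cases hD hx with rfl | ⟨i, a, rfl, rfl⟩
    · rw [zero_mul]; exact Submodule.zero_mem _
    rcases gr_cases hD hy with rfl | ⟨j, b, rfl, rfl⟩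
    · rw [mul_zero]; exact Submodule.zero_mem _
    rw [mon_mul, ← mul_add]
    exact mon_mem K D _ _
  toDecomposition := DirectSum.Decomposition.ofAddHom _
    (liftA fun i => (DirectSum.of (fun n => gr (K := K) C A D n) (D * i)).comp
      (AddMonoidHom.mk' (fun a => ⟨mon C i a, mon_mem K D i a⟩) fun a b =>
        Subtype.ext (map_add _ a b)))
    (by
      refine addHom_ext fun i a => ?_
      simp)
    (by
      refine DirectSum.addHom_ext fun n x => ?_
      obtain ⟨x, hx⟩ := x
      simp only [AddMonoidHom.comp_apply, DirectSum.coeAddMonoidHom_of, AddMonoidHom.id_apply]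
      rcases gr_cases hD hx with rfl | ⟨i, a, rfl, rfl⟩
      · rw [map_zero, eq_comm]
        exact map_zero (DirectSum.of (fun n => gr (K := K) C A D n) n)
      · rw [liftA_mon]
        rfl)

end Linear

end TwistedPoly

end

/-! ### Restriction to the multiples of m, and twisted polynomials as chain algebras -/

section

open ChainAlgebra HochschildCochain

namespace TwistedPoly

section Maps

variable {C C' : StructureConstants} {A : Type u} [Ring A] {K : Type v} [CommRing K] [Algebra K A]

/-- The linear map with prescribed values on the `a e_i`. -/
noncomputable def liftL {M : Type*} [AddCommGroup M] [Module K M] (f : ∀ _ : ℕ, A →ₗ[K] M) :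
    TwistedPoly C A →ₗ[K] M :=
  toLin (liftA fun i => (f i).toAddMonoidHom) fun r i a => by simp

@[simp] theorem liftL_mon {M : Type*} [AddCommGroup M] [Module K M] (f : ∀ _ : ℕ, A →ₗ[K] M)
    (i : ℕ) (a : A) : (liftL f : TwistedPoly C A →ₗ[K] M) (mon C i a) = f i a := by
  simp [liftL]

variable (K) in
/-- `mon` as a linear map. -/
noncomputable def monL (C : StructureConstants) (i : ℕ) : A →ₗ[K] TwistedPoly C A :=
  { mon C i with map_smul' := fun r a => (smul_mon r i a).symm }

@[simp] theorem monL_apply (i : ℕ) (a : A) : monL K C i a = mon C i a := rfl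

/-- A linear map that is multiplicative on the `a e_i` as an algebra map. -/
noncomputable def toAlgHom {S : Type*} [Ring S] [Algebra K S] (f : TwistedPoly C A →ₗ[K] S)
    (h1 : f (mon C 0 1) = 1)
    (h : ∀ i j a b, f (mon C (i + j) (C.c i j • (a * b))) = f (mon C i a) * f (mon C j b)) :
    TwistedPoly C A →ₐ[K] S :=
  AlgHom.ofLinearMap f h1 fun x y =>
    map_mul_of_mon (f := f.toAddMonoidHom) (fun i j a b => by
      rw [mon_mul]; exact h i j a b) x y

@[simp] theorem toAlgHom_apply {S : Type*} [Ring S] [Algebra K S] (f : TwistedPoly C A →ₗ[K] S)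
    (h1 : f (mon C 0 1) = 1)
    (h : ∀ i j a b, f (mon C (i + j) (C.c i j • (a * b))) = f (mon C i a) * f (mon C j b))
    (x : TwistedPoly C A) : toAlgHom f h1 h x = f x := rfl

theorem lmap_ext {M : Type*} [AddCommGroup M] [Module K M] {f g : TwistedPoly C A →ₗ[K] M}
    (h : ∀ i a, f (mon C i a) = g (mon C i a)) : f = g :=
  LinearMap.toAddMonoidHom_injective (addHom_ext h)

variable (K) in
/-- `C'` is obtained from `C` by restriction to the multiples of `m`, compatibly with the
projection. -/
structure _root_.StructureConstants.IsRestriction (m : ℕ) (C C' : StructureConstants) : Prop where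
  pos : 0 < m
  eq : ∀ i j, ((C.c (m * i) (m * j) : ℕ) : K) = (C'.c i j : ℕ)
  zero : ∀ i j, m ∣ i + j → ¬ m ∣ i → ((C.c i j : ℕ) : K) = 0

variable {m : ℕ}

theorem nsmul_congr {c c' : ℕ} (h : (c : K) = c') (a : A) : c • a = c' • a := by
  rw [← Nat.cast_smul_eq_nsmul K, h, Nat.cast_smul_eq_nsmul]

/-- The inclusion `e_i ↦ e_{m i}`. -/
noncomputable def up (h : C.IsRestriction K m C') : TwistedPoly C' A →ₐ[K] TwistedPoly C A :=
  toAlgHom (liftL fun i => monL K C (m * i)) (by rw [liftL_mon]; simp [mon_one]) fun i j a b => by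
    simp [mon_mul, mul_add, nsmul_congr (h.eq i j)]

@[simp] theorem up_mon (h : C.IsRestriction K m C') (i : ℕ) (a : A) :
    up h (mon C' i a) = mon C (m * i) a := by
  simp [up]

/-- The projection `e_{m i} ↦ e_i`. -/
noncomputable def down (h : C.IsRestriction K m C') : TwistedPoly C A →ₐ[K] TwistedPoly C' A :=
  toAlgHom (liftL fun i => if m ∣ i then monL K C' (i / m) else 0)
    (by rw [liftL_mon]; simp [mon_one])
    fun i j a b => by
      have hm := h.pos
      by_cases hi : m ∣ i
      · by_cases hj : m ∣ j
        · obtain ⟨i, rfl⟩ := hi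
          obtain ⟨j, rfl⟩ := hj
          rw [liftL_mon, if_pos (dvd_add (dvd_mul_right _ _) (dvd_mul_right _ _)), ← mul_add]
          simp [mon_mul, nsmul_congr (h.eq i j), Nat.mul_div_cancel_left _ hm]
        · have : ¬ m ∣ i + j := fun h' => hj ((Nat.dvd_add_right hi).1 h')
          simp [hj, this]
      -- Here two discarded monomials could have a product that is kept; the structure constant is
      -- zero in `K` in that case, which is what makes the projection multiplicative.
      · by_cases hij : m ∣ i + j
        · have h0 := nsmul_congr (c' := 0) ((h.zero i j hij hi).trans Nat.cast_zero.symm) (a * b)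
          rw [h0]
          simp [hi]
        · simp [hi, hij]

theorem down_mon (h : C.IsRestriction K m C') (i : ℕ) (a : A) :
    down h (mon C i a) = if m ∣ i then mon C' (i / m) a else 0 := by
  simp only [down, toAlgHom_apply, liftL_mon]
  split_ifs <;> rfl

theorem down_up (h : C.IsRestriction K m C') (z : TwistedPoly C' A) : down h (up h z) = z := by
  have : (down h).toLinearMap ∘ₗ (up h).toLinearMap = LinearMap.id (R := K) (M := TwistedPoly C' A) := by
    refine lmap_ext fun i a => ?_
    simp [down_mon, Nat.mul_div_cancel_left _ h.pos]
  exact LinearMap.congr_fun this z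

theorem up_down_mon (h : C.IsRestriction K m C') (i : ℕ) (a : A) :
    up h (down h (mon C i a)) = if m ∣ i then mon C i a else 0 := by
  rw [down_mon]
  split_ifs with hi
  · rw [up_mon, Nat.mul_div_cancel' hi]
  · simp

end Maps

section Chain

variable (K : Type v) [CommRing K] (C C' : StructureConstants) (A : Type u) [Ring A] [Algebra K A]

/-- Twisted polynomials as a chain algebra with zero differential, `e_i` having degree `D i`. -/
@[reducible]
noncomputable def chain (D : ℕ) (hD : 0 < D) : ChainAlgebra.{v, u} K :=
  letI := gradedAlgebra (K := K) (C := C) (A := A) D hD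
  { carrier := TwistedPoly C A
    gr := gr C A D
    d := 0
    d_gr_zero := fun _ _ => rfl
    d_gr_succ := fun _ _ _ => Submodule.zero_mem _
    d_d := fun _ => rfl
    leibniz := fun _ _ _ _ => by simp }

/-- The coefficient of `e_0` as an algebra map. -/
noncomputable def coef₀ : TwistedPoly C A →ₐ[K] A :=
  toAlgHom (liftL fun i => if i = 0 then LinearMap.id else 0) (by simp) fun i j a b => by
    rcases Nat.eq_zero_or_pos i with rfl | hi
    · rcases Nat.eq_zero_or_pos j with rfl | hj
      · simp [C.zero_left]
      · simp [hj.ne']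
    · simp [hi.ne']

variable {A} in
theorem coef₀_mon (i : ℕ) (a : A) : coef₀ K C A (mon C i a) = if i = 0 then a else 0 := by
  simp only [coef₀, toAlgHom_apply, liftL_mon]
  split_ifs <;> rfl

theorem coef₀_gr {D : ℕ} (hD : 0 < D) (n : ℕ) (x : TwistedPoly C A) (hx : x ∈ gr (K := K) C A D n) :
    coef₀ K C A x ∈ concGr K A n := by
  rcases gr_cases hD hx with rfl | ⟨i, a, rfl, rfl⟩
  · rw [map_zero]; exact Submodule.zero_mem _
  rw [coef₀_mon]
  rcases Nat.eq_zero_or_pos i with rfl | hi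
  · simp only [if_true]; exact Submodule.mem_top
  · rw [if_neg hi.ne']; exact Submodule.zero_mem _

/-- The augmentation of `chain`. -/
noncomputable def aug (D : ℕ) (hD : 0 < D) : Hom (chain K C A D hD) (ofAlgebra K A) where
  toAlgHom := coef₀ K C A
  map_gr := coef₀_gr K C A hD
  map_d _ := map_zero (coef₀ K C A)

@[simp] theorem aug_apply (D : ℕ) (hD : 0 < D) (x : chain K C A D hD) :
    (aug K C A D hD).aug x = coef₀ K C A x := rfl

theorem sgn_mon (D : ℕ) (hD : 0 < D) (i : ℕ) (a : A) :
    (chain K C A D hD).sgn (mon C i a) = (-1 : K) ^ (D * i + 1) • mon C i a :=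
  (chain K C A D hD).sgn_of_mem (mon_mem K D i a)

variable {C C'} {K} {m D D' : ℕ} (hD : 0 < D) (hD' : 0 < D') (h : C.IsRestriction K m C')
  (e : D' = D * m)

/-- `up` as a morphism. -/
noncomputable def upMor : AugMor (aug K C' A D' hD') (aug K C A D hD) :=
  Hom.toAugMor
    { toAlgHom := up h
      map_gr := fun n x hx => by
        rcases gr_cases hD' hx with rfl | ⟨i, a, rfl, rfl⟩
        · rw [map_zero]; exact Submodule.zero_mem _
        · rw [up_mon, e, mul_assoc]
          exact mon_mem K D _ a
      map_d := fun x => map_zero (up h) }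
    (fun x => by
      change (coef₀ K C A).toLinearMap.comp (up h).toLinearMap x = (coef₀ K C' A).toLinearMap x
      congr 1
      refine lmap_ext fun i a => ?_
      simp [coef₀_mon, h.pos.ne'])

/-- `down` as a morphism. -/
noncomputable def downMor : AugMor (aug K C A D hD) (aug K C' A D' hD') :=
  Hom.toAugMor
    { toAlgHom := down h
      map_gr := fun n x hx => by
        rcases gr_cases hD hx with rfl | ⟨i, a, rfl, rfl⟩
        · rw [map_zero]; exact Submodule.zero_mem _
        · rw [down_mon]
          split_ifs with hi
          · obtain ⟨i, rfl⟩ := hi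
            rw [Nat.mul_div_cancel_left _ h.pos, ← mul_assoc, ← e]
            exact mon_mem K D' _ a
          · exact Submodule.zero_mem _
      map_d := fun x => map_zero (down h) }
    (fun x => by
      change (coef₀ K C' A).toLinearMap.comp (down h).toLinearMap x = (coef₀ K C A).toLinearMap x
      congr 1
      refine lmap_ext fun i a => ?_
      simp only [LinearMap.comp_apply, AlgHom.toLinearMap_apply, down_mon, coef₀_mon]
      split_ifs with h1 h2 h3
      · rw [coef₀_mon]
        obtain ⟨i, rfl⟩ := h1
        simp [h.pos.ne'] at h2
        simp [h2]
      · rw [coef₀_mon]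
        obtain ⟨i, rfl⟩ := h1
        simp [h.pos.ne'] at h2
        simp [h.pos, h2]
      · subst h3
        exact absurd (dvd_zero _) h1
      · simp)

theorem upMor_apply (x) : (upMor A hD hD' h e).φ x = up h x := rfl

theorem downMor_apply (x) : (downMor A hD hD' h e).φ x = down h x := rfl

theorem downMor_upMor (x) : (downMor A hD hD' h e).φ ((upMor A hD hD' h e).φ x) = x := down_up h x

end Chain

end TwistedPoly

end

/-! ### Divided powers, and the splitting of an exterior generator -/

section

open ChainAlgebra HochschildCochain

/-- Divided powers. -/
def StructureConstants.gamma : StructureConstants where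
  c i j := (i + j).choose i
  zero_left j := by simp
  zero_right i := by simp
  assoc i j k := by
    have h := Nat.choose_mul (n := i + j + k) (k := i + j) (s := i) (by omega)
    rw [show i + j + k - i = j + k by omega, show i + j - i = j by omega] at h
    rw [mul_comm, h, mul_comm, add_assoc]

open StructureConstants

theorem StructureConstants.gamma_c (i j : ℕ) : gamma.c i j = (i + j).choose i := rfl

/-- Divided powers tensored with an exterior algebra on one generator. -/
def StructureConstants.lambdaGamma : StructureConstants where
  c i j := if i % 2 + j % 2 = 2 then 0 else gamma.c (i / 2) (j / 2)
  zero_left j := by rw [if_neg (by omega)]; simp [gamma_c]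
  zero_right i := by rw [if_neg (by omega)]; simp [gamma_c]
  assoc i j k := by
    have h := StructureConstants.gamma.assoc (i / 2) (j / 2) (k / 2)
    rcases Nat.mod_two_eq_zero_or_one i with hi | hi <;>
      rcases Nat.mod_two_eq_zero_or_one j with hj | hj <;>
        rcases Nat.mod_two_eq_zero_or_one k with hk | hk <;>
          simp [hi, hj, hk, Nat.add_mod, Nat.add_div, h]

theorem StructureConstants.lambdaGamma_c (i j : ℕ) :
    lambdaGamma.c i j = if i % 2 + j % 2 = 2 then 0 else gamma.c (i / 2) (j / 2) := rfl

/-- The index encodes the degree: e_{2j} is y^[j] and e_{2j+1} is x y^[j]. A sum of two odd indices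
is even, but the product vanishes because x² = 0. -/
theorem isRestriction_lambdaGamma (K : Type*) [CommRing K] :
    lambdaGamma.IsRestriction K 2 gamma where
  pos := two_pos
  eq i j := by simp [lambdaGamma_c]
  zero i j h h' := by
    rw [lambdaGamma_c, if_pos (by omega), Nat.cast_zero]

section Prime

variable (p : ℕ) [hp : Fact p.Prime]

theorem ZMod.choose_eq (n k : ℕ) : ((n.choose k : ℕ) : ZMod p) =
    ((n % p).choose (k % p) * (n / p).choose (k / p) : ℕ) :=
  (ZMod.natCast_eq_natCast_iff _ _ _).2 Choose.choose_modEq_choose_mod_mul_choose_div_nat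

/-- Lucas' congruence. The monomials with index divisible by p form a copy of the divided power
algebra that is also a quotient; this self-similarity produces the infinite tower. -/
theorem isRestriction_gamma : gamma.IsRestriction (ZMod p) p gamma where
  pos := hp.out.pos
  eq i j := by
    rw [gamma_c, gamma_c, ← mul_add, ZMod.choose_eq]
    simp [Nat.mul_div_cancel_left _ hp.out.pos]
  zero i j h h' := by
    rw [gamma_c, ZMod.choose_eq, Nat.mod_eq_zero_of_dvd h, Nat.choose_eq_zero_of_lt]
    · simp
    · exact Nat.pos_of_ne_zero fun h0 => h' (Nat.dvd_of_mod_eq_zero h0)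

end Prime

namespace TwistedPoly

section Odd

variable (K : Type v) [CommRing K] (A : Type u) [Ring A] [Algebra K A]

theorem induction_parity {A : Type u} [Ring A] {F : TwistedPoly lambdaGamma A → Prop} (h0 : F 0)
    (he : ∀ i a, F (mon lambdaGamma (2 * i) a)) (ho : ∀ i a, F (mon lambdaGamma (2 * i + 1) a))
    (h2 : ∀ x y, F x → F y → F (x + y)) (x : TwistedPoly lambdaGamma A) : F x := by
  induction x using induction with
  | h0 => exact h0
  | h1 i a => rcases Nat.even_or_odd' i with ⟨i, rfl | rfl⟩ <;> simp only [he, ho]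
  | h2 x y hx hy => exact h2 x y hx hy

section Products

variable {A : Type u} [Ring A] (i j : ℕ) (a b : A)

theorem even_mul_even : mon lambdaGamma (2 * i) a * mon lambdaGamma (2 * j) b =
    mon lambdaGamma (2 * (i + j)) (gamma.c i j • (a * b)) := by
  rw [mon_mul, lambdaGamma_c, if_neg (by omega), mul_add]; simp

theorem even_mul_odd : mon lambdaGamma (2 * i) a * mon lambdaGamma (2 * j + 1) b =
    mon lambdaGamma (2 * (i + j) + 1) (gamma.c i j • (a * b)) := by
  rw [mon_mul, lambdaGamma_c, if_neg (by omega), mul_add, add_assoc,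
    show (2 * j + 1) / 2 = j by omega]; simp

theorem odd_mul_even : mon lambdaGamma (2 * i + 1) a * mon lambdaGamma (2 * j) b =
    mon lambdaGamma (2 * (i + j) + 1) (gamma.c i j • (a * b)) := by
  rw [mon_mul, lambdaGamma_c, if_neg (by omega), mul_add, add_right_comm,
    show (2 * i + 1) / 2 = i by omega]; simp

theorem odd_mul_odd : mon lambdaGamma (2 * i + 1) a * mon lambdaGamma (2 * j + 1) b = 0 := by
  rw [mon_mul, lambdaGamma_c, if_pos (by omega)]; simp

end Products

/-- The coefficient of the odd generator. -/
noncomputable def ρodd : TwistedPoly lambdaGamma A →ₗ[K] TwistedPoly lambdaGamma A :=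
  liftL fun i => if 2 ∣ i then 0 else monL K lambdaGamma (i - 1)

/-- The projection to the even part. -/
noncomputable def πodd : TwistedPoly lambdaGamma A →ₐ[K] TwistedPoly lambdaGamma A :=
  (up (isRestriction_lambdaGamma K)).comp (down (isRestriction_lambdaGamma K))

section

variable {A} (i : ℕ) (a : A)

theorem ρodd_even : ρodd K A (mon lambdaGamma (2 * i) a) = 0 := by
  simp [ρodd]

theorem ρodd_odd : ρodd K A (mon lambdaGamma (2 * i + 1) a) = mon lambdaGamma (2 * i) a := by
  simp [ρodd]

theorem πodd_even : πodd K A (mon lambdaGamma (2 * i) a) = mon lambdaGamma (2 * i) a := by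
  rw [πodd, AlgHom.comp_apply, up_down_mon, if_pos (dvd_mul_right _ _)]

theorem πodd_odd : πodd K A (mon lambdaGamma (2 * i + 1) a) = 0 := by
  rw [πodd, AlgHom.comp_apply, up_down_mon, if_neg (by omega)]

theorem sgn_even : (chain K lambdaGamma A 1 one_pos).sgn (mon lambdaGamma (2 * i) a) =
    -mon lambdaGamma (2 * i) a := by
  rw [sgn_mon, Odd.neg_one_pow ⟨i, by ring⟩, neg_one_smul]

theorem sgn_odd : (chain K lambdaGamma A 1 one_pos).sgn (mon lambdaGamma (2 * i + 1) a) =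
    mon lambdaGamma (2 * i + 1) a := by
  rw [sgn_mon, Even.neg_one_pow ⟨i + 1, by ring⟩, one_smul]

end

/-- The splitting of `lambdaGamma` over `gamma`. -/
noncomputable def oddSplitting : OddSplitting (aug K lambdaGamma A 1 one_pos) where
  hd _ := rfl
  π := πodd K A
  ρ := ρodd K A
  -- The index 1 is written in the form to which the parity lemmas apply.
  x := mon lambdaGamma (2 * 0 + 1) 1
  π_gr n w hw := by
    rcases gr_cases one_pos hw with rfl | ⟨i, a, rfl, rfl⟩
    · rw [map_zero]; exact Submodule.zero_mem _
    · rw [πodd, AlgHom.comp_apply, up_down_mon]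
      split_ifs
      · exact hw
      · exact Submodule.zero_mem _
  π_sgn w := by
    induction w using induction_parity with
    | h0 => simp
    | he i a => rw [sgn_even, map_neg]
    | ho i a => rw [sgn_odd, πodd_odd, neg_zero]
    | h2 x y hx hy => rw [map_add, map_add, map_add, hx, hy, neg_add]
  sgn_π w := by
    induction w using induction_parity with
    | h0 => simp
    | he i a => rw [πodd_even, sgn_even]
    | ho i a => rw [πodd_odd, map_zero, neg_zero]
    | h2 x y hx hy => rw [map_add, map_add, hx, hy, neg_add]
  aug_π w := by
    have h := isRestriction_lambdaGamma K
    exact ((upMor A (D := 1) (D' := 2) one_pos two_pos h rfl).map_aug _).trans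
      ((downMor A (D := 1) (D' := 2) one_pos two_pos h rfl).map_aug _)
  x_mem := mon_mem K 1 1 1
  π_x := πodd_odd K 0 1
  π_π w := by rw [πodd, AlgHom.comp_apply, AlgHom.comp_apply, down_up]
  ρ_x := ρodd_odd K 0 1
  ρ_π w := by
    induction w using induction_parity with
    | h0 => simp
    | he i a => rw [πodd_even, ρodd_even]
    | ho i a => rw [πodd_odd, map_zero]
    | h2 x y hx hy => rw [map_add, map_add, hx, hy, add_zero]
  x_mul w := by
    induction w using induction_parity with
    | h0 => simp
    | he i a => rw [πodd_even, odd_mul_even, even_mul_odd]; simp [gamma_c]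
    | ho i a => rw [πodd_odd, odd_mul_odd, zero_mul]
    | h2 x y hx hy => rw [map_add, mul_add, add_mul, hx, hy]
  add_eq w := by
    induction w using induction_parity with
    | h0 => simp
    | he i a => rw [πodd_even, ρodd_even, zero_mul, add_zero]
    | ho i a => rw [πodd_odd, ρodd_odd, even_mul_odd]; simp [gamma_c]
    | h2 x y hx hy =>
      conv_lhs => rw [hx, hy]
      simp only [map_add, add_mul]; abel
  ρ_mul u v := by
    induction u using induction_parity with
    | h0 => simp
    | he i a =>
      induction v using induction_parity with
      | h0 => simp
      | he j b => simp only [even_mul_even, ρodd_even]; simp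
      | ho j b =>
        simp only [even_mul_odd, ρodd_even, ρodd_odd, πodd_even, πodd_odd, even_mul_even]; simp
      | h2 x y hx hy => simp only [mul_add, map_add, hx, hy]; abel
    | ho i a =>
      induction v using induction_parity with
      | h0 => simp
      | he j b =>
        simp only [odd_mul_even, ρodd_even, ρodd_odd, πodd_even, πodd_odd, even_mul_even]; simp
      | ho j b => simp only [odd_mul_odd, πodd_odd]; simp
      | h2 x y hx hy => simp only [mul_add, map_add, hx, hy]; abel
    | h2 x y hx hy => simp only [add_mul, map_add, hx, hy]; abel
  ρ_sgn w := by
    induction w using induction_parity with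
    | h0 => simp
    | he i a => rw [sgn_even, map_neg, ρodd_even, neg_zero]
    | ho i a => rw [sgn_odd]
    | h2 x y hx hy => rw [map_add, map_add, map_add, hx, hy]
  sgn_ρ w := by
    induction w using induction_parity with
    | h0 => simp
    | he i a => rw [ρodd_even, map_zero, neg_zero]
    | ho i a => rw [ρodd_odd, sgn_even]
    | h2 x y hx hy => rw [map_add, map_add, hx, hy, neg_add]
  ρ_gr n w hw := by
    rcases gr_cases one_pos hw with rfl | ⟨i, a, rfl, rfl⟩
    · left; simp
    · rcases Nat.even_or_odd' i with ⟨i, rfl | rfl⟩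
      · left; exact ρodd_even K i a
      · right
        refine ⟨1 * (2 * i), by ring, ?_⟩
        rw [ρodd_odd]
        exact mon_mem K 1 (2 * i) a

end Odd

end TwistedPoly

end

/-! ### Divided powers over 𝔽_p, and the splitting of a truncated polynomial generator -/

section

open ChainAlgebra HochschildCochain

open StructureConstants

namespace TwistedPoly

variable (p : ℕ) [hp : Fact p.Prime]

/-- The coefficients of the cocycle `bz`. -/
noncomputable def bzCoeff (i j : ℕ) : ZMod p :=
  if p ∣ i + j then (i : ZMod p)⁻¹ * ((i + j - 1).choose j : ℕ) else 0

/-- The convention 0⁻¹ = 0 is used in earnest: formulas with i⁻¹ vanish by themselves at the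
multiples of p, that is, on the image of π. -/
theorem inv_natCast_of_dvd {i : ℕ} (h : p ∣ i) : (i : ZMod p)⁻¹ = 0 := by
  rw [(ZMod.natCast_eq_zero_iff i p).2 h, inv_zero]

theorem natCast_ne_zero {i : ℕ} (h : ¬ p ∣ i) : (i : ZMod p) ≠ 0 := fun h' =>
  h ((ZMod.natCast_eq_zero_iff i p).1 h')

theorem pos_of_not_dvd {i : ℕ} (h : ¬ p ∣ i) : 0 < i :=
  Nat.pos_of_ne_zero fun h0 => h (h0 ▸ dvd_zero p)

/-- This computes the defect of the derivation rule on monomials. If p does not divide i + j,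
absorption identities for binomial coefficients make it zero. If p divides i + j, the term of the
product drops out, and what remains is the definition of `bzCoeff`. -/
theorem inv_mul_choose (i j : ℕ) :
    (i : ZMod p)⁻¹ * ((i + j - 1).choose j : ℕ) +
      (if p ∣ i then (j : ZMod p)⁻¹ * ((i + j - 1).choose i : ℕ) else 0) -
      ((i + j : ℕ) : ZMod p)⁻¹ * ((i + j).choose i : ℕ) = bzCoeff p i j := by
  rw [bzCoeff]
  by_cases hij : p ∣ i + j
  · rw [if_pos hij, inv_natCast_of_dvd p hij, zero_mul, sub_zero]
    by_cases hi : p ∣ i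
    · rw [if_pos hi, inv_natCast_of_dvd p hi, inv_natCast_of_dvd p ((Nat.dvd_add_right hi).1 hij)]
      ring
    · rw [if_neg hi, add_zero]
  · rw [if_neg hij, sub_eq_zero]
    have hn := natCast_ne_zero p hij
    by_cases hi : p ∣ i
    · rw [if_pos hi, inv_natCast_of_dvd p hi, zero_mul, zero_add]
      have hj : ¬ p ∣ j := fun h => hij (dvd_add hi h)
      have e : ((i + j : ℕ) : ZMod p) = j := by
        rw [Nat.cast_add, (ZMod.natCast_eq_zero_iff i p).2 hi, zero_add]
      rw [e]
      congr 1
      have hj0 := pos_of_not_dvd p hj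
      have h := Nat.choose_mul_succ_eq (i + j - 1) i
      rw [show i + j - 1 + 1 = i + j by omega, show i + j - i = j by omega] at h
      have h' := congrArg (Nat.cast (R := ZMod p)) h
      rw [Nat.cast_mul, Nat.cast_mul, e] at h'
      exact mul_right_cancel₀ (natCast_ne_zero p hj) h'
    · rw [if_neg hi, add_zero]
      have hi0 := pos_of_not_dvd p hi
      have h := Nat.add_one_mul_choose_eq (i + j - 1) (i - 1)
      rw [show i + j - 1 + 1 = i + j by omega, show i - 1 + 1 = i by omega,
        ← Nat.choose_symm (n := i + j - 1) (k := i - 1) (by omega),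
        show i + j - 1 - (i - 1) = j by omega] at h
      have h' := congrArg (Nat.cast (R := ZMod p)) h
      rw [Nat.cast_mul, Nat.cast_mul] at h'
      have hi' := natCast_ne_zero p hi
      field_simp
      linear_combination h'

/-- Together with the next lemma, a case of Lucas' congruence: multiplication by t' = e_{p-1} shifts
the monomials with index divisible by p and kills all the others. -/
theorem choose_pred_prime (n : ℕ) (h : p ∣ n) :
    (((p - 1 + n).choose (p - 1) : ℕ) : ZMod p) = 1 := by
  obtain ⟨m, rfl⟩ := h
  have := hp.out.one_lt
  rw [ZMod.choose_eq, Nat.add_mul_mod_self_left, Nat.mod_eq_of_lt (by omega), Nat.choose_self,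
    Nat.div_eq_of_lt (a := p - 1) (by omega), Nat.choose_zero_right]
  simp

theorem choose_pred_prime' (n : ℕ) (h : ¬ p ∣ n) :
    (((p - 1 + n).choose (p - 1) : ℕ) : ZMod p) = 0 := by
  have h1 := hp.out.one_lt
  rw [ZMod.choose_eq, Nat.mod_eq_of_lt (a := p - 1) (by omega), Nat.choose_eq_zero_of_lt]
  · simp
  · have h3 : n % p ≠ 0 := fun h0 => h (Nat.dvd_of_mod_eq_zero h0)
    have h2 : (p - 1 + n) % p = (n % p - 1) % p := by
      conv_lhs => rw [← Nat.div_add_mod n p]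
      rw [show p - 1 + (p * (n / p) + n % p) = n % p - 1 + p * (n / p + 1) by
        rw [mul_add]; omega, Nat.add_mul_mod_self_left]
    have h4 := Nat.mod_lt n hp.out.pos
    rw [h2, Nat.mod_eq_of_lt (by omega)]
    omega

variable (A : Type u) [Ring A] [Algebra (ZMod p) A]

/-- The projection to the span of the `e_{p i}`. -/
noncomputable def πeven : TwistedPoly gamma A →ₐ[ZMod p] TwistedPoly gamma A :=
  (up (isRestriction_gamma p)).comp (down (isRestriction_gamma p))

/-- `e_i ↦ i⁻¹ e_{i - 1}`. -/
noncomputable def ρeven : TwistedPoly gamma A →ₗ[ZMod p] TwistedPoly gamma A :=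
  liftL fun i => (i : ZMod p)⁻¹ • monL (ZMod p) gamma (i - 1)

/-- `e_i, e_j ↦ bzCoeff i j e_{i + j - p}`. -/
noncomputable def bzeven :
    TwistedPoly gamma A →ₗ[ZMod p] TwistedPoly gamma A →ₗ[ZMod p] TwistedPoly gamma A :=
  bilinear (bzCoeff p) fun i j => i + j - p

section

variable {A} (i j : ℕ) (a b : A)

theorem πeven_mon : πeven p A (mon gamma i a) = if p ∣ i then mon gamma i a else 0 := by
  rw [πeven, AlgHom.comp_apply, up_down_mon]

theorem ρeven_mon : ρeven p A (mon gamma i a) = (i : ZMod p)⁻¹ • mon gamma (i - 1) a := by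
  rw [ρeven, liftL_mon]; rfl

theorem bzeven_mon : bzeven p A (mon gamma i a) (mon gamma j b) =
    bzCoeff p i j • mon gamma (i + j - p) (a * b) := by
  rw [bzeven, bilinear_mon, smul_mon]

theorem gamma_mon_mul : mon gamma i a * mon gamma j b =
    (((i + j).choose i : ℕ) : ZMod p) • mon gamma (i + j) (a * b) := by
  rw [mon_mul, gamma_c, Nat.cast_smul_eq_nsmul, map_nsmul]

theorem mon_pred_mul : mon gamma (p - 1) (1 : A) * mon gamma j b =
    if p ∣ j then mon gamma (p - 1 + j) b else 0 := by
  rw [gamma_mon_mul p]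
  split_ifs with h
  · rw [choose_pred_prime p j h, one_smul, one_mul]
  · rw [choose_pred_prime' p j h, zero_smul]

variable {p} in
theorem bzCoeff_eq_zero (hij : ¬ p ∣ i + j) : bzCoeff p i j = 0 := if_neg hij

variable {p} in
theorem bzCoeff_eq_zero_of_dvd (hi : p ∣ i) : bzCoeff p i j = 0 := by
  rw [bzCoeff, inv_natCast_of_dvd p hi]; simp

end

theorem ρeven_mul (u v : TwistedPoly gamma A) :
    ρeven p A u * v + πeven p A u * ρeven p A v - ρeven p A (u * v) =
      mon gamma (p - 1) 1 * bzeven p A u v := by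
  induction u using induction with
  | h0 => simp
  | h1 i a =>
    induction v using induction with
    | h0 => simp
    | h1 j b =>
      have h1 := hp.out.one_lt
      have e1 : ρeven p A (mon gamma i a) * mon gamma j b =
          ((i : ZMod p)⁻¹ * ((i + j - 1).choose j : ℕ)) • mon gamma (i + j - 1) (a * b) := by
        rw [ρeven_mon, smul_mul_assoc, gamma_mon_mul p, smul_smul]
        rcases Nat.eq_zero_or_pos i with rfl | hi
        · simp
        · rw [show i - 1 + j = i + j - 1 by omega, ← Nat.choose_symm_of_eq_add
            (n := i + j - 1) (a := i - 1) (b := j) (by omega)]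
      have e2 : πeven p A (mon gamma i a) * ρeven p A (mon gamma j b) =
          (if p ∣ i then (j : ZMod p)⁻¹ * ((i + j - 1).choose i : ℕ) else 0) •
            mon gamma (i + j - 1) (a * b) := by
        rw [ρeven_mon, πeven_mon, mul_smul_comm]
        split_ifs with hi
        · rw [gamma_mon_mul p, smul_smul]
          rcases Nat.eq_zero_or_pos j with rfl | hj
          · simp
          · rw [show i + (j - 1) = i + j - 1 by omega]
        · simp
      have e3 : ρeven p A (mon gamma i a * mon gamma j b) =
          (((i + j : ℕ) : ZMod p)⁻¹ * ((i + j).choose i : ℕ)) • mon gamma (i + j - 1) (a * b) := by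
        rw [gamma_mon_mul p, map_smul, ρeven_mon, smul_smul, mul_comm]
      have e4 : mon gamma (p - 1) (1 : A) * bzeven p A (mon gamma i a) (mon gamma j b) =
          bzCoeff p i j • mon gamma (i + j - 1) (a * b) := by
        rw [bzeven_mon, mul_smul_comm]
        -- The subtraction `i + j - p` is truncated only where the coefficient vanishes: if p does
        -- not divide i + j, or if i = j = 0.
        by_cases hij : p ∣ i + j
        · rcases Nat.eq_zero_or_pos (i + j) with h0 | h0
          · rw [bzCoeff_eq_zero_of_dvd i j (by rw [show i = 0 by omega]; exact dvd_zero p),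
              zero_smul, zero_smul]
          · have := Nat.le_of_dvd h0 hij
            rw [mon_pred_mul, if_pos (Nat.dvd_sub hij dvd_rfl),
              show p - 1 + (i + j - p) = i + j - 1 by omega]
        · rw [bzCoeff_eq_zero i j hij, zero_smul, zero_smul]
      rw [e1, e2, e3, e4, ← add_smul, ← sub_smul, inv_mul_choose]
    | h2 x y hx hy => simp only [mul_add, map_add, ← hx, ← hy]; abel
  | h2 x y hx hy => simp only [add_mul, map_add, LinearMap.add_apply, mul_add, ← hx, ← hy]; abel

/-- Both sides see only monomials with index divisible by p, and on these the two binomial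
coefficients agree by symmetry. This is the centrality of `t'` in the form needed for insertions. -/
theorem pred_mul (w : TwistedPoly gamma A) :
    mon gamma (p - 1) 1 * w = πeven p A w * mon gamma (p - 1) 1 := by
  induction w using induction with
  | h0 => simp
  | h1 i a =>
    rw [mon_pred_mul, πeven_mon]
    split_ifs with h
    · rw [gamma_mon_mul p, add_comm i, Nat.choose_symm_of_eq_add (n := p - 1 + i) (a := i)
        (b := p - 1) (by omega), choose_pred_prime p i h, one_smul, mul_one]
    · rw [zero_mul]
  | h2 x y hx hy => rw [map_add, mul_add, add_mul, hx, hy]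

/-- On the image of π, multiplication by t' is undone by lowering the index by p - 1. -/
theorem eq_zero_of_pred_mul (w : TwistedPoly gamma A) (hw : πeven p A w = w)
    (h : mon gamma (p - 1) 1 * w = 0) : w = 0 := by
  have key : ∀ y : TwistedPoly gamma A, (liftL fun i => monL (ZMod p) gamma (i - (p - 1)) :
      TwistedPoly gamma A →ₗ[ZMod p] TwistedPoly gamma A) (mon gamma (p - 1) 1 * y) =
      πeven p A y := by
    intro y
    induction y using induction with
    | h0 => simp
    | h1 i a =>
      rw [mon_pred_mul, πeven_mon]
      split_ifs
      · rw [liftL_mon]; simp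
      · rw [map_zero]
    | h2 x y hx hy => rw [mul_add, map_add, map_add, hx, hy]
  rw [← hw, ← key w, h, map_zero]

theorem πeven_πeven (w : TwistedPoly gamma A) : πeven p A (πeven p A w) = πeven p A w := by
  rw [πeven, AlgHom.comp_apply, AlgHom.comp_apply, down_up]

theorem πeven_bzeven (u v : TwistedPoly gamma A) :
    πeven p A (bzeven p A u v) = bzeven p A u v := by
  induction u using induction with
  | h0 => simp
  | h1 i a =>
    induction v using induction with
    | h0 => simp
    | h1 j b =>
      rw [bzeven_mon, map_smul, πeven_mon]
      by_cases hij : p ∣ i + j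
      · rw [if_pos (Nat.dvd_sub hij dvd_rfl)]
      · rw [bzCoeff_eq_zero i j hij, zero_smul, zero_smul]
    | h2 x y hx hy => simp only [map_add, hx, hy]
  | h2 x y hx hy => simp only [map_add, LinearMap.add_apply, hx, hy]

/-- After multiplication by t', which is injective on the image of π, bz becomes the defect of the
derivation rule for ρ. For such a defect the cocycle identity is formal, so no binomial identity in
three indices is needed. -/
theorem bzeven_cocycle (u v w : TwistedPoly gamma A) :
    πeven p A u * bzeven p A v w - bzeven p A (u * v) w + bzeven p A u (v * w) -
      bzeven p A u v * πeven p A w = 0 := by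
  refine eq_zero_of_pred_mul p A _ ?_ ?_
  · simp only [map_sub, map_add, map_mul, πeven_bzeven, πeven_πeven]
  · have h1 : mon gamma (p - 1) 1 * (πeven p A u * bzeven p A v w) =
        πeven p A u * (mon gamma (p - 1) 1 * bzeven p A v w) := by
      rw [← mul_assoc, ← mul_assoc, pred_mul, πeven_πeven]
    have h2 : mon gamma (p - 1) 1 * (bzeven p A u v * πeven p A w) =
        mon gamma (p - 1) 1 * bzeven p A u v * w := by
      rw [mul_assoc, pred_mul, pred_mul p A (bzeven p A u v * w), map_mul, map_mul, πeven_πeven]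
    rw [mul_sub, mul_add, mul_sub, h1, h2]
    simp only [← ρeven_mul, map_mul, mul_assoc, mul_add, mul_sub, add_mul, sub_mul]
    abel

/-- The splitting of `gamma` over the subalgebra spanned by the `e_{p i}`. -/
noncomputable def evenSplitting (D : ℕ) (hD : 0 < D) (hD2 : Even D) :
    EvenSplitting (aug (ZMod p) gamma A D hD) where
  hd _ := rfl
  hs w := by
    induction w using induction with
    | h0 => simp
    | h1 i a =>
      rw [sgn_mon, Odd.neg_one_pow, neg_one_smul]
      exact (hD2.mul_right i).add_one
    | h2 x y hx hy => rw [map_add, hx, hy, neg_add]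
  π := πeven p A
  ρ := ρeven p A
  bz := bzeven p A
  t := mon gamma 1 1
  t' := mon gamma (p - 1) 1
  dt := D
  dt' := D * (p - 1)
  dt_pos := hD
  dt'_pos := Nat.mul_pos hD (Nat.sub_pos_of_lt hp.out.one_lt)
  π_gr n w hw := by
    rcases gr_cases hD hw with rfl | ⟨i, a, rfl, rfl⟩
    · rw [map_zero]; exact Submodule.zero_mem _
    · rw [πeven_mon]
      split_ifs
      · exact hw
      · exact Submodule.zero_mem _
  aug_π w := by
    have h := isRestriction_gamma p
    exact ((upMor A (D := D) (D' := D * p) hD (Nat.mul_pos hD hp.out.pos) h rfl).map_aug _).trans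
      ((downMor A (D := D) (D' := D * p) hD (Nat.mul_pos hD hp.out.pos) h rfl).map_aug _)
  t_mem := by
    have := mon_mem (C := gamma) (ZMod p) D 1 (1 : A)
    rwa [mul_one] at this
  t'_mem := mon_mem (ZMod p) D _ 1
  π_t := by rw [πeven_mon, if_neg]; exact hp.out.one_lt.not_ge ∘ Nat.le_of_dvd one_pos
  π_t' := by
    have := hp.out.one_lt
    rw [πeven_mon, if_neg]
    intro h
    have := Nat.le_of_dvd (by omega) h
    omega
  t_mul_t' := by
    have := hp.out.one_lt
    rw [gamma_mon_mul p, show 1 + (p - 1) = p by omega, Nat.choose_one_right]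
    simp
  π_π := πeven_πeven p A
  ρ_t := by rw [ρeven_mon]; simp [mon_one]
  ρ_π w := by
    induction w using induction with
    | h0 => simp
    | h1 i a =>
      rw [πeven_mon]
      split_ifs with h
      · rw [ρeven_mon, inv_natCast_of_dvd p h, zero_smul]
      · rw [map_zero]
    | h2 x y hx hy => rw [map_add, map_add, hx, hy, add_zero]
  t_mul w := by
    induction w using induction with
    | h0 => simp
    | h1 i a =>
      rw [πeven_mon]
      split_ifs with h
      · rw [mon_mul, mon_mul, one_mul, mul_one, add_comm i 1, gamma_c, gamma_c, add_comm i 1,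
          Nat.choose_symm_of_eq_add (n := 1 + i) (a := i) (b := 1) (by omega)]
      · simp
    | h2 x y hx hy => rw [map_add, mul_add, add_mul, hx, hy]
  t'_mul := pred_mul p A
  add_eq w := by
    induction w using induction with
    | h0 => simp
    | h1 i a =>
      rw [πeven_mon, ρeven_mon, mul_smul_comm]
      split_ifs with h
      · rw [inv_natCast_of_dvd p h, zero_smul, add_zero]
      · have hi := pos_of_not_dvd p h
        rw [gamma_mon_mul p, show 1 + (i - 1) = i by omega, Nat.choose_one_right, smul_smul,
          inv_mul_cancel₀ (natCast_ne_zero p h), one_smul, one_mul, zero_add]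
    | h2 x y hx hy =>
      conv_lhs => rw [hx, hy]
      simp only [map_add, mul_add]; abel
  π_bz := πeven_bzeven p A
  ρ_mul := ρeven_mul p A
  bz_cocycle := bzeven_cocycle p A
  bz_t_t' := by
    have := hp.out.one_lt
    rw [bzeven_mon, bzCoeff, show 1 + (p - 1) = p by omega, if_pos dvd_rfl]
    simp [mon_one]
  aug_bz_t' w := by
    have h1 := hp.out.one_lt
    induction w using induction with
    | h0 => simp
    | h1 i a =>
      rw [bzeven_mon, ρeven_mon, map_smul, map_smul, aug_apply, aug_apply, coef₀_mon, coef₀_mon]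
      rcases Nat.eq_zero_or_pos i with rfl | hi
      · rw [bzCoeff_eq_zero, Nat.cast_zero, inv_zero, zero_smul, zero_smul]
        intro h
        have := Nat.le_of_dvd (by omega) h
        omega
      · rcases Nat.eq_or_lt_of_le hi with rfl | hi
        · rw [bzCoeff, show p - 1 + 1 = p by omega, if_pos dvd_rfl, Nat.choose_one_right,
            inv_mul_cancel₀]
          · simp
          · refine natCast_ne_zero p fun h => ?_
            have := Nat.le_of_dvd (by omega) h
            omega
        · rw [if_neg (by omega), if_neg (by omega), smul_zero, smul_zero]
    | h2 x y hx hy => simp only [map_add, hx, hy]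
  bz_π u w := by
    induction u using induction with
    | h0 => simp
    | h1 i a =>
      induction w using induction with
      | h0 => simp
      | h1 j b =>
        rw [πeven_mon]
        split_ifs with h
        · rw [bzeven_mon]
          by_cases hi : p ∣ i
          · rw [bzCoeff_eq_zero_of_dvd i j hi, zero_smul]
          · rw [bzCoeff_eq_zero i j fun h' => hi ((Nat.dvd_add_left h).1 h'), zero_smul]
        · rw [map_zero]
      | h2 x y hx hy => rw [map_add, map_add, hx, hy, add_zero]
    | h2 x y hx hy => rw [map_add, LinearMap.add_apply, hx, hy, add_zero]
  π_bz' u w := by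
    induction u using induction with
    | h0 => simp
    | h1 j b =>
      induction w using induction with
      | h0 => simp
      | h1 i a =>
        rw [πeven_mon]
        split_ifs with h
        · rw [bzeven_mon, bzCoeff_eq_zero_of_dvd i j h, zero_smul]
        · rw [map_zero, LinearMap.zero_apply]
      | h2 x y hx hy => rw [map_add, map_add, LinearMap.add_apply, hx, hy, add_zero]
    | h2 x y hx hy => rw [map_add, hx, hy, add_zero]
  ρ_gr n w hw := by
    rcases gr_cases hD hw with rfl | ⟨i, a, rfl, rfl⟩
    · left; simp
    · rw [ρeven_mon]
      rcases Nat.eq_zero_or_pos i with rfl | hi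
      · left; simp
      · right
        refine ⟨D * (i - 1), ?_, Submodule.smul_mem _ _ (mon_mem (ZMod p) D _ a)⟩
        conv_lhs => rw [show i = i - 1 + 1 by omega, mul_add, mul_one]
  bz_gr m n u hu v hv := by
    have h1 := hp.out.one_lt
    rcases gr_cases hD hu with rfl | ⟨i, a, rfl, rfl⟩
    · left; simp
    rcases gr_cases hD hv with rfl | ⟨j, b, rfl, rfl⟩
    · left; simp
    rw [bzeven_mon]
    by_cases hij : p ∣ i + j
    · rcases Nat.eq_zero_or_pos (i + j) with h0 | h0
      · left
        rw [bzCoeff_eq_zero_of_dvd i j (by rw [show i = 0 by omega]; exact dvd_zero p), zero_smul]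
      · right
        have := Nat.le_of_dvd h0 hij
        refine ⟨D * (i + j - p), ?_, Submodule.smul_mem _ _ (mon_mem (ZMod p) D _ _)⟩
        have e : i + j = i + j - p + (1 + (p - 1)) := by omega
        rw [← mul_add]
        conv_lhs => rw [e]
        ring
    · left; rw [bzCoeff_eq_zero i j hij, zero_smul]

variable {A} in
theorem coef₀_ρeven_mon (i : ℕ) (a : A) :
    coef₀ (ZMod p) gamma A (ρeven p A (mon gamma i a)) = if i = 1 then a else 0 := by
  rw [ρeven_mon, map_smul, coef₀_mon]
  rcases i with _ | _ | i <;> simp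

/-- For p = 2 the only pair of monomials that bz sends to a nonzero multiple of e_0 is (e_1, e_1).
-/
theorem evenSplitting_aug_bz (hp2 : p = 2) (D : ℕ) (hD : 0 < D) (hD2 : Even D)
    (u v : TwistedPoly gamma A) :
    (aug (ZMod p) gamma A D hD).aug ((evenSplitting p A D hD hD2).bz u v) =
      (aug (ZMod p) gamma A D hD).aug ((evenSplitting p A D hD hD2).ρ u) *
        (aug (ZMod p) gamma A D hD).aug ((evenSplitting p A D hD hD2).ρ v) := by
  change coef₀ _ _ _ (bzeven p A u v) = coef₀ _ _ _ (ρeven p A u) * coef₀ _ _ _ (ρeven p A v)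
  induction u using induction with
  | h0 => simp
  | h1 i a =>
    induction v using induction with
    | h0 => simp
    | h1 j b =>
      subst hp2
      rw [bzeven_mon, coef₀_ρeven_mon, coef₀_ρeven_mon, map_smul, coef₀_mon]
      rcases i with _ | _ | i
      · rw [bzCoeff_eq_zero_of_dvd _ _ (dvd_zero 2)]; simp
      · rcases j with _ | _ | j
        · rw [bzCoeff_eq_zero _ _ (by norm_num)]; simp
        · simp [bzCoeff]
        · rw [if_neg (by omega)]; simp
      · rcases j with _ | _ | j
        · rcases i with _ | i
          · rw [bzCoeff_eq_zero_of_dvd _ _ (by norm_num)]; simp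
          · rw [if_neg (by omega)]; simp
        · rw [if_neg (by omega)]; simp
        · rw [if_neg (by omega)]; simp
    | h2 x y hx hy => simp only [map_add, mul_add, hx, hy]
  | h2 x y hx hy => simp only [map_add, LinearMap.add_apply, add_mul, hx, hy]

/-- The coefficient of `e_2`. -/
noncomputable def coef₂ : TwistedPoly gamma A →ₗ[ZMod p] A :=
  liftL fun i => if i = 2 then LinearMap.id else 0

variable {A} in
theorem coef₂_mon (i : ℕ) (a : A) : coef₂ p A (mon gamma i a) = if i = 2 then a else 0 := by
  rw [coef₂, liftL_mon]
  split_ifs <;> rfl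

/-- The index 2 arises as 0 + 2, 2 + 0 and 1 + 1, with binomial coefficient 2 in the last case. -/
theorem coef₂_mul (u v : TwistedPoly gamma A) : coef₂ p A (u * v) =
    coef₀ (ZMod p) gamma A u * coef₂ p A v + coef₂ p A u * coef₀ (ZMod p) gamma A v +
      2 * (coef₀ (ZMod p) gamma A (ρeven p A u) * coef₀ (ZMod p) gamma A (ρeven p A v)) := by
  induction u using induction with
  | h0 => simp
  | h1 i a =>
    induction v using induction with
    | h0 => simp
    | h1 j b =>
      rw [gamma_mon_mul p, map_smul, coef₀_ρeven_mon, coef₀_ρeven_mon]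
      simp only [coef₀_mon, coef₂_mon]
      rcases i with _ | _ | _ | i
      · simp
      · rcases j with _ | _ | j
        · simp
        · simp [two_smul, two_mul]
        · rw [if_neg (by omega)]; simp
      · rcases j with _ | j
        · simp
        · rw [if_neg (by omega)]; simp
      · rw [if_neg (by omega)]; simp
    | h2 x y hx hy => simp only [map_add, mul_add, hx, hy]; abel
  | h2 x y hx hy => simp only [map_add, add_mul, mul_add, hx, hy]; abel

theorem coef₂_gr (D : ℕ) (hD : 0 < D) (n : ℕ) (x : TwistedPoly gamma A)
    (hx : x ∈ gr (K := ZMod p) gamma A D n) (hn : n ≠ 2 * D) : coef₂ p A x = 0 := by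
  rcases gr_cases hD hx with rfl | ⟨i, a, rfl, rfl⟩
  · simp
  · rw [coef₂_mon, if_neg]
    rintro rfl
    exact hn (mul_comm _ _)

end TwistedPoly

end

/-! ### Contractions modulo p and the comparison of cohomology -/

section

open ChainAlgebra HochschildCochain

/-- Over a field take a section s of ψ with values in cycles and a section k of d, defined on
boundaries, with values in ker ψ. The correction term 1 - sψ - kd has boundaries as values, so k can
be applied to it, and h = k(1 - sψ - kd) works. Choosing k inside ker ψ yields ψh = 0. -/
theorem exists_homotopy {F V Z : Type*} [Field F] [AddCommGroup V] [Module F V] [AddCommGroup Z]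
    [Module F Z] (d : V →ₗ[F] V) (ψ : V →ₗ[F] Z) (hd : ∀ v, d (d v) = 0) (hψ : ∀ v, ψ (d v) = 0)
    (h1 : ∀ v, ψ v = 0 → d v = 0 → ∃ y, d y = v) (h2 : ∀ z, ∃ v, d v = 0 ∧ ψ v = z) :
    ∃ (h : V →ₗ[F] V) (s : Z →ₗ[F] V), (∀ v, d (h v) + h (d v) = v - s (ψ v)) ∧
      ∀ v, ψ (h v) = 0 := by
  obtain ⟨s', hs'⟩ := (ψ.comp (LinearMap.ker d).subtype).exists_rightInverse_of_surjective
    (LinearMap.range_eq_top.2 fun z => by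
      obtain ⟨v, hv, rfl⟩ := h2 z
      exact ⟨⟨v, hv⟩, rfl⟩)
  set s : Z →ₗ[F] V := (LinearMap.ker d).subtype.comp s' with hs
  have hds : ∀ z, d (s z) = 0 := fun z => (s' z).2
  have hψs : ∀ z, ψ (s z) = z := fun z => LinearMap.congr_fun hs' z
  obtain ⟨k', hk'⟩ := (d.rangeRestrict.comp
    (LinearMap.ker ψ).subtype).exists_rightInverse_of_surjective
    (LinearMap.range_eq_top.2 fun y => by
      obtain ⟨_, v, rfl⟩ := y
      refine ⟨⟨v - s (ψ v), ?_⟩, Subtype.ext ?_⟩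
      · rw [LinearMap.mem_ker, map_sub, hψs, sub_self]
      · change d (v - s (ψ v)) = d v
        rw [map_sub, hds, sub_zero])
  have hdk : ∀ v, d (k' (d.rangeRestrict v)).1 = d v := fun v =>
    congrArg Subtype.val (LinearMap.congr_fun hk' (d.rangeRestrict v))
  have hψk : ∀ y, ψ (k' y).1 = 0 := fun y => (k' y).2
  -- `e v` is killed by ψ and by d, hence is a boundary by `h1`; and `e` fixes boundaries. These two
  -- facts give the homotopy identity.
  set e : V →ₗ[F] V := LinearMap.id - s.comp ψ -
    (LinearMap.ker ψ).subtype.comp (k'.comp d.rangeRestrict) with he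
  have hev : ∀ v, e v = v - s (ψ v) - (k' (d.rangeRestrict v)).1 := fun v => rfl
  have her : ∀ v, e v ∈ LinearMap.range d := fun v => by
    refine h1 _ ?_ ?_
    · rw [hev, map_sub, map_sub, hψs, hψk, sub_self, sub_zero]
    · rw [hev, map_sub, map_sub, hds, hdk, sub_zero, sub_self]
  have hed : ∀ v, e (d v) = d v := fun v => by
    have : d.rangeRestrict (d v) = 0 := Subtype.ext (hd v)
    rw [hev, hψ, this, map_zero, map_zero, sub_zero]
    simp
  refine ⟨(LinearMap.ker ψ).subtype.comp (k'.comp (e.codRestrict _ her)), s, fun v => ?_,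
    fun v => hψk _⟩
  have ha : ∀ v y, d y = e v → d (k' (e.codRestrict _ her v)).1 = e v := fun v y hy => by
    have : e.codRestrict _ her v = d.rangeRestrict y := Subtype.ext hy.symm
    rw [this, hdk, hy]
  obtain ⟨y, hy⟩ := her v
  have hb : e.codRestrict _ her (d v) = d.rangeRestrict v := Subtype.ext (hed v)
  change d (k' (e.codRestrict _ her v)).1 + (k' (e.codRestrict _ her (d v))).1 = _
  rw [ha v y hy, hb, hev]
  abel

namespace HochschildCochain

section Additive

variable {K : Type*} [CommRing K] {P : ChainAlgebra.{_, v} K} {B : Type w} [Ring B] [Algebra K B]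

/-- Over a quotient of ℤ additivity implies linearity, so cochains can be moved between ℤ/p² and
ℤ/p. -/
theorem isMultilinear_of_additive (hK : Function.Surjective (Nat.cast : ℕ → K)) {f : List P → B}
    (hf : ∀ L₁ L₂ x y, f (L₁ ++ (x + y) :: L₂) = f (L₁ ++ x :: L₂) + f (L₁ ++ y :: L₂)) :
    IsMultilinear f := by
  refine ⟨hf, fun L₁ L₂ c x => ?_⟩
  obtain ⟨n, rfl⟩ := hK c
  rw [Nat.cast_smul_eq_nsmul, Nat.cast_smul_eq_nsmul]
  exact map_nsmul (AddMonoidHom.mk' (fun x => f (L₁ ++ x :: L₂)) (hf L₁ L₂)) n x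

theorem IsMultilinear.congr_mod {p : ℕ} (hB : ∀ b : B, p • b = 0) {f : List P → B} (hf : IsMultilinear f) {L L' : List P}
    (h : List.Forall₂ (fun x y => ∃ r, x = y + p • r) L L') : f L = f L' := by
  induction h generalizing f with
  | nil => rfl
  | cons hx _ ih =>
    rename_i x y L L' _
    obtain ⟨r, rfl⟩ := hx
    have e : ∀ r, f ((p • r) :: L') = 0 := fun r => by
      have := hf.cons_smul (p : K) r L'
      rwa [Nat.cast_smul_eq_nsmul, Nat.cast_smul_eq_nsmul, hB] at this
    rw [show f ((y + p • r) :: L) = HochschildCochain.der (y + p • r) f L from rfl, ih (hf.der _),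
      der_apply, hf.cons_add, e, add_zero]

/-- The operator `f ↦ ∑ f(φ x_1, …, φ x_{i-1}, g x_i, x_{i+1}, …)`. -/
def slot (φ g : P →ₗ[K] P) : (List P → B) →ₗ[B] (List P → B) := pre φ (op1 g LinearMap.id)

variable (φ g : P →ₗ[K] P)

@[simp] theorem slot_nil (f : List P → B) : slot φ g f [] = 0 := rfl

theorem slot_cons (f : List P → B) (x : P) (L : List P) :
    slot φ g f (x :: L) = f (g x :: L) + slot φ g (der (φ x) f) L := rfl

theorem slot_congr {f f' : List P → B} {L : List P}
    (h : ∀ L', L'.length = L.length → f L' = f' L') : slot φ g f L = slot φ g f' L := by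
  induction L generalizing f f' with
  | nil => rfl
  | cons x L ih =>
    rw [slot_cons, slot_cons, h _ (by simp)]
    congr 1
    exact ih fun L' hL' => h _ (by simp [hL'])

theorem slot_eq_zero {f : List P → B} {L : List P} (h : ∀ L', L'.length = L.length → f L' = 0) :
    slot φ g f L = 0 := by
  rw [slot_congr φ g (f' := 0) h, map_zero]; rfl

theorem IsMultilinear.op1 {f : List P → B} (hf : IsMultilinear f) :
    IsMultilinear (op1 g LinearMap.id f) := by
  refine ⟨fun L₁ L₂ x y => ?_, fun L₁ L₂ c x => ?_⟩ <;> rcases L₁ with _ | ⟨b, L₁⟩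
  · simp [hf.cons_add]
  · exact hf.1 (g b :: L₁) L₂ x y
  · simp [hf.cons_smul]
  · exact hf.2 (g b :: L₁) L₂ c x

theorem IsMultilinear.slot {f : List P → B} (hf : IsMultilinear f) :
    IsMultilinear (slot φ g f) :=
  hf.pre fun _ hf' => hf'.op1 g

variable {φ g} in
theorem HasDeg.slot {f : List P → B} (hf : IsMultilinear f) {n : ℤ} (hd : HasDeg f n)
    (hφ : ∀ n, ∀ x ∈ P.gr n, φ x ∈ P.gr n) (hg : ∀ n, ∀ x ∈ P.gr n, g x ∈ P.gr (n + 1)) :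
    HasDeg (HochschildCochain.slot φ g f) (n - 1) := fun L e he hne => by
  induction he generalizing f n with
  | nil => rfl
  | cons hx hL ih =>
    rename_i x i L e
    rw [slot_cons, ih (hf.der _) (hd.der (hφ _ _ hx)), hd (g x :: L) ((i + 1) :: e)
      (.cons (hg _ _ hx) hL), add_zero]
    · simp only [List.length_cons, List.sum_cons] at hne ⊢
      intro h; apply hne; push_cast at h ⊢; linarith
    · simp only [List.length_cons, List.sum_cons] at hne
      intro h; apply hne; push_cast at h ⊢; linarith

variable (ε : Hom P (ofAlgebra K B))

theorem actR_eq_zero {f : List P → B} (a : P) {L : List P}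
    (h : ∀ L', L'.length ≤ L.length → f L' = 0) : actR ε a f L = 0 := by
  cases L with
  | nil => rw [actR_nil, h [] le_rfl, zero_mul]
  | cons y L => exact h _ (by simp)

/-- Every other term of the coboundary evaluates `f` on a shorter list. So the internal differential
is the leading part of `D` for the filtration by length. -/
theorem D_eq_slot {f : List P → B} {L : List P} (h : ∀ L', L'.length < L.length → f L' = 0) :
    D ε f L = slot P.sgn P.d f L := by
  have key : ∀ (L : List P) (f : List P → B), (∀ L', L'.length < L.length → f L' = 0) →
      barR ε f L = slot P.sgn P.d f L := by
    intro L
    induction L with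
    | nil => intro f _; rw [barR_nil, slot_nil]
    | cons x L ih =>
      intro f h
      rw [barR_cons, slot_cons, actR_eq_zero ε _ fun L' hL' => h L' (by simp; omega), add_zero,
        ih (der (P.sgn x) f) fun L' hL' => h (P.sgn x :: L') (by simpa using hL')]
  rw [D_eq_barR, Pi.add_apply, key L f h]
  cases L with
  | nil => rw [cup_tw_nil, zero_add]
  | cons x L => rw [cup_tw_cons, h L (by simp), mul_zero, zero_add]

end Additive

end HochschildCochain

section Contraction

variable {K K' : Type*} [CommRing K] [CommRing K'] {P : ChainAlgebra.{_, v} K}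
  {Q : ChainAlgebra.{_, w} K'} {B : Type*} [Ring B] [Algebra K B] [Algebra K' B]
  {ε : Hom P (ofAlgebra K B)} {ε' : Hom Q (ofAlgebra K' B)}

/-- A contraction, modulo `p`, of the kernel of a surjection. -/
structure AugMor.Contraction (M : AugMor ε ε') (p : ℕ) where
  h : P →ₗ[K] P
  E : P →ₗ[K] P
  h_gr : ∀ n, ∀ x ∈ P.gr n, h x ∈ P.gr (n + 1)
  E_gr : ∀ n, ∀ x ∈ P.gr n, E x ∈ P.gr n
  homotopy : ∀ x, ∃ r, P.d (h x) + h (P.d x) = x - E x + p • r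
  φ_h : ∀ x, M.φ (h x) = 0
  E_eq : ∀ x, M.φ x = 0 → ∃ r, E x = p • r

namespace AugMor.Contraction

variable {M : AugMor ε ε'} {p : ℕ} (T : M.Contraction p)

theorem E_d (hQ : ∀ x, Q.d x = 0) (x : P) : ∃ r, T.E (P.d x) = p • r :=
  T.E_eq _ (by rw [M.map_d, hQ])

/-- Apply d to the homotopy identity at x and compare it with the identity at dx; the term E(dx) is
a multiple of p because dx is mapped to zero in `Q`. -/
theorem d_E (hQ : ∀ x, Q.d x = 0) (x : P) : ∃ r, P.d (T.E x) = p • r := by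
  obtain ⟨r₁, h₁⟩ := T.homotopy x
  obtain ⟨r₂, h₂⟩ := T.homotopy (P.d x)
  obtain ⟨r₃, h₃⟩ := T.E_d hQ x
  rw [P.d_d, map_zero, add_zero, h₃] at h₂
  have h₄ := congrArg P.d h₁
  rw [map_add, P.d_d, zero_add, map_add, map_sub, map_nsmul, h₂] at h₄
  refine ⟨P.d r₁ + r₃ - r₂, ?_⟩
  rw [smul_sub, smul_add]
  linear_combination (norm := module) (1 : ℤ) • h₄

theorem E_sgn (x : P) : T.E (P.sgn x) = P.sgn (T.E x) := by
  induction x using P.gr_induction with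
  | h0 => simp
  | hom n x hx => rw [P.sgn_of_mem hx, map_smul, P.sgn_of_mem (T.E_gr n x hx)]
  | add x y hx hy => simp only [map_add, hx, hy]

theorem h_sgn (x : P) : T.h (P.sgn x) = - P.sgn (T.h x) := by
  induction x using P.gr_induction with
  | h0 => simp
  | hom n x hx =>
    rw [P.sgn_of_mem hx, map_smul, P.sgn_of_mem (T.h_gr n x hx), pow_succ _ (n + 1)]
    simp
  | add x y hx hy => simp only [map_add, hx, hy, neg_add]

/-- The contraction of the internal differential. -/
noncomputable def H : (List P → B) →ₗ[B] (List P → B) := slot (T.E ∘ₗ P.sgn) T.h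

theorem der_eq_zero {f : List P → B} (hf : IsMultilinear f) (hB : ∀ b : B, p • b = 0) {x : P}
    (h : ∃ r, x = p • r) : der x f = 0 := by
  funext L
  obtain ⟨r, hr⟩ := h
  have := hf.congr_mod hB (L := x :: L) (L' := 0 :: L)
    (.cons ⟨r, by rw [hr, zero_add]⟩ (List.forall₂_same.2 fun x _ => ⟨0, by simp⟩))
  rw [der_apply, this, hf.cons_zero]; rfl

/-- The tensor power of a homotopy: entries before the chosen one go through E, the chosen one
through h, and later ones stay as they are. The sum telescopes from the identity to E in every
entry, up to multiples of p, which do not matter. -/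
theorem homotopy_H (hQ : ∀ x, Q.d x = 0) (hB : ∀ b : B, p • b = 0) {f : List P → B}
    (hf : IsMultilinear f) (L : List P) :
    slot P.sgn P.d (T.H f) L + T.H (slot P.sgn P.d f) L = f L - f (L.map T.E) := by
  induction L generalizing f with
  | nil => simp [H]
  | cons x L ih =>
    have e1 : slot P.sgn P.d (T.H f) (x :: L) = f (T.h (P.d x) :: L) +
        slot P.sgn P.d (der (T.h (P.sgn x)) f) L +
        slot P.sgn P.d (T.H (der (T.E x) f)) L := by
      have h1 : der (P.sgn x) (T.H f) = der (T.h (P.sgn x)) f + T.H (der (T.E x) f) := by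
        funext L
        change T.H f (P.sgn x :: L) = _
        rw [H, slot_cons]
        simp [P.sgn_sgn]
      have h2 : T.H f (P.d x :: L) = f (T.h (P.d x) :: L) := by
        rw [H, slot_cons, LinearMap.comp_apply, P.sgn_d, ← map_neg P.d,
          der_eq_zero hf hB (T.E_d hQ _), map_zero]
        simp
      rw [slot_cons, h1, map_add, h2, Pi.add_apply, add_assoc]
    have e2 : T.H (slot P.sgn P.d f) (x :: L) = f (P.d (T.h x) :: L) +
        slot P.sgn P.d (der (P.sgn (T.h x)) f) L + T.H (slot P.sgn P.d (der (T.E x) f)) L := by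
      have h1 : der (T.E (P.sgn x)) (slot P.sgn P.d f) = slot P.sgn P.d (der (T.E x) f) := by
        funext L
        rw [der_apply, slot_cons, T.E_sgn, P.sgn_sgn]
        have : f (P.d (P.sgn (T.E x)) :: L) = 0 := by
          rw [← T.E_sgn]
          exact congrFun (der_eq_zero hf hB (T.d_E hQ _)) L
        rw [this, zero_add]
      conv_lhs => rw [H, slot_cons]
      rw [LinearMap.comp_apply, h1, slot_cons]
      rfl
    have e3 : f (T.h (P.d x) :: L) + f (P.d (T.h x) :: L) = f (x :: L) - f (T.E x :: L) := by
      obtain ⟨r, hr⟩ := T.homotopy x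
      rw [← hf.cons_add, ← hf.cons_sub, add_comm, hr]
      exact hf.congr_mod hB (.cons ⟨r, rfl⟩ (List.forall₂_same.2 fun x _ => ⟨0, by simp⟩))
    have e4 : slot P.sgn P.d (der (T.h (P.sgn x)) f) L =
        - slot P.sgn P.d (der (P.sgn (T.h x)) f) L := by
      rw [T.h_sgn, hf.der_neg, map_neg]; rfl
    have e5 := ih (hf.der (T.E x))
    rw [der_apply, der_apply] at e5
    rw [e1, e2, e4, List.map_cons]
    calc _ = (f (T.h (P.d x) :: L) + f (P.d (T.h x) :: L)) +
          (slot P.sgn P.d (T.H (der (T.E x) f)) L + T.H (slot P.sgn P.d (der (T.E x) f)) L) := by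
            abel
      _ = _ := by rw [e3, e5]; abel

/-- This is why a contraction is required to satisfy φh = 0: cochains from `Q` are not disturbed. -/
theorem H_pull {g : List Q → B} (hg : IsMultilinear g) : T.H (pull M.φ g) = 0 := by
  funext L
  induction L generalizing g with
  | nil => simp [H]
  | cons x L ih =>
    rw [H, slot_cons, pull_apply, List.map_cons, T.φ_h, hg.cons_zero, zero_add, der_pull]
    exact ih (hg.der _)

theorem surjective (hs : ∀ n, ∀ z ∈ Q.gr n, ∃ x ∈ P.gr n, M.φ x = z) :
    Function.Surjective M.φ := fun z => by
  induction z using Q.gr_induction with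
  | h0 => exact ⟨0, map_zero _⟩
  | hom n z hz =>
    obtain ⟨x, -, hx⟩ := hs n z hz
    exact ⟨x, hx⟩
  | add x y hx hy =>
    obtain ⟨a, rfl⟩ := hx
    obtain ⟨b, rfl⟩ := hy
    exact ⟨a + b, map_add _ _ _⟩

theorem E_congr {x y : P} (h : M.φ x = M.φ y) : ∃ r, T.E x = T.E y + p • r := by
  obtain ⟨r, hr⟩ := T.E_eq (x - y) (by rw [map_sub, h, sub_self])
  exact ⟨r, by rw [← hr, map_sub]; abel⟩

/-- Modulo p, E depends only on the image under φ. Hence any set-theoretic section σ of φ may be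
used, and multilinearity and degree survive, since the choices are invisible to cochains with values
killed by p. -/
theorem exists_pull (hK' : Function.Surjective (Nat.cast : ℕ → K')) (hB : ∀ b : B, p • b = 0)
    (hs : ∀ n, ∀ z ∈ Q.gr n, ∃ x ∈ P.gr n, M.φ x = z) {f : List P → B} (hf : IsMultilinear f)
    {n : ℤ} (hn : HasDeg f n) :
    ∃ g : List Q → B, IsMultilinear g ∧ HasDeg g n ∧ ∀ L : List P, g (L.map M.φ) = f (L.map T.E) := by
  set σ := Function.surjInv (surjective hs) with hσ
  have hσ' : ∀ z, M.φ (σ z) = z := Function.surjInv_eq _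
  refine ⟨fun L => f (L.map (T.E ∘ σ)), isMultilinear_of_additive hK' fun L₁ L₂ x y => ?_,
    fun L e he hne => ?_, fun L => ?_⟩
  · have h : ∀ L : List Q, List.Forall₂ (fun x y => ∃ r, x = y + p • r) (L.map (T.E ∘ σ))
        (L.map (T.E ∘ σ)) := fun L => List.forall₂_same.2 fun x _ => ⟨0, by simp⟩
    simp only [List.map_append, List.map_cons]
    rw [← hf.1]
    refine hf.congr_mod hB (List.rel_append (h L₁) (.cons ?_ (h L₂)))
    simp only [Function.comp_apply]
    rw [← map_add]
    exact T.E_congr (by rw [map_add, hσ', hσ', hσ'])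
  · obtain ⟨L', h1, h2⟩ : ∃ L' : List P, List.Forall₂ (fun x i => x ∈ P.gr i) L' e ∧
        L'.map M.φ = L := by
      clear hne
      induction he with
      | nil => exact ⟨[], .nil, rfl⟩
      | cons hx _ ih =>
        obtain ⟨L', h1, rfl⟩ := ih
        obtain ⟨x, hx', rfl⟩ := hs _ _ hx
        exact ⟨x :: L', .cons hx' h1, rfl⟩
    subst h2
    change f _ = 0
    rw [hf.congr_mod hB (L' := L'.map T.E)]
    · refine hn _ e ?_ (by simpa using hne)
      rw [List.forall₂_map_left_iff]
      exact h1.imp fun x i hx => T.E_gr i x hx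
    · rw [List.map_map, List.forall₂_map_left_iff, List.forall₂_map_right_iff]
      exact List.forall₂_same.2 fun x _ => T.E_congr (hσ' _)
  · simp only [List.map_map]
    refine hf.congr_mod hB ?_
    rw [List.forall₂_map_left_iff, List.forall₂_map_right_iff]
    exact List.forall₂_same.2 fun x _ => T.E_congr (hσ' _)

/-- The spectral sequence of the filtration by length, carried out by hand: each step corrects `f`
by a pulled back cochain and a coboundary so that it vanishes on longer lists than before. The
hypothesis on D f is weaker than being a cocycle; with u = 0 it gives surjectivity on cohomology,
and with a general u injectivity. -/
theorem exists_decomp (T : M.Contraction p)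
    (hK' : Function.Surjective (Nat.cast : ℕ → K')) (hQ : ∀ x, Q.d x = 0)
    (hB : ∀ b : B, p • b = 0) (hs : ∀ n, ∀ z ∈ Q.gr n, ∃ x ∈ P.gr n, M.φ x = z) {f : List P → B}
    (hf : IsMultilinear f) {n : ℕ} (hn : HasDeg f n) {u : List Q → B} (hu : IsMultilinear u)
    (hfu : D ε f = pull M.φ u) :
    ∃ (g : List Q → B) (h : List P → B), IsMultilinear g ∧ HasDeg g n ∧ IsMultilinear h ∧
      HasDeg h (n - 1 : ℤ) ∧ f = pull M.φ g + D ε h := by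
  have key : ∀ N, ∃ (g : List Q → B) (h : List P → B), IsMultilinear g ∧ HasDeg g n ∧
      IsMultilinear h ∧ HasDeg h (n - 1 : ℤ) ∧
        ∀ L : List P, L.length < N → (f - pull M.φ g - D ε h) L = 0 := by
    intro N
    induction N with
    | zero =>
      exact ⟨0, 0, isMultilinear_zero, fun _ _ _ _ => rfl, isMultilinear_zero, fun _ _ _ _ => rfl,
        fun L hL => absurd hL (Nat.not_lt_zero _)⟩
    | succ N ih =>
      -- The remainder f' vanishes on lists shorter than N. On length N it equals f' ∘ E, which
      -- comes from `Q`, plus the coboundary of H f'.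
      obtain ⟨g, h, hg, hgn, hh, hhn, H0⟩ := ih
      set f' := f - pull M.φ g - D ε h with hf'
      have hDhn : HasDeg (D ε h) n := by simpa using HasDeg.D ε hh hhn
      have hpgn : HasDeg (pull M.φ g) n := hasDeg_iff.2 (M.hasDegree (hasDeg_iff.1 hgn))
      have hf'm : IsMultilinear f' := (hf.sub (M.ml g hg)).sub (hh.D ε)
      have hf'n : HasDeg f' n := by
        have := (hn.add hpgn.neg).add hDhn.neg
        rwa [← sub_eq_add_neg, ← sub_eq_add_neg] at this
      have hDf' : D ε f' = pull M.φ (u - D ε' g) := by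
        rw [hf', sub_eq_add_neg, sub_eq_add_neg, D_add, D_add, map_sub, ← hfu, M.pull_D]
        have hneg : ∀ g, D ε (-g) = - D ε g := fun g => by simpa using D_smul ε (-1 : ℤ) g
        rw [hneg, hneg, D_D ε hh, neg_zero, add_zero, sub_eq_add_neg]
      obtain ⟨g', hg'm, hg'n, hg'⟩ := T.exists_pull hK' hB hs hf'm hf'n
      have hHn : HasDeg (T.H f') (n - 1 : ℤ) := by
        refine HasDeg.slot hf'm hf'n (fun n x hx => T.E_gr n _ (P.sgn_mem hx)) T.h_gr
      have hHm : IsMultilinear (T.H f') := hf'm.slot _ _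
      refine ⟨g + g', h + T.H f', hg.add hg'm, hgn.add hg'n, hh.add hHm, hhn.add hHn,
        fun L hL => ?_⟩
      have e : (f - pull M.φ (g + g') - D ε (h + T.H f')) L =
          f' L - f' (L.map T.E) - D ε (T.H f') L := by
        rw [← hg' L, map_add, D_add]
        change _ = (f - pull M.φ g - D ε h) L - _ - _
        simp only [Pi.sub_apply, Pi.add_apply, pull_apply]
        abel
      have hlt : ∀ L' : List P, L'.length < L.length → f' L' = 0 := fun L' hL' =>
        H0 L' (by omega)
      rw [e, D_eq_slot ε (f := T.H f') fun L' hL' => slot_eq_zero _ _ fun L'' hL'' =>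
        hlt L'' (by omega)]
      -- At this length the internal differential of f' is all of D f', which is pulled back from
      -- `Q` and thus killed by H.
      have h3 : T.H (slot P.sgn P.d f') L = 0 := by
        have : T.H (slot P.sgn P.d f') L = T.H (D ε f') L := by
          refine slot_congr _ _ fun L' hL' => (D_eq_slot ε fun L'' hL'' => hlt L'' (by omega)).symm
        rw [this, hDf', T.H_pull (hu.sub (hg.D ε'))]; rfl
      have h4 := T.homotopy_H hQ hB hf'm L
      rw [h3, add_zero] at h4
      rw [h4, sub_self]
  obtain ⟨g, h, hg, hgn, hh, hhn, H0⟩ := key (n + 1)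
  refine ⟨g, h, hg, hgn, hh, hhn, ?_⟩
  have hDhn : HasDeg (D ε h) n := by simpa using HasDeg.D ε hh hhn
  have hpgn : HasDeg (pull M.φ g) n := hasDeg_iff.2 (M.hasDegree (hasDeg_iff.1 hgn))
  have hz : f - pull M.φ g - D ε h = 0 := by
    refine ((hf.sub (M.ml g hg)).sub (hh.D ε)).ext_homogeneous fun L e he => ?_
    -- The length of a list is at most its total degree, so a cochain of degree n vanishes on
    -- homogeneous lists longer than n, and n + 1 steps suffice.
    by_cases hL : L.length < n + 1
    · exact H0 L hL
    · have := (hn.add hpgn.neg).add hDhn.neg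
      rw [← sub_eq_add_neg, ← sub_eq_add_neg] at this
      refine this L e he fun h => ?_
      have := Nat.cast_injective h
      omega
  rw [sub_sub, sub_eq_zero] at hz
  exact hz

variable {k : Type*} [CommRing k] [Algebra k B]

theorem pullH_surjective (T : M.Contraction p)
    (hK' : Function.Surjective (Nat.cast : ℕ → K')) (hQ : ∀ x, Q.d x = 0)
    (hB : ∀ b : B, p • b = 0) (hs : ∀ n, ∀ z ∈ Q.gr n, ∃ x ∈ P.gr n, M.φ x = z) :
    Function.Surjective (M.pullH k) := fun y => by
  induction y using Coh.induction with
  | h0 => exact ⟨0, map_zero _⟩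
  | h1 n f hf =>
    obtain ⟨g, h, hg, hgn, hh, hhn, e⟩ := T.exists_decomp hK' hQ hB hs hf.ml hf.hasDeg
      isMultilinear_zero (hf.D_eq.trans (map_zero _).symm)
    have hDg : D ε' g = 0 := by
      have h1 : pull M.φ (D ε' g) = 0 := by
        rw [M.pull_D, ← hf.D_eq, e, D_add, D_D ε hh, add_zero]
      funext L
      obtain ⟨L, rfl⟩ := List.map_surjective_iff.2 (surjective hs) L
      exact congrFun h1 L
    have hgc : IsCocycle ε' n g := ⟨⟨hg, hasDeg_iff.1 hgn⟩, hDg⟩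
    refine ⟨cls k ε' n g hgc, ?_⟩
    rw [AugMor.pullH_cls, eq_comm, cls_eq_iff]
    exact ⟨h, hh, hhn, by rw [e]; abel⟩
  | h2 x y hx hy =>
    obtain ⟨a, rfl⟩ := hx
    obtain ⟨b, rfl⟩ := hy
    exact ⟨a + b, map_add _ _ _⟩

theorem pullH_cls_eq_zero (T : M.Contraction p)
    (hK' : Function.Surjective (Nat.cast : ℕ → K')) (hQ : ∀ x, Q.d x = 0)
    (hB : ∀ b : B, p • b = 0) (hs : ∀ n, ∀ z ∈ Q.gr n, ∃ x ∈ P.gr n, M.φ x = z)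
    {n : ℕ} {u : List Q → B} (hu : IsCocycle ε' n u) (h0 : M.pullH k (cls k ε' n u hu) = 0) :
    cls k ε' n u hu = 0 := by
  rw [AugMor.pullH_cls, cls_eq_zero_iff] at h0
  obtain ⟨f, hf, hfn, hfu⟩ := h0
  rw [cls_eq_zero_iff]
  rcases n with _ | n
  · refine ⟨0, isMultilinear_zero, fun _ _ _ _ => rfl, ?_⟩
    rw [hfn.eq_zero hf (by simp)] at hfu
    have : D ε (0 : List P → B) = 0 := IsCocycle.zero (n := 0).2
    rw [this] at hfu
    have : D ε' (0 : List Q → B) = 0 := IsCocycle.zero (n := 0).2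
    rw [this]
    funext L
    obtain ⟨L, rfl⟩ := List.map_surjective_iff.2 (surjective hs) L
    exact congrFun hfu L
  · have e : ((n + 1 : ℕ) : ℤ) - 1 = n := by push_cast; ring
    rw [e] at hfn ⊢
    obtain ⟨g, h, hg, hgn, hh, hhn, rfl⟩ := T.exists_decomp hK' hQ hB hs hf hfn hu.ml hfu
    refine ⟨g, hg, hgn, ?_⟩
    rw [D_add, D_D ε hh, add_zero, ← M.pull_D] at hfu
    funext L
    obtain ⟨L, rfl⟩ := List.map_surjective_iff.2 (surjective hs) L
    exact congrFun hfu L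

end AugMor.Contraction

end Contraction

section Components

variable {K K' : Type*} [CommRing K] [CommRing K'] {P : ChainAlgebra.{_, v} K}
  {Q : ChainAlgebra.{_, w} K'} {B B' : Type*} [Ring B] [Algebra K B] [Ring B'] [Algebra K' B']
  {ε : Hom P (ofAlgebra K B)} {ε' : Hom Q (ofAlgebra K' B')} {k : Type*} [CommRing k]
  [Algebra k B] [Algebra k B']

theorem HochschildCochain.Coh.map_component (T : Coh k ε →+ Coh k ε')
    (hT : ∀ n c, (T (DirectSum.of (HochschildH k ε) n c)).IsHomog n) (x : Coh k ε) (n : ℕ) :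
    DirectSum.of (HochschildH k ε') n (T x n) = T (DirectSum.of (HochschildH k ε) n (x n)) := by
  induction x using DirectSum.induction_on with
  | zero => simp
  | of m c =>
    by_cases h : m = n
    · subst h
      rw [DirectSum.of_eq_same]
      obtain ⟨c', hc'⟩ := (hT m c).exists_of
      rw [hc', DirectSum.of_eq_same]
    · rw [(hT m c).component h, DirectSum.of_eq_of_ne _ _ _ (Ne.symm h)]
      simp
  | add x y hx hy => rw [map_add, DirectSum.add_apply, DirectSum.add_apply, map_add, map_add,
      map_add, hx, hy]

theorem HochschildCochain.Coh.eq_zero_of_map (T : Coh k ε →+ Coh k ε')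
    (hT : ∀ n c, (T (DirectSum.of (HochschildH k ε) n c)).IsHomog n)
    (h : ∀ n (c : HochschildH k ε n), T (DirectSum.of (HochschildH k ε) n c) = 0 →
      DirectSum.of (HochschildH k ε) n c = 0) (x : Coh k ε) (hx : T x = 0) : x = 0 := by
  refine DFinsupp.ext fun n => ?_
  have h1 := Coh.map_component T hT x n
  rw [hx, DirectSum.zero_apply, map_zero] at h1
  exact DirectSum.of_injective n ((h n _ h1.symm).trans (map_zero _).symm)

end Components

theorem AugMor.Contraction.pullH_bijective {K K' : Type*} [CommRing K] [CommRing K']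
    {P : ChainAlgebra.{_, v} K} {Q : ChainAlgebra.{_, w} K'} {B : Type*} [Ring B] [Algebra K B]
    [Algebra K' B] {ε : Hom P (ofAlgebra K B)} {ε' : Hom Q (ofAlgebra K' B)} {M : AugMor ε ε'}
    {p : ℕ} (T : M.Contraction p) {k : Type*} [CommRing k] [Algebra k B]
    (hK' : Function.Surjective (Nat.cast : ℕ → K')) (hQ : ∀ x, Q.d x = 0)
    (hB : ∀ b : B, p • b = 0) (hs : ∀ n, ∀ z ∈ Q.gr n, ∃ x ∈ P.gr n, M.φ x = z) :
    Function.Bijective (M.pullH k) := by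
  refine ⟨(injective_iff_map_eq_zero _).2 fun x hx => Coh.eq_zero_of_map
    (M.pullH k).toAddMonoidHom (fun n c => M.isHomog (Coh.isHomog_of c)) (fun n c hc => ?_) x hx,
    T.pullH_surjective hK' hQ hB hs⟩
  obtain ⟨f, hf, e⟩ := exists_cls k c
  rw [e] at hc ⊢
  exact T.pullH_cls_eq_zero hK' hQ hB hs hf hc

end

/-! ### Constructing a contraction -/

section

open ChainAlgebra HochschildCochain

theorem exists_homotopy_zmod {V Z : Type*} [AddCommGroup V] [AddCommGroup Z] (p : ℕ)
    [Fact p.Prime] (hV : ∀ v : V, p • v = 0) (hZ : ∀ z : Z, p • z = 0) (d : V →+ V) (ψ : V →+ Z)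
    (hd : ∀ v, d (d v) = 0) (hψ : ∀ v, ψ (d v) = 0)
    (h1 : ∀ v, ψ v = 0 → d v = 0 → ∃ y, d y = v) (h2 : ∀ z, ∃ v, d v = 0 ∧ ψ v = z) :
    ∃ (h : V →+ V) (s : Z →+ V), (∀ v, d (h v) + h (d v) = v - s (ψ v)) ∧ ∀ v, ψ (h v) = 0 := by
  let _ : Module (ZMod p) V := AddCommGroup.zmodModule hV
  let _ : Module (ZMod p) Z := AddCommGroup.zmodModule hZ
  obtain ⟨h, s, h3, h4⟩ :=
    exists_homotopy (d.toZModLinearMap p) (ψ.toZModLinearMap p) hd hψ h1 h2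
  exact ⟨h.toAddMonoidHom, s.toAddMonoidHom, h3, h4⟩

namespace ChainAlgebra

variable {K : Type*} [CommRing K] (P : ChainAlgebra.{_, v} K)

/-- The projection to the component of degree `n`. -/
noncomputable def proj (n : ℕ) : P →ₗ[K] P := GradedAlgebra.proj P.gr n

theorem proj_mem (n : ℕ) (x : P) : P.proj n x ∈ P.gr n := (DirectSum.decompose P.gr x n).2

theorem proj_self {n : ℕ} {x : P} (hx : x ∈ P.gr n) : P.proj n x = x :=
  DirectSum.decompose_of_mem_same P.gr hx

theorem proj_ne {m n : ℕ} {x : P} (hx : x ∈ P.gr m) (h : m ≠ n) : P.proj n x = 0 :=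
  DirectSum.decompose_of_mem_ne P.gr hx h

theorem d_proj (n : ℕ) (x : P) : P.d (P.proj (n + 1) x) = P.proj n (P.d x) := by
  induction x using P.gr_induction with
  | h0 => simp
  | hom m x hx =>
    by_cases h : m = n + 1
    · subst h
      rw [P.proj_self hx, P.proj_self (P.d_gr_succ n x hx)]
    · rw [P.proj_ne hx h, map_zero]
      rcases m with _ | m
      · rw [P.d_gr_zero x hx, map_zero]
      · rw [P.proj_ne (P.d_gr_succ m x hx) (by omega)]
  | add x y hx hy => simp only [map_add, hx, hy]

theorem d_proj_zero (x : P) : P.d (P.proj 0 x) = 0 := P.d_gr_zero _ (P.proj_mem 0 x)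

/-- The component of degree `a` of a linear endomorphism. -/
noncomputable def component (a : ℕ) (T : P →ₗ[K] P) : P →ₗ[K] P :=
  (DirectSum.toModule K ℕ P fun n => P.proj (n + a) ∘ₗ T ∘ₗ (P.gr n).subtype) ∘ₗ
    (DirectSum.decomposeLinearEquiv P.gr).toLinearMap

theorem component_apply (a : ℕ) (T : P →ₗ[K] P) {n : ℕ} {x : P} (hx : x ∈ P.gr n) :
    P.component a T x = P.proj (n + a) (T x) := by
  rw [component, LinearMap.comp_apply, LinearEquiv.coe_coe, DirectSum.decomposeLinearEquiv_apply,
    DirectSum.decompose_of_mem _ hx, ← DirectSum.lof_eq_of K, DirectSum.toModule_lof]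
  rfl

end ChainAlgebra

section

variable {K K' : Type*} [CommRing K] [CommRing K'] {P : ChainAlgebra.{_, v} K}
  {Q : ChainAlgebra.{_, w} K'} {B : Type*} [Ring B] [Algebra K B] [Algebra K' B]
  {ε : Hom P (ofAlgebra K B)} {ε' : Hom Q (ofAlgebra K' B)}

theorem AugMor.map_proj (M : AugMor ε ε') (n : ℕ) (x : P) :
    M.φ (P.proj n x) = Q.proj n (M.φ x) := by
  induction x using P.gr_induction with
  | h0 => simp
  | hom m x hx =>
    by_cases h : m = n
    · subst h
      rw [P.proj_self hx, Q.proj_self (M.map_gr m x hx)]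
    · rw [P.proj_ne hx h, Q.proj_ne (M.map_gr m x hx) h, map_zero]
  | add x y hx hy => simp only [map_add, hx, hy]

/-- A surjection onto a complex of `𝔽_p`-vector spaces with zero differential that is a weak
equivalence modulo `p` has a contraction. -/
theorem AugMor.exists_contraction (M : AugMor ε ε') (p : ℕ) [Fact p.Prime] [Module.Projective K P]
    (hK : Function.Surjective (Nat.cast : ℕ → K)) (hQ : ∀ x, Q.d x = 0) (hpQ : ∀ x : Q, p • x = 0)
    (h1 : ∀ n, ∀ x ∈ P.gr n, M.φ x = 0 → (∃ r, P.d x = p • r) →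
      ∃ y ∈ P.gr (n + 1), ∃ r, P.d y = x + p • r)
    (h2 : ∀ n, ∀ z ∈ Q.gr n, ∃ x ∈ P.gr n, M.φ x = z ∧ ∃ r, P.d x = p • r) :
    Nonempty (M.Contraction p) := by
  -- The multiples of p. The quotient by `N` is an 𝔽_p-vector space, where linear algebra provides
  -- the homotopy.
  set N : Submodule K P := LinearMap.range ((p : K) • LinearMap.id : P →ₗ[K] P) with hN
  have hmem : ∀ x : P, x ∈ N ↔ ∃ r, x = p • r := fun x => by
    rw [hN, LinearMap.mem_range]
    refine exists_congr fun r => ?_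
    rw [LinearMap.smul_apply, LinearMap.id_apply, Nat.cast_smul_eq_nsmul, eq_comm]
  have hpV : ∀ v : P ⧸ N, p • v = 0 := fun v => by
    obtain ⟨x, rfl⟩ := N.mkQ_surjective v
    rw [← map_nsmul, Submodule.mkQ_apply, Submodule.Quotient.mk_eq_zero, hmem]
    exact ⟨x, rfl⟩
  set q := N.mkQ with hq
  have hqs : Function.Surjective q := N.mkQ_surjective
  have hq0 : ∀ x, q x = 0 ↔ ∃ r, x = p • r := fun x => by
    rw [hq, Submodule.mkQ_apply, Submodule.Quotient.mk_eq_zero, hmem]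
  let d : (P ⧸ N) →+ (P ⧸ N) := (N.mapQ N P.d fun x hx => by
      obtain ⟨r, rfl⟩ := (hmem x).1 hx
      exact (hmem _).2 ⟨P.d r, map_nsmul _ _ _⟩).toAddMonoidHom
  have hdq : ∀ x, d (q x) = q (P.d x) := fun x => rfl
  let ψ : (P ⧸ N) →+ Q := (QuotientAddGroup.lift N.toAddSubgroup (M.φ : P →+ Q) fun x hx => by
      obtain ⟨r, rfl⟩ := (hmem x).1 hx
      change M.φ (p • r) = 0
      rw [map_nsmul, hpQ])
  have hψq : ∀ x, ψ (q x) = M.φ x := fun x => rfl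
  have hproj : ∀ x : P, (∃ r, x = p • r) → ∀ n, ∃ r, P.proj n x = p • r := by
    rintro _ ⟨r, rfl⟩ n
    exact ⟨P.proj n r, map_nsmul _ _ _⟩
  have hadd : ∀ x y : P, (∃ r, x = p • r) → (∃ r, y = p • r) → ∃ r, x + y = p • r := by
    rintro _ _ ⟨r, rfl⟩ ⟨s, rfl⟩
    exact ⟨r + s, (smul_add _ _ _).symm⟩
  have e1 : ∀ v, ψ v = 0 → d v = 0 → ∃ y, d y = v := by
    intro v hv hdv
    obtain ⟨x, rfl⟩ := hqs v
    rw [hψq] at hv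
    rw [hdq, hq0] at hdv
    have hx : ∀ n, ∃ y, d y = q (P.proj n x) := fun n => by
      obtain ⟨y, -, r, hy⟩ := h1 n _ (P.proj_mem n x) (by rw [M.map_proj, hv, map_zero]) (by
        rcases n with _ | n
        · exact ⟨0, by rw [P.d_proj_zero, smul_zero]⟩
        · rw [P.d_proj]; exact hproj _ hdv n)
      refine ⟨q y, ?_⟩
      rw [hdq, hy, map_add, (hq0 (p • r)).2 ⟨r, rfl⟩, add_zero]
    choose y hy using hx
    classical
    refine ⟨∑ n ∈ (DirectSum.decompose P.gr x).support, y n, ?_⟩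
    rw [map_sum]
    conv_rhs => rw [← DirectSum.sum_support_decompose P.gr x]
    rw [map_sum]
    exact Finset.sum_congr rfl fun n _ => hy n
  have e2 : ∀ z, ∃ v, d v = 0 ∧ ψ v = z := by
    intro z
    induction z using Q.gr_induction with
    | h0 => exact ⟨0, map_zero _, map_zero _⟩
    | hom n z hz =>
      obtain ⟨x, -, hx, hr⟩ := h2 n z hz
      exact ⟨q x, by rw [hdq, hq0]; exact hr, by rw [hψq, hx]⟩
    | add x y hx hy =>
      obtain ⟨a, ha, rfl⟩ := hx
      obtain ⟨b, hb, rfl⟩ := hy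
      exact ⟨a + b, by rw [map_add, ha, hb, add_zero], map_add _ _ _⟩
  obtain ⟨h, s, hhs, hψh⟩ := exists_homotopy_zmod p hpV hpQ d ψ
    (fun v => by
      obtain ⟨x, rfl⟩ := hqs v
      rw [hdq, hdq, P.d_d, map_zero])
    (fun v => by
      obtain ⟨x, rfl⟩ := hqs v
      rw [hdq, hψq, M.map_d, hQ]) e1 e2
  -- Endomorphisms of the quotient lift to `P` because `P` is projective; the identities then hold
  -- only modulo p, which is all that a contraction asks for.
  have lift : ∀ t : (P ⧸ N) →+ (P ⧸ N), ∃ T : P →ₗ[K] P, ∀ x, q (T x) = t (q x) := by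
    intro t
    have ht : ∀ (c : K) v, t (c • v) = c • t v := fun c v => by
      obtain ⟨n, rfl⟩ := hK c
      rw [Nat.cast_smul_eq_nsmul, Nat.cast_smul_eq_nsmul, map_nsmul]
    obtain ⟨T, hT⟩ := Module.projective_lifting_property q
      (({ t with map_smul' := ht } : (P ⧸ N) →ₗ[K] (P ⧸ N)).comp q) hqs
    exact ⟨T, fun x => LinearMap.congr_fun hT x⟩
  obtain ⟨H, hH⟩ := lift h
  obtain ⟨E, hE⟩ := lift (s.comp ψ)
  have hom : ∀ x, ∃ r, P.d (H x) + H (P.d x) = x - E x + p • r := fun x => by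
    have : q (P.d (H x) + H (P.d x) - (x - E x)) = 0 := by
      rw [map_sub, map_add, map_sub, ← hdq, hH, hH, hE, sub_eq_zero]
      exact hhs (q x)
    obtain ⟨r, hr⟩ := (hq0 _).1 this
    exact ⟨r, by rw [← hr]; abel⟩
  have hφH : ∀ x, M.φ (H x) = 0 := fun x => by
    rw [← hψq, hH]; exact hψh _
  have hEφ : ∀ x, M.φ x = 0 → ∃ r, E x = p • r := fun x hx => by
    rw [← hq0, hE]
    change s (ψ (q x)) = 0
    rw [hψq, hx, map_zero]
  -- The homotopy was chosen without regard to the grading. Its component of degree 1 and the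
  -- component of degree 0 of E satisfy the same identities.
  refine ⟨⟨P.component 1 H, P.component 0 E, fun n x hx => ?_, fun n x hx => ?_, fun x => ?_,
    fun x => ?_, fun x hx => ?_⟩⟩
  · rw [P.component_apply 1 H hx]; exact P.proj_mem _ _
  · rw [P.component_apply 0 E hx]; exact P.proj_mem _ _
  · induction x using P.gr_induction with
    | h0 => exact ⟨0, by simp⟩
    | hom n x hx =>
      have e : P.component 1 H (P.d x) = P.proj n (H (P.d x)) := by
        rcases n with _ | n
        · rw [P.d_gr_zero x hx, map_zero, map_zero, map_zero]
        · rw [P.component_apply 1 H (P.d_gr_succ n x hx)]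
      obtain ⟨r, hr⟩ := hom x
      refine ⟨P.proj n r, ?_⟩
      rw [P.component_apply 1 H hx, P.component_apply 0 E hx, e, P.d_proj, ← map_add, hr, map_add,
        map_sub, map_nsmul, P.proj_self hx, add_zero]
    | add x y hx hy =>
      obtain ⟨r, hr⟩ := hx
      obtain ⟨r', hr'⟩ := hy
      refine ⟨r + r', ?_⟩
      rw [map_add, map_add, map_add, map_add, map_add, smul_add]
      linear_combination (norm := module) (1 : ℤ) • hr + (1 : ℤ) • hr'
  · induction x using P.gr_induction with
    | h0 => simp
    | hom n x hx => rw [P.component_apply 1 H hx, M.map_proj, hφH, map_zero]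
    | add x y hx hy => rw [map_add, map_add, hx, hy, add_zero]
  · classical
    rw [← DirectSum.sum_support_decompose P.gr x, map_sum]
    refine Finset.sum_induction _ (fun y => ∃ r, y = p • r) hadd ⟨0, (smul_zero _).symm⟩
      fun n _ => ?_
    change ∃ r, P.component 0 E (P.proj n x) = p • r
    rw [P.component_apply 0 E (P.proj_mem n x)]
    exact hproj _ (hEφ _ (by

      rw [M.map_proj, hx, map_zero])) _

end

end

/-! ### Quasi-free algebras and the lifting of augmentations -/

section

open ChainAlgebra HochschildCochain

namespace ChainAlgebra

section Generators

variable {K : Type*} [CommRing K] {P : ChainAlgebra.{_, v} K} {X : Type*} {deg : X → ℕ} {g : X → P}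

/-- Induction on words, arranged so that the property may depend on the degree. Taking components at
the end returns from the sum of all pieces to the piece of degree n. -/
theorem mem_of_generators (hs : Function.Surjective (FreeAlgebra.lift K g))
    {C : ℕ → Submodule K P} (hC : ∀ n, C n ≤ P.gr n) (h1 : 1 ∈ C 0)
    (hmul : ∀ n x, ∀ u ∈ C n, u * g x ∈ C (n + deg x)) {n : ℕ} {r : P} (hr : r ∈ P.gr n) :
    r ∈ C n := by
  have hU : ∀ a, ∀ u ∈ ⨆ n, C n, u * FreeAlgebra.lift K g a ∈ ⨆ n, C n := by
    intro a
    induction a using FreeAlgebra.induction with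
    | grade0 c =>
      intro u hu
      rw [AlgHom.commutes, ← Algebra.commutes, ← Algebra.smul_def]
      exact Submodule.smul_mem _ _ hu
    | grade1 x =>
      intro u hu
      rw [FreeAlgebra.lift_ι_apply]
      induction hu using Submodule.iSup_induction' with
      | mem n u hu => exact Submodule.mem_iSup_of_mem _ (hmul n x u hu)
      | zero => rw [zero_mul]; exact Submodule.zero_mem _
      | add u v _ _ hu hv => rw [add_mul]; exact Submodule.add_mem _ hu hv
    | mul a b ha hb =>
      intro u hu
      rw [map_mul, ← mul_assoc]
      exact hb _ (ha u hu)
    | add a b ha hb =>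
      intro u hu
      rw [map_add, mul_add]
      exact Submodule.add_mem _ (ha u hu) (hb u hu)
  have hr' : r ∈ ⨆ n, C n := by
    obtain ⟨a, rfl⟩ := hs r
    have := hU a 1 (Submodule.mem_iSup_of_mem 0 h1)
    rwa [one_mul] at this
  have key : ∀ n, P.proj n r ∈ C n := by
    clear hr
    induction hr' using Submodule.iSup_induction' with
    | mem m u hu =>
      intro n
      by_cases h : m = n
      · subst h
        rwa [P.proj_self (hC _ hu)]
      · rw [P.proj_ne (hC _ hu) h]; exact Submodule.zero_mem _
    | zero => intro n; rw [map_zero]; exact Submodule.zero_mem _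
    | add u v _ _ hu hv => intro n; rw [map_add]; exact Submodule.add_mem _ (hu n) (hv n)
  rw [← P.proj_self hr]
  exact key n

/-- A word of degree m contains no generator of degree above m. This justifies recursion on the
degree of generators. -/
theorem eqOn_of_generators (hg : ∀ x, g x ∈ P.gr (deg x))
    (hs : Function.Surjective (FreeAlgebra.lift K g)) {S : Type*} [Ring S] [Algebra K S]
    {f f' : P →ₐ[K] S} {m : ℕ} (h : ∀ x, deg x ≤ m → f (g x) = f' (g x)) {r : P}
    (hr : r ∈ P.gr m) : f r = f' r := by
  have := mem_of_generators (deg := deg) hs (C := fun n =>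
    { carrier := {u | u ∈ P.gr n ∧ (n ≤ m → f u = f' u)}
      zero_mem' := ⟨Submodule.zero_mem _, fun _ => by simp⟩
      add_mem' := fun ha hb => ⟨Submodule.add_mem _ ha.1 hb.1, fun hn => by
        rw [map_add, map_add, ha.2 hn, hb.2 hn]⟩
      smul_mem' := fun c a ha => ⟨Submodule.smul_mem _ _ ha.1, fun hn => by
        rw [map_smul, map_smul, ha.2 hn]⟩ }) (fun n u hu => hu.1)
    ⟨SetLike.GradedOne.one_mem, fun _ => by rw [map_one, map_one]⟩
    (fun n x u hu => ⟨SetLike.mul_mem_graded hu.1 (hg x), fun hn => by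
      rw [map_mul, map_mul, hu.2 (by omega), h x (by omega)]⟩) hr
  exact this.2 le_rfl

variable {B : Type*} [Ring B] [Algebra K B] {ε : Hom P (ofAlgebra K B)}
  {Q : ChainAlgebra.{_, w} K} {ε' : Hom Q (ofAlgebra K B)}

theorem isMorphism_of_generators (hg : ∀ x, g x ∈ P.gr (deg x))
    (hs : Function.Surjective (FreeAlgebra.lift K g)) {f : P →ₐ[K] Q} {m : ℕ}
    (h : ∀ x, deg x ≤ m → f (g x) ∈ Q.gr (deg x) ∧ f (P.d (g x)) = Q.d (f (g x)) ∧
      ε'.aug (f (g x)) = ε.aug (g x)) {n : ℕ} (hn : n ≤ m) {r : P} (hr : r ∈ P.gr n) :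
    f r ∈ Q.gr n ∧ f (P.d r) = Q.d (f r) ∧ ε'.aug (f r) = ε.aug r := by
  have h1 : (1 : P) ∈ P.gr 0 := SetLike.GradedOne.one_mem
  have h1' : (1 : Q) ∈ Q.gr 0 := SetLike.GradedOne.one_mem
  have := mem_of_generators (deg := deg) hs (C := fun n =>
    { carrier := {u | u ∈ P.gr n ∧
        (n ≤ m → f u ∈ Q.gr n ∧ f (P.d u) = Q.d (f u) ∧ ε'.aug (f u) = ε.aug u)}
      zero_mem' := ⟨Submodule.zero_mem _, fun _ => by simp⟩
      add_mem' := fun ha hb => ⟨Submodule.add_mem _ ha.1 hb.1, fun hn => by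
        obtain ⟨a1, a2, a3⟩ := ha.2 hn
        obtain ⟨b1, b2, b3⟩ := hb.2 hn
        refine ⟨?_, ?_, ?_⟩
        · rw [map_add]; exact Submodule.add_mem _ a1 b1
        · simp only [map_add, a2, b2]
        · simp only [map_add, a3, b3]⟩
      smul_mem' := fun c a ha => ⟨Submodule.smul_mem _ _ ha.1, fun hn => by
        obtain ⟨a1, a2, a3⟩ := ha.2 hn
        refine ⟨?_, ?_, ?_⟩
        · rw [map_smul]; exact Submodule.smul_mem _ _ a1
        · simp only [map_smul, a2]
        · simp only [map_smul, a3]⟩ }) (fun n u hu => hu.1)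
    ⟨h1, fun _ => ⟨by rw [map_one]; exact h1', by
      rw [P.d_gr_zero _ h1, map_one, Q.d_gr_zero _ h1', map_zero], by simp only [map_one]⟩⟩
    (fun n x u hu => ⟨SetLike.mul_mem_graded hu.1 (hg x), fun hn => by
      obtain ⟨a1, a2, a3⟩ := hu.2 (by omega)
      obtain ⟨b1, b2, b3⟩ := h x (by omega)
      refine ⟨?_, ?_, ?_⟩
      · rw [map_mul]; exact SetLike.mul_mem_graded a1 b1
      · rw [P.leibniz n u hu.1, map_mul, Q.leibniz n _ a1, map_add, map_mul, map_smul, map_mul,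
          a2, b2]
      · rw [map_mul, map_mul, map_mul, a3, b3]⟩) hr
  exact this.2 hn

/-- Augmentations with surjective degree zero part and no other homology. -/
structure Hom.IsAcyclic {K : Type*} [CommRing K] {Q : ChainAlgebra.{_, w} K} {B : Type*} [Ring B]
    [Algebra K B] (ε : Hom Q (ofAlgebra K B)) : Prop where
  surj : ∀ b, ∃ x ∈ Q.gr 0, ε.aug x = b
  exact : ∀ n, ∀ x ∈ Q.gr n, Q.d x = 0 → ε.aug x = 0 → ∃ y ∈ Q.gr (n + 1), Q.d y = x

theorem Hom.IsWeakEquivalence.isAcyclic (h : ε.IsWeakEquivalence) : ε.IsAcyclic where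
  surj b := by
    obtain ⟨x, hx, -, z, -, hz⟩ := (h 0).2 b Submodule.mem_top rfl
    exact ⟨x, hx, (sub_eq_zero.1 hz.symm)⟩
  exact n x hx hd hε := (h n).1 x hx hd ⟨0, Submodule.zero_mem _, hε.symm⟩

theorem Hom.IsAcyclic.isWeakEquivalence (h : ε.IsAcyclic) : ε.IsWeakEquivalence := by
  refine fun n => ⟨fun x hx hd ⟨y, hy, e⟩ => h.exact n x hx hd e.symm, fun y hy _ => ?_⟩
  rcases n with _ | n
  · obtain ⟨x, hx, e⟩ := h.surj y
    exact ⟨x, hx, P.d_gr_zero x hx, 0, Submodule.zero_mem _, (sub_eq_zero.2 e).symm⟩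
  · have hy0 : y = 0 := hy
    exact ⟨0, Submodule.zero_mem _, map_zero _, 0, Submodule.zero_mem _, by
      rw [hy0, sub_zero]; exact (map_zero ε.toAlgHom).symm⟩

/-- Images of generators are chosen by recursion on the degree: the image of dg is already known, it
is a cycle of augmentation zero, and exactness of `Q` supplies an element that bounds it. -/
theorem IsQuasiFree.exists_hom (hP : P.IsQuasiFree) (h : ε'.IsAcyclic) :
    ∃ f : Hom P Q, ∀ x, ε'.aug (f.toAlgHom x) = ε.aug x := by
  obtain ⟨X, deg, g, hg, hb⟩ := hP
  set e := AlgEquiv.ofBijective _ hb with he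
  set Φ : (X → Q) → (P →ₐ[K] Q) := fun s => (FreeAlgebra.lift K s).comp e.symm with hΦ
  have hΦg : ∀ s x, Φ s (g x) = s x := fun s x => by
    have : e.symm (g x) = FreeAlgebra.ι K x := by
      rw [AlgEquiv.symm_apply_eq, he, AlgEquiv.ofBijective_apply, FreeAlgebra.lift_ι_apply]
    change FreeAlgebra.lift K s (e.symm (g x)) = s x
    rw [this, FreeAlgebra.lift_ι_apply]
  classical
  -- `Classical.epsilon` allows the recursion to be written down first; that a suitable element
  -- exists at every stage is proved afterwards, in `good`.
  set F : ∀ x, (∀ y, deg y < deg x → Q) → Q := fun x s =>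
    Classical.epsilon fun q => q ∈ Q.gr (deg x) ∧
      Φ (fun y => if h : deg y < deg x then s y h else 0) (P.d (g x)) = Q.d q ∧
      ε'.aug q = ε.aug (g x) with hF
  set s : X → Q := (measure deg).wf.fix F with hs
  have hsF : ∀ x, s x = F x fun y _ => s y := fun x => WellFounded.fix_eq _ _ _
  have good : ∀ n x, deg x = n → Φ s (g x) ∈ Q.gr (deg x) ∧ Φ s (P.d (g x)) = Q.d (Φ s (g x)) ∧
      ε'.aug (Φ s (g x)) = ε.aug (g x) := by
    intro n
    induction n using Nat.strong_induction_on with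
    | _ n ih =>
      intro x hx
      -- d(g x) has smaller degree than g x, so replacing the images of the other generators by 0
      -- does not change its image.
      have hag : Φ (fun y => if h : deg y < deg x then s y else 0) (P.d (g x)) =
          Φ s (P.d (g x)) := by
        rcases n with _ | n
        · have := hg x
          rw [hx] at this
          rw [P.d_gr_zero _ this, map_zero, map_zero]
        · have := hg x
          rw [hx] at this
          refine eqOn_of_generators hg hb.2 (m := n) (fun y hy => ?_) (P.d_gr_succ n _ this)
          rw [hΦg, hΦg, dif_pos (by omega)]
      have hex : ∃ q, q ∈ Q.gr (deg x) ∧ Φ s (P.d (g x)) = Q.d q ∧ ε'.aug q = ε.aug (g x) := by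
        have hgx := hg x
        rw [hx] at hgx ⊢
        rcases n with _ | n
        · obtain ⟨q, hq, hqa⟩ := h.surj (ε.aug (g x))
          exact ⟨q, hq, by rw [P.d_gr_zero _ hgx, map_zero, Q.d_gr_zero _ hq], hqa⟩
        · obtain ⟨a1, a2, a3⟩ := isMorphism_of_generators (ε := ε) (ε' := ε') hg hb.2 (f := Φ s)
            (m := n) (fun y hy => ih _ (by omega) y rfl) le_rfl (P.d_gr_succ n _ hgx)
          rw [P.d_d, map_zero] at a2
          rw [ε.aug_d] at a3
          obtain ⟨q, hq, hqd⟩ := h.exact n _ a1 a2.symm a3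
          exact ⟨q, hq, hqd.symm, by rw [ε'.aug_gr_succ hq, ε.aug_gr_succ hgx]⟩
      rw [hΦg, hsF x, hF]
      rw [← hag] at hex ⊢
      exact Classical.epsilon_spec hex
  refine ⟨⟨Φ s, fun n x hx => ?_, fun x => ?_⟩, fun x => ?_⟩
  · exact (isMorphism_of_generators (ε := ε) (ε' := ε') hg hb.2
      (fun y _ => good _ y rfl) (le_refl n) hx).1
  · induction x using P.gr_induction with
    | h0 => simp
    | hom n x hx => exact (isMorphism_of_generators (ε := ε) (ε' := ε') hg hb.2
        (fun y _ => good _ y rfl) (le_refl n) hx).2.1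
    | add x y hx hy => simp only [map_add, hx, hy]
  · induction x using P.gr_induction with
    | h0 => simp
    | hom n x hx => exact (isMorphism_of_generators (ε := ε) (ε' := ε') hg hb.2
        (fun y _ => good _ y rfl) (le_refl n) hx).2.2
    | add x y hx hy =>
      change ε'.aug (Φ s x) = _ at hx
      change ε'.aug (Φ s y) = _ at hy
      change ε'.aug (Φ s (x + y)) = _
      simp only [map_add, hx, hy]

theorem IsQuasiFree.free (hP : P.IsQuasiFree) : Module.Free K P := by
  obtain ⟨X, deg, g, hg, hb⟩ := hP
  exact Module.Free.of_equiv (AlgEquiv.ofBijective _ hb).toLinearEquiv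

end Generators

end ChainAlgebra

/-! ### Mapping cones and exactness modulo p -/

section Cone

/-- An acyclic complex whose p-torsion is divisible by p stays acyclic modulo p. If dc = pe, then de
is p-torsion, so de = pe', and induction on the degree writes e = df + pg. Then c - pf is a cycle,
because p² = 0, hence a boundary. -/
theorem exact_mod {C : Type*} [AddCommGroup C] (G : ℕ → AddSubgroup C) (d : C →+ C) (p : ℕ)
    (hp : ∀ c : C, p • p • c = 0) (hd : ∀ c, d (d c) = 0) (hd0 : ∀ c ∈ G 0, d c = 0)
    (hdG : ∀ n, ∀ c ∈ G (n + 1), d c ∈ G n)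
    (hex : ∀ n, ∀ c ∈ G n, d c = 0 → ∃ c' ∈ G (n + 1), d c' = c)
    (htor : ∀ n, ∀ c ∈ G n, p • c = 0 → ∃ c' ∈ G n, c = p • c') (n : ℕ) {c : C} (hc : c ∈ G (n + 1))
    {e : C} (he : e ∈ G n) (hce : d c = p • e) : ∃ f ∈ G (n + 2), ∃ g, c = d f + p • g := by
  have key : ∀ n, ∀ c ∈ G (n + 1), ∀ e ∈ G n, d c = p • e →
      ∃ f ∈ G (n + 2), ∃ g, c = d f + p • g := by
    intro n
    induction n with
    | zero =>
      intro c hc e he hce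
      obtain ⟨f, hf, hfe⟩ := hex 0 e he (hd0 e he)
      obtain ⟨h, hh, hhe⟩ := hex 1 (c - p • f) (sub_mem hc (nsmul_mem hf p)) (by
        rw [map_sub, map_nsmul, hfe, hce, sub_self])
      exact ⟨h, hh, f, by rw [hhe]; abel⟩
    | succ n ih =>
      intro c hc e he hce
      obtain ⟨e', he', hee'⟩ := htor n (d e) (hdG n e he) (by
        rw [← map_nsmul, ← hce, hd])
      obtain ⟨f, hf, g, hfg⟩ := ih e he e' he' hee'
      obtain ⟨h, hh, hhe⟩ := hex (n + 2) (c - p • f) (sub_mem hc (nsmul_mem hf p)) (by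
        rw [map_sub, map_nsmul, hce, hfg, smul_add, hp, add_zero, sub_self])
      exact ⟨h, hh, f, by rw [hhe]; abel⟩
  exact key n c hc e he hce

variable {K : Type*} [CommRing K] {P : ChainAlgebra.{_, v} K} {Q : ChainAlgebra.{_, w} K}
  {B : Type*} [Ring B] [Algebra K B] {ε : Hom P (ofAlgebra K B)} {ε' : Hom Q (ofAlgebra K B)}
  (f : Hom P Q)

/-- The graded pieces of the mapping cone. -/
def coneGr (P : ChainAlgebra.{_, v} K) (Q : ChainAlgebra.{_, w} K) : ℕ → AddSubgroup (P × Q)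
  | 0 => AddSubgroup.prod ⊥ (Q.gr 0).toAddSubgroup
  | n + 1 => AddSubgroup.prod (P.gr n).toAddSubgroup (Q.gr (n + 1)).toAddSubgroup

/-- The differential of the mapping cone. -/
def coneD : P × Q →+ P × Q where
  toFun c := (-P.d c.1, Q.d c.2 - f.toAlgHom c.1)
  map_zero' := by simp
  map_add' c c' := by
    ext
    · simp [add_comm]
    · simp only [Prod.fst_add, Prod.snd_add, map_add]; abel

theorem coneD_apply (x : P) (q : Q) : coneD f (x, q) = (-P.d x, Q.d q - f.toAlgHom x) := rfl

theorem coneD_coneD (c : P × Q) : coneD f (coneD f c) = 0 := by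
  obtain ⟨x, q⟩ := c
  rw [coneD_apply, coneD_apply]
  ext
  · simp [P.d_d]
  · simp [Q.d_d, f.map_d]

theorem coneD_gr_zero (c : P × Q) (hc : c ∈ coneGr P Q 0) : coneD f c = 0 := by
  obtain ⟨x, q⟩ := c
  obtain ⟨hx, hq⟩ := hc
  have hx : x = 0 := hx
  rw [coneD_apply, hx, map_zero, map_zero, Q.d_gr_zero q hq]
  simp

theorem coneD_gr (n : ℕ) (c : P × Q) (hc : c ∈ coneGr P Q (n + 1)) : coneD f c ∈ coneGr P Q n := by
  obtain ⟨x, q⟩ := c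
  obtain ⟨hx, hq⟩ := hc
  rw [coneD_apply]
  rcases n with _ | n
  · refine ⟨?_, Submodule.sub_mem _ (Q.d_gr_succ 0 q hq) (f.map_gr 0 x hx)⟩
    change -P.d x = 0
    rw [P.d_gr_zero x hx, neg_zero]
  · exact ⟨Submodule.neg_mem _ (P.d_gr_succ n x hx), Submodule.sub_mem _ (Q.d_gr_succ _ q hq) (f.map_gr _ x hx)⟩

/-- Both sides resolve the same algebra compatibly: exactness of `P` removes the first component,
and exactness of `Q` then handles what is left. -/
theorem cone_exact (hf : ∀ x, ε'.aug (f.toAlgHom x) = ε.aug x) (h : ε.IsAcyclic)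
    (h' : ε'.IsAcyclic) (n : ℕ) (c : P × Q) (hc : c ∈ coneGr P Q n) (hd : coneD f c = 0) :
    ∃ c' ∈ coneGr P Q (n + 1), coneD f c' = c := by
  obtain ⟨x, q⟩ := c
  rw [coneD_apply, Prod.mk_eq_zero, neg_eq_zero, sub_eq_zero] at hd
  rcases n with _ | n <;> obtain ⟨hx, hq⟩ := hc
  · have hx : x = 0 := hx
    obtain ⟨y, hy, hya⟩ := h.surj (ε'.aug q)
    obtain ⟨z, hz, hzd⟩ := h'.exact 0 (q + f.toAlgHom (-y))
      (Submodule.add_mem _ hq (f.map_gr 0 _ (Submodule.neg_mem _ hy)))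
      (Q.d_gr_zero _ (Submodule.add_mem _ hq (f.map_gr 0 _ (Submodule.neg_mem _ hy))))
      (by rw [map_add, hf, map_neg, hya, add_neg_cancel])
    refine ⟨(-y, z), ⟨Submodule.neg_mem _ hy, hz⟩, ?_⟩
    rw [coneD_apply, hzd, map_neg P.d, P.d_gr_zero y hy, hx]
    simp
  · obtain ⟨y, hy, hyd⟩ := h.exact n x hx hd.1 (by
      rw [← hf, ← hd.2, ε'.aug_d])
    obtain ⟨z, hz, hzd⟩ := h'.exact (n + 1) (q + f.toAlgHom (-y))
      (Submodule.add_mem _ hq (f.map_gr _ _ (Submodule.neg_mem _ hy)))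
      (by rw [map_add, hd.2, ← f.map_d, map_neg, hyd, map_neg, add_neg_cancel])
      (by rw [map_add, hf, ε'.aug_gr_succ hq, ε.aug_gr_succ (Submodule.neg_mem _ hy), add_zero])
    refine ⟨(-y, z), ⟨Submodule.neg_mem _ hy, hz⟩, ?_⟩
    rw [coneD_apply, hzd, map_neg P.d, hyd]
    simp

variable {p : ℕ}

theorem cone_torsion (hP : ∀ n, ∀ x ∈ P.gr n, p • x = 0 → ∃ y, x = p • y)
    (hQ : ∀ n, ∀ x ∈ Q.gr n, p • x = 0 → ∃ y, x = p • y) (n : ℕ) (c : P × Q)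
    (hc : c ∈ coneGr P Q n) (h : p • c = 0) : ∃ c' ∈ coneGr P Q n, c = p • c' := by
  obtain ⟨x, q⟩ := c
  rw [Prod.smul_mk, Prod.mk_eq_zero] at h
  have hq : q ∈ Q.gr n := by rcases n with _ | n <;> exact hc.2
  obtain ⟨q', hq'⟩ := hQ n q hq h.2
  have eq : q = p • Q.proj n q' := by rw [← map_nsmul, ← hq', Q.proj_self hq]
  rcases n with _ | n <;> obtain ⟨hx, -⟩ := hc
  · have hx : x = 0 := hx
    refine ⟨(0, Q.proj 0 q'), ⟨rfl, Q.proj_mem 0 q'⟩, ?_⟩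
    rw [Prod.smul_mk, ← eq, hx, smul_zero]
  · obtain ⟨y, hy⟩ := hP n x hx h.1
    refine ⟨(P.proj n y, Q.proj (n + 1) q'), ⟨P.proj_mem n y, Q.proj_mem _ q'⟩, ?_⟩
    rw [Prod.smul_mk, ← eq, ← map_nsmul, ← hy, P.proj_self hx]

/-- Injectivity modulo p, for elements that vanish in `Q` modulo p: the pair (x, 0) is a cycle of
the cone modulo p, so it bounds modulo p. -/
theorem exists_of_map_mod (hf : ∀ x, ε'.aug (f.toAlgHom x) = ε.aug x) (h : ε.IsAcyclic)
    (h' : ε'.IsAcyclic) (hP : ∀ n, ∀ x ∈ P.gr n, p • x = 0 → ∃ y, x = p • y)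
    (hQ : ∀ n, ∀ x ∈ Q.gr n, p • x = 0 → ∃ y, x = p • y) (hp : ((p : K)) * p = 0)
    (n : ℕ) {x : P} (hx : x ∈ P.gr n) (hfx : ∃ q, f.toAlgHom x = p • q)
    (hdx : ∃ r, P.d x = p • r) : ∃ y ∈ P.gr (n + 1), ∃ r, P.d y = x + p • r := by
  obtain ⟨q, hq⟩ := hfx
  obtain ⟨r, hr⟩ := hdx
  have hpp : ∀ c : P × Q, p • p • c = 0 := fun c => by
    rw [← Nat.cast_smul_eq_nsmul K, ← Nat.cast_smul_eq_nsmul K, smul_smul, hp, zero_smul]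
  have hq' : f.toAlgHom x = p • Q.proj n q := by
    rw [← map_nsmul, ← hq, Q.proj_self (f.map_gr n x hx)]
  obtain ⟨e, he, hxe⟩ : ∃ e ∈ coneGr P Q n, coneD f (x, 0) = p • e := by
    rcases n with _ | n
    · refine ⟨(0, -Q.proj 0 q), ⟨rfl, Submodule.neg_mem _ (Q.proj_mem 0 q)⟩, ?_⟩
      rw [coneD_apply, P.d_gr_zero x hx, hq']
      simp
    · have hr' : P.d x = p • P.proj n r := by
        rw [← map_nsmul, ← hr, P.proj_self (P.d_gr_succ n x hx)]
      refine ⟨(-P.proj n r, -Q.proj (n + 1) q), ⟨Submodule.neg_mem _ (P.proj_mem n r),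
        Submodule.neg_mem _ (Q.proj_mem _ q)⟩, ?_⟩
      rw [coneD_apply, hr', hq']
      simp
  obtain ⟨⟨y, z⟩, hyz, ⟨g, g'⟩, e⟩ := exact_mod (coneGr P Q) (coneD f) p hpp (coneD_coneD f)
    (coneD_gr_zero f) (coneD_gr f) (cone_exact f hf h h') (cone_torsion hP hQ) n
    (c := (x, 0)) ⟨hx, Submodule.zero_mem _⟩ he hxe
  have e1 : x = -P.d y + p • g := congrArg Prod.fst e
  exact ⟨-y, Submodule.neg_mem _ hyz.1, -g, by rw [map_neg, e1, smul_neg]; abel⟩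

/-- Surjectivity on homology modulo p, from the cone element (0, q). -/
theorem exists_map_eq_mod (hf : ∀ x, ε'.aug (f.toAlgHom x) = ε.aug x) (h : ε.IsAcyclic)
    (h' : ε'.IsAcyclic) (hP : ∀ n, ∀ x ∈ P.gr n, p • x = 0 → ∃ y, x = p • y)
    (hQ : ∀ n, ∀ x ∈ Q.gr n, p • x = 0 → ∃ y, x = p • y) (hp : ((p : K)) * p = 0)
    (n : ℕ) {q : Q} (hq : q ∈ Q.gr n) (hdq : ∃ r, Q.d q = p • r) :
    ∃ x ∈ P.gr n, (∃ r, P.d x = p • r) ∧ ∃ s y, f.toAlgHom x = q + Q.d y + p • s := by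
  obtain ⟨r, hr⟩ := hdq
  have hpp : ∀ c : P × Q, p • p • c = 0 := fun c => by
    rw [← Nat.cast_smul_eq_nsmul K, ← Nat.cast_smul_eq_nsmul K, smul_smul, hp, zero_smul]
  have hc : ((0, q) : P × Q) ∈ coneGr P Q n := by
    rcases n with _ | n
    · exact ⟨rfl, hq⟩
    · exact ⟨Submodule.zero_mem _, hq⟩
  obtain ⟨⟨y, z⟩, hyz, ⟨g, g'⟩, e⟩ : ∃ c ∈ coneGr P Q (n + 1), ∃ g, (0, q) = coneD f c + p • g := by
    rcases n with _ | n
    · obtain ⟨c, hc, hcd⟩ := cone_exact f hf h h' 0 _ hc (coneD_gr_zero f _ hc)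
      exact ⟨c, hc, 0, by rw [hcd, smul_zero, add_zero]⟩
    · have hr' : Q.d q = p • Q.proj n r := by
        rw [← map_nsmul, ← hr, Q.proj_self (Q.d_gr_succ n q hq)]
      refine exact_mod (coneGr P Q) (coneD f) p hpp (coneD_coneD f)
        (coneD_gr_zero f) (coneD_gr f) (cone_exact f hf h h') (cone_torsion hP hQ) n hc
        (e := (0, Q.proj n r)) ?_ ?_
      · rcases n with _ | n
        · exact ⟨rfl, Q.proj_mem 0 r⟩
        · exact ⟨Submodule.zero_mem _, Q.proj_mem _ r⟩
      · rw [coneD_apply, hr']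
        simp
  have e1 : 0 = -P.d y + p • g := congrArg Prod.fst e
  have e2 : q = Q.d z - f.toAlgHom y + p • g' := congrArg Prod.snd e
  refine ⟨-y, Submodule.neg_mem _ hyz.1, ⟨-g, ?_⟩, -g', -z, ?_⟩
  · rw [map_neg, smul_neg, ← sub_eq_zero, sub_neg_eq_add, ← e1]
  · conv_rhs => rw [e2]
    rw [map_neg, map_neg, smul_neg]
    abel

end Cone

end

/-! ### The Koszul resolution over ℤ/p² and its reduction modulo p -/

section

open ChainAlgebra HochschildCochain

open StructureConstants

namespace TwistedPoly

section Koszul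

variable (K : Type v) [CommRing K] (A : Type u) [Ring A] [Algebra K A] (p : ℕ)

/-- The differential `e_{i + 1} ↦ p e_i`. -/
noncomputable def koszulD : TwistedPoly lambdaGamma A →ₗ[K] TwistedPoly lambdaGamma A :=
  liftL fun i => if i = 0 then 0 else p • monL K lambdaGamma (i - 1)

variable {A}

theorem koszulD_zero (a : A) : koszulD K A p (mon lambdaGamma 0 a) = 0 := by
  rw [koszulD, liftL_mon]; rfl

theorem koszulD_succ (i : ℕ) (a : A) :
    koszulD K A p (mon lambdaGamma (i + 1) a) = p • mon lambdaGamma i a := by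
  rw [koszulD, liftL_mon]; rfl

variable {K} in
theorem koszulD_koszulD (hp : (p : K) * p = 0) (x : TwistedPoly lambdaGamma A) :
    koszulD K A p (koszulD K A p x) = 0 := by
  induction x using induction with
  | h0 => simp
  | h1 i a =>
    rcases i with _ | _ | i
    · rw [koszulD_zero, map_zero]
    · rw [koszulD_succ, map_nsmul, koszulD_zero, smul_zero]
    · rw [koszulD_succ, map_nsmul, koszulD_succ, ← Nat.cast_smul_eq_nsmul K,
        ← Nat.cast_smul_eq_nsmul K, smul_smul, hp, zero_smul]
  | h2 x y hx hy => rw [map_add, map_add, hx, hy, add_zero]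

/-- In the main case this is Pascal's rule for the structure constants. -/
theorem koszulD_even_mul_even (i j : ℕ) (a b : A) :
    koszulD K A p (mon lambdaGamma (2 * i) a * mon lambdaGamma (2 * j) b) =
      koszulD K A p (mon lambdaGamma (2 * i) a) * mon lambdaGamma (2 * j) b +
        mon lambdaGamma (2 * i) a * koszulD K A p (mon lambdaGamma (2 * j) b) := by
  rw [even_mul_even]
  rcases i with _ | i
  · rcases j with _ | j
    · simp [koszulD_zero]
    · rw [show 2 * (0 + (j + 1)) = 2 * j + 1 + 1 by ring, show 2 * (j + 1) = 2 * j + 1 + 1 by ring,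
        koszulD_succ, koszulD_succ, koszulD_zero, mul_smul_comm, even_mul_odd]
      simp [gamma_c]
  · rcases j with _ | j
    · rw [show 2 * (i + 1 + 0) = 2 * i + 1 + 1 by ring, koszulD_succ, koszulD_succ, koszulD_zero, smul_mul_assoc, odd_mul_even]
      simp [gamma_c]
    · rw [show 2 * (i + 1 + (j + 1)) = 2 * (i + j + 1) + 1 + 1 by ring, koszulD_succ,
        show koszulD K A p (mon lambdaGamma (2 * (i + 1)) a) = p • mon lambdaGamma (2 * i + 1) a from
          koszulD_succ K p _ a,
        show koszulD K A p (mon lambdaGamma (2 * (j + 1)) b) = p • mon lambdaGamma (2 * j + 1) b from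
          koszulD_succ K p _ b, smul_mul_assoc, mul_smul_comm, odd_mul_even, even_mul_odd,
        ← smul_add, show i + (j + 1) = i + j + 1 by ring, show i + 1 + j = i + j + 1 by ring,
        ← map_add, ← add_smul]
      congr 3
      rw [gamma_c, gamma_c, gamma_c, show i + 1 + (j + 1) = (i + (j + 1)) + 1 by ring,
        show i + 1 + j = i + (j + 1) by ring, Nat.choose_succ_succ]

variable {K} in
theorem koszulD_leibniz (n : ℕ) (x : TwistedPoly lambdaGamma A)
    (hx : x ∈ gr (K := K) lambdaGamma A 1 n) (y : TwistedPoly lambdaGamma A) :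
    koszulD K A p (x * y) = koszulD K A p x * y + (-1 : K) ^ n • (x * koszulD K A p y) := by
  rcases gr_cases one_pos hx with rfl | ⟨i, a, rfl, rfl⟩
  · simp
  rw [one_mul]
  induction y using induction_parity with
  | h0 => simp
  | he j b =>
    rcases Nat.even_or_odd' i with ⟨i, rfl | rfl⟩
    · rw [Even.neg_one_pow (even_two_mul i), one_smul, koszulD_even_mul_even]
    · rw [odd_mul_even, koszulD_succ, koszulD_succ, smul_mul_assoc, even_mul_even]
      rcases j with _ | j
      · rw [Nat.mul_zero, koszulD_zero, mul_zero, smul_zero]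
        exact (add_zero _).symm
      · rw [show 2 * (j + 1) = 2 * j + 1 + 1 by ring, koszulD_succ, mul_smul_comm, odd_mul_odd,
          smul_zero, smul_zero, add_zero]
  | ho j b =>
    rcases Nat.even_or_odd' i with ⟨i, rfl | rfl⟩
    · rw [Even.neg_one_pow (even_two_mul i), one_smul, even_mul_odd, koszulD_succ, koszulD_succ,
        mul_smul_comm, even_mul_even]
      rcases i with _ | i
      · rw [Nat.mul_zero, koszulD_zero, zero_mul]
        exact (zero_add _).symm
      · rw [show 2 * (i + 1) = 2 * i + 1 + 1 by ring, koszulD_succ, smul_mul_assoc, odd_mul_odd,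
          smul_zero, zero_add]
    · rw [Odd.neg_one_pow ⟨i, rfl⟩, odd_mul_odd, koszulD_succ, koszulD_succ, smul_mul_assoc,
        mul_smul_comm, even_mul_odd, odd_mul_even, map_zero, neg_one_smul, add_neg_cancel]
  | h2 y z hy hz => rw [mul_add, map_add, hy, hz, map_add, mul_add, mul_add, smul_add]; abel

variable {K} (A) in
/-- The resolution `A₀⟨x, y⟩` of `A₀ / p` over a ring in which `p² = 0`. -/
@[reducible]
noncomputable def koszul (hp : (p : K) * p = 0) : ChainAlgebra.{v, u} K :=
  letI := gradedAlgebra (K := K) (C := lambdaGamma) (A := A) 1 one_pos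
  { carrier := TwistedPoly lambdaGamma A
    gr := gr lambdaGamma A 1
    d := koszulD K A p
    d_gr_zero := fun x hx => by
      rcases gr_cases one_pos hx with rfl | ⟨i, a, h, rfl⟩
      · exact map_zero _
      · obtain rfl : i = 0 := by omega
        exact koszulD_zero K p a
    d_gr_succ := fun n x hx => by
      rcases gr_cases one_pos hx with rfl | ⟨i, a, h, rfl⟩
      · rw [map_zero]; exact Submodule.zero_mem _
      · obtain rfl : i = n + 1 := by omega
        rw [koszulD_succ, ← map_nsmul]
        have := mon_mem (C := lambdaGamma) K 1 n (p • a)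
        rwa [one_mul] at this
    d_d := koszulD_koszulD p hp
    leibniz := koszulD_leibniz p }

variable {K} {B : Type u} [Ring B] [Algebra K B] (π : A →ₐ[K] B)

/-- The augmentation of `koszul`. -/
noncomputable def koszulAug (hp : (p : K) * p = 0) (hπ : ∀ a, π (p • a) = 0) :
    Hom (koszul A p hp) (ofAlgebra K B) where
  toAlgHom := π.comp (coef₀ K lambdaGamma A)
  map_gr n x hx := by
    have := coef₀_gr K lambdaGamma A one_pos n x hx
    rcases n with _ | n
    · exact Submodule.mem_top
    · have h0 : coef₀ K lambdaGamma A x = 0 := this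
      change π (coef₀ K lambdaGamma A x) = 0
      rw [h0, map_zero]
  map_d x := by
    change π (coef₀ K lambdaGamma A (koszulD K A p x)) = 0
    induction x using induction with
    | h0 => simp
    | h1 i a =>
      rcases i with _ | i
      · rw [koszulD_zero, map_zero, map_zero]
      · rw [koszulD_succ, ← map_nsmul, coef₀_mon]
        split_ifs
        · exact hπ a
        · exact map_zero π
    | h2 x y hx hy => rw [map_add, map_add, map_add, hx, hy, add_zero]

variable (hp : (p : K) * p = 0) (hπ : ∀ a, π (p • a) = 0)

/-- If a e_i with i > 0 is a cycle, then pa = 0, so a = pb and a e_i is the differential of b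
e_{i+1}. In degree zero the divisibility comes from the kernel of π instead. -/
theorem koszul_isAcyclic (hs : Function.Surjective π) (hker : ∀ a, π a = 0 → ∃ b, a = p • b)
    (htor : ∀ a : A, p • a = 0 → ∃ b, a = p • b) : (koszulAug p π hp hπ).IsAcyclic where
  surj b := by
    obtain ⟨a, rfl⟩ := hs b
    refine ⟨mon lambdaGamma 0 a, mon_mem K 1 0 a, ?_⟩
    change π (coef₀ K lambdaGamma A _) = _
    rw [coef₀_mon, if_pos rfl]
  exact n x hx hd hε := by
    rcases gr_cases one_pos hx with rfl | ⟨i, a, rfl, rfl⟩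
    · exact ⟨0, Submodule.zero_mem _, map_zero _⟩
    obtain ⟨b, rfl⟩ : ∃ b, a = p • b := by
      rcases i with _ | i
      · refine hker a ?_
        change π (coef₀ K lambdaGamma A _) = _ at hε
        rwa [coef₀_mon, if_pos rfl] at hε
      · refine htor a ?_
        change koszulD K A p _ = 0 at hd
        rw [koszulD_succ, ← map_nsmul] at hd
        have := congrArg (coef i) hd
        rwa [coef_mon_self, map_zero] at this
    refine ⟨mon lambdaGamma (i + 1) b, ?_, ?_⟩
    · have := mon_mem (C := lambdaGamma) K 1 (i + 1) b
      rwa [mul_add] at this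
    · change koszulD K A p _ = _
      rw [koszulD_succ, map_nsmul]

theorem koszul_torsion (htor : ∀ a : A, p • a = 0 → ∃ b, a = p • b) (n : ℕ)
    (x : koszul A p hp) (hx : x ∈ (koszul A p hp).gr n) (h : p • x = 0) : ∃ y, x = p • y := by
  rcases gr_cases one_pos hx with rfl | ⟨i, a, rfl, rfl⟩
  · exact ⟨0, (smul_zero _).symm⟩
  · rw [← map_nsmul] at h
    have h' := congrArg (coef i) h
    rw [coef_mon_self, map_zero] at h'
    obtain ⟨b, rfl⟩ := htor a h'
    exact ⟨mon lambdaGamma i b, map_nsmul _ _ _⟩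

theorem exists_koszulD_eq (x : TwistedPoly lambdaGamma A) : ∃ r, koszulD K A p x = p • r := by
  induction x using induction with
  | h0 => exact ⟨0, by simp⟩
  | h1 i a =>
    rcases i with _ | i
    · exact ⟨0, by rw [koszulD_zero, smul_zero]⟩
    · exact ⟨_, koszulD_succ K p i a⟩
  | h2 x y hx hy =>
    obtain ⟨r, hr⟩ := hx
    obtain ⟨s, hs⟩ := hy
    exact ⟨r + s, by rw [map_add, hr, hs, smul_add]⟩

end Koszul

section Reduction

variable (C : StructureConstants) {A B : Type u} [Ring A] [Ring B] (π : A →+* B)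

/-- The map on coefficients. -/
noncomputable def mapCoef : TwistedPoly C A →+* TwistedPoly C B :=
  { liftA fun i => (mon C i).comp (π : A →+ B) with
    map_one' := by
      change liftA _ (mon C 0 (1 : A)) = _
      rw [liftA_mon]
      change mon C 0 (π 1) = 1
      rw [map_one, mon_one]
    map_mul' := map_mul_of_mon fun i j a b => by
      rw [mon_mul, liftA_mon, liftA_mon, liftA_mon]
      change mon C _ (π _) = mon C _ (π a) * mon C _ (π b)
      rw [mon_mul, map_nsmul, map_mul] }

@[simp] theorem mapCoef_mon (i : ℕ) (a : A) : mapCoef C π (mon C i a) = mon C i (π a) :=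
  liftA_mon (fun i => (mon C i).comp (π : A →+ B)) i a

end Reduction

end TwistedPoly

/-- Coordinatewise in a basis: if p² divides pn, then p divides n. -/
theorem ZMod.exists_of_nsmul_eq_zero {p : ℕ} (hp : 0 < p) {M : Type*} [AddCommGroup M]
    [Module (ZMod (p ^ 2)) M] [Module.Free (ZMod (p ^ 2)) M] (x : M) (h : p • x = 0) :
    ∃ y, x = p • y := by
  have hc : ∀ c : ZMod (p ^ 2), p • c = 0 → ∃ b, c = p • b := fun c hc => by
    have : NeZero (p ^ 2) := ⟨(pow_pos hp 2).ne'⟩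
    obtain ⟨n, rfl⟩ := ZMod.natCast_zmod_surjective c
    rw [nsmul_eq_mul, ← Nat.cast_mul, ZMod.natCast_eq_zero_iff, pow_two] at hc
    obtain ⟨m, rfl⟩ := Nat.dvd_of_mul_dvd_mul_left hp hc
    exact ⟨m, by simp⟩
  set b := Module.Free.chooseBasis (ZMod (p ^ 2)) M
  have hx : ∀ i, ∃ y, b.repr x i = p • y := fun i => hc _ (by
    rw [← Finsupp.smul_apply, ← map_nsmul, h, map_zero]; rfl)
  choose y hy using hx
  refine ⟨∑ i ∈ (b.repr x).support, y i • b i, ?_⟩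
  conv_lhs => rw [← b.linearCombination_repr x, Finsupp.linearCombination_apply, Finsupp.sum]
  rw [Finset.smul_sum]
  exact Finset.sum_congr rfl fun i _ => by rw [hy, smul_assoc]

theorem ZMod.natCast_sq_eq_zero (p : ℕ) : (p : ZMod (p ^ 2)) * p = 0 := by
  rw [← Nat.cast_mul, ← pow_two, ZMod.natCast_self]

open TwistedPoly in
/-- Quasi-free resolutions over `ℤ/p²` compute the cohomology of twisted polynomials. -/
theorem QuasiFreeResolution.exists_bijective (p : ℕ) [hp : Fact p.Prime] {A : Type u} [Ring A]
    [Algebra (ZMod p) A] [Algebra (ZMod (p ^ 2)) A] (hA : HasLifting p A)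
    (R : QuasiFreeResolution (ZMod (p ^ 2)) A) :
    ∃ M : AugMor R.aug (TwistedPoly.aug (ZMod p) lambdaGamma A 1 one_pos),
      Function.Bijective (M.pullH (ZMod p)) := by
  obtain ⟨A₀, _, _, hfree, π₀, hs, hker⟩ := hA
  have hq : NeZero (p ^ 2) := ⟨(pow_pos hp.out.pos 2).ne'⟩
  have hK : Function.Surjective (Nat.cast : ℕ → ZMod (p ^ 2)) := ZMod.natCast_zmod_surjective
  have hK' : Function.Surjective (Nat.cast : ℕ → ZMod p) := ZMod.natCast_zmod_surjective
  let π : A₀ →ₐ[ZMod (p ^ 2)] A := { π₀ with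
    commutes' := fun c => by
      obtain ⟨n, rfl⟩ := hK c
      change π₀ _ = _
      rw [map_natCast, map_natCast, map_natCast] }
  have hpA : ∀ a : A, p • a = 0 := fun a => by
    rw [← Nat.cast_smul_eq_nsmul (ZMod p), ZMod.natCast_self, zero_smul]
  have hπ : ∀ a, π (p • a) = 0 := fun a => by rw [map_nsmul, hpA]
  have hker' : ∀ a, π a = 0 → ∃ b, a = p • b := fun a ha => by
    obtain ⟨b, hb⟩ := (hker a).1 ha
    exact ⟨b, by rw [hb, nsmul_eq_mul]⟩
  have htor : ∀ a : A₀, p • a = 0 → ∃ b, a = p • b :=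
    fun a ha => ZMod.exists_of_nsmul_eq_zero hp.out.pos a ha
  have hp2 := ZMod.natCast_sq_eq_zero p
  have hac := koszul_isAcyclic p π hp2 hπ hs hker' htor
  obtain ⟨f, hf⟩ := R.quasiFree.exists_hom (ε := R.aug) hac
  have hRf : Module.Free (ZMod (p ^ 2)) R.complex := R.quasiFree.free
  have hRtor : ∀ n, ∀ x ∈ R.complex.gr n, p • x = 0 → ∃ y, x = p • y :=
    fun _ x _ hx => ZMod.exists_of_nsmul_eq_zero hp.out.pos x hx
  have hQtor := koszul_torsion (K := ZMod (p ^ 2)) p hp2 htor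
  have hR := R.weakEquivalence.isAcyclic
  -- Reduction of the coefficients modulo p. It kills the differential, which is a multiple of p, so
  -- its target may carry the zero differential.
  let ρ := mapCoef lambdaGamma π₀
  have hρp : ∀ x, ρ (p • x) = 0 := fun x => by
    induction x using TwistedPoly.induction with
    | h0 => simp
    | h1 i a => rw [← map_nsmul, mapCoef_mon, map_nsmul, hpA, map_zero]
    | h2 x y hx hy => rw [smul_add, map_add, hx, hy, add_zero]
  have hρd : ∀ x, ρ (koszulD (ZMod (p ^ 2)) A₀ p x) = 0 := fun x => by
    obtain ⟨r, hr⟩ := exists_koszulD_eq (K := ZMod (p ^ 2)) p x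
    rw [hr, hρp]
  have hρ0 : ∀ n, ∀ x ∈ (koszul A₀ p hp2).gr n, ρ x = 0 → ∃ y, x = p • y := fun n x hx h => by
    rcases gr_cases one_pos hx with rfl | ⟨i, a, rfl, rfl⟩
    · exact ⟨0, (smul_zero _).symm⟩
    · rw [mapCoef_mon] at h
      have h' := congrArg (coef i) h
      rw [coef_mon_self, map_zero] at h'
      obtain ⟨b, rfl⟩ := hker' a h'
      exact ⟨mon lambdaGamma i b, map_nsmul _ _ _⟩
  let M : AugMor R.aug (TwistedPoly.aug (ZMod p) lambdaGamma A 1 one_pos) :=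
    { φ := ρ.comp f.toAlgHom
      map_gr := fun n x hx => by
        change ρ (f.toAlgHom x) ∈ _
        rcases gr_cases one_pos (f.map_gr n x hx) with h | ⟨i, a, rfl, h⟩
        · rw [h, map_zero]; exact Submodule.zero_mem _
        · rw [h, mapCoef_mon]
          exact mon_mem (ZMod p) 1 i _
      map_d := fun x => by
        change ρ (f.toAlgHom (R.complex.d x)) = 0
        rw [f.map_d]
        exact hρd _
      map_aug := fun x => by
        rw [← hf x]
        change coef₀ (ZMod p) lambdaGamma A (ρ (f.toAlgHom x)) =
          π₀ (coef₀ (ZMod (p ^ 2)) lambdaGamma A₀ (f.toAlgHom x))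
        generalize f.toAlgHom x = y
        induction y using TwistedPoly.induction with
        | h0 => simp
        | h1 i a =>
          rw [mapCoef_mon, coef₀_mon, coef₀_mon]
          split_ifs
          · rfl
          · exact (map_zero π₀).symm
        | h2 x y hx hy => simp only [map_add, hx, hy]
      ml := fun g hg => isMultilinear_of_additive hK fun L₁ L₂ x y => by
        simp only [pull_apply, List.map_append, List.map_cons, map_add, hg.1] }
  have hMd : ∀ x, M.φ x = ρ (f.toAlgHom x) := fun _ => rfl
  -- A lift of z to the Koszul algebra is a cycle modulo p. It comes from `R` up to a boundary and a
  -- multiple of p, and both vanish under ρ.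
  have h2 : ∀ n, ∀ z ∈ (TwistedPoly.chain (ZMod p) lambdaGamma A 1 one_pos).gr n,
      ∃ x ∈ R.complex.gr n, M.φ x = z ∧ ∃ r, R.complex.d x = p • r := by
    intro n z hz
    obtain ⟨q, hqn, rfl⟩ : ∃ q ∈ (koszul A₀ p hp2).gr n, ρ q = z := by
      rcases gr_cases one_pos hz with rfl | ⟨i, a, rfl, rfl⟩
      · exact ⟨0, Submodule.zero_mem _, map_zero _⟩
      · obtain ⟨b, rfl⟩ := hs a
        exact ⟨mon lambdaGamma i b, mon_mem _ 1 i b, mapCoef_mon _ _ _ _⟩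
    obtain ⟨x, hx, hdx, s, y, e⟩ := exists_map_eq_mod f hf hR hac hRtor hQtor hp2 n hqn
      (exists_koszulD_eq (K := ZMod (p ^ 2)) p q)
    refine ⟨x, hx, ?_, hdx⟩
    rw [hMd, e, map_add, map_add, hρp, add_zero]
    change ρ q + ρ (koszulD _ _ _ y) = _
    rw [hρd, add_zero]
  obtain ⟨T⟩ := M.exists_contraction p hK (fun _ => rfl)
    (fun x => by
      rw [← Nat.cast_smul_eq_nsmul (ZMod p), ZMod.natCast_self, zero_smul])
    (fun n x hx hMx hdx => exists_of_map_mod f hf hR hac hRtor hQtor hp2 n hx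
      (hρ0 n _ (f.map_gr n x hx) hMx) hdx) h2
  refine ⟨M, T.pullH_bijective hK' (fun _ => rfl) hpA fun n z hz => ?_⟩
  obtain ⟨x, hx, e, -⟩ := h2 n z hz
  exact ⟨x, hx, e⟩

end

/-! ### Existence of quasi-free resolutions -/

section

open ChainAlgebra HochschildCochain

namespace FreeAlgebra

section Weighted

variable (K : Type v) [CommRing K] {X : Type u} (deg : X → ℕ)

/-- The span of the words of weight `n`. -/
def wordGr (n : ℕ) : Submodule K (FreeAlgebra K X) :=
  Submodule.span K {u | ∃ L : List X, (L.map deg).sum = n ∧ (L.map (ι K)).prod = u}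

theorem word_mem (L : List X) : (L.map (ι K)).prod ∈ wordGr K deg (L.map deg).sum :=
  Submodule.subset_span ⟨L, rfl, rfl⟩

theorem ι_mem (x : X) : ι K x ∈ wordGr K deg (deg x) := by
  simpa using word_mem K deg [x]

instance wordGr_gradedMonoid : SetLike.GradedMonoid (wordGr K deg) where
  one_mem := by simpa using word_mem K deg []
  mul_mem := by
    intro m n u v hu hv
    refine Submodule.span_induction₂ (p := fun u v _ _ => u * v ∈ wordGr K deg (m + n)) ?_ ?_ ?_
      ?_ ?_ ?_ ?_ hu hv
    · rintro _ _ ⟨L, rfl, rfl⟩ ⟨L', rfl, rfl⟩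
      rw [← List.sum_append, ← List.map_append, ← List.prod_append, ← List.map_append]
      exact word_mem K deg _
    · intro y _; rw [zero_mul]; exact Submodule.zero_mem _
    · intro y _; rw [mul_zero]; exact Submodule.zero_mem _
    · intro x y z _ _ _ hx hy; rw [add_mul]; exact Submodule.add_mem _ hx hy
    · intro x y z _ _ _ hx hy; rw [mul_add]; exact Submodule.add_mem _ hx hy
    · intro r x y _ _ h; rw [smul_mul_assoc]; exact Submodule.smul_mem _ _ h
    · intro r x y _ _ h; rw [mul_smul_comm]; exact Submodule.smul_mem _ _ h

/-- The decomposition into words. -/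
noncomputable def decomposeHom : FreeAlgebra K X →ₐ[K] ⨁ n, wordGr K deg n :=
  lift K fun x => DirectSum.of (fun n => wordGr K deg n) (deg x) ⟨ι K x, ι_mem K deg x⟩

theorem decomposeHom_word (L : List X) : decomposeHom K deg (L.map (ι K)).prod =
    DirectSum.of (fun n => wordGr K deg n) (L.map deg).sum ⟨_, word_mem K deg L⟩ := by
  induction L with
  | nil => exact map_one (decomposeHom K deg)
  | cons x L ih =>
    simp only [List.map_cons, List.prod_cons]
    rw [map_mul, ih, decomposeHom, lift_ι_apply, DirectSum.of_mul_of]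
    rfl

noncomputable instance wordGr_gradedAlgebra : GradedAlgebra (wordGr K deg) :=
  GradedAlgebra.ofAlgHom _ (decomposeHom K deg)
    (by ext x; simp [decomposeHom])
    (by
      rintro i ⟨x, hx⟩
      refine Submodule.span_induction (p := fun x hx => decomposeHom K deg x =
        DirectSum.of (fun n => wordGr K deg n) i ⟨x, hx⟩) ?_ ?_ ?_ ?_ hx
      · rintro _ ⟨L, rfl, rfl⟩
        exact decomposeHom_word K deg L
      · rw [map_zero]; exact (map_zero (DirectSum.of (fun n => wordGr K deg n) i)).symm
      · intro x y hx hy h h'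
        rw [map_add, h, h', ← map_add]; rfl
      · intro r x hx h
        rw [map_smul, h]
        exact (map_smul (DirectSum.lof K ℕ (fun n => wordGr K deg n) i) r ⟨x, hx⟩).symm)

/-- The chain algebra of words with zero differential. -/
@[reducible]
noncomputable def wordChain : ChainAlgebra K where
  carrier := FreeAlgebra K X
  gr := wordGr K deg
  d := 0
  d_gr_zero _ _ := rfl
  d_gr_succ _ _ _ := Submodule.zero_mem _
  d_d _ := rfl
  leibniz _ _ _ _ := by simp

variable (δ : X → FreeAlgebra K X)

/-- Upper triangular matrices with the signed derivation extending `δ` off the diagonal. -/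
noncomputable def derMatrix : FreeAlgebra K X →ₐ[K] Matrix (Fin 2) (Fin 2) (FreeAlgebra K X) :=
  lift K fun x => !![(-1 : K) ^ deg x • ι K x, δ x; 0, ι K x]

/-- The signed derivation extending `δ`. -/
noncomputable def signedDer : FreeAlgebra K X →ₗ[K] FreeAlgebra K X :=
  Matrix.entryLinearMap K (FreeAlgebra K X) 0 1 ∘ₗ (derMatrix K deg δ).toLinearMap

theorem signedDer_apply (u : FreeAlgebra K X) : signedDer K deg δ u = derMatrix K deg δ u 0 1 := rfl

theorem derMatrix_lower (u : FreeAlgebra K X) :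
    derMatrix K deg δ u 1 0 = 0 ∧ derMatrix K deg δ u 1 1 = u := by
  induction u using FreeAlgebra.induction with
  | grade0 c => simp [Algebra.algebraMap_eq_smul_one]
  | grade1 x => simp [derMatrix]
  | mul a b ha hb => simp [Matrix.mul_apply, ha, hb]
  | add a b ha hb => simp [ha, hb]

theorem signedDer_ι (x : X) : signedDer K deg δ (ι K x) = δ x := by
  rw [signedDer_apply, derMatrix, lift_ι_apply]; rfl

theorem mem_wordGr {C : ℕ → Submodule K (FreeAlgebra K X)} (hC : ∀ n, C n ≤ wordGr K deg n)
    (h1 : 1 ∈ C 0) (hmul : ∀ n x, ∀ u ∈ C n, u * ι K x ∈ C (n + deg x)) {n : ℕ}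
    {r : FreeAlgebra K X} (hr : r ∈ wordGr K deg n) : r ∈ C n := by
  refine mem_of_generators (P := wordChain K deg) (g := ι K) (deg := deg) (fun u => ⟨u, ?_⟩) hC h1
    hmul hr
  have : lift K (ι K : X → FreeAlgebra K X) = AlgHom.id K _ := by ext x; simp
  rw [this]; rfl

theorem derMatrix_zero_zero {n : ℕ} {u : FreeAlgebra K X} (hu : u ∈ wordGr K deg n) :
    derMatrix K deg δ u 0 0 = (-1 : K) ^ n • u := by
  have := mem_wordGr K deg (C := fun n =>
    { carrier := {u | u ∈ wordGr K deg n ∧ derMatrix K deg δ u 0 0 = (-1 : K) ^ n • u}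
      zero_mem' := ⟨Submodule.zero_mem _, by simp⟩
      add_mem' := fun ha hb => ⟨Submodule.add_mem _ ha.1 hb.1, by
        rw [map_add, Matrix.add_apply, ha.2, hb.2, smul_add]⟩
      smul_mem' := fun c a ha => ⟨Submodule.smul_mem _ _ ha.1, by
        rw [map_smul, Matrix.smul_apply, ha.2, smul_comm]⟩ }) (fun n u hu => hu.1)
    ⟨SetLike.GradedOne.one_mem, by simp⟩
    (fun n x u hu => ⟨SetLike.mul_mem_graded hu.1 (ι_mem K deg x), by
      rw [map_mul, Matrix.mul_apply, Fin.sum_univ_two, hu.2]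
      simp [derMatrix, pow_add, smul_smul, mul_comm]⟩) hu
  exact this.2

/-- Read off the upper right entry of a product of triangular matrices: the diagonal entries are the
element and its signed copy. -/
theorem signedDer_mul {n : ℕ} {u : FreeAlgebra K X} (hu : u ∈ wordGr K deg n)
    (v : FreeAlgebra K X) : signedDer K deg δ (u * v) =
      signedDer K deg δ u * v + (-1 : K) ^ n • (u * signedDer K deg δ v) := by
  rw [signedDer_apply, map_mul, Matrix.mul_apply, Fin.sum_univ_two, derMatrix_zero_zero K deg δ hu,
    (derMatrix_lower K deg δ v).2, smul_mul_assoc, add_comm]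
  rfl

/-- Only the values on generators of degree at most m enter. This makes a recursive definition of
the differential on generators possible. -/
theorem signedDer_congr {δ δ' : X → FreeAlgebra K X} {m : ℕ} (h : ∀ x, deg x ≤ m → δ x = δ' x)
    {u : FreeAlgebra K X} (hu : u ∈ wordGr K deg m) :
    signedDer K deg δ u = signedDer K deg δ' u := by
  have key := eqOn_of_generators (P := wordChain K deg) (g := ι K) (deg := deg)
    (f := derMatrix K deg δ) (f' := derMatrix K deg δ') (ι_mem K deg) (fun u => ⟨u, by
      have : lift K (ι K : X → FreeAlgebra K X) = AlgHom.id K _ := by ext x; simp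
      rw [this]; rfl⟩) (fun x hx => by rw [derMatrix, derMatrix, lift_ι_apply, lift_ι_apply, h x hx])
    (r := u) hu
  rw [signedDer_apply, signedDer_apply, key]

variable {K deg δ}

theorem signedDer_one : signedDer K deg δ 1 = 0 := by rw [signedDer_apply, map_one]; rfl

theorem signedDer_gr (h0 : ∀ x, deg x = 0 → δ x = 0)
    (hs : ∀ x n, deg x = n + 1 → δ x ∈ wordGr K deg n) (hδ : ∀ x, signedDer K deg δ (δ x) = 0)
    {n : ℕ} {u : FreeAlgebra K X} (hu : u ∈ wordGr K deg n) :
    (n = 0 → signedDer K deg δ u = 0) ∧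
      (∀ m, n = m + 1 → signedDer K deg δ u ∈ wordGr K deg m) ∧
      signedDer K deg δ (signedDer K deg δ u) = 0 := by
  have := mem_wordGr K deg (C := fun n =>
    { carrier := {u | u ∈ wordGr K deg n ∧ (n = 0 → signedDer K deg δ u = 0) ∧
        (∀ m, n = m + 1 → signedDer K deg δ u ∈ wordGr K deg m) ∧
        signedDer K deg δ (signedDer K deg δ u) = 0}
      zero_mem' := ⟨Submodule.zero_mem _, by simp⟩
      add_mem' := fun ha hb => ⟨Submodule.add_mem _ ha.1 hb.1,
        fun hn => by rw [map_add, ha.2.1 hn, hb.2.1 hn, add_zero],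
        fun m hm => by rw [map_add]; exact Submodule.add_mem _ (ha.2.2.1 m hm) (hb.2.2.1 m hm),
        by rw [map_add, map_add, ha.2.2.2, hb.2.2.2, add_zero]⟩
      smul_mem' := fun c a ha => ⟨Submodule.smul_mem _ _ ha.1,
        fun hn => by rw [map_smul, ha.2.1 hn, smul_zero],
        fun m hm => by rw [map_smul]; exact Submodule.smul_mem _ _ (ha.2.2.1 m hm),
        by rw [map_smul, map_smul, ha.2.2.2, smul_zero]⟩ }) (fun n u hu => hu.1)
    ⟨SetLike.GradedOne.one_mem, by simp [signedDer_one]⟩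
    (fun n x u hu => by
      obtain ⟨hu, hu0, hus, hud⟩ := hu
      refine ⟨SetLike.mul_mem_graded hu (ι_mem K deg x), fun hn => ?_, fun m hm => ?_, ?_⟩
      · rw [signedDer_mul K deg δ hu, hu0 (by omega), signedDer_ι, h0 x (by omega)]
        simp
      · rw [signedDer_mul K deg δ hu, signedDer_ι]
        refine Submodule.add_mem _ ?_ (Submodule.smul_mem _ _ ?_)
        · rcases n with _ | n
          · rw [hu0 rfl, zero_mul]; exact Submodule.zero_mem _
          · have := SetLike.mul_mem_graded (hus n rfl) (ι_mem K deg x)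
            rwa [show n + deg x = m by omega] at this
        · rcases hx : deg x with _ | k
          · rw [h0 x hx, mul_zero]; exact Submodule.zero_mem _
          · have := SetLike.mul_mem_graded hu (hs x k hx)
            rwa [show n + k = m by omega] at this
      · rw [signedDer_mul K deg δ hu, signedDer_ι, map_add, map_smul, signedDer_mul K deg δ hu, hδ,
          mul_zero, smul_zero, add_zero]
        rcases n with _ | n
        · rw [hu0 rfl]; simp
        · rw [signedDer_mul K deg δ (hus n rfl), hud, signedDer_ι, zero_mul, zero_add,
            ← add_smul, pow_succ]
          simp) hu
  exact this.2

end Weighted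

end FreeAlgebra

section Resolution

variable (K : Type) [CommRing K] (A : Type u) [Ring A] [Algebra K A]

/-- Names for the elements of a free algebra on generators that are indexed by such names. -/
inductive ResolutionTerm : Type u
  | gen (a : A)
  | var (n : ℕ) (t : ResolutionTerm)
  | const (c : K)
  | add (s t : ResolutionTerm)
  | mul (s t : ResolutionTerm)

namespace ResolutionTerm

/-- The generators: the elements of `A`, and elements `(n, t)` of degree `n + 1`. -/
abbrev Gen : Type u := A ⊕ (ℕ × ResolutionTerm K A)

variable {K A}

/-- The degree of a generator. -/
def deg : Gen K A → ℕ
  | .inl _ => 0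
  | .inr (n, _) => n + 1

/-- The element with a given name. -/
noncomputable def eval : ResolutionTerm K A → FreeAlgebra K (Gen K A)
  | gen a => FreeAlgebra.ι K (.inl a)
  | var n t => FreeAlgebra.ι K (.inr (n, t))
  | const c => algebraMap K _ c
  | add s t => eval s + eval t
  | mul s t => eval s * eval t

/-- Generators are indexed by names of elements of the very algebra they generate; the inductive
type of names closes this circle in one step, without attaching cells degree by degree. Since every
element has a name, every cycle has a generator meant to bound it. -/
theorem eval_surjective (u : FreeAlgebra K (Gen K A)) : ∃ t, eval t = u := by
  induction u using FreeAlgebra.induction with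
  | grade0 c => exact ⟨const c, rfl⟩
  | grade1 x =>
    rcases x with a | ⟨n, t⟩
    · exact ⟨gen a, rfl⟩
    · exact ⟨var n t, rfl⟩
  | mul a b ha hb =>
    obtain ⟨s, rfl⟩ := ha
    obtain ⟨t, rfl⟩ := hb
    exact ⟨mul s t, rfl⟩
  | add a b ha hb =>
    obtain ⟨s, rfl⟩ := ha
    obtain ⟨t, rfl⟩ := hb
    exact ⟨add s t, rfl⟩

variable (K A)

/-- The augmentation. -/
noncomputable def toA : FreeAlgebra K (Gen K A) →ₐ[K] A :=
  FreeAlgebra.lift K (Sum.elim id fun _ => 0)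

/-- The differential on generators: `(n, t)` is sent to the element named `t` if this is a cycle
of degree `n` and augmentation zero. -/
theorem exists_differential : ∃ δ : Gen K A → FreeAlgebra K (Gen K A), (∀ a, δ (.inl a) = 0) ∧
    ∀ n t, (eval t ∈ FreeAlgebra.wordGr K deg n ∧ FreeAlgebra.signedDer K deg δ (eval t) = 0 ∧
      toA K A (eval t) = 0 ∧ δ (.inr (n, t)) = eval t) ∨
      (¬ (eval t ∈ FreeAlgebra.wordGr K deg n ∧ FreeAlgebra.signedDer K deg δ (eval t) = 0 ∧
      toA K A (eval t) = 0) ∧ δ (.inr (n, t)) = 0) := by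
  classical
  -- Whether an element of degree n is a cycle involves only generators of degree at most n, so the
  -- generators above are replaced by 0 in the test.
  set F : ∀ x : Gen K A, (∀ y : Gen K A, deg y < deg x → FreeAlgebra K (Gen K A)) →
      FreeAlgebra K (Gen K A) := fun x s =>
    match x with
    | .inl _ => 0
    | .inr (n, t) => if eval t ∈ FreeAlgebra.wordGr K deg n ∧ FreeAlgebra.signedDer K deg
        (fun y => if h : deg y < n + 1 then s y h else 0) (eval t) = 0 ∧ toA K A (eval t) = 0
      then eval t else 0 with hF
  set δ := (measure (deg (K := K) (A := A))).wf.fix F with hδ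
  have hδF : ∀ x, δ x = F x fun y _ => δ y := fun x => WellFounded.fix_eq _ _ _
  refine ⟨δ, fun a => hδF _, fun n t => ?_⟩
  have h1 := hδF (.inr (n, t))
  have h2 : eval t ∈ FreeAlgebra.wordGr K deg n → FreeAlgebra.signedDer K deg
      (fun y => if deg y < n + 1 then δ y else 0) (eval t) =
      FreeAlgebra.signedDer K deg δ (eval t) := fun h =>
    FreeAlgebra.signedDer_congr K deg (fun x hx => if_pos (by omega)) h
  simp only [hF, dite_eq_ite] at h1
  by_cases h : eval t ∈ FreeAlgebra.wordGr K deg n ∧ FreeAlgebra.signedDer K deg δ (eval t) = 0 ∧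
      toA K A (eval t) = 0
  · left
    refine ⟨h.1, h.2.1, h.2.2, h1.trans (if_pos ⟨h.1, (h2 h.1).trans h.2.1, h.2.2⟩)⟩
  · right
    refine ⟨h, h1.trans (if_neg fun h' => h ⟨h'.1, (h2 h'.1).symm.trans h'.2.1, h'.2.2⟩)⟩

end ResolutionTerm

open ResolutionTerm FreeAlgebra in
-- The generators of degree zero make the augmentation surjective. A cycle of degree n and
-- augmentation zero with name t is the differential of the generator (n, t), so the algebra is
-- acyclic by construction.
theorem nonempty_quasiFreeResolution : Nonempty (QuasiFreeResolution K A) := by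
  obtain ⟨δ, hl, hr⟩ := exists_differential K A
  have h0 : ∀ x, deg x = 0 → δ x = 0 := by
    rintro (a | ⟨n, t⟩) hx
    · exact hl a
    · cases hx
  have hs : ∀ x n, deg x = n + 1 → δ x ∈ wordGr K deg n := by
    rintro (a | ⟨n, t⟩) m hx
    · cases hx
    · obtain rfl : n = m := Nat.succ_injective hx
      rcases hr n t with ⟨h1, -, -, h⟩ | ⟨-, h⟩
      · rwa [h]
      · rw [h]; exact Submodule.zero_mem _
  have hd : ∀ x, signedDer K deg δ (δ x) = 0 := by
    rintro (a | ⟨n, t⟩)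
    · rw [hl, map_zero]
    · rcases hr n t with ⟨-, h1, -, h⟩ | ⟨-, h⟩
      · rwa [h]
      · rw [h, map_zero]
  have ha : ∀ x, toA K A (δ x) = 0 := by
    rintro (a | ⟨n, t⟩)
    · rw [hl, map_zero]
    · rcases hr n t with ⟨-, -, h1, h⟩ | ⟨-, h⟩
      · rwa [h]
      · rw [h, map_zero]
  let P : ChainAlgebra.{0, u} K :=
    { carrier := FreeAlgebra K (Gen K A)
      gr := wordGr K deg
      d := signedDer K deg δ
      d_gr_zero := fun x hx => (signedDer_gr h0 hs hd hx).1 rfl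
      d_gr_succ := fun n x hx => (signedDer_gr h0 hs hd hx).2.1 n rfl
      d_d := fun x => by
        refine ChainAlgebra.gr_induction (wordChain K deg)
          (p := fun x => signedDer K deg δ (signedDer K deg δ x) = 0) (by simp)
          (fun n x hx => (signedDer_gr h0 hs hd hx).2.2)
          (fun x y hx hy => by rw [map_add, map_add, hx, hy, add_zero]) x
      leibniz := fun n x hx y => signedDer_mul K deg δ hx y }
  let ε : Hom P (ofAlgebra K A) :=
    { toAlgHom := toA K A
      map_gr := fun n x hx => by
        rcases n with _ | n
        · exact Submodule.mem_top
        have := mem_wordGr K deg (C := fun n =>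
          { carrier := {u | u ∈ wordGr K deg n ∧ (n ≠ 0 → toA K A u = 0)}
            zero_mem' := ⟨Submodule.zero_mem _, fun _ => map_zero _⟩
            add_mem' := fun ha hb => ⟨Submodule.add_mem _ ha.1 hb.1, fun hn => by
              rw [map_add, ha.2 hn, hb.2 hn, add_zero]⟩
            smul_mem' := fun c a ha => ⟨Submodule.smul_mem _ _ ha.1, fun hn => by
              rw [map_smul, ha.2 hn, smul_zero]⟩ }) (fun n u hu => hu.1)
          ⟨SetLike.GradedOne.one_mem, fun h => absurd rfl h⟩
          (fun n x u hu => ⟨SetLike.mul_mem_graded hu.1 (ι_mem K deg x), fun hn => by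
            rw [map_mul]
            rcases Nat.eq_zero_or_pos n with rfl | hn'
            · rcases x with a | ⟨k, t⟩
              · exact absurd rfl hn
              · rw [toA, lift_ι_apply (R := K)]; simp
            · rw [hu.2 hn'.ne', zero_mul]⟩) hx
        exact this.2 (Nat.succ_ne_zero n)
      map_d := fun x => by
        change toA K A (signedDer K deg δ x) = 0
        refine ChainAlgebra.gr_induction (wordChain K deg)
          (p := fun x => toA K A (signedDer K deg δ x) = 0) (by simp) (fun n x hx => ?_)
          (fun x y hx hy => by rw [map_add, map_add, hx, hy, add_zero]) x
        have := mem_wordGr K deg (C := fun n =>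
          { carrier := {u | u ∈ wordGr K deg n ∧ toA K A (signedDer K deg δ u) = 0}
            zero_mem' := ⟨Submodule.zero_mem _, by simp⟩
            add_mem' := fun ha hb => ⟨Submodule.add_mem _ ha.1 hb.1, by
              rw [map_add, map_add, ha.2, hb.2, add_zero]⟩
            smul_mem' := fun c a ha => ⟨Submodule.smul_mem _ _ ha.1, by
              rw [map_smul, map_smul, ha.2, smul_zero]⟩ }) (fun n u hu => hu.1)
          ⟨SetLike.GradedOne.one_mem, by rw [signedDer_one, map_zero]⟩
          (fun n x u hu => ⟨SetLike.mul_mem_graded hu.1 (ι_mem K deg x), by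
            rw [signedDer_mul K deg δ hu.1, signedDer_ι, map_add, map_mul, hu.2, map_smul, map_mul,
              ha, zero_mul, mul_zero, smul_zero, add_zero]⟩) hx
        exact this.2 }
  have hε : ε.IsAcyclic :=
    { surj := fun a => ⟨ι K (.inl a), ι_mem K deg (.inl a), by
        change toA K A _ = a
        rw [toA, lift_ι_apply]; rfl⟩
      exact := fun n x hx hdx hax => by
        obtain ⟨t, rfl⟩ := eval_surjective x
        refine ⟨ι K (.inr (n, t)), ι_mem K deg (.inr (n, t)), ?_⟩
        change signedDer K deg δ _ = _
        rw [signedDer_ι]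
        rcases hr n t with ⟨-, -, -, h⟩ | ⟨h, -⟩
        · exact h
        · exact absurd ⟨hx, hdx, hax⟩ h }
  refine ⟨⟨P, ⟨Gen K A, deg, ι K, ι_mem K deg, ?_⟩, ε, hε.isWeakEquivalence⟩⟩
  have : lift K (ι K : Gen K A → FreeAlgebra K (Gen K A)) = AlgHom.id K _ := by ext x; simp
  change Function.Bijective (lift K (ι K : Gen K A → FreeAlgebra K (Gen K A)))
  rw [this]
  exact Function.bijective_id

end Resolution

end

/-! ### Constant coefficients and stabilisation in low degrees -/

section

open ChainAlgebra HochschildCochain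

namespace TwistedPoly

section Constants

variable (K : Type v) [CommRing K] (C : StructureConstants) (A : Type u) [Ring A] [Algebra K A]

/-- The augmentation as a morphism of augmented chain algebras. -/
noncomputable def augMor (D : ℕ) (hD : 0 < D) :
    AugMor (aug K C A D hD) (Hom.id (ofAlgebra K A)) :=
  Hom.toAugMor (aug K C A D hD) fun _ => rfl

theorem augMor_apply (D : ℕ) (hD : 0 < D) (x) : (augMor K C A D hD).φ x = coef₀ K C A x := rfl

/-- The inclusion of the coefficients as a morphism of augmented chain algebras. -/
noncomputable def constMor (D : ℕ) (hD : 0 < D) :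
    AugMor (Hom.id (ofAlgebra K A)) (aug K C A D hD) :=
  Hom.toAugMor
    { toAlgHom := AlgHom.ofLinearMap (monL K C 0) (mon_one C) fun a b => by
        change mon C 0 (a * b) = mon C 0 a * mon C 0 b
        rw [mon_mul, C.zero_left, one_smul]
      map_gr := fun n x hx => by
        change mon C 0 x ∈ gr (K := K) C A D n
        rcases n with _ | n
        · simpa using mon_mem (C := C) K D 0 x
        · have h : x = 0 := hx
          rw [h, map_zero]
          exact Submodule.zero_mem _
      map_d := fun x => (mon C 0).map_zero }
    (fun x => by
      change coef₀ K C A (mon C 0 x) = x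
      rw [coef₀_mon, if_pos rfl])

theorem constMor_apply (D : ℕ) (hD : 0 < D) (a : A) :
    (constMor K C A D hD).φ a = mon C 0 a := rfl

variable {K C A} in
/-- A cochain of low degree depends only on the constant terms of its arguments. -/
theorem eq_of_hasDeg_le {D : ℕ} (hD : 0 < D) {f : List (chain K C A D hD) → A}
    (hf : IsMultilinear f) {n : ℤ} (hn : HasDeg f n) (hnD : n ≤ D)
    (L : List (chain K C A D hD)) : f L = f (L.map fun x => mon C 0 (coef₀ K C A x)) := by
  induction L generalizing f n with
  | nil => rfl
  | cons x L ih =>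
    have key : der x f = der (mon C 0 (coef₀ K C A x)) f := by
      induction x using TwistedPoly.induction with
      | h0 => rw [map_zero, map_zero]
      | h1 i a =>
        rw [coef₀_mon]
        rcases Nat.eq_zero_or_pos i with rfl | hi
        · simp
        · rw [if_neg hi.ne', map_zero]
          have h0 : der (0 : chain K C A D hD) f = 0 := by
            funext L; rw [der_apply, hf.cons_zero]; rfl
          rw [h0]
          -- An entry e_i with i > 0 uses up degree at least D + 1, which is more than n, so what
          -- remains has negative degree.
          refine (hn.der (mon_mem K D i a)).eq_zero (hf.der _) ?_
          have : D ≤ D * i := Nat.le_mul_of_pos_right _ hi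
          push_cast
          have : (D : ℤ) ≤ D * i := by exact_mod_cast this
          omega
      | h2 x y hx hy =>
        rw [map_add, map_add]
        have h (u v : chain K C A D hD) : der (u + v) f = der u f + der v f := by
          funext L
          exact hf.cons_add u v L
        rw [h, h, hx, hy]
    have h0 : coef₀ K C A (mon C 0 (coef₀ K C A x)) = coef₀ K C A x := by
      rw [coef₀_mon, if_pos rfl]
    have hd := hn.der (i := 0) (by simpa using mon_mem (C := C) K D 0 (coef₀ K C A x))
    rw [List.map_cons]
    change der x f L = der (mon C 0 (coef₀ K C A x)) f _
    rw [key]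
    exact ih (hf.der _) hd (by push_cast; omega)

variable (k : Type*) [CommRing k] [Algebra k A]

/-- The map on cohomology induced by the augmentation. -/
noncomputable def hat (D : ℕ) (hD : 0 < D) :
    Coh k (Hom.id (ofAlgebra K A)) →ₐ[k] Coh k (aug K C A D hD) := (augMor K C A D hD).pullH k

/-- The map on cohomology induced by the inclusion of the coefficients. -/
noncomputable def res (D : ℕ) (hD : 0 < D) :
    Coh k (aug K C A D hD) →ₐ[k] Coh k (Hom.id (ofAlgebra K A)) := (constMor K C A D hD).pullH k

theorem res_hat (D : ℕ) (hD : 0 < D) (x) : res K C A k D hD (hat K C A k D hD x) = x :=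
  pullH_pullH (M := augMor K C A D hD) (N := constMor K C A D hD) (fun z => by
    rw [augMor_apply, constMor_apply, coef₀_mon, if_pos rfl]) x

/-- Up to degree D the divided powers are invisible. Since D grows along the tower, each fixed
degree is eventually the Hochschild cohomology of `A`. -/
theorem hat_res (D : ℕ) (hD : 0 < D) {n : ℕ} (hn : n ≤ D) {x : Coh k (aug K C A D hD)}
    (hx : x.IsHomog n) : hat K C A k D hD (res K C A k D hD x) = x := by
  obtain ⟨f, hf, rfl⟩ := hx
  rw [hat, res, AugMor.pullH_cls, AugMor.pullH_cls]
  refine cls_congr k _ _ rfl ?_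
  funext L
  rw [pull_apply, pull_apply, List.map_map]
  exact (eq_of_hasDeg_le hD hf.ml hf.hasDeg (by exact_mod_cast hn) L).symm

end Constants

end TwistedPoly

theorem AugMor.pullH_comp_of_eq {K K' K'' : Type*} [CommRing K] [CommRing K'] [CommRing K'']
    {P : ChainAlgebra.{_, v} K} {Q : ChainAlgebra.{_, w} K'} {R : ChainAlgebra.{_, u} K''}
    {B : Type*} [Ring B] [Algebra K B] [Algebra K' B] [Algebra K'' B]
    {ε : Hom P (ofAlgebra K B)} {ε' : Hom Q (ofAlgebra K' B)} {ε'' : Hom R (ofAlgebra K'' B)}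
    {k : Type*} [CommRing k] [Algebra k B] {M : AugMor ε ε'} {N : AugMor ε' ε''}
    {L : AugMor ε ε''} (h : ∀ x, N.φ (M.φ x) = L.φ x) (x : Coh k ε'') :
    M.pullH k (N.pullH k x) = L.pullH k x := by
  induction x using Coh.induction with
  | h0 => simp
  | h1 n f hf =>
    rw [AugMor.pullH_cls, AugMor.pullH_cls, AugMor.pullH_cls]
    refine cls_congr k _ _ rfl ?_
    funext L
    simp only [pull_apply, List.map_map]
    congr 2
    funext z
    exact h z
  | h2 x y hx hy => simp only [map_add, hx, hy]

namespace TwistedPoly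

section Restrict

variable {C C' : StructureConstants} {A : Type u} [Ring A] {K : Type v} [CommRing K] [Algebra K A]
  {m D D' : ℕ} (hD : 0 < D) (hD' : 0 < D') (h : C.IsRestriction K m C') (e : D' = D * m)
  (k : Type*) [CommRing k] [Algebra k A]

theorem down_hat (x) : (downMor A hD hD' h e).pullH k (hat K C' A k D' hD' x) =
    hat K C A k D hD x :=
  AugMor.pullH_comp_of_eq (downMor A hD hD' h e).map_aug x

end Restrict

end TwistedPoly

end

/-! ### Monomials in a system of generators -/

section

open ChainAlgebra HochschildCochain

/-- Elements that generate a ring `E` like an exterior or polynomial ring: `x` and `b i` are central,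
the `l i` anticommute, and the square of `l i` is `κ • b i`. -/
structure GenData (k : Type*) [CommRing k] (κ : k) (E : Type*) [Ring E] [Algebra k E] where
  x : E
  l : ℕ → E
  b : ℕ → E
  x_comm : ∀ e, x * e = e * x
  b_comm : ∀ i e, b i * e = e * b i
  l_anti : ∀ i j, i ≠ j → l i * l j = -(l j * l i)
  l_sq : ∀ i, l i * l i = κ • b i
  gen : ∀ S : Submodule k E, 1 ∈ S → (∀ e ∈ S, e * x ∈ S) → (∀ e ∈ S, ∀ i, e * b i ∈ S) →
    (∀ e ∈ S, ∀ i, e * l i ∈ S) → S = ⊤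

namespace GenData

variable {k : Type*} [CommRing k] {κ : k} {E : Type*} [Ring E] [Algebra k E] (G : GenData k κ E)

/-- The monomials in `b i`, `l i` with `i ≥ n`. -/
def mono : ℕ → List ℕ → E
  | _, [] => 1
  | n, e :: m => G.b n ^ (e / 2) * mono (n + 1) m * G.l n ^ (e % 2)

/-- Padding with zero exponents lets finitely many monomials be written with lists of one length,
and then distinct lists can be separated by coefficients. -/
theorem mono_append (n : ℕ) (m : List ℕ) (N : ℕ) :
    G.mono n (m ++ List.replicate N 0) = G.mono n m := by
  induction m generalizing n with
  | nil =>
    induction N generalizing n with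
    | zero => rfl
    | succ N ih =>
      have := ih (n + 1)
      rw [List.nil_append] at this ⊢
      rw [List.replicate_succ, mono.eq_2, this]
      simp [mono]
  | cons e m ih => rw [List.cons_append, mono, mono, ih]

theorem exists_mono_mul_b (i n : ℕ) (m : List ℕ) : ∃ m', G.mono n m * G.b (n + i) = G.mono n m' := by
  induction i generalizing n m with
  | zero =>
    rcases m with _ | ⟨e, m⟩
    · exact ⟨[2], by simp [mono]⟩
    · refine ⟨(e + 2) :: m, ?_⟩
      rw [mono, mono, Nat.add_mod_right, Nat.add_div_right _ two_pos, pow_succ, add_zero, ← G.b_comm]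
      simp only [← mul_assoc]
      rw [← pow_succ', pow_succ]
  | succ i ih =>
    rcases m with _ | ⟨e, m⟩
    · obtain ⟨m', h⟩ := ih (n + 1) []
      refine ⟨0 :: m', ?_⟩
      rw [mono.eq_2, ← h, mono, mono, add_right_comm, add_assoc n]
      simp
    · obtain ⟨m', h⟩ := ih (n + 1) m
      refine ⟨e :: m', ?_⟩
      rw [mono, mono, ← h, mul_assoc, ← G.b_comm, add_right_comm n 1, add_assoc n]
      simp only [mul_assoc]

/-- A later l passes the outer l at the price of a sign; meeting its own index it forms a square,
which raises the exponent of b at the price of κ. So the product is a multiple of one monomial for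
both values of κ in use. -/
theorem exists_mono_mul_l (i n : ℕ) (m : List ℕ) :
    ∃ m' c, G.mono n m * G.l (n + i) = (c : k) • G.mono n m' := by
  induction i generalizing n m with
  | zero =>
    rcases m with _ | ⟨e, m⟩
    · exact ⟨[1], 1, by simp [mono]⟩
    · rcases Nat.mod_two_eq_zero_or_one e with h | h
      · refine ⟨(e + 1) :: m, 1, ?_⟩
        rw [mono, mono, h, show (e + 1) % 2 = 1 by omega, show (e + 1) / 2 = e / 2 by omega]
        simp
      · refine ⟨(e + 1) :: m, κ, ?_⟩
        rw [mono, mono, h, show (e + 1) % 2 = 0 by omega, show (e + 1) / 2 = e / 2 + 1 by omega,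
          pow_one, pow_zero, mul_one, add_zero, mul_assoc, G.l_sq, mul_smul_comm, ← G.b_comm,
          pow_succ', mul_assoc]
  | succ i ih =>
    rcases m with _ | ⟨e, m⟩
    · obtain ⟨m', c, h⟩ := ih (n + 1) []
      refine ⟨0 :: m', c, ?_⟩
      rw [add_right_comm, add_assoc, mono, one_mul] at h
      rw [mono, mono, one_mul, h]
      simp
    · obtain ⟨m', c, h⟩ := ih (n + 1) m
      rw [add_right_comm, add_assoc] at h
      rcases Nat.mod_two_eq_zero_or_one e with he | he
      · refine ⟨e :: m', c, ?_⟩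
        rw [mono, mono, he, pow_zero, mul_one, mul_one, mul_assoc, h, mul_smul_comm]
      · refine ⟨e :: m', -c, ?_⟩
        rw [mono, mono, he, pow_one, mul_assoc, G.l_anti _ _ (by omega), mul_neg, ← mul_assoc,
          mul_assoc _ _ (G.l (n + (i + 1))), h, mul_smul_comm, smul_mul_assoc, neg_smul]

theorem span_mono : Submodule.span k
    (Set.range fun cm : ℕ × List ℕ => G.x ^ cm.1 * G.mono 0 cm.2) = ⊤ := by
  have hx (r : ℕ) (e : E) : G.x ^ r * e = e * G.x ^ r := Commute.pow_left (G.x_comm e) r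
  have key (g : E) (hg : ∀ c m, ∃ c' m' a, G.x ^ c * G.mono 0 m * g =
      (a : k) • (G.x ^ c' * G.mono 0 m')) : ∀ e ∈ Submodule.span k
        (Set.range fun cm : ℕ × List ℕ => G.x ^ cm.1 * G.mono 0 cm.2),
      e * g ∈ Submodule.span k
        (Set.range fun cm : ℕ × List ℕ => G.x ^ cm.1 * G.mono 0 cm.2) := by
    intro e he
    induction he using Submodule.span_induction with
    | mem y hy =>
      obtain ⟨⟨c, m⟩, rfl⟩ := hy
      obtain ⟨c', m', a, h⟩ := hg c m
      dsimp only
      rw [h]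
      exact Submodule.smul_mem _ _ (Submodule.subset_span ⟨(c', m'), rfl⟩)
    | zero => rw [zero_mul]; exact Submodule.zero_mem _
    | add y z _ _ hy hz => rw [add_mul]; exact Submodule.add_mem _ hy hz
    | smul r y _ hy => rw [smul_mul_assoc]; exact Submodule.smul_mem _ _ hy
  refine G.gen _ (Submodule.subset_span ⟨(0, []), by simp [mono]⟩)
    (key _ fun c m => ⟨c + 1, m, 1, ?_⟩) (fun e he i => key _ (fun c m => ?_) e he)
    (fun e he i => key _ (fun c m => ?_) e he)
  · rw [one_smul, ← G.x_comm, pow_succ', mul_assoc]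
  · obtain ⟨m', h⟩ := G.exists_mono_mul_b i 0 m
    rw [zero_add] at h
    exact ⟨c, m', 1, by rw [mul_assoc, h, one_smul]⟩
  · obtain ⟨m', a, h⟩ := G.exists_mono_mul_l i 0 m
    rw [zero_add] at h
    exact ⟨c, m', a, by rw [mul_assoc, h, mul_smul_comm]⟩

/-- The combination of monomials with given coefficients. -/
noncomputable def comb (M : Type*) [AddCommGroup M] [Module k M] :
    (ℕ × List ℕ →₀ M) →ₗ[k] M ⊗[k] E :=
  Finsupp.lsum k fun cm => (TensorProduct.mk k M E).flip (G.x ^ cm.1 * G.mono 0 cm.2)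

theorem comb_apply {M : Type*} [AddCommGroup M] [Module k M] (y : ℕ × List ℕ →₀ M) :
    G.comb M y = ∑ cm ∈ y.support, y cm ⊗ₜ (G.x ^ cm.1 * G.mono 0 cm.2) := rfl

/-- Every tensor is a combination of monomials of one fixed length. -/
theorem exists_comb_eq {M : Type*} [AddCommGroup M] [Module k M] (t : M ⊗[k] E) :
    ∃ N₀, ∀ N ≥ N₀, ∃ y ∈ Finsupp.supported M k {cm : ℕ × List ℕ | cm.2.length = N},
      G.comb M y = t := by
  have hadd (s t : M ⊗[k] E) (hs : ∃ N₀, ∀ N ≥ N₀,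
        ∃ y ∈ Finsupp.supported M k {cm : ℕ × List ℕ | cm.2.length = N}, G.comb M y = s)
      (ht : ∃ N₀, ∀ N ≥ N₀,
        ∃ y ∈ Finsupp.supported M k {cm : ℕ × List ℕ | cm.2.length = N}, G.comb M y = t) :
      ∃ N₀, ∀ N ≥ N₀,
        ∃ y ∈ Finsupp.supported M k {cm : ℕ × List ℕ | cm.2.length = N}, G.comb M y = s + t := by
    obtain ⟨N₁, h₁⟩ := hs
    obtain ⟨N₂, h₂⟩ := ht
    refine ⟨max N₁ N₂, fun N hN => ?_⟩
    obtain ⟨y, hy, rfl⟩ := h₁ N (le_trans (le_max_left _ _) hN)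
    obtain ⟨z, hz, rfl⟩ := h₂ N (le_trans (le_max_right _ _) hN)
    exact ⟨y + z, Submodule.add_mem _ hy hz, map_add _ _ _⟩
  induction t using TensorProduct.induction_on with
  | zero => exact ⟨0, fun N _ => ⟨0, Submodule.zero_mem _, map_zero _⟩⟩
  | add s t hs ht => exact hadd s t hs ht
  | tmul f e =>
    have he : e ∈ Submodule.span k
      (Set.range fun cm : ℕ × List ℕ => G.x ^ cm.1 * G.mono 0 cm.2) := G.span_mono ▸ trivial
    induction he using Submodule.span_induction generalizing f with
    | mem e he =>
      obtain ⟨⟨c, m⟩, rfl⟩ := he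
      refine ⟨m.length, fun N hN => ⟨Finsupp.single (c, m ++ List.replicate (N - m.length) 0) f,
        Finsupp.single_mem_supported _ _ ?_, ?_⟩⟩
      · simp only [Set.mem_ofPred_eq, List.length_append, List.length_replicate]
        omega
      · rw [comb, Finsupp.lsum_single, mono_append]
        rfl
    | zero =>
      rw [TensorProduct.tmul_zero]
      exact ⟨0, fun N _ => ⟨0, Submodule.zero_mem _, map_zero _⟩⟩
    | add a b _ _ ha hb => rw [TensorProduct.tmul_add]; exact hadd _ _ (ha f) (hb f)
    | smul r a _ ha => rw [← TensorProduct.smul_tmul]; exact ha _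

end GenData

end

/-! ### The tower of cohomology rings, treated algebraically -/

section

open ChainAlgebra HochschildCochain

/-- The algebraic structure of a tower of cohomology rings `H n` below `HW`, each obtained from the
next one by adjoining classes `lam n`, `bet n`, all of them algebras over `HA`. The predicates
`gA`, `g n`, `gW` single out the homogeneous elements of a given degree. -/
structure CohTower (k : Type*) [CommRing k] (κ : k) (p : ℕ) (HA HW : Type*) (H : ℕ → Type*)
    [Ring HA] [Algebra k HA] [Ring HW] [Algebra k HW] [∀ n, Ring (H n)] [∀ n, Algebra k (H n)] where
  gA : ℕ → HA → Prop
  g : ∀ n, ℕ → H n → Prop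
  gW : ℕ → HW → Prop
  hat : ∀ n, HA →ₐ[k] H n
  res : ∀ n, H n →ₐ[k] HA
  J : ∀ n, H (n + 1) →ₐ[k] H n
  I : ∀ n, H n →ₐ[k] H (n + 1)
  Jx : H 0 →ₐ[k] HW
  Ix : HW →ₐ[k] H 0
  ξ : HW
  Sx : HW →ₗ[k] HW
  lam : ∀ n, H n
  bet : ∀ n, H n
  R : ∀ n, H n →ₗ[k] H n
  S : ∀ n, H n →ₗ[k] H n
  res_hat : ∀ n f, res n (hat n f) = f
  J_hat : ∀ n f, J n (hat (n + 1) f) = hat n f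
  I_J : ∀ n y, I n (J n y) = y
  Ix_Jx : ∀ y, Ix (Jx y) = y
  Ix_ξ : Ix ξ = 0
  Sx_mul : ∀ y, Sx (ξ * y) = y
  Sx_J : ∀ y, Sx (Jx y) = 0
  I_lam : ∀ n, I n (lam n) = 0
  I_bet : ∀ n, I n (bet n) = 0
  S_mul : ∀ n y, S n (bet n * y) = y
  R_mul : ∀ n y, R n (bet n * y) = 0
  S_J : ∀ n y, S n (J n y) = 0
  R_J : ∀ n y, R n (J n y) = 0
  S_J_mul : ∀ n y, S n (J n y * lam n) = 0
  R_J_mul : ∀ n y, R n (J n y * lam n) = J n y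
  ξ_comm : ∀ y, ξ * Jx y = Jx y * ξ
  bet_comm : ∀ n y, bet n * J n y = J n y * bet n
  lam_bet : ∀ n, lam n * bet n = bet n * lam n
  lam_sq : ∀ n, lam n * lam n = κ • bet n
  lam_comm : ∀ n d y, g (n + 1) d y → lam n * J n y = (-1 : ℤ) ^ d • (J n y * lam n)
  hat_homog : ∀ n d f, gA d f → g n d (hat n f)
  J_homog : ∀ n d y, g (n + 1) d y → g n d (J n y)
  I_homog : ∀ n d y, g n d y → g (n + 1) d (I n y)
  Jx_homog : ∀ d y, g 0 d y → gW d (Jx y)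
  Ix_homog : ∀ d y, gW d y → g 0 d (Ix y)
  lam_homog : ∀ n, g n (2 * p ^ n + 1) (lam n)
  bet_homog : ∀ n, g n (2 * p ^ (n + 1) + 2) (bet n)
  ξ_homog : gW 2 ξ
  decomp_x : ∀ d x, gW d x → ∃ z, (z = 0 ∨ 2 ≤ d ∧ gW (d - 2) z) ∧ x = Jx (Ix x) + ξ * z
  decomp : ∀ n d x, g n d x → ∃ y z, g n (d - (2 * p ^ n + 1)) y ∧
    g n (d - (2 * p ^ (n + 1) + 2)) z ∧ x = J n (I n x) + y * lam n + bet n * z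
  hat_res : ∀ n d x, g n d x → d ≤ 2 * p ^ n → hat n (res n x) = x
  gW_span : ∀ S : Submodule k HW, (∀ d x, gW d x → x ∈ S) → S = ⊤

namespace CohTower

variable {k : Type*} [CommRing k] {κ : k} {p : ℕ} {HA HW : Type*} {H : ℕ → Type*}
    [Ring HA] [Algebra k HA] [Ring HW] [Algebra k HW] [∀ n, Ring (H n)] [∀ n, Algebra k (H n)]
    (T : CohTower k κ p HA HW H)

/-- The map from stage `n` of the tower to the total cohomology. -/
def Jt : ∀ n, H n →ₐ[k] HW
  | 0 => T.Jx
  | n + 1 => (Jt n).comp (T.J n)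

theorem Jt_succ (n : ℕ) (y : H (n + 1)) : T.Jt (n + 1) y = T.Jt n (T.J n y) := rfl

/-- The map from the coefficients to the total cohomology. -/
def hatW : HA →ₐ[k] HW := T.Jx.comp (T.hat 0)

theorem Jt_hat (n : ℕ) (f : HA) : T.Jt n (T.hat n f) = T.hatW f := by
  induction n with
  | zero => rfl
  | succ n ih => rw [Jt_succ, J_hat, ih]

/-- The class `lam n` in the total cohomology. -/
def l (n : ℕ) : HW := T.Jt n (T.lam n)

/-- The class `bet n` in the total cohomology. -/
def b (n : ℕ) : HW := T.Jt n (T.bet n)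

/-- A class of a late stage reaches the total ring through every earlier one. Relations between a
stage and the next thus give relations between the generators with indices m < n. -/
theorem exists_Jt_of_le {m n : ℕ} (h : m ≤ n) {d : ℕ} {y : H n} (hy : T.g n d y) :
    ∃ z, T.g m d z ∧ T.Jt n y = T.Jt m z := by
  induction n, h using Nat.le_induction with
  | base => exact ⟨y, hy, rfl⟩
  | succ n _ ih => rw [Jt_succ]; exact ih (T.J_homog n d y hy)

theorem homog_Jt (n d : ℕ) (y : H n) (hy : T.g n d y) : T.gW d (T.Jt n y) := by
  obtain ⟨z, hz, h⟩ := T.exists_Jt_of_le (Nat.zero_le n) hy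
  rw [h]
  exact T.Jx_homog d z hz

theorem homog_l (n : ℕ) : T.gW (2 * p ^ n + 1) (T.l n) := T.homog_Jt n _ _ (T.lam_homog n)

theorem homog_b (n : ℕ) : T.gW (2 * p ^ (n + 1) + 2) (T.b n) := T.homog_Jt n _ _ (T.bet_homog n)

theorem homog_hatW {d : ℕ} {f : HA} (hf : T.gA d f) : T.gW d (T.hatW f) :=
  T.Jx_homog _ _ (T.hat_homog 0 d f hf)

theorem ξ_comm_Jt (n : ℕ) (y : H n) : T.ξ * T.Jt n y = T.Jt n y * T.ξ := by
  induction n with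
  | zero => exact T.ξ_comm y
  | succ n ih => exact ih _

theorem ξ_comm_hatW (f : HA) : T.ξ * T.hatW f = T.hatW f * T.ξ := T.ξ_comm _

theorem b_comm_Jt (n : ℕ) (y : H (n + 1)) : T.b n * T.Jt (n + 1) y = T.Jt (n + 1) y * T.b n := by
  rw [Jt_succ, b, ← map_mul, bet_comm, map_mul]

theorem b_comm_hatW (n : ℕ) (f : HA) : T.b n * T.hatW f = T.hatW f * T.b n := by
  rw [← T.Jt_hat (n + 1), b_comm_Jt]

theorem l_comm_Jt (n d : ℕ) (y : H (n + 1)) (hy : T.g (n + 1) d y) :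
    T.l n * T.Jt (n + 1) y = (-1 : ℤ) ^ d • (T.Jt (n + 1) y * T.l n) := by
  rw [Jt_succ, l, ← map_mul, T.lam_comm n d y hy, map_zsmul, map_mul]

theorem l_comm_hatW (n d : ℕ) (f : HA) (hf : T.gA d f) :
    T.l n * T.hatW f = (-1 : ℤ) ^ d • (T.hatW f * T.l n) := by
  rw [← T.Jt_hat (n + 1), T.l_comm_Jt n d _ (T.hat_homog _ _ _ hf)]

theorem b_comm_b (m n : ℕ) : T.b m * T.b n = T.b n * T.b m := by
  have key (m n : ℕ) (h : m < n) : T.b m * T.b n = T.b n * T.b m := by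
    obtain ⟨z, -, hz⟩ := T.exists_Jt_of_le h (T.bet_homog n)
    rw [b, b, hz]
    exact T.b_comm_Jt m z
  rcases lt_trichotomy m n with h | rfl | h
  · exact key m n h
  · rfl
  · exact (key n m h).symm

theorem b_comm_l (m n : ℕ) : T.b m * T.l n = T.l n * T.b m := by
  rcases lt_trichotomy m n with h | rfl | h
  · obtain ⟨z, -, hz⟩ := T.exists_Jt_of_le h (T.lam_homog n)
    rw [l, hz]
    exact T.b_comm_Jt m z
  · rw [b, l, ← map_mul, ← map_mul, lam_bet]
  · obtain ⟨z, hg, hz⟩ := T.exists_Jt_of_le h (T.bet_homog m)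
    -- The degree of β_m is even, so the sign disappears.
    rw [b, hz, T.l_comm_Jt n _ z hg, Even.neg_one_pow ⟨p ^ (m + 1) + 1, by ring⟩, one_smul]

theorem l_anti (m n : ℕ) (h : m ≠ n) : T.l m * T.l n = -(T.l n * T.l m) := by
  have key (m n : ℕ) (h : m < n) : T.l m * T.l n = -(T.l n * T.l m) := by
    obtain ⟨z, hg, hz⟩ := T.exists_Jt_of_le h (T.lam_homog n)
    have := T.l_comm_Jt m _ z hg
    rw [← hz, Odd.neg_one_pow ⟨p ^ n, rfl⟩, neg_smul, one_smul] at this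
    exact this
  rcases lt_or_gt_of_ne h with h | h
  · exact key m n h
  · rw [key n m h, neg_neg]

theorem l_sq (n : ℕ) : T.l n * T.l n = κ • T.b n := by
  rw [l, ← map_mul, lam_sq, map_smul]
  rfl

/-- The monomials with coefficient `y` in the classes `bet i`, `lam i`, `i ≥ n`. -/
def elem (y : HA) : ∀ n, List ℕ → H n
  | n, [] => T.hat n y
  | n, e :: m => T.bet n ^ (e / 2) * T.J n (elem y (n + 1) m) * T.lam n ^ (e % 2)

/-- Coefficients with respect to the monomials `elem`. -/
def coeff : ∀ n, List ℕ → H n →ₗ[k] HA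
  | n, [] => (T.res n).toLinearMap
  | n, e :: m => coeff (n + 1) m ∘ₗ (T.I n).toLinearMap ∘ₗ
      (if e % 2 = 0 then LinearMap.id else T.R n) ∘ₗ (T.S n) ^ (e / 2)

theorem S_pow_mul_of_le (n i j : ℕ) (h : i ≤ j) (y : H n) :
    (T.S n ^ j) (T.bet n ^ i * y) = (T.S n ^ (j - i)) y := by
  induction i generalizing j with
  | zero => simp
  | succ i ih =>
    obtain ⟨j, rfl⟩ : ∃ j', j = j' + 1 := ⟨j - 1, by omega⟩
    rw [pow_succ' (T.bet n), mul_assoc, pow_succ, Module.End.mul_apply, S_mul, ih j (by omega)]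
    congr 2
    omega

theorem S_pow_mul_of_ge (n i j : ℕ) (h : j ≤ i) (y : H n) :
    (T.S n ^ j) (T.bet n ^ i * y) = T.bet n ^ (i - j) * y := by
  obtain ⟨r, rfl⟩ := Nat.exists_eq_add_of_le h
  rw [pow_add, mul_assoc, S_pow_mul_of_le _ _ _ _ le_rfl, Nat.sub_self, Nat.add_sub_cancel_left]
  simp

/-- `S` divides by β on the left, `R` takes the coefficient of λ, and `I` restricts to the next
stage. A surplus of β is annihilated by `I` or `R`, a deficit by `S`, and for equal powers of β the
parity decides. -/
theorem coeff_step (n e e' : ℕ) (u : H (n + 1)) :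
    T.I n ((if e % 2 = 0 then (LinearMap.id : H n →ₗ[k] H n) else T.R n)
      ((T.S n ^ (e / 2)) (T.bet n ^ (e' / 2) * T.J n u * T.lam n ^ (e' % 2)))) =
      if e = e' then u else 0 := by
  rw [mul_assoc]
  rcases lt_trichotomy (e / 2) (e' / 2) with h | h | h
  · rw [S_pow_mul_of_ge _ _ _ _ h.le, if_neg (c := e = e') (by rintro rfl; omega)]
    obtain ⟨r, hr⟩ : ∃ r, e' / 2 - e / 2 = r + 1 := ⟨e' / 2 - e / 2 - 1, by omega⟩
    rw [hr, pow_succ', mul_assoc]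
    split_ifs
    · rw [LinearMap.id_apply, map_mul, I_bet, zero_mul]
    · rw [R_mul, map_zero]
  · rw [h, S_pow_mul_of_le _ _ _ _ le_rfl, Nat.sub_self, pow_zero, Module.End.one_apply]
    rcases Nat.mod_two_eq_zero_or_one e with h1 | h1 <;>
      rcases Nat.mod_two_eq_zero_or_one e' with h2 | h2
    · rw [if_pos h1, h2, if_pos (by omega), pow_zero, mul_one, LinearMap.id_apply, I_J]
    · rw [if_pos h1, h2, if_neg (by omega), pow_one, LinearMap.id_apply, map_mul, I_lam, mul_zero]
    · rw [if_neg (by omega), h2, if_neg (by omega), pow_zero, mul_one, R_J, map_zero]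
    · rw [if_neg (by omega), h2, if_pos (by omega), pow_one, R_J_mul, I_J]
  · rw [S_pow_mul_of_le _ _ _ _ h.le, if_neg (c := e = e') (by rintro rfl; omega)]
    obtain ⟨r, hr⟩ : ∃ r, e / 2 - e' / 2 = r + 1 := ⟨e / 2 - e' / 2 - 1, by omega⟩
    have h0 : T.S n (T.J n u * T.lam n ^ (e' % 2)) = 0 := by
      rcases Nat.mod_two_eq_zero_or_one e' with h2 | h2
      · rw [h2, pow_zero, mul_one, S_J]
      · rw [h2, pow_one, S_J_mul]
    rw [hr, pow_succ, Module.End.mul_apply, h0, map_zero, map_zero, map_zero]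

/-- Equal length is essential: lists that differ only by trailing zeros give the same monomial. -/
theorem coeff_elem (y : HA) (n : ℕ) (m m' : List ℕ) (h : m.length = m'.length) :
    T.coeff n m (T.elem y n m') = if m = m' then y else 0 := by
  induction m generalizing n m' with
  | nil =>
    obtain rfl : m' = [] := List.length_eq_zero_iff.1 h.symm
    rw [if_pos rfl]
    exact T.res_hat n y
  | cons e m ih =>
    rcases m' with _ | ⟨e', m'⟩
    · cases h
    · have key := T.coeff_step n e e' (T.elem y (n + 1) m')
      rw [elem]
      change T.coeff (n + 1) m (T.I n _) = _
      refine (congrArg (T.coeff (n + 1) m) key).trans ?_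
      by_cases he : e = e'
      · rw [if_pos he, ih _ _ (by simpa using h)]
        simp [he]
      · rw [if_neg he, if_neg (by simp [he]), map_zero]

/-- Coefficients with respect to the monomials in all the classes. -/
def coeffW (cm : ℕ × List ℕ) : HW →ₗ[k] HA :=
  T.coeff 0 cm.2 ∘ₗ T.Ix.toLinearMap ∘ₗ T.Sx ^ cm.1

theorem Sx_pow_mul (i : ℕ) (y : HW) : (T.Sx ^ i) (T.ξ ^ i * y) = y := by
  induction i with
  | zero => simp
  | succ i ih => rw [pow_succ' T.ξ, mul_assoc, pow_succ, Module.End.mul_apply, Sx_mul, ih]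

theorem coeffW_elem (y : HA) (cm cm' : ℕ × List ℕ) (h : cm.2.length = cm'.2.length) :
    T.coeffW cm (T.ξ ^ cm'.1 * T.Jx (T.elem y 0 cm'.2)) = if cm = cm' then y else 0 := by
  obtain ⟨c, m⟩ := cm
  obtain ⟨c', m'⟩ := cm'
  change T.coeff 0 m (T.Ix ((T.Sx ^ c) (T.ξ ^ c' * _))) = _
  rcases lt_trichotomy c c' with hc | rfl | hc
  · obtain ⟨r, rfl⟩ := Nat.exists_eq_add_of_lt hc
    rw [add_assoc, pow_add, mul_assoc, Sx_pow_mul, pow_succ', mul_assoc, map_mul, Ix_ξ, zero_mul,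
      map_zero, if_neg (by simp)]
  · rw [Sx_pow_mul, Ix_Jx, T.coeff_elem y 0 m m' h]
    simp
  · obtain ⟨r, rfl⟩ : ∃ r, c = (r + 1) + c' := ⟨c - c' - 1, by omega⟩
    rw [pow_add, Module.End.mul_apply, Sx_pow_mul, pow_succ, Module.End.mul_apply, Sx_J, map_zero,
      map_zero, map_zero, if_neg (by simp)]

section Iso

variable {E : Type*} [Ring E] [Algebra k E] (G : GenData k κ E) (φ : E →ₐ[k] HW)

/-- The multiplication map from the tensor product. -/
noncomputable def Ψ : HA ⊗[k] E →ₗ[k] HW :=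
  TensorProduct.lift ((LinearMap.mul k HW).compl₁₂ T.hatW.toLinearMap φ.toLinearMap)

theorem Ψ_tmul (f : HA) (e : E) : T.Ψ φ (f ⊗ₜ e) = T.hatW f * φ e := rfl

variable {G φ} (hx : φ G.x = T.ξ) (hl : ∀ n, φ (G.l n) = T.l n) (hb : ∀ n, φ (G.b n) = T.b n)

include hl hb in
theorem Jt_elem (y : HA) (n : ℕ) (m : List ℕ) :
    T.Jt n (T.elem y n m) = T.hatW y * φ (G.mono n m) := by
  induction m generalizing n with
  | nil => rw [elem, Jt_hat, GenData.mono, map_one, mul_one]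
  | cons e m ih =>
    have hc : T.b n ^ (e / 2) * T.hatW y = T.hatW y * T.b n ^ (e / 2) :=
      Commute.pow_left (T.b_comm_hatW n y) _
    rw [elem, map_mul, map_mul, map_pow, map_pow, ← Jt_succ, ih, GenData.mono, map_mul, map_mul,
      map_pow, map_pow, hl, hb]
    change T.b n ^ (e / 2) * _ * T.l n ^ (e % 2) = _
    rw [← mul_assoc, hc]
    simp only [mul_assoc]

include hx hl hb in
-- The functionals `coeffW` are dual to the monomials. A tensor is a combination of monomials with
-- lists of one length and coefficients in `HA`, and each coefficient can be read off from the
-- image.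
theorem Ψ_injective : Function.Injective (T.Ψ φ) := by
  rw [injective_iff_map_eq_zero]
  intro t ht
  obtain ⟨N, hN⟩ := G.exists_comb_eq t
  obtain ⟨y, hy, rfl⟩ := hN N le_rfl
  have hξ (r : ℕ) (f : HA) : T.ξ ^ r * T.hatW f = T.hatW f * T.ξ ^ r :=
    Commute.pow_left (T.ξ_comm_hatW f) r
  have hsum : T.Ψ φ (G.comb HA y) =
      ∑ cm ∈ y.support, T.ξ ^ cm.1 * T.Jx (T.elem (y cm) 0 cm.2) := by
    rw [GenData.comb_apply, map_sum]
    refine Finset.sum_congr rfl fun cm _ => ?_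
    have := T.Jt_elem (G := G) (φ := φ) hl hb (y cm) 0 cm.2
    change T.Jx _ = _ at this
    rw [Ψ_tmul, this, map_mul, map_pow, hx, ← mul_assoc, ← mul_assoc, hξ]
  rw [hsum] at ht
  have hz : y = 0 := by
    ext cm
    by_contra hne
    have hcm : cm ∈ y.support := Finsupp.mem_support_iff.2 hne
    have hy (cm) (h : cm ∈ y.support) : cm.2.length = N := hy h
    have h := congrArg (T.coeffW cm) ht
    rw [map_sum, map_zero, Finset.sum_congr rfl (fun cm' h' =>
      T.coeffW_elem (y cm') cm cm' ((hy cm hcm).trans (hy cm' h').symm)),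
      Finset.sum_ite_eq, if_pos hcm] at h
    exact hne h
  rw [hz, map_zero]

theorem range_mul (x : HW) (hx : x ∈ LinearMap.range (T.Ψ φ)) (e : E) :
    x * φ e ∈ LinearMap.range (T.Ψ φ) := by
  obtain ⟨t, rfl⟩ := hx
  induction t using TensorProduct.induction_on with
  | zero => rw [map_zero, zero_mul]; exact Submodule.zero_mem _
  | add s t hs ht => rw [map_add, add_mul]; exact Submodule.add_mem _ hs ht
  | tmul f e' => exact ⟨f ⊗ₜ (e' * e), by rw [Ψ_tmul, Ψ_tmul, map_mul, mul_assoc]⟩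

/-- In the decomposition β and ξ stand on the left of an arbitrary class; as they commute with the
coefficients, such products stay in the range. -/
theorem mul_range (e : E) (he : ∀ f, φ e * T.hatW f = T.hatW f * φ e) (x : HW)
    (hx : x ∈ LinearMap.range (T.Ψ φ)) : φ e * x ∈ LinearMap.range (T.Ψ φ) := by
  obtain ⟨t, rfl⟩ := hx
  induction t using TensorProduct.induction_on with
  | zero => rw [map_zero, mul_zero]; exact Submodule.zero_mem _
  | add s t hs ht => rw [map_add, mul_add]; exact Submodule.add_mem _ hs ht
  | tmul f e' =>
    exact ⟨f ⊗ₜ (e * e'), by rw [Ψ_tmul, Ψ_tmul, map_mul, ← mul_assoc, ← mul_assoc, he]⟩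

include hl hb in
-- Strong induction on the degree d, and inside it on m, a bound for the number of stages still to
-- climb. If d ≤ 2pⁿ the class comes from the coefficients. Otherwise it is decomposed: the
-- coefficients of λ and β have smaller degree, and the remaining part comes from stage n + 1, where
-- m drops by one.
theorem Jt_mem_range (hp : 1 < p) (d m n : ℕ) (hd : d ≤ n + m) (x : H n) (hx : T.g n d x) :
    T.Jt n x ∈ LinearMap.range (T.Ψ φ) := by
  induction d using Nat.strong_induction_on generalizing m n with
  | _ d ihd =>
    have hlow (n : ℕ) (x : H n) (hx : T.g n d x) (h : d ≤ 2 * p ^ n) :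
        T.Jt n x ∈ LinearMap.range (T.Ψ φ) := by
      refine ⟨T.res n x ⊗ₜ 1, ?_⟩
      rw [Ψ_tmul, map_one, mul_one, ← T.Jt_hat n, T.hat_res n d x hx h]
    induction m generalizing n with
    -- Now d ≤ n < pⁿ, so the low degree case applies.
    | zero =>
      refine hlow n x hx ?_
      have := Nat.lt_pow_self hp (n := n)
      omega
    | succ m ih =>
      by_cases h : d ≤ 2 * p ^ n
      · exact hlow n x hx h
      · obtain ⟨y, z, hy, hz, e⟩ := T.decomp n d x hx
        rw [e, map_add, map_add, map_mul, map_mul]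
        refine Submodule.add_mem _ (Submodule.add_mem _ ?_ ?_) ?_
        · exact ih (n + 1) (by omega) _ (T.I_homog n d x hx)
        · have := T.range_mul _ (ihd _ (by omega) _ n (Nat.le_add_left _ n) y hy) (G.l n)
          rwa [hl] at this
        · have := T.mul_range (G.b n) (fun f => by rw [hb, b_comm_hatW]) _
            (ihd _ (by omega) _ n (Nat.le_add_left _ n) z hz)
          rwa [hb] at this

include hx hl hb in
theorem mem_range (hp : 1 < p) (d : ℕ) (x : HW) (h : T.gW d x) :
    x ∈ LinearMap.range (T.Ψ φ) := by
  induction d using Nat.strong_induction_on generalizing x with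
  | _ d ih =>
    obtain ⟨z, hz, e⟩ := T.decomp_x d x h
    rw [e]
    refine Submodule.add_mem _
      (T.Jt_mem_range hl hb hp d d 0 (Nat.le_add_left _ _) _ (T.Ix_homog d x h)) ?_
    rcases hz with rfl | ⟨hd, hz⟩
    · rw [mul_zero]; exact Submodule.zero_mem _
    · have := T.mul_range G.x (fun f => by rw [hx, ξ_comm_hatW]) _ (ih _ (by omega) z hz)
      rwa [hx] at this

include hx hl hb in
theorem Ψ_bijective (hp : 1 < p) : Function.Bijective (T.Ψ φ) :=
  ⟨T.Ψ_injective hx hl hb, LinearMap.range_eq_top.1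
    (T.gW_span _ (T.mem_range hx hl hb hp))⟩

end Iso

end CohTower

end

/-! ### The tower for divided powers over 𝔽_p -/

section

open ChainAlgebra HochschildCochain

theorem HochschildCochain.OddSplitting.ξ_homog {K : Type u} [CommRing K] {P : ChainAlgebra.{u, v} K}
    {B : Type w} [Ring B] [Algebra K B] {ε : Hom P (ofAlgebra K B)} (X : OddSplitting ε)
    (k : Type*) [CommRing k] [Algebra k B] : (X.ξ k).IsHomog 2 := Coh.isHomog_cls _

namespace TwistedPoly

variable (p : ℕ) [hp : Fact p.Prime] (A : Type u) [Ring A] [Algebra (ZMod p) A]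

/-- The augmented algebra `Λ[x] ⊗ Γ[y] ⊗ A`. -/
noncomputable abbrev topStage : Hom (chain (ZMod p) .lambdaGamma A 1 one_pos) (ofAlgebra (ZMod p) A) :=
  aug (ZMod p) .lambdaGamma A 1 one_pos

include hp in
theorem stage_pos (n : ℕ) : 0 < 2 * p ^ n := Nat.mul_pos two_pos (pow_pos hp.out.pos n)

/-- The augmented algebra `Γ[y] ⊗ A` with `y` of degree `2 p ^ n`. -/
noncomputable abbrev stage (n : ℕ) :
    Hom (chain (ZMod p) .gamma A (2 * p ^ n) (stage_pos p n)) (ofAlgebra (ZMod p) A) :=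
  aug (ZMod p) .gamma A (2 * p ^ n) (stage_pos p n)

theorem stage_succ (n : ℕ) : 2 * p ^ (n + 1) = 2 * p ^ n * p := by ring

theorem stage_zero : 2 * p ^ 0 = 1 * 2 := by ring

/-- The quotient map between consecutive stages. -/
noncomputable def stageDown (n : ℕ) : AugMor (stage p A n) (stage p A (n + 1)) :=
  downMor A (stage_pos p n) (stage_pos p (n + 1)) (isRestriction_gamma p) (stage_succ p n)

/-- The inclusion between consecutive stages. -/
noncomputable def stageUp (n : ℕ) : AugMor (stage p A (n + 1)) (stage p A n) :=
  upMor A (stage_pos p n) (stage_pos p (n + 1)) (isRestriction_gamma p) (stage_succ p n)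

/-- The quotient map from the top stage. -/
noncomputable def topDown : AugMor (topStage p A) (stage p A 0) :=
  downMor A one_pos (stage_pos p 0) (isRestriction_lambdaGamma (ZMod p)) (stage_zero p)

/-- The inclusion into the top stage. -/
noncomputable def topUp : AugMor (stage p A 0) (topStage p A) :=
  upMor A one_pos (stage_pos p 0) (isRestriction_lambdaGamma (ZMod p)) (stage_zero p)

/-- The splitting of a stage. -/
noncomputable def stageSplitting (n : ℕ) : EvenSplitting (stage p A n) :=
  evenSplitting p A (2 * p ^ n) (stage_pos p n) (even_two_mul _)

theorem stage_split (n : ℕ) (w) :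
    (stageUp p A n).φ ((stageDown p A n).φ w) = (stageSplitting p A n).π w := rfl

theorem stage_retract (n : ℕ) (z) : (stageDown p A n).φ ((stageUp p A n).φ z) = z :=
  downMor_upMor _ _ _ (isRestriction_gamma p) (stage_succ p n) z

theorem top_split (w) : (topUp p A).φ ((topDown p A).φ w) = (oddSplitting (ZMod p) A).π w := rfl

theorem top_retract (z) : (topDown p A).φ ((topUp p A).φ z) = z :=
  downMor_upMor _ _ _ (isRestriction_lambdaGamma (ZMod p)) (stage_zero p) z

/-- The degrees of t and t' add up to p times that of t, the degree of the generator of the next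
stage. -/
theorem stage_dt' (n : ℕ) : (stageSplitting p A n).dt + (stageSplitting p A n).dt' + 2 =
    2 * p ^ (n + 1) + 2 := by
  change 2 * p ^ n + 2 * p ^ n * (p - 1) + 2 = _
  obtain ⟨q, hq⟩ : ∃ q, p = q + 1 := ⟨p - 1, (Nat.succ_pred_eq_of_pos hp.out.pos).symm⟩
  rw [stage_succ, show p - 1 = q by omega]
  nth_rewrite 4 [hq]
  ring

/-- This relation distinguishes p = 2 from odd p: equality of cochains in the first case, and in the
second a coboundary for twice the square, with 2 invertible. -/
theorem stage_lam_sq (n : ℕ) : (stageSplitting p A n).lam (ZMod p) * (stageSplitting p A n).lam (ZMod p) =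
    (if p = 2 then 1 else 0 : ZMod p) • (stageSplitting p A n).bet (ZMod p) := by
  split_ifs with h
  · rw [one_smul]
    refine (stageSplitting p A n).lam_sq_eq_bet
      (evenSplitting_aug_bz p A h (2 * p ^ n) (stage_pos p n) (even_two_mul _)) ?_
    change 2 * p ^ n = 2 * p ^ n * (p - 1)
    rw [show p - 1 = 1 by omega, mul_one]
  · rw [zero_smul]
    have := (stageSplitting p A n).lam_sq_eq_zero (k := ZMod p) (μ := coef₂ p A)
      (coef₂_mul p A) (coef₂_gr p A (2 * p ^ n) (stage_pos p n))
    rw [← Int.cast_smul_eq_zsmul (ZMod p)] at this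
    refine (smul_eq_zero_iff_right ?_).1 this
    intro h0
    have h1 : ((2 : ℕ) : ZMod p) = 0 := by exact_mod_cast h0
    rw [ZMod.natCast_eq_zero_iff] at h1
    exact h ((Nat.prime_dvd_prime_iff_eq hp.out Nat.prime_two).1 h1)

/-- The tower of cohomology rings of the stages. -/
noncomputable def tower {κ : ZMod p} (hκ : κ = if p = 2 then 1 else 0) : CohTower (ZMod p) κ p
    (Coh (ZMod p) (Hom.id (ofAlgebra (ZMod p) A))) (Coh (ZMod p) (topStage p A))
    (fun n => Coh (ZMod p) (stage p A n)) where
  gA d x := x.IsHomog d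
  g n d x := x.IsHomog d
  gW d x := x.IsHomog d
  hat n := hat (ZMod p) .gamma A (ZMod p) (2 * p ^ n) (stage_pos p n)
  res n := res (ZMod p) .gamma A (ZMod p) (2 * p ^ n) (stage_pos p n)
  J n := (stageDown p A n).pullH (ZMod p)
  I n := (stageUp p A n).pullH (ZMod p)
  Jx := (topDown p A).pullH (ZMod p)
  Ix := (topUp p A).pullH (ZMod p)
  ξ := (oddSplitting (ZMod p) A).ξ (ZMod p)
  Sx := (oddSplitting (ZMod p) A).SH (ZMod p)
  lam n := (stageSplitting p A n).lam (ZMod p)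
  bet n := (stageSplitting p A n).bet (ZMod p)
  R n := (stageSplitting p A n).RH (ZMod p)
  S n := (stageSplitting p A n).SH (ZMod p)
  res_hat n f := res_hat _ _ _ _ _ _ f
  J_hat n f := down_hat _ _ _ _ _ f
  I_J n y := pullH_pullH (stage_retract p A n) y
  Ix_Jx y := pullH_pullH (top_retract p A) y
  Ix_ξ := (oddSplitting (ZMod p) A).pull_ξ (top_split p A) (top_retract p A)
  Sx_mul y := (oddSplitting (ZMod p) A).SH_mul y
  Sx_J y := (oddSplitting (ZMod p) A).SH_pull (top_split p A) (top_retract p A) y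
  I_lam n := (stageSplitting p A n).pull_lam (stage_split p A n) (stage_retract p A n)
  I_bet n := (stageSplitting p A n).pull_bet (stage_split p A n) (stage_retract p A n)
  S_mul n y := (stageSplitting p A n).SH_mul y
  R_mul n y := (stageSplitting p A n).RH_mul y
  S_J n y := (stageSplitting p A n).SH_pull (stage_split p A n) (stage_retract p A n) y
  R_J n y := (stageSplitting p A n).RH_pull (stage_split p A n) (stage_retract p A n) y
  S_J_mul n y := (stageSplitting p A n).SH_pull_mul (stage_split p A n) (stage_retract p A n) y
  R_J_mul n y := (stageSplitting p A n).RH_pull_mul (stage_split p A n) (stage_retract p A n) y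
  ξ_comm y := (oddSplitting (ZMod p) A).ξ_comm (top_split p A) (top_retract p A) y
  bet_comm n y := (stageSplitting p A n).bet_comm (stage_split p A n) (stage_retract p A n) y
  lam_bet n := (stageSplitting p A n).lam_mul_bet (stage_split p A n) (stage_retract p A n)
  lam_sq n := hκ ▸ stage_lam_sq p A n
  lam_comm n d y hy := (stageSplitting p A n).lam_comm (stage_split p A n) (stage_retract p A n) hy
  hat_homog n d f hf := (augMor _ _ _ _ _).isHomog hf
  J_homog n d y hy := (stageDown p A n).isHomog hy
  I_homog n d y hy := (stageUp p A n).isHomog hy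
  Jx_homog d y hy := (topDown p A).isHomog hy
  Ix_homog d y hy := (topUp p A).isHomog hy
  lam_homog n := Coh.isHomog_cls _
  bet_homog n := (Coh.isHomog_cls (stageSplitting p A n).isCocycle₂).congr (stage_dt' p A n) rfl
  ξ_homog := (oddSplitting (ZMod p) A).ξ_homog (ZMod p)
  decomp_x d x hx := by
    obtain ⟨f, hf, rfl⟩ := hx
    refine ⟨_, ?_, (oddSplitting (ZMod p) A).decomp (top_split p A) hf⟩
    -- In degrees below 2 the coefficient of ξ vanishes. Recording this guarantees that the degree
    -- strictly drops in the induction on degrees.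
    by_cases hd : 2 ≤ d
    · exact Or.inr ⟨hd, (Coh.isHomog_cls hf).op _ _⟩
    · left
      rw [OddSplitting.SH, Coh.op_cls, ← cls_zero]
      refine cls_congr _ _ _ rfl ?_
      have hS := (oddSplitting (ZMod p) A).isOp_S
      exact ((hS f hf.ml).2 _ hf.hasDeg).eq_zero (hS.ml f hf.ml) (by omega)
  decomp n d x hx := by
    have h := hx
    obtain ⟨f, hf, rfl⟩ := hx
    refine ⟨_, _, ?_, ?_, (stageSplitting p A n).decomp (stage_split p A n) hf⟩
    · exact h.op (stageSplitting p A n).isOp_R' _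
    · exact (h.op (stageSplitting p A n).isOp_S' _).congr (by rw [stage_dt']) rfl
  hat_res n d x hx hd := hat_res _ _ _ _ _ _ hd hx
  gW_span S hS := by
    rw [eq_top_iff]
    intro x _
    induction x using Coh.induction with
    | h0 => exact S.zero_mem
    | h1 n f hf => exact hS n _ (Coh.isHomog_cls hf)
    | h2 x y hx hy => exact S.add_mem (hx trivial) (hy trivial)

end TwistedPoly

end

/-! ### Polynomial and exterior algebras mapping to a noncommutative ring -/

section

open ChainAlgebra HochschildCochain

section Generators

variable {k : Type*} [CommRing k]

theorem mem_of_adjoin_eq_top {E : Type*} [Ring E] [Algebra k E] {s : Set E}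
    (hs : Algebra.adjoin k s = ⊤) (S : Submodule k E) (h1 : 1 ∈ S)
    (h : ∀ g ∈ s, ∀ e ∈ S, e * g ∈ S) : S = ⊤ := by
  have key (z : E) : ∀ e ∈ S, e * z ∈ S := by
    have hz : z ∈ Algebra.adjoin k s := hs ▸ Algebra.mem_top
    induction hz using Algebra.adjoin_induction with
    | mem z hz => exact h z hz
    | algebraMap r =>
      intro e he
      rw [← Algebra.commutes, ← Algebra.smul_def]
      exact S.smul_mem _ he
    | add y z _ _ hy hz => exact fun e he => by rw [mul_add]; exact S.add_mem (hy e he) (hz e he)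
    | mul y z _ _ hy hz => exact fun e he => by rw [← mul_assoc]; exact hz _ (hy e he)
  exact eq_top_iff.2 fun z _ => by simpa using key z 1 h1

/-- The generators of a polynomial ring in characteristic two. -/
noncomputable def GenData.ofMvPolynomial (h2 : (2 : k) = 0) :
    GenData k 1 (MvPolynomial (Option ℕ) k) where
  x := .X none
  l i := .X (some i)
  b i := .X (some i) * .X (some i)
  x_comm e := mul_comm _ _
  b_comm i e := mul_comm _ _
  l_anti i j _ := by
    rw [mul_comm, eq_neg_iff_add_eq_zero, ← two_mul]
    have : (2 : MvPolynomial (Option ℕ) k) = 0 := by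
      rw [← map_ofNat (MvPolynomial.C : k →+* MvPolynomial (Option ℕ) k) 2, h2, map_zero]
    rw [this, zero_mul]
  l_sq i := by rw [one_smul]
  gen S h1 hx hb hl := mem_of_adjoin_eq_top MvPolynomial.adjoin_range_X S h1 (by
    rintro _ ⟨_ | i, rfl⟩ e he
    · exact hx e he
    · exact hl e he i)

theorem adjoin_exterior_tensor_eq_top :
    Algebra.adjoin k (Set.range (fun o : Option ℕ ⊕ ℕ => (o.elim (fun i => 1 ⊗ₜ .X i)
      fun i => ExteriorAlgebra.ι k (Finsupp.single i 1) ⊗ₜ 1 :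
        ExteriorAlgebra k (ℕ →₀ k) ⊗[k] MvPolynomial (Option ℕ) k))) = ⊤ := by
  set T := Algebra.adjoin k (Set.range (fun o : Option ℕ ⊕ ℕ => (o.elim (fun i => 1 ⊗ₜ .X i)
      fun i => ExteriorAlgebra.ι k (Finsupp.single i 1) ⊗ₜ 1 :
        ExteriorAlgebra k (ℕ →₀ k) ⊗[k] MvPolynomial (Option ℕ) k))) with hT
  have hr (q : MvPolynomial (Option ℕ) k) : Algebra.TensorProduct.includeRight
      (A := ExteriorAlgebra k (ℕ →₀ k)) q ∈ T := by
    induction q using MvPolynomial.induction_on with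
    | C a =>
      rw [MvPolynomial.C_eq_algebraMap, AlgHom.commutes]
      exact T.algebraMap_mem a
    | add a b ha hb => rw [map_add]; exact T.add_mem ha hb
    | mul_X a i ha =>
      rw [map_mul]
      exact T.mul_mem ha (Algebra.subset_adjoin ⟨.inl i, rfl⟩)
  have hl (q : ExteriorAlgebra k (ℕ →₀ k)) : Algebra.TensorProduct.includeLeft (S := k)
      (B := MvPolynomial (Option ℕ) k) q ∈ T := by
    induction q using ExteriorAlgebra.induction with
    | algebraMap a => rw [AlgHom.commutes]; exact T.algebraMap_mem a
    | add a b ha hb => rw [map_add]; exact T.add_mem ha hb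
    | mul a b ha hb => rw [map_mul]; exact T.mul_mem ha hb
    | ι v =>
      induction v using Finsupp.induction_linear with
      | zero => rw [map_zero, map_zero]; exact T.zero_mem
      | add a b ha hb => rw [map_add, map_add]; exact T.add_mem ha hb
      | single i a =>
        rw [← mul_one a, ← smul_eq_mul, ← Finsupp.smul_single, map_smul, map_smul]
        exact T.smul_mem (Algebra.subset_adjoin ⟨.inr i, rfl⟩) a
  rw [eq_top_iff]
  intro z _
  induction z using TensorProduct.induction_on with
  | zero => exact T.zero_mem
  | add a b ha hb => exact T.add_mem (ha trivial) (hb trivial)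
  | tmul a q =>
    have := T.mul_mem (hl a) (hr q)
    rwa [Algebra.TensorProduct.includeLeft_apply, Algebra.TensorProduct.includeRight_apply,
      Algebra.TensorProduct.tmul_mul_tmul, mul_one, one_mul] at this

theorem one_tmul_comm {A B : Type*} [Ring A] [Algebra k A] [CommRing B] [Algebra k B] (b : B)
    (z : A ⊗[k] B) : (1 ⊗ₜ b) * z = z * (1 ⊗ₜ b) := by
  induction z using TensorProduct.induction_on with
  | zero => rw [mul_zero, zero_mul]
  | add y z hy hz => rw [mul_add, add_mul, hy, hz]
  | tmul a c => simp [mul_comm]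

/-- The generators of the tensor product of an exterior and a polynomial ring. -/
noncomputable def GenData.ofExterior :
    GenData k 0 (ExteriorAlgebra k (ℕ →₀ k) ⊗[k] MvPolynomial (Option ℕ) k) where
  x := 1 ⊗ₜ .X none
  l i := ExteriorAlgebra.ι k (Finsupp.single i 1) ⊗ₜ 1
  b i := 1 ⊗ₜ .X (some i)
  x_comm e := one_tmul_comm _ e
  b_comm i e := one_tmul_comm _ e
  l_anti i j _ := by
    rw [Algebra.TensorProduct.tmul_mul_tmul, Algebra.TensorProduct.tmul_mul_tmul,
      eq_neg_iff_add_eq_zero, ← TensorProduct.add_tmul, ExteriorAlgebra.ι_add_mul_swap,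
      TensorProduct.zero_tmul]
  l_sq i := by
    rw [Algebra.TensorProduct.tmul_mul_tmul, ExteriorAlgebra.ι_sq_zero, TensorProduct.zero_tmul,
      zero_smul]
  gen S h1 hx hb hl := mem_of_adjoin_eq_top adjoin_exterior_tensor_eq_top S h1 (by
    rintro _ ⟨(_ | i) | i, rfl⟩ e he
    · exact hx e he
    · exact hb e he i
    · exact hl e he i)

/-- The target is not commutative, but commuting elements generate a commutative subalgebra, and
evaluation takes place there. -/
theorem exists_mvPolynomial_algHom {σ S : Type*} [Ring S] [Algebra k S] (f : σ → S)
    (h : ∀ i j, f i * f j = f j * f i) :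
    ∃ φ : MvPolynomial σ k →ₐ[k] S, ∀ i, φ (.X i) = f i := by
  have hc := Algebra.isMulCommutative_adjoin k (s := Set.range f) (by
    rintro _ ⟨i, rfl⟩ _ ⟨j, rfl⟩
    exact h i j)
  let _ : CommRing (Algebra.adjoin k (Set.range f)) :=
    { (inferInstance : Ring (Algebra.adjoin k (Set.range f))) with mul_comm := hc.is_comm.comm }
  refine ⟨(Algebra.adjoin k (Set.range f)).val.comp
    (MvPolynomial.aeval (R := k) (S₁ := Algebra.adjoin k (Set.range f)) fun i : σ =>
      ⟨f i, Algebra.subset_adjoin ⟨i, rfl⟩⟩), fun i => ?_⟩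
  rw [AlgHom.comp_apply, MvPolynomial.aeval_X]
  rfl

theorem exists_exterior_algHom {S : Type*} [Ring S] [Algebra k S] (l : ℕ → S)
    (b : Option ℕ → S) (hl : ∀ i, l i * l i = 0) (hll : ∀ i j, i ≠ j → l i * l j = -(l j * l i))
    (hb : ∀ i j, b i * b j = b j * b i) (hbl : ∀ i j, b i * l j = l j * b i) :
    ∃ φ : ExteriorAlgebra k (ℕ →₀ k) ⊗[k] MvPolynomial (Option ℕ) k →ₐ[k] S,
      (∀ i, φ (ExteriorAlgebra.ι k (Finsupp.single i 1) ⊗ₜ 1) = l i) ∧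
        ∀ i, φ (1 ⊗ₜ .X i) = b i := by
  have hanti (i j) : l i * l j = -(l j * l i) := by
    by_cases h : i = j
    · subst h
      rw [hl, neg_zero]
    · exact hll i j h
  set f : (ℕ →₀ k) →ₗ[k] S := Finsupp.linearCombination k l with hf
  have hf1 (i : ℕ) (a : k) : f (Finsupp.single i a) = a • l i := Finsupp.linearCombination_single ..
  have hlf (i : ℕ) (v : ℕ →₀ k) : l i * f v = -(f v * l i) := by
    induction v using Finsupp.induction_linear with
    | zero => simp
    | add a b ha hb => rw [map_add, mul_add, add_mul, ha, hb, neg_add]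
    | single j a => rw [hf1, mul_smul_comm, smul_mul_assoc, hanti, smul_neg]
  -- The universal property requires all squares to vanish, not merely anticommutation; the
  -- generators square to zero and the cross terms cancel in pairs.
  have hff (v : ℕ →₀ k) : f v * f v = 0 := by
    induction v using Finsupp.induction with
    | zero => simp
    | single_add i a v _ _ ih =>
      rw [map_add, hf1]
      simp only [mul_add, add_mul, smul_mul_assoc, mul_smul_comm, hl, ih, hlf, smul_zero]
      simp
  have hbf (i : Option ℕ) (v : ℕ →₀ k) : f v * b i = b i * f v := by
    induction v using Finsupp.induction_linear with
    | zero => simp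
    | add x y hx hy => rw [map_add, mul_add, add_mul, hx, hy]
    | single j a => rw [hf1, mul_smul_comm, smul_mul_assoc, hbl]
  obtain ⟨ψ, hψ⟩ := exists_mvPolynomial_algHom (k := k) b hb
  set χ := ExteriorAlgebra.lift k ⟨f, hff⟩ with hχ
  have hχι (v : ℕ →₀ k) : χ (ExteriorAlgebra.ι k v) = f v := ExteriorAlgebra.lift_ι_apply ..
  have hcomm (a : ExteriorAlgebra k (ℕ →₀ k)) (q : MvPolynomial (Option ℕ) k) :
      Commute (χ a) (ψ q) := by
    induction q using MvPolynomial.induction_on with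
    | C r =>
      have : ψ (MvPolynomial.C r) = algebraMap k S r := ψ.commutes r
      rw [this]
      exact Algebra.commute_algebraMap_right r _
    | add x y hx hy => rw [map_add]; exact hx.add_right hy
    | mul_X x i hx =>
      rw [map_mul, hψ]
      refine hx.mul_right ?_
      clear hx
      induction a using ExteriorAlgebra.induction with
      | algebraMap r => rw [AlgHom.commutes]; exact Algebra.commute_algebraMap_left r _
      | add x y hx hy => rw [map_add]; exact hx.add_left hy
      | mul x y hx hy => rw [map_mul]; exact hx.mul_left hy
      | ι v => rw [hχι]; exact hbf i v
  refine ⟨Algebra.TensorProduct.lift χ ψ hcomm, fun i => ?_, fun i => ?_⟩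
  · rw [Algebra.TensorProduct.lift_tmul, map_one, mul_one, hχι, hf1, one_smul]
  · rw [Algebra.TensorProduct.lift_tmul, map_one, one_mul, hψ]

end Generators

namespace CohTower

variable {k : Type*} [CommRing k] {κ : k} {p : ℕ} {HA HW : Type*} {H : ℕ → Type*}
    [Ring HA] [Algebra k HA] [Ring HW] [Algebra k HW] [∀ n, Ring (H n)] [∀ n, Algebra k (H n)]

theorem ξ_comm_l (T : CohTower k κ p HA HW H) (n : ℕ) : T.ξ * T.l n = T.l n * T.ξ :=
  T.ξ_comm_Jt n _

theorem ξ_comm_b (T : CohTower k κ p HA HW H) (n : ℕ) : T.ξ * T.b n = T.b n * T.ξ :=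
  T.ξ_comm_Jt n _

/-- When 2 = 0, anticommuting elements commute, and with κ = 1 the classes b are the squares of the
l, so no separate generators are needed for them. -/
theorem exists_ofMvPolynomial (T : CohTower k 1 p HA HW H) (h2 : (2 : k) = 0) :
    ∃ φ : MvPolynomial (Option ℕ) k →ₐ[k] HW, φ (GenData.ofMvPolynomial h2).x = T.ξ ∧
      (∀ n, φ ((GenData.ofMvPolynomial h2).l n) = T.l n) ∧
      ∀ n, φ ((GenData.ofMvPolynomial h2).b n) = T.b n := by
  have hll (m n : ℕ) : T.l m * T.l n = T.l n * T.l m := by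
    by_cases h : m = n
    · rw [h]
    · rw [T.l_anti m n h, eq_comm, eq_neg_iff_add_eq_zero, ← two_smul k, h2, zero_smul]
  obtain ⟨φ, hφ⟩ := exists_mvPolynomial_algHom (k := k) (fun o : Option ℕ => o.elim T.ξ T.l) (by
    rintro (_ | i) (_ | j)
    · rfl
    · exact T.ξ_comm_l j
    · exact (T.ξ_comm_l i).symm
    · exact hll i j)
  refine ⟨φ, hφ none, fun n => hφ (some n), fun n => ?_⟩
  change φ (.X (some n) * .X (some n)) = _
  rw [map_mul, hφ]
  exact (T.l_sq n).trans (one_smul _ _)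

theorem exists_ofExterior (T : CohTower k 0 p HA HW H) :
    ∃ φ : ExteriorAlgebra k (ℕ →₀ k) ⊗[k] MvPolynomial (Option ℕ) k →ₐ[k] HW,
      φ GenData.ofExterior.x = T.ξ ∧ (∀ n, φ (GenData.ofExterior.l n) = T.l n) ∧
      ∀ n, φ (GenData.ofExterior.b n) = T.b n := by
  obtain ⟨φ, h1, h2⟩ := exists_exterior_algHom (k := k) T.l (fun o : Option ℕ => o.elim T.ξ T.b)
    (fun i => by rw [T.l_sq, zero_smul]) T.l_anti (by
      rintro (_ | i) (_ | j)
      · rfl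
      · exact T.ξ_comm_b j
      · exact (T.ξ_comm_b i).symm
      · exact T.b_comm_b i j) (by
      rintro (_ | i) j
      · exact T.ξ_comm_l j
      · exact T.b_comm_l i j)
  exact ⟨φ, h2 none, h1, fun n => h2 (some n)⟩

end CohTower

end

/-! ### The ground field, and homogeneous elements without a grading on E -/

section

open ChainAlgebra HochschildCochain

section Ground

variable (k : Type u) [CommRing k]

/-- The Hochschild cohomology of the ground ring is concentrated in degree zero. -/
theorem exists_algebraMap_eq_of_ground (x : Coh k (Hom.id (ofAlgebra k k))) :
    ∃ c : k, x = algebraMap k _ c := by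
  set P := ofAlgebra k k
  have hsgn (x : P) : P.sgn x = -x := by
    have h : x ∈ P.gr 0 := Submodule.mem_top
    rw [P.sgn_of_mem h, zero_add, pow_one, neg_one_smul]
  induction x using Coh.induction with
  | h0 => exact ⟨0, (map_zero _).symm⟩
  | h2 x y hx hy =>
    obtain ⟨a, rfl⟩ := hx
    obtain ⟨b, rfl⟩ := hy
    exact ⟨a + b, (map_add _ _ _).symm⟩
  | h1 n f hf =>
    rcases n with _ | n
    · refine ⟨f [], ?_⟩
      refine congrArg (DirectSum.of (HochschildH k (Hom.id P)) 0)
        (congrArg (HochschildH.mk k (Hom.id P) 0) (Subtype.ext ?_))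
      change f = f [] • unit
      funext L
      rcases L with _ | ⟨x, L⟩
      · change f [] = f [] * 1
        rw [mul_one]
      · have h0 : f (x :: L) = 0 := by
          refine hf.1.2 (x :: L) (List.replicate (L.length + 1) 0) ?_ (by simp)
          rw [List.forall₂_iff_get]
          refine ⟨by simp, fun i _ _ => ?_⟩
          simp only [List.get_eq_getElem, List.getElem_replicate]
          exact Submodule.mem_top
        rw [h0]
        exact (mul_zero (f [])).symm
    · refine ⟨0, ?_⟩
      rw [map_zero, cls_eq_zero_iff]
      have h1 : (1 : P) ∈ P.gr 0 := Submodule.mem_top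
      -- Fixing 1 as the first entry is the contracting homotopy: by linearity every entry is a
      -- scalar multiple of 1.
      refine ⟨der 1 f, hf.ml.der 1, ?_, ?_⟩
      · have := hf.hasDeg.der h1
        simpa using this
      · have hnil : f [] = 0 := hf.1.2 [] [] .nil (by simp)
        have hd : ∀ x : P, P.d x = 0 := fun _ => rfl
        funext L
        -- In the cocycle identity at `1 :: L` the first two terms cancel when `L` is nonempty, so
        -- every term but the first of the coboundary of the bounding cochain vanishes.
        have e := congrFun hf.D_eq (1 :: L)
        rw [D_eq_barR, Pi.add_apply, cup_tw_cons, barR_cons' _ hd hf.ml, hsgn,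
          actR_neg _ hf.ml, hf.ml.der_neg, map_neg, map_one, one_mul, Pi.neg_apply,
          Pi.neg_apply, Pi.zero_apply] at e
        rw [D_eq_barR, Pi.add_apply]
        rcases L with _ | ⟨x, L⟩
        · rw [actR_nil, hnil, zero_mul, neg_zero, zero_add, zero_add, neg_eq_zero] at e
          rw [e, hnil, add_zero, cup_nil, tw_nil, zero_mul]
        · rw [actR_cons, one_mul] at e
          have e2 : barR (Hom.id P) (der 1 f) (x :: L) = 0 := by
            have e3 : f (x :: L) + (-f (x :: L) + -barR (Hom.id P) (der 1 f) (x :: L)) = 0 := e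
            rwa [← add_assoc, add_neg_cancel, zero_add, neg_eq_zero] at e3
          rw [e2, add_zero, cup_tw_cons]
          have h := hf.ml.2 [] L (x : k) (1 : P)
          simp only [List.nil_append] at h
          have hx : (x : k) • (1 : P) = x := mul_one (x : k)
          rw [hx] at h
          exact h.symm

/-- The unit could only bound a cochain of degree -1, which is zero. Nontriviality makes E embed
into its tensor product with this cohomology. -/
theorem nontrivial_coh_ground [Nontrivial k] : Nontrivial (Coh k (Hom.id (ofAlgebra k k))) := by
  refine ⟨1, 0, fun h => ?_⟩
  rw [← cls_unit, cls_eq_zero_iff] at h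
  obtain ⟨f, hf, hd, e⟩ := h
  rw [hd.eq_zero hf (by simp)] at e
  have h0 : D (Hom.id (ofAlgebra k k)) (0 : List (ofAlgebra k k) → k) = 0 := by
    simpa using D_smul (Hom.id (ofAlgebra k k)) (0 : ℤ) (0 : List (ofAlgebra k k) → k)
  rw [h0] at e
  exact zero_ne_one (congrFun e [])

end Ground

section Graded

variable {k : Type*} [CommRing k] {K K' : Type*} [CommRing K] [CommRing K']
  {P : ChainAlgebra.{_, v} K} {Q : ChainAlgebra.{_, w} K'} {B B' : Type*} [Ring B] [Ring B']
  [Algebra K B] [Algebra K' B'] [Algebra k B] [Algebra k B']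
  {ε : Hom P (ofAlgebra K B)} {ε' : Hom Q (ofAlgebra K' B')}
  {κ : k} {E : Type*} [Ring E] [Algebra k E] (G : GenData k κ E)

/-- An algebra map that is homogeneous on generators of prescribed degrees. -/
structure GenData.IsGraded (p : ℕ) (φ : E →ₐ[k] Coh k ε) : Prop where
  x : (φ G.x).IsHomog 2
  l : ∀ n, (φ (G.l n)).IsHomog (2 * p ^ n + 1)
  b : ∀ n, (φ (G.b n)).IsHomog (2 * p ^ (n + 1) + 2)

/-- `z` commutes up to the Koszul sign with the image of `h`. -/
def SignComm {K'' : Type*} [CommRing K''] {R : ChainAlgebra.{_, u} K''} {B'' : Type*} [Ring B'']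
    [Algebra K'' B''] [Algebra k B''] {ε'' : Hom R (ofAlgebra K'' B'')}
    (h : Coh k ε'' →ₐ[k] Coh k ε) (j : ℕ) (z : Coh k ε) : Prop :=
  ∀ i y, Coh.IsHomog y i → z * h y = (-1 : ℤ) ^ (j * i) • (h y * z)

variable {K'' : Type*} [CommRing K''] {R : ChainAlgebra.{_, u} K''} {B'' : Type*} [Ring B'']
    [Algebra K'' B''] [Algebra k B''] {ε'' : Hom R (ofAlgebra K'' B'')}
    (h : Coh k ε'' →ₐ[k] Coh k ε)

theorem SignComm.mul {i j : ℕ} {y z : Coh k ε} (hy : SignComm h i y) (hz : SignComm h j z) :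
    SignComm h (i + j) (y * z) := fun n f hf => by
  rw [mul_assoc, hz n f hf, mul_smul_comm, ← mul_assoc, hy n f hf, smul_mul_assoc, smul_smul,
    mul_assoc, ← pow_add]
  congr 2
  ring

/-- The elements of `E` that behave as homogeneous elements of degree `j`. -/
def homogPart (φ : E →ₐ[k] Coh k ε) (φ' : E →ₐ[k] Coh k ε') (j : ℕ) : Submodule k E where
  carrier := {e | (φ e).IsHomog j ∧ (φ' e).IsHomog j ∧ SignComm h j (φ e)}
  zero_mem' := by
    refine ⟨?_, ?_, ?_⟩
    · rw [map_zero]; exact Coh.isHomog_zero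
    · rw [map_zero]; exact Coh.isHomog_zero
    · intro i y _; simp
  add_mem' := by
    rintro a b ⟨h1, h2, h3⟩ ⟨h1', h2', h3'⟩
    refine ⟨?_, ?_, ?_⟩
    · rw [map_add]; exact h1.add h1'
    · rw [map_add]; exact h2.add h2'
    · intro i y hy; rw [map_add, add_mul, mul_add, h3 i y hy, h3' i y hy, smul_add]
  smul_mem' := by
    rintro c a ⟨h1, h2, h3⟩
    refine ⟨?_, ?_, ?_⟩
    · rw [map_smul]; exact h1.smul c
    · rw [map_smul]; exact h2.smul c
    · intro i y hy; rw [map_smul, smul_mul_assoc, mul_smul_comm, h3 i y hy, smul_comm]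

variable {h} {φ : E →ₐ[k] Coh k ε} {φ' : E →ₐ[k] Coh k ε'}

theorem homogPart_mul {i j : ℕ} {a b : E} (ha : a ∈ homogPart h φ φ' i)
    (hb : b ∈ homogPart h φ φ' j) : a * b ∈ homogPart h φ φ' (i + j) := by
  obtain ⟨h1, h2, h3⟩ := ha
  obtain ⟨h1', h2', h3'⟩ := hb
  refine ⟨?_, ?_, ?_⟩
  · rw [map_mul]; exact h1.mul h1'
  · rw [map_mul]; exact h2.mul h2'
  · rw [map_mul]; exact h3.mul h h3'

variable {G} {p : ℕ}

/-- E carries no chosen grading; its homogeneous elements are those that behave as such under both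
maps and satisfy the sign rule. These properties are multiplicative and hold for the generators. -/
theorem iSup_homogPart (hφ : G.IsGraded p φ) (hφ' : G.IsGraded p φ') (hx : SignComm h 2 (φ G.x))
    (hl : ∀ n, SignComm h (2 * p ^ n + 1) (φ (G.l n)))
    (hb : ∀ n, SignComm h (2 * p ^ (n + 1) + 2) (φ (G.b n))) :
    ⨆ j, homogPart h φ φ' j = ⊤ := by
  have key {j : ℕ} {g : E} (hg : g ∈ homogPart h φ φ' j) (e : E) (he : e ∈ ⨆ j, homogPart h φ φ' j) :
      e * g ∈ ⨆ j, homogPart h φ φ' j := by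
    induction he using Submodule.iSup_induction' with
    | mem i e he => exact Submodule.mem_iSup_of_mem (i + j) (homogPart_mul he hg)
    | zero => rw [zero_mul]; exact Submodule.zero_mem _
    | add a b _ _ ha hb => rw [add_mul]; exact Submodule.add_mem _ ha hb
  refine G.gen _ (Submodule.mem_iSup_of_mem 0 ⟨?_, ?_, ?_⟩) (fun e he => key ⟨hφ.x, hφ'.x, hx⟩ e he)
    (fun e he n => key ⟨hφ.b n, hφ'.b n, hb n⟩ e he)
    (fun e he n => key ⟨hφ.l n, hφ'.l n, hl n⟩ e he)
  · rw [map_one]; exact Coh.isHomog_one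
  · rw [map_one]; exact Coh.isHomog_one
  · intro i y _; simp

/-- Split e into parts of the various degrees. The parts of degree other than j have zero image
under the injective φ', so e is a single part; hence the degree of φ'(e) controls the degree of φ(e)
and the sign with which it commutes. -/
theorem mem_homogPart (hi : Function.Injective φ') (ht : ⨆ j, homogPart h φ φ' j = ⊤) {j : ℕ} {e : E}
    (he : (φ' e).IsHomog j) : e ∈ homogPart h φ φ' j := by
  obtain ⟨f, hf, rfl⟩ := (Submodule.mem_iSup_iff_exists_finsupp _ e).1 (ht ▸ Submodule.mem_top)
  have hfi (i : ℕ) (hij : i ≠ j) : f i = 0 := by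
    refine hi ?_
    rw [map_zero]
    have hh := (hf i).2.1
    have h0 : φ' (f i) i = 0 := by
      have h1 := he.component hij.symm
      rw [Finsupp.sum, map_sum, DirectSum.sum_apply] at h1
      by_cases hs : i ∈ f.support
      · rwa [Finset.sum_eq_single_of_mem i hs fun i' _ hne => (hf i').2.1.component hne] at h1
      · rw [Finsupp.notMem_support_iff.1 hs, map_zero]; rfl
    obtain ⟨c, hc⟩ := hh.exists_of
    rw [hc] at h0 ⊢
    rw [DirectSum.of_eq_same] at h0
    rw [h0, map_zero]
  have hs : (f.sum fun _ x => x) = f j := by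
    rw [Finsupp.sum]
    by_cases hs : j ∈ f.support
    · exact Finset.sum_eq_single_of_mem j hs fun i _ hne => hfi i hne
    · rw [Finsupp.notMem_support_iff.1 hs]
      exact Finset.sum_eq_zero fun i _ => by
        by_cases hij : i = j
        · rw [hij, Finsupp.notMem_support_iff.1 hs]
        · exact hfi i hij
  rw [hs]
  exact hf j

end Graded

end

/-! ### The tensor product decomposition -/

section

open ChainAlgebra HochschildCochain

section Kunneth

variable {k : Type*} [CommRing k] {K K' K'' : Type*} [CommRing K] [CommRing K'] [CommRing K'']
  {P : ChainAlgebra.{_, v} K} {Q : ChainAlgebra.{_, w} K'} {R : ChainAlgebra.{_, u} K''}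
  {B B' B'' : Type*} [Ring B] [Ring B'] [Ring B''] [Algebra K B] [Algebra K' B'] [Algebra K'' B'']
  [Algebra k B] [Algebra k B'] [Algebra k B'']
  {ε : Hom P (ofAlgebra K B)} {ε' : Hom Q (ofAlgebra K' B')} {ε'' : Hom R (ofAlgebra K'' B'')}
  {E : Type*} [Ring E] [Algebra k E]

/-- The product of two algebra maps as a linear map on the tensor product. -/
noncomputable def mulMap (h : Coh k ε'' →ₐ[k] Coh k ε) (ψ : Coh k ε' →ₐ[k] Coh k ε) :
    Coh k ε'' ⊗[k] Coh k ε' →ₗ[k] Coh k ε :=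
  TensorProduct.lift ((LinearMap.mul k (Coh k ε)).compl₁₂ h.toLinearMap ψ.toLinearMap)

theorem mulMap_tmul (h : Coh k ε'' →ₐ[k] Coh k ε) (ψ : Coh k ε' →ₐ[k] Coh k ε) (x y) :
    mulMap h ψ (x ⊗ₜ y) = h x * ψ y := rfl

/-- On homogeneous tensors the Koszul sign of the graded product is the sign for moving the second
factor of s past the first factor of t. -/
theorem mulMap_gradedMul (h : Coh k ε'' →ₐ[k] Coh k ε) (ψ : Coh k ε' →ₐ[k] Coh k ε)
    (hs : ∀ j y, Coh.IsHomog y j → SignComm h j (ψ y)) (s t : Coh k ε'' ⊗[k] Coh k ε') :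
    mulMap h ψ (TensorProduct.gradedMul k (HochschildH k ε'') (HochschildH k ε') s t) =
      mulMap h ψ s * mulMap h ψ t := by
  induction s using TensorProduct.induction_on with
  | zero => rw [map_zero, LinearMap.zero_apply, map_zero, zero_mul]
  | add s s' hs hs' => rw [map_add, LinearMap.add_apply, map_add, map_add, hs, hs', add_mul]
  | tmul a b =>
    induction t using TensorProduct.induction_on with
    | zero => rw [map_zero, map_zero, mul_zero]
    | add t t' ht ht' => rw [map_add, map_add, map_add, ht, ht', mul_add]
    | tmul c d =>
      induction b using DirectSum.induction_on with
      | zero => rw [TensorProduct.tmul_zero, map_zero, LinearMap.zero_apply, map_zero, zero_mul]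
      | add b b' hb hb' =>
        rw [TensorProduct.tmul_add, map_add, LinearMap.add_apply, map_add, map_add, hb, hb', add_mul]
      | of j b =>
        induction c using DirectSum.induction_on with
        | zero => rw [TensorProduct.zero_tmul, map_zero, map_zero, mul_zero]
        | add c c' hc hc' =>
          rw [TensorProduct.add_tmul, map_add, map_add, map_add, hc, hc', mul_add]
        | of i c =>
          have e := TensorProduct.tmul_of_gradedMul_of_tmul (R := k) (HochschildH k ε'')
            (HochschildH k ε') j i a b c d
          rw [DirectSum.lof_eq_of, DirectSum.lof_eq_of] at e
          rw [e, Units.smul_def, map_zsmul, mulMap_tmul, mulMap_tmul, mulMap_tmul, map_mul, map_mul,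
            mul_assoc, mul_assoc, ← mul_assoc (ψ _) (h _), hs j _ (Coh.isHomog_of b) i _
              (Coh.isHomog_of c), smul_mul_assoc, mul_smul_comm, mul_assoc]
          congr 1

/-- A multiplicative decomposition of cohomology rings is an isomorphism of graded algebras. -/
theorem exists_gradedIso (h : Coh k ε'' →ₐ[k] Coh k ε) (ψ : Coh k ε' →ₐ[k] Coh k ε)
    (hs : ∀ j y, Coh.IsHomog y j → SignComm h j (ψ y))
    (hh : ∀ j y, Coh.IsHomog y j → (h y).IsHomog j) (hψ : ∀ j y, Coh.IsHomog y j → (ψ y).IsHomog j)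
    (hb : Function.Bijective (mulMap h ψ)) :
    ∃ e : Coh k ε ≃ₗ[k] Coh k ε'' ⊗[k] Coh k ε', e 1 = 1 ⊗ₜ 1 ∧
      (∀ x y, e (x * y) = TensorProduct.gradedMul k (HochschildH k ε'') (HochschildH k ε')
        (e x) (e y)) ∧
      ∀ i j (a : HochschildH k ε'' i) (b : HochschildH k ε' j), ∃ c : HochschildH k ε (i + j),
        e (DirectSum.of (HochschildH k ε) (i + j) c) =
          DirectSum.of (HochschildH k ε'') i a ⊗ₜ DirectSum.of (HochschildH k ε') j b := by
  set e := LinearEquiv.ofBijective (mulMap h ψ) hb with he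
  have hes (t) : e t = mulMap h ψ t := rfl
  refine ⟨e.symm, ?_, fun x y => ?_, fun i j a b => ?_⟩
  · rw [LinearEquiv.symm_apply_eq, hes, mulMap_tmul, map_one, map_one, one_mul]
  · rw [LinearEquiv.symm_apply_eq, hes, mulMap_gradedMul h ψ hs, ← hes, ← hes, e.apply_symm_apply,
      e.apply_symm_apply]
  · obtain ⟨c, hc⟩ := ((hh i _ (Coh.isHomog_of a)).mul (hψ j _ (Coh.isHomog_of b))).exists_of
    refine ⟨c, ?_⟩
    rw [LinearEquiv.symm_apply_eq, hes, mulMap_tmul, hc]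

end Kunneth

namespace TwistedPoly

variable (p : ℕ) [hp : Fact p.Prime]

theorem hasLifting_ground : HasLifting p (ZMod p) := by
  have hpp : p ∣ p ^ 2 := Dvd.intro_left p (pow_two p).symm
  refine ⟨ZMod (p ^ 2), inferInstance, Algebra.id _, Module.Free.self _, ZMod.castHom hpp _,
    ZMod.castHom_surjective hpp, fun x => ?_⟩
  obtain ⟨n, rfl⟩ := ZMod.intCast_surjective x
  rw [map_intCast, ZMod.intCast_zmod_eq_zero_iff_dvd]
  constructor
  · rintro ⟨m, rfl⟩
    exact ⟨m, by push_cast; rfl⟩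
  · rintro ⟨y, hy⟩
    obtain ⟨m, rfl⟩ := ZMod.intCast_surjective y
    have h1 : ((n - p * m : ℤ) : ZMod (p ^ 2)) = 0 := by
      push_cast
      rw [hy, sub_self]
    rw [ZMod.intCast_zmod_eq_zero_iff_dvd] at h1
    have h2 : (p : ℤ) ∣ n - p * m := dvd_trans (by exact_mod_cast hpp) h1
    simpa using dvd_add h2 (dvd_mul_right (p : ℤ) m)

variable {p} {E : Type*} [Ring E] [Algebra (ZMod p) E] {κ : ZMod p}
  {G : GenData (ZMod p) κ E} (hκ : κ = if p = 2 then 1 else 0)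

/-- For the ground field the coefficient ring of the tower consists of scalars, so the isomorphism
from the tensor product is already one from E. -/
theorem bijective_of_ground {φ : E →ₐ[ZMod p] Coh (ZMod p) (topStage p (ZMod p))}
    (hx : φ G.x = (tower p (ZMod p) hκ).ξ) (hl : ∀ n, φ (G.l n) = (tower p (ZMod p) hκ).l n)
    (hb : ∀ n, φ (G.b n) = (tower p (ZMod p) hκ).b n) : Function.Bijective φ := by
  have hΨ := (tower p (ZMod p) hκ).Ψ_bijective hx hl hb hp.out.one_lt
  have := nontrivial_coh_ground (ZMod p)
  have h1 (e : E) : (tower p (ZMod p) hκ).Ψ φ (1 ⊗ₜ e) = φ e := by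
    rw [CohTower.Ψ_tmul, map_one, one_mul]
  constructor
  · intro a b hab
    rw [← h1, ← h1] at hab
    exact Algebra.TensorProduct.includeRight_injective (R := ZMod p)
      (FaithfulSMul.algebraMap_injective (ZMod p) _) (hΨ.1 hab)
  · intro y
    obtain ⟨t, rfl⟩ := hΨ.2 y
    induction t using TensorProduct.induction_on with
    | zero => exact ⟨0, by rw [map_zero, map_zero]⟩
    | add s t hs ht =>
      obtain ⟨a, ha⟩ := hs
      obtain ⟨b, hb⟩ := ht
      exact ⟨a + b, by rw [map_add, map_add, ha, hb]⟩
    | tmul f e =>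
      obtain ⟨c, rfl⟩ := exists_algebraMap_eq_of_ground (ZMod p) f
      refine ⟨c • e, ?_⟩
      rw [Algebra.algebraMap_eq_smul_one, TensorProduct.smul_tmul, h1]

variable {A : Type u} [Ring A] [Algebra (ZMod p) A] [Algebra (ZMod (p ^ 2)) A]
  [Algebra (ZMod (p ^ 2)) (ZMod p)]

/-- Both Shukla rings are described by the same E. The map ψ carries the cohomology of the ground
field to E and from there into that of `A`; together with the classes coming from the Hochschild
cohomology of `A` it gives the tensor product. -/
theorem exists_iso (hA : HasLifting p A)
    {φA : E →ₐ[ZMod p] Coh (ZMod p) (topStage p A)} (hx : φA G.x = (tower p A hκ).ξ)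
    (hl : ∀ n, φA (G.l n) = (tower p A hκ).l n) (hb : ∀ n, φA (G.b n) = (tower p A hκ).b n)
    {φ : E →ₐ[ZMod p] Coh (ZMod p) (topStage p (ZMod p))}
    (hx' : φ G.x = (tower p (ZMod p) hκ).ξ) (hl' : ∀ n, φ (G.l n) = (tower p (ZMod p) hκ).l n)
    (hb' : ∀ n, φ (G.b n) = (tower p (ZMod p) hκ).b n)
    (R : QuasiFreeResolution (ZMod (p ^ 2)) A) (S : QuasiFreeResolution (ZMod (p ^ 2)) (ZMod p)) :
    (∃ e : Coh (ZMod p) R.aug ≃ₗ[ZMod p]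
        Coh (ZMod p) (Hom.id (ofAlgebra (ZMod p) A)) ⊗[ZMod p] Coh (ZMod p) S.aug,
      e 1 = 1 ⊗ₜ 1 ∧
      (∀ x y, e (x * y) = TensorProduct.gradedMul (ZMod p)
        (HochschildAlg (ZMod p) A) (Shukla (ZMod p) S) (e x) (e y)) ∧
      ∀ i j (a : HochschildAlg (ZMod p) A i) (b : Shukla (ZMod p) S j),
        ∃ c : Shukla (ZMod p) R (i + j),
          e (DirectSum.of (Shukla (ZMod p) R) (i + j) c) =
            DirectSum.of (HochschildAlg (ZMod p) A) i a ⊗ₜ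
              DirectSum.of (Shukla (ZMod p) S) j b) ∧
    ∃ Φ : E ≃ₐ[ZMod p] Coh (ZMod p) S.aug, G.IsGraded p Φ.toAlgHom := by
  obtain ⟨M, hM⟩ := QuasiFreeResolution.exists_bijective p hA R
  obtain ⟨N, hN⟩ := QuasiFreeResolution.exists_bijective p (hasLifting_ground p) S
  let Φ : E ≃ₐ[ZMod p] Coh (ZMod p) S.aug := AlgEquiv.ofBijective ((N.pullH (ZMod p)).comp φ)
    (hN.comp (bijective_of_ground hκ hx' hl' hb'))
  have hΦg : G.IsGraded p Φ.toAlgHom := by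
    refine ⟨?_, fun n => ?_, fun n => ?_⟩
    · exact N.isHomog (hx' ▸ (tower p (ZMod p) hκ).ξ_homog)
    · exact N.isHomog (hl' n ▸ (tower p (ZMod p) hκ).homog_l n)
    · exact N.isHomog (hb' n ▸ (tower p (ZMod p) hκ).homog_b n)
  refine ⟨?_, Φ, hΦg⟩
  let φM := (M.pullH (ZMod p)).comp φA
  let hat := (M.pullH (ZMod p)).comp (tower p A hκ).hatW
  have hφM : G.IsGraded p φM := by
    refine ⟨?_, fun n => ?_, fun n => ?_⟩
    · exact M.isHomog (hx ▸ (tower p A hκ).ξ_homog)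
    · exact M.isHomog (hl n ▸ (tower p A hκ).homog_l n)
    · exact M.isHomog (hb n ▸ (tower p A hκ).homog_b n)
  have hmap (z f) : M.pullH (ZMod p) z * hat f = M.pullH (ZMod p) (z * (tower p A hκ).hatW f) :=
    (map_mul (M.pullH (ZMod p)) _ _).symm
  have hmap' (z f) : hat f * M.pullH (ZMod p) z = M.pullH (ZMod p) ((tower p A hκ).hatW f * z) :=
    (map_mul (M.pullH (ZMod p)) _ _).symm
  have heven (j i : ℕ) : (-1 : ℤ) ^ ((2 * j) * i) = 1 := by
    rw [mul_assoc]
    exact Even.neg_one_pow (even_two_mul _)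
  have htop : ⨆ j, homogPart hat φM Φ.toAlgHom j = ⊤ := by
    refine iSup_homogPart hφM hΦg (fun i y _ => ?_) (fun n i y hy => ?_) (fun n i y _ => ?_)
    · change M.pullH (ZMod p) (φA G.x) * _ = _ • (_ * M.pullH (ZMod p) (φA G.x))
      rw [hmap, hmap', hx, CohTower.ξ_comm_hatW]
      exact ((congrArg (· • _) (heven 1 i)).trans (one_smul _ _)).symm
    · change M.pullH (ZMod p) (φA (G.l n)) * _ = _ • (_ * M.pullH (ZMod p) (φA (G.l n)))
      rw [hmap, hmap', hl, (tower p A hκ).l_comm_hatW n i y hy, map_zsmul, add_mul, pow_add, heven,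
        one_mul, one_mul]
    · change M.pullH (ZMod p) (φA (G.b n)) * _ = _ • (_ * M.pullH (ZMod p) (φA (G.b n)))
      rw [hmap, hmap', hb, CohTower.b_comm_hatW, show 2 * p ^ (n + 1) + 2 = 2 * (p ^ (n + 1) + 1) by
        ring, heven, one_smul]
  let ψ := φM.comp Φ.symm.toAlgHom
  -- The grading of the ground field cohomology is transported to E along Φ, which yields the
  -- degrees and the sign rule for ψ.
  have hmem (j y) (hy : Coh.IsHomog y j) : Φ.symm y ∈ homogPart hat φM Φ.toAlgHom j := by
    refine mem_homogPart Φ.injective htop ?_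
    change Coh.IsHomog (Φ (Φ.symm y)) j
    rwa [Φ.apply_symm_apply]
  refine exists_gradedIso hat ψ (fun j y hy => (hmem j y hy).2.2)
    (fun j y hy => M.isHomog ((tower p A hκ).homog_hatW hy)) (fun j y hy => (hmem j y hy).1) ?_
  -- Up to identifying the second tensor factor with E, the multiplication map is the isomorphism of
  -- the tower followed by the comparison with `R`.
  have hΨ := hM.comp ((tower p A hκ).Ψ_bijective hx hl hb hp.out.one_lt)
  have hcomp := hΨ.comp (TensorProduct.congr (LinearEquiv.refl (ZMod p)
    (Coh (ZMod p) (Hom.id (ofAlgebra (ZMod p) A)))) Φ.symm.toLinearEquiv).bijective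
  convert hcomp using 1
  funext t
  induction t using TensorProduct.induction_on with
  | zero => simp
  | add s t hs ht => simp only [map_add, hs, ht, Function.comp_apply]
  | tmul f y =>
    rw [mulMap_tmul, Function.comp_apply, Function.comp_apply, TensorProduct.congr_tmul,
      CohTower.Ψ_tmul, map_mul]
    rfl

end TwistedPoly

end

/-! ### The main theorem -/

theorem mainTheorem12 (p : ℕ) [Fact p.Prime] (A : Type u) [Ring A] [Algebra (ZMod p) A]
    [Algebra (ZMod (p ^ 2)) A] [Algebra (ZMod (p ^ 2)) (ZMod p)] (hA : HasLifting p A) :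
    -- quasi-free resolutions exist, so that Shukla cohomology is defined
    Nonempty (QuasiFreeResolution (ZMod (p ^ 2)) A) ∧
    Nonempty (QuasiFreeResolution (ZMod (p ^ 2)) (ZMod p)) ∧
    -- `R` and `S` are any resolutions that compute the two Shukla cohomologies
    ∀ (R : QuasiFreeResolution (ZMod (p ^ 2)) A) (S : QuasiFreeResolution (ZMod (p ^ 2)) (ZMod p)),
      -- an isomorphism of graded algebras, the tensor product having the Koszul sign rule
      (∃ e : DirectSum ℕ (Shukla (ZMod p) R) ≃ₗ[ZMod p]
          DirectSum ℕ (HochschildAlg (ZMod p) A) ⊗[ZMod p] DirectSum ℕ (Shukla (ZMod p) S),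
        e 1 = 1 ⊗ₜ 1 ∧
        (∀ x y, e (x * y) = TensorProduct.gradedMul (ZMod p)
          (HochschildAlg (ZMod p) A) (Shukla (ZMod p) S) (e x) (e y)) ∧
        (∀ i j (a : HochschildAlg (ZMod p) A i) (b : Shukla (ZMod p) S j),
          ∃ c : Shukla (ZMod p) R (i + j),
            e (DirectSum.of (Shukla (ZMod p) R) (i + j) c) =
              DirectSum.of (HochschildAlg (ZMod p) A) i a ⊗ₜ
                DirectSum.of (Shukla (ZMod p) S) j b)) ∧
      -- for `p = 2`: polynomial generators `σx` of degree `2` and `σy^[2^n]` of degree `2 * 2^n + 1`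
      (p = 2 →
        ∃ φ : MvPolynomial (Option ℕ) (ZMod p) ≃ₐ[ZMod p] DirectSum ℕ (Shukla (ZMod p) S),
          (∃ c, φ (MvPolynomial.X none) = DirectSum.of (Shukla (ZMod p) S) 2 c) ∧
          (∀ n, ∃ c, φ (MvPolynomial.X (some n)) =
            DirectSum.of (Shukla (ZMod p) S) (2 * p ^ n + 1) c)) ∧
      -- for `p` odd: exterior generators `σy^[p^n]` of degree `2 * p^n + 1`, polynomial generators
      -- `σx` of degree `2` and `σ²y^[p^n]` of degree `2 * p^(n+1) + 2`
      (p ≠ 2 →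
        ∃ φ : ExteriorAlgebra (ZMod p) (ℕ →₀ ZMod p) ⊗[ZMod p] MvPolynomial (Option ℕ) (ZMod p)
            ≃ₐ[ZMod p] DirectSum ℕ (Shukla (ZMod p) S),
          (∀ n, ∃ c, φ (ExteriorAlgebra.ι (ZMod p) (Finsupp.single n 1) ⊗ₜ 1) =
            DirectSum.of (Shukla (ZMod p) S) (2 * p ^ n + 1) c) ∧
          (∃ c, φ (1 ⊗ₜ MvPolynomial.X none) = DirectSum.of (Shukla (ZMod p) S) 2 c) ∧
          (∀ n, ∃ c, φ (1 ⊗ₜ MvPolynomial.X (some n)) =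
            DirectSum.of (Shukla (ZMod p) S) (2 * p ^ (n + 1) + 2) c)) := by
  refine ⟨nonempty_quasiFreeResolution _ _, nonempty_quasiFreeResolution _ _, fun R S => ?_⟩
  -- The two cases differ only in κ, which is 1 for p = 2 and 0 otherwise, and in the algebra
  -- generated with this κ.
  by_cases h2 : p = 2
  · have hκ : (1 : ZMod p) = if p = 2 then 1 else 0 := (if_pos h2).symm
    have h0 : (2 : ZMod p) = 0 := by subst h2; rfl
    obtain ⟨φA, hx, hl, hb⟩ := (TwistedPoly.tower p A hκ).exists_ofMvPolynomial h0
    obtain ⟨φ, hx', hl', hb'⟩ := (TwistedPoly.tower p (ZMod p) hκ).exists_ofMvPolynomial h0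
    obtain ⟨he, Φ, hΦ⟩ := TwistedPoly.exists_iso hκ hA hx hl hb hx' hl' hb' R S
    exact ⟨he, fun _ => ⟨Φ, hΦ.x.exists_of, fun n => (hΦ.l n).exists_of⟩, fun h => absurd h2 h⟩
  · have hκ : (0 : ZMod p) = if p = 2 then 1 else 0 := (if_neg h2).symm
    obtain ⟨φA, hx, hl, hb⟩ := (TwistedPoly.tower p A hκ).exists_ofExterior
    obtain ⟨φ, hx', hl', hb'⟩ := (TwistedPoly.tower p (ZMod p) hκ).exists_ofExterior
    obtain ⟨he, Φ, hΦ⟩ := TwistedPoly.exists_iso hκ hA hx hl hb hx' hl' hb' R S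
    exact ⟨he, fun h => absurd h h2, fun _ => ⟨Φ, fun n => (hΦ.l n).exists_of,
      hΦ.x.exists_of, fun n => (hΦ.b n).exists_of⟩⟩
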